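/- Equip $\mathbb R^3$ with the contact structure $\ker(dz-y\,dx)$. Legendrian links are oriented, closed one-dimensional submanifolds tangent to it, considered up to Legendrian isotopy; the front of a link is its projection to the $xz$-plane. A crossing of the front (a double point of two non-cusp strands) is negative if its two strands point to opposite sides of the vertical line through it. An oriented Legendrian surgery replaces, inside a rectangle $[a,b]\times[c,d]$ of the $xz$-plane, two oppositely oriented front strands without cusps and crossings running between the left and right sides (a $0$-tangle) by two strands without crossings, each with exactly one (semi-cubical) cusp, one joining two points of the left side and the other joining two points of the right side (an $\infty$-tangle). Let $\sigma_0(\Lambda)\in\mathbb N\cup\{\infty\}$ be the minimal $n$ for which there are oriented Legendrian links $\Lambda=\Lambda_n,\Lambda_{n-1},\dots,\Lambda_0$, each $\Lambda_j$ ($j<n$) obtained from $\Lambda_{j+1}$ by one oriented Legendrian surgery, with $\Lambda_0$ topologically an unknot. **Lemma 5.2.** Let $\Lambda$ be a Legendrian knot, let $M$ be Legendrian isotopic to $\Lambda$, and let $B$ be a rectangle in the $xz$-plane over which the front of $M$ consists of two graphs over the $x$-interval that meet in exactly one point, a negative crossing. Let the smooth knot $K$ be obtained from $M$ by changing this crossing: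 $K$ agrees with $M$ outside the cylinder over $B$, has the same $xz$-projection as $M$ over $B$, and has the order of the two strands in the $y$-direction reversed at the crossing. Then: 1. There are Legendrian links $M_1,M_0$, which agree with $M$ outside the cylinder over $B$, such that $M_1$ is obtained from $M$, and $M_0$ from $M_1$, by an oriented Legendrian surgery, and $M_0$ is smoothly ambient isotopic to $K$. 2. If $K$ is topologically an unknot, then $\sigma_0(\Lambda)\le 2$. In particular, if a Legendrian knot has a front projection that can be topologically unknotted by changing one negative crossing, then its surgery unknotting number is at most $2$. -/

import Mathlib

open Set
open scoped ContDiff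

/-- Three-space with coordinates `(x, y, z)`: `p.1 = x`, `p.2.1 = y`, `p.2.2 = z`. -/
abbrev R3 : Type := ℝ × ℝ × ℝ

/-- The front projection `(x, y, z) ↦ (x, z)`. -/
def front (p : R3) : ℝ × ℝ := (p.1, p.2.2)

/-- The contact form `dz - y dx` at `p`, evaluated on the tangent vector `v`. -/
def contactForm (p v : R3) : ℝ := v.2.2 - p.2.1 * v.1

/-- An oriented smooth link in three-space: a compact, oriented, embedded one-dimensional
submanifold (hence a finite disjoint union of circles). It is recorded by the set `vec` of all
pairs `(p, v)` where `p` is a point of the link and `v` is a positively oriented nonzero vector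
tangent to the link at `p`. The chart condition says that near each of its points the link is the
image of an embedded smooth curve `γ` (the smooth left inverse `τ` makes `γ` an injective
immersion and a homeomorphism onto its image) whose velocity gives the orientation. -/
structure OrientedLink where
  vec : Set (R3 × R3)
  isCompact_points : IsCompact (Prod.fst '' vec)
  chart : ∀ p ∈ Prod.fst '' vec, ∃ (U : Set R3) (I : Set ℝ) (γ : ℝ → R3) (τ : R3 → ℝ),
    IsOpen U ∧ p ∈ U ∧ IsOpen I ∧ ContDiffOn ℝ ∞ γ I ∧ ContDiffOn ℝ ∞ τ U ∧
    (∀ t ∈ I, τ (γ t) = t) ∧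
    {q ∈ vec | q.1 ∈ U} = {q | ∃ t ∈ I, ∃ c : ℝ, 0 < c ∧ q = (γ t, c • deriv γ t)}

/-- The underlying set of points of a link. -/
def OrientedLink.carrier (L : OrientedLink) : Set R3 := Prod.fst '' L.vec

/-- A knot is a link with exactly one component. -/
def OrientedLink.IsKnot (L : OrientedLink) : Prop := IsConnected L.carrier

/-- A link is Legendrian if its tangent lines lie in `ker (dz - y dx)`. -/
structure LegendrianLink extends OrientedLink where
  legendrian : ∀ q ∈ vec, contactForm q.1 q.2 = 0

/-- Two subsets of three-space are smoothly ambient isotopic: there is a smooth family `F t` of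
diffeomorphisms (with inverses `G t`) that starts at the identity and ends with one carrying
`S` onto `T`. -/
def AmbientIsotopic (S T : Set R3) : Prop :=
  ∃ F G : ℝ → R3 → R3,
    ContDiff ℝ ∞ (fun w : ℝ × R3 => F w.1 w.2) ∧
    ContDiff ℝ ∞ (fun w : ℝ × R3 => G w.1 w.2) ∧
    (∀ t p, G t (F t p) = p ∧ F t (G t p) = p) ∧
    (∀ p, F 0 p = p) ∧ F 1 '' S = T

/-- The round circle. -/
def roundCircle : Set R3 := {p | p.1 ^ 2 + p.2.1 ^ 2 = 1 ∧ p.2.2 = 0}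

/-- A link is topologically an unknot. -/
def OrientedLink.IsUnknot (L : OrientedLink) : Prop := AmbientIsotopic L.carrier roundCircle

/-- Equivalence of oriented Legendrian links: a smooth one-parameter family of Legendrian links
from `Λ` to `Λ'`. The family is given by smooth maps `φ t` of three-space whose restrictions to
`Λ` are injective immersions (hence embeddings, as `Λ` is compact) with Legendrian image. -/
def LegendrianIsotopic (Λ Λ' : LegendrianLink) : Prop :=
  ∃ φ : ℝ → R3 → R3,
    ContDiff ℝ ∞ (fun w : ℝ × R3 => φ w.1 w.2) ∧
    (∀ p, φ 0 p = p) ∧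
    (∀ t ∈ Icc (0 : ℝ) 1, InjOn (φ t) Λ.carrier ∧
      ∀ q ∈ Λ.vec, fderiv ℝ (φ t) q.1 q.2 ≠ 0 ∧
        contactForm (φ t q.1) (fderiv ℝ (φ t) q.1 q.2) = 0) ∧
    (fun q : R3 × R3 => (φ 1 q.1, fderiv ℝ (φ 1) q.1 q.2)) '' Λ.vec = Λ'.vec

/-- The rectangle `[a, b] × [c, d]` in the `xz`-plane. -/
structure Rect where
  a : ℝ
  b : ℝ
  c : ℝ
  d : ℝ

/-- The part of three-space that projects to a given rectangle of the `xz`-plane. -/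
def Rect.cylinder (B : Rect) : Set R3 := {p | p.1 ∈ Icc B.a B.b ∧ p.2.2 ∈ Icc B.c B.d}

/-- Two oriented links coincide, with their orientations, outside the cylinder over `B`. -/
def AgreeOutside (B : Rect) (L L' : OrientedLink) : Prop :=
  {q ∈ L.vec | q.1 ∉ B.cylinder} = {q ∈ L'.vec | q.1 ∉ B.cylinder}

/-- Over the rectangle `B` the link consists of the two positively parametrized arcs `γ`, `δ`
(with parameter in `[-1, 1]`), which stay away from the top and bottom sides of `B`, and the front
projection of the two arcs has no crossings. -/
def IsCrossinglessTangle (L : OrientedLink) (B : Rect) (γ δ : ℝ → R3) : Prop :=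
  ContDiff ℝ ∞ γ ∧ ContDiff ℝ ∞ δ ∧
  (∀ t ∈ Icc (-1 : ℝ) 1, (γ t, deriv γ t) ∈ L.vec ∧ (δ t, deriv δ t) ∈ L.vec) ∧
  L.carrier ∩ B.cylinder = γ '' Icc (-1) 1 ∪ δ '' Icc (-1) 1 ∧
  (∀ t ∈ Icc (-1 : ℝ) 1, (γ t).2.2 ∈ Ioo B.c B.d ∧ (δ t).2.2 ∈ Ioo B.c B.d) ∧
  InjOn (front ∘ γ) (Icc (-1) 1) ∧ InjOn (front ∘ δ) (Icc (-1) 1) ∧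
  Disjoint ((front ∘ γ) '' Icc (-1) 1) ((front ∘ δ) '' Icc (-1) 1)

/-- The front of the Legendrian arc `γ` (with parameter in `[-1, 1]`) has no cusps. -/
def HasNoCusp (γ : ℝ → R3) : Prop := ∀ t ∈ Icc (-1 : ℝ) 1, (deriv γ t).1 ≠ 0

/-- The front of the Legendrian arc `γ` (with parameter in `[-1, 1]`) has precisely one cusp,
and that cusp is semi-cubical. -/
def HasOneCusp (γ : ℝ → R3) : Prop :=
  ∃ t₀ ∈ Ioo (-1 : ℝ) 1, iteratedDeriv 2 (fun t => (γ t).1) t₀ ≠ 0 ∧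
    ∀ t ∈ Icc (-1 : ℝ) 1, (deriv γ t).1 = 0 ↔ t = t₀

/-- Over `B` the link is a basic, compatibly oriented Legendrian `0`-tangle: two strands without
crossings and cusps, one running from the left side to the right side of `B`, the other one from
the right side to the left side. -/
def IsBasicZeroTangle (Λ : LegendrianLink) (B : Rect) : Prop :=
  ∃ γ δ : ℝ → R3, IsCrossinglessTangle Λ.toOrientedLink B γ δ ∧
    HasNoCusp γ ∧ HasNoCusp δ ∧
    (γ (-1)).1 = B.a ∧ (γ 1).1 = B.b ∧ (δ (-1)).1 = B.b ∧ (δ 1).1 = B.a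

/-- Over `B` the link is a basic, compatibly oriented Legendrian `∞`-tangle: two strands without
crossings, with one cusp each, one joining two points of the left side of `B`, the other one
joining two points of the right side. -/
def IsBasicInftyTangle (Λ : LegendrianLink) (B : Rect) : Prop :=
  ∃ γ δ : ℝ → R3, IsCrossinglessTangle Λ.toOrientedLink B γ δ ∧
    HasOneCusp γ ∧ HasOneCusp δ ∧
    (γ (-1)).1 = B.a ∧ (γ 1).1 = B.a ∧ (δ (-1)).1 = B.b ∧ (δ 1).1 = B.b

/-- `Λ'` is obtained from `Λ` by one oriented Legendrian surgery (Legendrian links being regarded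
up to equivalence): after a Legendrian isotopy, a basic, compatibly oriented `0`-tangle is replaced
by a basic, compatibly oriented `∞`-tangle. -/
def IsLegendrianSurgery (Λ Λ' : LegendrianLink) : Prop :=
  ∃ M M' : LegendrianLink, LegendrianIsotopic Λ M ∧ LegendrianIsotopic M' Λ' ∧
    ∃ B : Rect, AgreeOutside B M.toOrientedLink M'.toOrientedLink ∧
      IsBasicZeroTangle M B ∧ IsBasicInftyTangle M' B

/-- There is an oriented, unknotting surgery string `(s n, …, s 1, s 0)` of length `n` for `Λ`. -/
def HasUnknottingString (Λ : LegendrianLink) (n : ℕ) : Prop :=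
  ∃ s : ℕ → LegendrianLink, s n = Λ ∧ (∀ j < n, IsLegendrianSurgery (s (j + 1)) (s j)) ∧
    (s 0).IsUnknot

/-- The surgery unknotting number: the minimal length of an oriented, unknotting surgery string
(it would be `⊤` if there were no such string). -/
noncomputable def surgeryUnknottingNumber (Λ : LegendrianLink) : ℕ∞ :=
  ⨅ (n : ℕ) (_ : HasUnknottingString Λ n), (n : ℕ∞)

/-- Over the rectangle `B` the front of `Λ` consists of the graphs of `f` and `g` over `[B.a, B.b]`,
which meet in exactly one point, a crossing with `x`-coordinate `x₀`, and this crossing is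
negative: the two strands point to opposite sides of the vertical line through it. (As `Λ` is
Legendrian, the strands are the lifts of the graphs by `y = dz/dx`.) -/
def IsNegativeCrossing (Λ : LegendrianLink) (B : Rect) (f g : ℝ → ℝ) (x₀ : ℝ) : Prop :=
  ContDiff ℝ ∞ f ∧ ContDiff ℝ ∞ g ∧ x₀ ∈ Ioo B.a B.b ∧
  (∀ x ∈ Icc B.a B.b, f x ∈ Ioo B.c B.d ∧ g x ∈ Ioo B.c B.d) ∧
  (∀ x ∈ Icc B.a B.b, f x = g x ↔ x = x₀) ∧
  deriv f x₀ ≠ deriv g x₀ ∧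
  Λ.carrier ∩ B.cylinder = (fun x => ((x, deriv f x, f x) : R3)) '' Icc B.a B.b ∪
    (fun x => ((x, deriv g x, g x) : R3)) '' Icc B.a B.b ∧
  ∃ v w : R3, (((x₀, deriv f x₀, f x₀) : R3), v) ∈ Λ.vec ∧
    (((x₀, deriv g x₀, g x₀) : R3), w) ∈ Λ.vec ∧ v.1 * w.1 < 0

/-- The smooth link `K` is obtained from the Legendrian link `Λ` by topologically changing a
negative crossing of the front inside the rectangle `B`: outside the cylinder over `B` nothing
changes, over `B` the projection to the `xz`-plane stays the same, and at the crossing the order of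
the two strands in the `y`-direction is reversed. -/
def IsNegativeCrossingChange (Λ : LegendrianLink) (B : Rect) (K : OrientedLink) : Prop :=
  ∃ (f g : ℝ → ℝ) (x₀ : ℝ), IsNegativeCrossing Λ B f g x₀ ∧
    AgreeOutside B Λ.toOrientedLink K ∧
    ∃ u v : ℝ → ℝ, ContDiff ℝ ∞ u ∧ ContDiff ℝ ∞ v ∧
      K.carrier ∩ B.cylinder = (fun x => ((x, u x, f x) : R3)) '' Icc B.a B.b ∪
        (fun x => ((x, v x, g x) : R3)) '' Icc B.a B.b ∧
      (deriv f x₀ - deriv g x₀) * (u x₀ - v x₀) < 0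

/-! At a negative crossing the two strands run in opposite `x`-directions, so just to the left of
the crossing they form a compatibly oriented `0`-tangle. A first surgery there closes off the two
left ends by a finger with a right cusp, and joins the two right ends by a bend, which has a left
cusp and whose branches form the old crossing. The finger is then pushed far to the right by a
Legendrian isotopy. It crosses the rising branch of the bend in the front, but its slope stays
smaller than that of the branch, so the strands never touch. Beyond this crossing the upper edge of
the finger runs below the rising branch and in the opposite direction. A second surgery on these two
strands pairs the four ends as they were paired at the start.

The new strand between the ends of the line `z = -x`, the hook, meets the other new strand, the
snake, in one front point, and there it has the larger `y`-coordinate. Before the surgeries the line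
`z = -x` had the smaller one. The double points of the hook with itself are ordered like the values
of a function `peak` with a single maximum, so the hook can be lifted above everything else and
unfolded there. The snake never descends, so afterwards it can be pulled straight underneath. What
remains is the original crossing with the strands exchanged in the `y`-direction.

All of this is done for one explicit model, the lines `z = -x` and `z = x` in a large cylinder.
Cusped Legendrian arcs are given by the formula `cuspArc`. The isotopies come from two extension
results for arcs, `ambientIsotopic_of_arc_family` and `legendrianIsotopic_of_arc_family`, and the
surgeries are `isLegendrianSurgery_first` and `isLegendrianSurgery_second`. The topological part is
`ambientIsotopic_model`.

A general negative crossing is carried to the model by a contact diffeomorphism `frontMap`, which is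
joined to the identity by contact maps. Since surgery is defined up to Legendrian isotopy, surgeries
can be pulled back along it. Finally, the link so obtained and `K` have the same front over the
rectangle and the same order at the crossing. A diffeomorphism which is affine on each line in the
`y`-direction carries one to the other (`ambientIsotopic_of_graphs`); its smoothness at the sides of
the rectangle uses that both links continue smoothly into the same link outside. -/

open scoped Topology Manifold

/-! ### Ambient isotopies: equivalence relation and small perturbations of the identity -/

/-- A global inverse of a smooth bijection with injective differentials is smooth. -/
theorem contDiff_inverse_of_injective_fderiv {E : Type*} [NormedAddCommGroup E] [NormedSpace ℝ E]
    [FiniteDimensional ℝ E] {f g : E → E} (hf : ContDiff ℝ ∞ f)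
    (hinj : ∀ x, Function.Injective (fderiv ℝ f x)) (hgf : ∀ x, g (f x) = x)
    (hfg : ∀ x, f (g x) = x) : ContDiff ℝ ∞ g := by
  have : CompleteSpace E := FiniteDimensional.complete ℝ E
  rw [contDiff_iff_contDiffAt]
  intro y
  set x := g y with hx
  let e : E ≃L[ℝ] E :=
    (LinearEquiv.ofInjectiveEndo (fderiv ℝ f x : E →ₗ[ℝ] E) (hinj x)).toContinuousLinearEquiv
  have he : (e : E →L[ℝ] E) = fderiv ℝ f x := by ext v; rfl
  have hd : HasFDerivAt f (e : E →L[ℝ] E) x := by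
    rw [he]; exact (hf.differentiable (by simp) x).hasFDerivAt
  have hs : HasStrictFDerivAt f (e : E →L[ℝ] E) x :=
    hf.contDiffAt.hasStrictFDerivAt' hd (by simp)
  have hli := (hf.contDiffAt (x := x)).to_localInverse hd (by simp)
  have hfx : f x = y := hfg y
  rw [hfx] at hli
  refine hli.congr_of_eventuallyEq ?_
  have := hs.eventually_right_inverse
  rw [hfx] at this
  filter_upwards [this] with z hz
  have h2 := congrArg g hz
  rw [hgf] at h2
  exact h2.symm

theorem AmbientIsotopic.trans {S T U : Set R3} (h₁ : AmbientIsotopic S T)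
    (h₂ : AmbientIsotopic T U) : AmbientIsotopic S U := by
  obtain ⟨F₁, G₁, hF₁, hG₁, hi₁, h0₁, he₁⟩ := h₁
  obtain ⟨F₂, G₂, hF₂, hG₂, hi₂, h0₂, he₂⟩ := h₂
  refine ⟨fun t p => F₂ t (F₁ t p), fun t p => G₁ t (G₂ t p),
    hF₂.comp (contDiff_fst.prodMk hF₁), hG₁.comp (contDiff_fst.prodMk hG₂), fun t p => ?_,
    fun p => ?_, ?_⟩
  · simp [(hi₁ t _).1, (hi₁ t _).2, (hi₂ t _).1, (hi₂ t _).2]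
  · simp [h0₁, h0₂]
  · rw [← he₂, ← he₁, image_image]

theorem AmbientIsotopic.symm {S T : Set R3} (h : AmbientIsotopic S T) : AmbientIsotopic T S := by
  obtain ⟨F, G, hF, hG, hi, h0, he⟩ := h
  -- Time is reversed, and precomposition with `G 1` makes the reversed family start at the
  -- identity.
  refine ⟨fun t p => F (1 - t) (G 1 p), fun t p => F 1 (G (1 - t) p), ?_, ?_, fun t p => ?_,
    fun p => ?_, ?_⟩
  · exact hF.comp ((contDiff_const.sub contDiff_fst).prodMk
      (hG.comp (contDiff_const.prodMk contDiff_snd)))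
  · exact hF.comp (contDiff_const.prodMk
      (hG.comp ((contDiff_const.sub contDiff_fst).prodMk contDiff_snd)))
  · simp [(hi _ _).1, (hi _ _).2]
  · simp [(hi _ _).2]
  · have h0' : ∀ p, F (1 - 1) p = p := by intro p; rw [sub_self]; exact h0 p
    rw [← he, image_image]
    simp [(hi _ _).1, h0]

/-- A smooth family of diffeomorphisms starting at the identity moves a set by an ambient
isotopy. -/
theorem ambientIsotopic_image {F G : ℝ → R3 → R3} (hF : ContDiff ℝ ∞ (fun w : ℝ × R3 => F w.1 w.2))
    (hG : ContDiff ℝ ∞ (fun w : ℝ × R3 => G w.1 w.2))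
    (hi : ∀ t p, G t (F t p) = p ∧ F t (G t p) = p) (h0 : ∀ p, F 0 p = p) (S : Set R3) :
    AmbientIsotopic S (F 1 '' S) :=
  ⟨F, G, hF, hG, hi, h0, rfl⟩

/-- A smooth vector field that is a contraction generates an ambient isotopy. -/
theorem ambientIsotopic_image_add {V : R3 → R3} (hV : ContDiff ℝ ∞ V)
    (hb : ∀ p, ‖fderiv ℝ V p‖ ≤ 1 / 2) (S : Set R3) :
    AmbientIsotopic S ((fun p => p + V p) '' S) := by
  -- Time ranges over all of `ℝ`. The smooth step keeps the factor of `V` in `[0, 1]`, so every `F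
  -- t` is the identity plus a `1/2`-Lipschitz map, hence a homeomorphism.
  let ρ : ℝ → ℝ := Real.smoothTransition
  have hρ : ContDiff ℝ ∞ ρ := Real.smoothTransition.contDiff
  let F : ℝ → R3 → R3 := fun t p => p + ρ t • V p
  have hF : ContDiff ℝ ∞ (fun w : ℝ × R3 => F w.1 w.2) :=
    contDiff_snd.add ((hρ.comp contDiff_fst).smul (hV.comp contDiff_snd))
  have hlip : LipschitzWith (1 / 2) V :=
    lipschitzWith_of_nnnorm_fderiv_le (hV.differentiable (by simp)) (fun p => by
      have := hb p
      rw [← NNReal.coe_le_coe]; simpa using this)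
  have happ : ∀ t, ApproximatesLinearOn (F t)
      ((ContinuousLinearEquiv.refl ℝ R3 : R3 ≃L[ℝ] R3) : R3 →L[ℝ] R3) univ (1 / 2) := by
    intro t
    rw [ApproximatesLinearOn.approximatesLinearOn_iff_lipschitzOnWith, lipschitzOnWith_univ]
    have : (F t - ⇑((ContinuousLinearEquiv.refl ℝ R3 : R3 ≃L[ℝ] R3) : R3 →L[ℝ] R3))
        = fun p => ρ t • V p := by
      ext1 p; simp [F]
    rw [this]
    refine LipschitzWith.of_dist_le_mul fun p q => ?_
    rw [dist_smul₀]
    have h1 := hlip.dist_le_mul p q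
    have h2 : ‖ρ t‖ ≤ 1 := by
      rw [Real.norm_eq_abs, abs_of_nonneg (Real.smoothTransition.nonneg t)]
      exact Real.smoothTransition.le_one t
    calc ‖ρ t‖ * dist (V p) (V q) ≤ 1 * dist (V p) (V q) := by gcongr
      _ ≤ _ := by simpa using h1
  have hc : Subsingleton R3 ∨ (1 / 2 : NNReal) <
      ‖((ContinuousLinearEquiv.refl ℝ R3 : R3 ≃L[ℝ] R3).symm : R3 →L[ℝ] R3)‖₊⁻¹ := by
    right
    have : ((ContinuousLinearEquiv.refl ℝ R3 : R3 ≃L[ℝ] R3).symm : R3 →L[ℝ] R3)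
      = ContinuousLinearMap.id ℝ R3 := rfl
    rw [this]
    have h1 : ‖ContinuousLinearMap.id ℝ R3‖₊ = 1 := by
      ext; exact ContinuousLinearMap.norm_id
    rw [h1, inv_one]
    rw [← NNReal.coe_lt_coe]; norm_num
  let H : ℝ → R3 ≃ₜ R3 := fun t => (happ t).toHomeomorph _ hc
  have hH : ∀ t p, H t p = F t p := fun t p => rfl
  let G : ℝ → R3 → R3 := fun t => (H t).symm
  have hi : ∀ t p, G t (F t p) = p ∧ F t (G t p) = p := fun t p =>
    ⟨(H t).symm_apply_apply p, (H t).apply_symm_apply p⟩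
  -- Joint smoothness of the inverses in time and space comes from inverting the track map on `ℝ ×
  -- R3`; its differential is injective because `V` contracts.
  let Φ : ℝ × R3 → ℝ × R3 := fun w => (w.1, F w.1 w.2)
  let Ψ : ℝ × R3 → ℝ × R3 := fun w => (w.1, G w.1 w.2)
  have hΦ : ContDiff ℝ ∞ Φ := contDiff_fst.prodMk hF
  have hΨ : ContDiff ℝ ∞ Ψ := by
    refine contDiff_inverse_of_injective_fderiv hΦ (fun w => ?_) (fun w => ?_) (fun w => ?_)
    · rw [injective_iff_map_eq_zero]
      intro v hv
      have hd1 : HasFDerivAt Φ ((ContinuousLinearMap.fst ℝ ℝ R3).prod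
          (ContinuousLinearMap.snd ℝ ℝ R3 +
            (ρ w.1 • (fderiv ℝ V w.2).comp (ContinuousLinearMap.snd ℝ ℝ R3) +
              ((fderiv ℝ ρ w.1).comp (ContinuousLinearMap.fst ℝ ℝ R3)).smulRight (V w.2)))) w := by
        refine HasFDerivAt.prodMk hasFDerivAt_fst ?_
        refine hasFDerivAt_snd.add ?_
        refine HasFDerivAt.fun_smul ?_ ?_
        · exact ((hρ.differentiable (by simp) w.1).hasFDerivAt).comp w hasFDerivAt_fst
        · exact ((hV.differentiable (by simp) w.2).hasFDerivAt).comp w hasFDerivAt_snd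
      rw [hd1.fderiv] at hv
      simp only [ContinuousLinearMap.prod_apply, ContinuousLinearMap.coe_fst', Prod.mk_eq_zero,
        add_apply, ContinuousLinearMap.coe_snd',
        smul_apply, ContinuousLinearMap.comp_apply,
        ContinuousLinearMap.smulRight_apply] at hv
      obtain ⟨h1, h2⟩ := hv
      rw [h1, map_zero, zero_smul, add_zero] at h2
      have h3 : ‖v.2‖ ≤ 1 / 2 * ‖v.2‖ := by
        have : v.2 = -(ρ w.1 • (fderiv ℝ V w.2) v.2) := eq_neg_of_add_eq_zero_left h2
        calc ‖v.2‖ = ‖ρ w.1‖ * ‖(fderiv ℝ V w.2) v.2‖ := by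
              conv_lhs => rw [this]
              rw [norm_neg, norm_smul]
          _ ≤ 1 * (1 / 2 * ‖v.2‖) := by
              gcongr
              · rw [Real.norm_eq_abs, abs_of_nonneg (Real.smoothTransition.nonneg _)]
                exact Real.smoothTransition.le_one _
              · exact ((fderiv ℝ V w.2).le_opNorm _).trans (by gcongr; exact hb _)
          _ = _ := one_mul _
      have h4 : v.2 = 0 := by
        rw [← norm_le_zero_iff]; linarith
      exact Prod.ext h1 h4
    · exact Prod.ext rfl (hi w.1 w.2).1
    · exact Prod.ext rfl (hi w.1 w.2).2
  have hG : ContDiff ℝ ∞ (fun w : ℝ × R3 => G w.1 w.2) := contDiff_snd.comp hΨ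
  have h := ambientIsotopic_image hF hG hi (fun p => by
    simp [F, ρ, Real.smoothTransition.zero]) S
  have hF1 : F 1 = fun p => p + V p := by
    ext1 p; simp [F, ρ, Real.smoothTransition.one]
  rwa [hF1] at h

/-! ### Left inverses of embedded arcs, and cutoff functions -/

/-- The inverse function theorem gives an inverse near one point. Shrinking to the open set where
the derivative is non-zero makes it smooth on its whole target. -/
theorem exists_open_smooth_inverse {φ : ℝ → ℝ} {I : Set ℝ} {t₀ : ℝ} (hI : IsOpen I) (ht : t₀ ∈ I)
    (hφ : ContDiffOn ℝ ∞ φ I) (hd : deriv φ t₀ ≠ 0) :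
    ∃ (σ : ℝ → ℝ) (W I' : Set ℝ), IsOpen W ∧ IsOpen I' ∧ φ t₀ ∈ W ∧ t₀ ∈ I' ∧ I' ⊆ I ∧
      ContDiffOn ℝ ∞ σ W ∧ (∀ t ∈ I', φ t ∈ W ∧ σ (φ t) = t) ∧
      (∀ y ∈ W, σ y ∈ I' ∧ φ (σ y) = y) := by
  have hφa : ∀ t ∈ I, ContDiffAt ℝ ∞ φ t := fun t h => hφ.contDiffAt (hI.mem_nhds h)
  have hda : ∀ t ∈ I, HasDerivAt φ (deriv φ t) t := fun t h =>
    ((hφa t h).differentiableAt (by simp)).hasDerivAt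
  have hfd := (hda t₀ ht).hasFDerivAt_equiv hd
  let e := (hφa t₀ ht).toOpenPartialHomeomorph φ hfd (by simp)
  have he : ∀ t, e t = φ t := fun t => rfl
  have hopen : IsOpen {t | t ∈ I ∧ deriv φ t ≠ 0} := by
    have hc : ContinuousOn (deriv φ) I := hφ.continuousOn_deriv_of_isOpen hI (by simp)
    have := hc.isOpen_inter_preimage hI (isOpen_compl_singleton (x := (0 : ℝ)))
    exact this
  let e' := e.restrOpen _ hopen
  have hsrc : e'.source = e.source ∩ {t | t ∈ I ∧ deriv φ t ≠ 0} := e.restrOpen_source _ hopen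
  refine ⟨e'.symm, e'.target, e'.source, e'.open_target, e'.open_source, ?_, ?_, ?_, ?_, ?_, ?_⟩
  · exact e'.map_source (x := t₀) (by
      rw [hsrc]; exact ⟨ContDiffAt.mem_toOpenPartialHomeomorph_source _ hfd _, ht, hd⟩)
  · rw [hsrc]; exact ⟨ContDiffAt.mem_toOpenPartialHomeomorph_source _ hfd _, ht, hd⟩
  · rw [hsrc]; exact fun t h => h.2.1
  · intro y hy
    have hs := e'.map_target hy
    rw [hsrc] at hs
    refine ContDiffAt.contDiffWithinAt ?_
    refine e'.contDiffAt_symm_deriv (f₀' := deriv φ (e'.symm y)) hs.2.2 hy ?_ ?_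
    · exact hda _ hs.2.1
    · exact hφa _ hs.2.1
  · exact fun t h => ⟨e'.map_source h, e'.left_inv h⟩
  · exact fun y h => ⟨e'.map_target h, e'.right_inv h⟩

/-- A coordinate of three-space. -/
def coordL (i : Fin 3) : R3 →L[ℝ] ℝ :=
  match i with
  | 0 => ContinuousLinearMap.fst ℝ ℝ (ℝ × ℝ)
  | 1 => (ContinuousLinearMap.fst ℝ ℝ ℝ).comp (ContinuousLinearMap.snd ℝ ℝ (ℝ × ℝ))
  | 2 => (ContinuousLinearMap.snd ℝ ℝ ℝ).comp (ContinuousLinearMap.snd ℝ ℝ (ℝ × ℝ))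

theorem exists_coordL_ne_zero {v : R3} (hv : v ≠ 0) : ∃ i, coordL i v ≠ 0 := by
  by_contra! h
  exact hv (Prod.ext (h 0) (Prod.ext (h 1) (h 2)))

/-- Some coordinate of the velocity is non-zero, and inverting that coordinate alone recovers the
parameter. -/
theorem exists_local_left_inverse {c : ℝ → R3} {t₀ : ℝ} (hc : ContDiff ℝ ∞ c)
    (hd : deriv c t₀ ≠ 0) :
    ∃ (U : Set R3) (I : Set ℝ) (τ : R3 → ℝ), IsOpen U ∧ c t₀ ∈ U ∧ IsOpen I ∧ t₀ ∈ I ∧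
      ContDiffOn ℝ ∞ τ U ∧ ∀ t ∈ I, c t ∈ U ∧ τ (c t) = t := by
  obtain ⟨i, hi⟩ := exists_coordL_ne_zero hd
  have hφ : ContDiff ℝ ∞ (fun t => coordL i (c t)) := (coordL i).contDiff.comp hc
  have hder : deriv (fun t => coordL i (c t)) t₀ = coordL i (deriv c t₀) :=
    ((coordL i).hasFDerivAt.comp_hasDerivAt t₀
      (hc.differentiable (by simp) t₀).hasDerivAt).deriv
  obtain ⟨σ, W, I', hW, hI', hmW, hmI, -, hσ, h1, -⟩ :=
    exists_open_smooth_inverse isOpen_univ (mem_univ t₀) hφ.contDiffOn (by rw [hder]; exact hi)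
  refine ⟨coordL i ⁻¹' W, I', fun p => σ (coordL i p), hW.preimage (coordL i).continuous, hmW, hI',
    hmI, ?_, fun t ht => h1 t ht⟩
  exact hσ.comp (coordL i).contDiff.contDiffOn (fun p hp => hp)

/-- An injectively immersed compact arc has a globally defined smooth left inverse. -/
theorem exists_global_left_inverse {c : ℝ → R3} {J : Set ℝ} (hJ : IsCompact J)
    (hc : ContDiff ℝ ∞ c) (hinj : InjOn c J) (hd : ∀ t ∈ J, deriv c t ≠ 0) :
    ∃ τ : R3 → ℝ, ContDiff ℝ ∞ τ ∧ ∀ t ∈ J, τ (c t) = t := by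
  -- `T p` is the set of values allowed at `p`: only the parameter if `p` lies on the arc,
  -- everything otherwise. These sets are convex, so a partition of unity glues local left inverses.
  let T : R3 → Set ℝ := fun p => {r | ∀ t ∈ J, c t = p → r = t}
  have hT : ∀ p, Convex ℝ (T p) := by
    intro p
    by_cases h' : ∃ t ∈ J, c t = p
    · obtain ⟨t, ht, htp⟩ := h'
      have : (T p).Subsingleton := fun a ha b hb => (ha t ht htp).trans (hb t ht htp).symm
      exact this.convex
    · push Not at h'
      have : T p = univ := eq_univ_of_forall fun r t ht h => absurd h (h' t ht)
      rw [this]; exact convex_univ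
  have hloc : ∀ p : R3, ∃ U ∈ 𝓝 p, ∃ g : R3 → ℝ,
      ContMDiffOn 𝓘(ℝ, R3) 𝓘(ℝ, ℝ) ∞ g U ∧ ∀ q ∈ U, g q ∈ T q := by
    intro p
    by_cases hp : p ∈ c '' J
    · obtain ⟨t₀, ht₀, rfl⟩ := hp
      obtain ⟨U, I, τ, hU, hmU, hI, hmI, hτ, h⟩ := exists_local_left_inverse hc (hd t₀ ht₀)
      have hcl : IsClosed (c '' (J \ I)) := ((hJ.diff hI).image hc.continuous).isClosed
      -- Removing the compact rest of the arc keeps distant parameters out of the neighbourhood.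
      refine ⟨U \ c '' (J \ I), (hU.sdiff hcl).mem_nhds ⟨hmU, ?_⟩, τ,
        (hτ.mono sdiff_subset).contMDiffOn, fun q hq t ht hqt => ?_⟩
      · rintro ⟨t, ht, he⟩
        exact ht.2 (hinj ht.1 ht₀ he ▸ hmI)
      · by_cases hti : t ∈ I
        · rw [← hqt, (h t hti).2]
        · exact absurd ⟨t, ⟨ht, hti⟩, hqt⟩ hq.2
    · refine ⟨(c '' J)ᶜ, (hJ.image hc.continuous).isClosed.isOpen_compl.mem_nhds hp, fun _ => 0,
        contMDiffOn_const, fun q hq t ht h => absurd ⟨t, ht, h⟩ hq⟩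
  obtain ⟨g, hg⟩ := exists_contMDiffMap_forall_mem_convex_of_local 𝓘(ℝ, R3) (n := ⊤) hT hloc
  exact ⟨g, g.contMDiff.contDiff, fun t ht => hg (c t) t ht rfl⟩

theorem exists_smooth_cutoff {E : Type*} [NormedAddCommGroup E] [NormedSpace ℝ E]
    [FiniteDimensional ℝ E] {s t : Set E} (hs : IsClosed s) (ht : IsClosed t)
    (hd : Disjoint s t) :
    ∃ χ : E → ℝ, ContDiff ℝ ∞ χ ∧ (∀ p ∈ s, ∀ᶠ q in 𝓝 p, χ q = 0) ∧
      (∀ p ∈ t, ∀ᶠ q in 𝓝 p, χ q = 1) ∧ ∀ p, χ p ∈ Icc (0 : ℝ) 1 := by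
  obtain ⟨f, h0, h1, h⟩ := exists_contMDiffMap_zero_one_nhds_of_isClosed 𝓘(ℝ, E) (n := ⊤) hs ht hd
  refine ⟨f, f.contMDiff.contDiff, fun p hp => ?_, fun p hp => ?_, h⟩
  · exact Filter.Eventually.filter_mono (nhds_le_nhdsSet hp) h0
  · exact Filter.Eventually.filter_mono (nhds_le_nhdsSet hp) h1

/-! ### Isotopy extension for arcs -/

/-- Isotopy extension for arcs: a smooth family of embedded arcs which is constant outside `J'` and
moves in the complement of a closed set `A` is realized by an ambient isotopy fixing `A`. -/
theorem ambientIsotopic_of_arc_family {c : ℝ → ℝ → R3}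
    (hc : ContDiff ℝ ∞ (fun w : ℝ × ℝ => c w.1 w.2)) {J J' : Set ℝ} (hJ : IsCompact J)
    (hJ' : IsCompact J') {A : Set R3} (hA : IsClosed A)
    (hinj : ∀ s ∈ Icc (0 : ℝ) 1, InjOn (c s) J)
    (himm : ∀ s ∈ Icc (0 : ℝ) 1, ∀ t ∈ J, deriv (c s) t ≠ 0)
    (hfix : ∀ s ∈ Icc (0 : ℝ) 1, ∀ t ∈ J, t ∉ J' → c s t = c 0 t)
    (havoid : ∀ s ∈ Icc (0 : ℝ) 1, ∀ t ∈ J', c s t ∉ A) :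
    AmbientIsotopic (A ∪ c 0 '' J) (A ∪ c 1 '' J) := by
  have hcs : ∀ s, ContDiff ℝ ∞ (c s) := fun s => hc.comp (contDiff_const.prodMk contDiff_id)
  -- Ambient isotopy is an equivalence relation and the time interval is connected, so it suffices
  -- to treat nearby times, for which the displacement is a contraction.
  refine isPreconnected_Icc.induction₂ (s := Icc (0 : ℝ) 1)
    (fun s s' => AmbientIsotopic (A ∪ c s '' J) (A ∪ c s' '' J)) ?_
    (fun _ _ _ _ _ _ => AmbientIsotopic.trans) (fun _ _ _ _ => AmbientIsotopic.symm)
    (left_mem_Icc.2 zero_le_one) (right_mem_Icc.2 zero_le_one)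
  intro s₀ hs₀
  obtain ⟨τ, hτ, hτc⟩ := exists_global_left_inverse hJ (hcs s₀) (hinj s₀ hs₀) (himm s₀ hs₀)
  have hK : IsCompact (c s₀ '' J') := hJ'.image (hcs s₀).continuous
  obtain ⟨R, hR⟩ := hK.isBounded.subset_ball (0 : R3)
  have hdisj : Disjoint (A ∪ (Metric.ball (0 : R3) R)ᶜ) (c s₀ '' J') := by
    rw [disjoint_right]
    rintro _ ⟨t, ht, rfl⟩ (h | h)
    · exact havoid s₀ hs₀ t ht h
    · exact h (hR ⟨t, ht, rfl⟩)
  obtain ⟨χ, hχ, hχ0, hχ1, -⟩ := exists_smooth_cutoff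
    (hA.union Metric.isOpen_ball.isClosed_compl) hK.isClosed hdisj
  -- The displacement of the arc is extended to space through the left inverse `τ` and cut off near
  -- `A` and outside a ball. It vanishes identically for `s = s₀`, so by compactness of the ball its
  -- differential is small for `s` near `s₀`.
  let W : ℝ → R3 → R3 := fun s q => χ q • (c s (τ q) - c s₀ (τ q))
  have hW : ContDiff ℝ ∞ (fun w : ℝ × R3 => W w.1 w.2) := by
    refine (hχ.comp contDiff_snd).smul (ContDiff.sub ?_ ?_)
    · exact hc.comp (contDiff_fst.prodMk (hτ.comp contDiff_snd))
    · exact (hcs s₀).comp (hτ.comp contDiff_snd)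
  have hWs : ∀ s, ContDiff ℝ ∞ (W s) := fun s => hW.comp (contDiff_const.prodMk contDiff_id)
  have hD : Continuous (fun w : ℝ × R3 => fderiv ℝ (W w.1) w.2) := by
    have h1 : ContDiff ℝ ∞ (Function.uncurry fun (w : ℝ × R3) (p : R3) => W w.1 p) :=
      hW.comp ((contDiff_fst.comp contDiff_fst).prodMk contDiff_snd)
    exact (ContDiff.fderiv (n := 0) (m := ∞) (f := fun w : ℝ × R3 => W w.1) h1 contDiff_snd
      (by simp)).continuous
  have hW0 : W s₀ = fun _ => 0 := by
    ext1 q; simp [W]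
  have hsmall : ∀ᶠ s in 𝓝 s₀, ∀ q ∈ Metric.closedBall (0 : R3) R, ‖fderiv ℝ (W s) q‖ < 1 / 2 := by
    refine (isCompact_closedBall (0 : R3) R).eventually_forall_of_forall_eventually
      (fun q _ => ?_)
    have h1 : ContinuousAt (fun w : ℝ × R3 => ‖fderiv ℝ (W w.1) w.2‖) (s₀, q) :=
      hD.norm.continuousAt
    refine h1.eventually_lt_const ?_
    simp [hW0]
  refine (hsmall.filter_mono nhdsWithin_le_nhds).and self_mem_nhdsWithin |>.mono ?_
  rintro s ⟨hs, hs01⟩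
  have hb : ∀ p, ‖fderiv ℝ (W s) p‖ ≤ 1 / 2 := by
    intro p
    by_cases hp : p ∈ Metric.closedBall (0 : R3) R
    · exact (hs p hp).le
    · have h0 := hχ0 p (Or.inr fun h => hp (Metric.ball_subset_closedBall h))
      have : W s =ᶠ[𝓝 p] fun _ => 0 := h0.mono fun q hq => by simp [W, hq]
      rw [this.fderiv_eq]; simp
  have key := ambientIsotopic_image_add (hWs s) hb (A ∪ c s₀ '' J)
  have himg : (fun p => p + W s p) '' (A ∪ c s₀ '' J) = A ∪ c s '' J := by
    rw [image_union]
    congr 1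
    · refine (image_congr fun p hp => ?_).trans (image_id' A)
      have : χ p = 0 := (hχ0 p (Or.inl hp)).self_of_nhds
      simp [W, this]
    · rw [image_image]
      refine image_congr fun t ht => ?_
      simp only [W, hτc t ht]
      by_cases h : t ∈ J'
      · have : χ (c s₀ t) = 1 := (hχ1 _ ⟨t, h, rfl⟩).self_of_nhds
        simp [this]
      · rw [hfix s hs01 t ht h, hfix s₀ hs₀ t ht h]; simp
  rwa [himg] at key

/-! ### Oriented arcs as pieces of links -/

/-- The positively oriented tangent vectors of the arc `a` over the parameter set `I`, where `a` is
traversed forwards if `ε > 0` and backwards if `ε < 0`. -/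
def vecOn (ε : ℝ) (a : ℝ → R3) (I : Set ℝ) : Set (R3 × R3) :=
  {q | ∃ t ∈ I, ∃ l : ℝ, 0 < l ∧ q = (a t, (l * ε) • deriv a t)}

/-- Differentiating `τ ∘ γ = id` shows that a chart has non-vanishing velocity. -/
theorem OrientedLink.vec_ne_zero (L : OrientedLink) {q : R3 × R3} (hq : q ∈ L.vec) : q.2 ≠ 0 := by
  obtain ⟨U, I, γ, τ, hU, hpU, hI, hγ, hτ, hinv, hset⟩ := L.chart q.1 ⟨q, hq, rfl⟩
  have hq' : q ∈ {q | ∃ t ∈ I, ∃ c : ℝ, 0 < c ∧ q = (γ t, c • deriv γ t)} := by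
    rw [← hset]; exact ⟨hq, hpU⟩
  obtain ⟨t, ht, c, hc, rfl⟩ := hq'
  have hγd : HasDerivAt γ (deriv γ t) t :=
    ((hγ.contDiffAt (hI.mem_nhds ht)).differentiableAt (by simp)).hasDerivAt
  have hτd : HasFDerivAt τ (fderiv ℝ τ (γ t)) (γ t) :=
    ((hτ.contDiffAt (hU.mem_nhds hpU)).differentiableAt (by simp)).hasFDerivAt
  have h1 : HasDerivAt (fun s => τ (γ s)) (fderiv ℝ τ (γ t) (deriv γ t)) t :=
    hτd.comp_hasDerivAt t hγd
  have h2 : HasDerivAt (fun s => τ (γ s)) 1 t :=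
    (hasDerivAt_id t).congr_of_eventuallyEq
      (Filter.eventuallyEq_of_mem (hI.mem_nhds ht) fun s hs => hinv s hs)
  have h3 := h1.unique h2
  intro h0
  rcases smul_eq_zero.1 h0 with h | h
  · exact hc.ne' h
  · rw [h, map_zero] at h3; exact zero_ne_one h3

/-- A chart for a link which near `a t₀` consists of the arc `a` alone. The closed set `D` holds
whatever else is nearby, and `K` confines the parameters visible in `W`, so that the distant parts
of the arc can be removed as a compact set. The substitution `t ↦ ε t` absorbs the orientation. -/
theorem exists_chart_of_arc {V : Set (R3 × R3)} {a : ℝ → R3} {ε : ℝ} (hε : ε = 1 ∨ ε = -1)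
    (ha : ContDiff ℝ ∞ a) (hinj : Function.Injective a) (himm : ∀ t, deriv a t ≠ 0) {t₀ : ℝ}
    {W D : Set R3} (hW : IsOpen W) (htW : a t₀ ∈ W) (hD : IsClosed D) (htD : a t₀ ∉ D)
    {K : Set ℝ} (hK : IsCompact K) (hWK : ∀ t, a t ∈ W → t ∈ K)
    (hV : ∀ q : R3 × R3, q.1 ∈ W → q.1 ∉ D → (q ∈ V ↔ q ∈ vecOn ε a univ)) :
    ∃ (U : Set R3) (I : Set ℝ) (γ : ℝ → R3) (τ : R3 → ℝ),
      IsOpen U ∧ a t₀ ∈ U ∧ IsOpen I ∧ ContDiffOn ℝ ∞ γ I ∧ ContDiffOn ℝ ∞ τ U ∧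
      (∀ t ∈ I, τ (γ t) = t) ∧
      {q ∈ V | q.1 ∈ U} = {q | ∃ t ∈ I, ∃ c : ℝ, 0 < c ∧ q = (γ t, c • deriv γ t)} := by
  obtain ⟨U₀, I₀, τ₀, hU₀, hmU, hI₀, hmI, hτ₀, hloc⟩ := exists_local_left_inverse ha (himm t₀)
  have hεε : ε * ε = 1 := by rcases hε with rfl | rfl <;> norm_num
  have hcl : IsClosed (a '' (K \ I₀)) := ((hK.diff hI₀).image ha.continuous).isClosed
  let U := ((U₀ ∩ W) \ D) \ a '' (K \ I₀)
  have hU : IsOpen U := ((hU₀.inter hW).sdiff hD).sdiff hcl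
  have hlin : ContDiff ℝ ∞ (fun t : ℝ => ε * t) := contDiff_const.mul contDiff_id
  have hγ : ContDiff ℝ ∞ (fun t => a (ε * t)) := ha.comp hlin
  have hder : ∀ t, deriv (fun t => a (ε * t)) t = ε • deriv a (ε * t) := by
    intro t
    have h1 : HasDerivAt (fun t : ℝ => ε * t) ε t := by
      simpa using (hasDerivAt_id t).const_mul ε
    exact ((ha.differentiable (by simp) (ε * t)).hasDerivAt.scomp t h1).deriv
  have hUI : ∀ t, a t ∈ U → t ∈ I₀ := fun t ht => by
    by_contra h
    exact ht.2 ⟨t, ⟨hWK t ht.1.1.2, h⟩, rfl⟩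
  refine ⟨U, {t | a (ε * t) ∈ U}, fun t => a (ε * t), fun p => ε * τ₀ p, hU, ?_,
    hU.preimage hγ.continuous, hγ.contDiffOn, ?_, ?_, ?_⟩
  · refine ⟨⟨⟨hmU, htW⟩, htD⟩, ?_⟩
    rintro ⟨t, ht, he⟩
    exact ht.2 (hinj he ▸ hmI)
  · exact contDiffOn_const.mul (hτ₀.mono fun p hp => hp.1.1.1)
  · intro t ht
    change ε * τ₀ (a (ε * t)) = t
    rw [(hloc _ (hUI _ ht)).2, ← mul_assoc, hεε, one_mul]
  · ext q
    constructor
    · rintro ⟨hq, hqU⟩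
      rw [hV q hqU.1.1.2 hqU.1.2] at hq
      obtain ⟨t, -, l, hl, rfl⟩ := hq
      have : ε * (ε * t) = t := by rw [← mul_assoc, hεε, one_mul]
      refine ⟨ε * t, ?_, l, hl, ?_⟩
      · change a (ε * (ε * t)) ∈ U
        rw [this]; exact hqU
      · rw [hder, smul_smul]; simp only [this]
    · rintro ⟨t, ht, l, hl, rfl⟩
      have ht' : a (ε * t) ∈ U := ht
      refine ⟨?_, ht'⟩
      rw [hV _ ht'.1.1.2 ht'.1.2]
      refine ⟨ε * t, mem_univ _, l, hl, ?_⟩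
      rw [hder, smul_smul]

/-- A smooth family of Legendrian arcs which is constant outside `J'` and moves in the complement
of a closed set `A` containing the rest of the link gives a Legendrian isotopy. -/
theorem legendrianIsotopic_of_arc_family {Λ Λ' : LegendrianLink} {c : ℝ → ℝ → R3} {ε : ℝ}
    (hc : ContDiff ℝ ∞ (fun w : ℝ × ℝ => c w.1 w.2)) {J J' : Set ℝ} (hJ : IsCompact J)
    (hJ' : IsCompact J') {A : Set R3} (hA : IsClosed A)
    (hinj : ∀ s ∈ Icc (0 : ℝ) 1, InjOn (c s) J)
    (himm : ∀ s ∈ Icc (0 : ℝ) 1, ∀ t ∈ J, deriv (c s) t ≠ 0)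
    (hleg : ∀ s ∈ Icc (0 : ℝ) 1, ∀ t ∈ J, contactForm (c s t) (deriv (c s) t) = 0)
    (hfix : ∀ s, ∀ t ∈ J, t ∉ J' → c s t = c 0 t)
    (havoid : ∀ s ∈ Icc (0 : ℝ) 1, ∀ t ∈ J', c s t ∉ A) (hε : ε ≠ 0)
    (hΛ : Λ.vec = {q ∈ Λ.vec | q.1 ∈ A} ∪ vecOn ε (c 0) (interior J))
    (hΛ' : Λ'.vec = {q ∈ Λ.vec | q.1 ∈ A} ∪ vecOn ε (c 1) (interior J)) :
    LegendrianIsotopic Λ Λ' := by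
  have h01 : (0 : ℝ) ∈ Icc (0 : ℝ) 1 := left_mem_Icc.2 zero_le_one
  have h11 : (1 : ℝ) ∈ Icc (0 : ℝ) 1 := right_mem_Icc.2 zero_le_one
  have hcs : ∀ s, ContDiff ℝ ∞ (c s) := fun s => hc.comp (contDiff_const.prodMk contDiff_id)
  obtain ⟨τ, hτ, hτc⟩ := exists_global_left_inverse hJ (hcs 0) (hinj 0 h01) (himm 0 h01)
  have hK : IsCompact (c 0 '' J') := hJ'.image (hcs 0).continuous
  have hdisj : Disjoint A (c 0 '' J') := by
    rw [disjoint_right]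
    rintro _ ⟨t, ht, rfl⟩
    exact havoid 0 h01 t ht
  obtain ⟨χ, hχ, hχ0, hχ1, -⟩ := exists_smooth_cutoff hA hK.isClosed hdisj
  -- A Legendrian isotopy only has to embed `Λ`, so no inverse and no smallness in `s` is needed:
  -- one formula serves for all times.
  let φ : ℝ → R3 → R3 := fun s q => q + χ q • (c s (τ q) - c 0 (τ q))
  have hφ : ContDiff ℝ ∞ (fun w : ℝ × R3 => φ w.1 w.2) := by
    refine contDiff_snd.add ((hχ.comp contDiff_snd).smul (ContDiff.sub ?_ ?_))
    · exact hc.comp (contDiff_fst.prodMk (hτ.comp contDiff_snd))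
    · exact (hcs 0).comp (hτ.comp contDiff_snd)
  have hφs : ∀ s, ContDiff ℝ ∞ (φ s) := fun s => hφ.comp (contDiff_const.prodMk contDiff_id)
  have hφA : ∀ s, ∀ p ∈ A, φ s =ᶠ[𝓝 p] fun q => q := fun s p hp =>
    (hχ0 p hp).mono fun q hq => by simp [φ, hq]
  have hφA' : ∀ s, ∀ p ∈ A, φ s p = p := fun s p hp => (hφA s p hp).self_of_nhds
  have hφA'' : ∀ s, ∀ p ∈ A, ∀ v, fderiv ℝ (φ s) p v = v := fun s p hp v => by
    rw [(hφA s p hp).fderiv_eq]; simp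
  have hφJ : ∀ s, ∀ t ∈ J, φ s (c 0 t) = c s t := by
    intro s t ht
    simp only [φ, hτc t ht]
    by_cases h : t ∈ J'
    · have : χ (c 0 t) = 1 := (hχ1 _ ⟨t, h, rfl⟩).self_of_nhds
      simp [this]
    · rw [hfix s t ht h]; simp
  have hφJ' : ∀ s, ∀ t ∈ interior J, fderiv ℝ (φ s) (c 0 t) (deriv (c 0) t) = deriv (c s) t := by
    intro s t ht
    have h1 : HasDerivAt (fun t => φ s (c 0 t)) (fderiv ℝ (φ s) (c 0 t) (deriv (c 0) t)) t :=
      ((hφs s).differentiable (by simp) (c 0 t)).hasFDerivAt.comp_hasDerivAt t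
        ((hcs 0).differentiable (by simp) t).hasDerivAt
    have h2 : (fun t => φ s (c 0 t)) =ᶠ[𝓝 t] c s :=
      Filter.eventuallyEq_of_mem (isOpen_interior.mem_nhds ht)
        fun u hu => hφJ s u (interior_subset hu)
    rw [← h2.deriv_eq, h1.deriv]
  have hcar : ∀ p ∈ Λ.carrier, p ∈ A ∨ ∃ t ∈ interior J, p = c 0 t := by
    rintro _ ⟨q, hq, rfl⟩
    rw [hΛ] at hq
    rcases hq with hq | ⟨t, ht, l, hl, rfl⟩
    · exact Or.inl hq.2
    · exact Or.inr ⟨t, ht, rfl⟩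
  -- A point of the moving arc can lie on `A` only if its parameter is outside `J'`, and then it has
  -- not moved. This separates the fixed part from the moving part.
  have hAc : ∀ s ∈ Icc (0 : ℝ) 1, ∀ p ∈ A, ∀ t ∈ J, p = c s t → p = c 0 t := by
    intro s hs p hp t ht h
    by_cases h' : t ∈ J'
    · exact absurd (h ▸ hp) (havoid s hs t h')
    · rw [h, hfix s t ht h']
  refine ⟨φ, hφ, fun p => by simp [φ], fun s hs => ⟨?_, ?_⟩, ?_⟩
  · intro p hp p' hp' he
    rcases hcar p hp with h | ⟨t, ht, rfl⟩ <;> rcases hcar p' hp' with h' | ⟨t', ht', rfl⟩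
    · rwa [hφA' s p h, hφA' s p' h'] at he
    · rw [hφA' s p h, hφJ s t' (interior_subset ht')] at he
      exact hAc s hs p h t' (interior_subset ht') he
    · rw [hφA' s p' h', hφJ s t (interior_subset ht)] at he
      exact (hAc s hs p' h' t (interior_subset ht) he.symm).symm
    · rw [hφJ s t (interior_subset ht), hφJ s t' (interior_subset ht')] at he
      rw [hinj s hs (interior_subset ht) (interior_subset ht') he]
  · intro q hq
    have hq' := hq
    rw [hΛ] at hq'
    rcases hq' with h | ⟨t, ht, l, hl, rfl⟩
    · rw [hφA'' s _ h.2, hφA' s _ h.2]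
      exact ⟨Λ.vec_ne_zero hq, Λ.legendrian q hq⟩
    · have htJ := interior_subset ht
      simp only [map_smul, hφJ' s t ht, hφJ s t htJ]
      refine ⟨smul_ne_zero (mul_ne_zero hl.ne' hε) (himm s hs t htJ), ?_⟩
      have := hleg s hs t htJ
      simp only [contactForm, Prod.smul_fst, Prod.smul_snd, smul_eq_mul] at this ⊢
      linear_combination (l * ε) * this
  · rw [hΛ']
    ext q
    constructor
    · rintro ⟨q, hq, rfl⟩
      have hq' := hq
      rw [hΛ] at hq'
      rcases hq' with h | ⟨t, ht, l, hl, rfl⟩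
      · left
        simp only [hφA'' 1 _ h.2, hφA' 1 _ h.2]
        exact h
      · right
        refine ⟨t, ht, l, hl, ?_⟩
        simp only [map_smul, hφJ' 1 t ht, hφJ 1 t (interior_subset ht)]
    · rintro (h | ⟨t, ht, l, hl, rfl⟩)
      · exact ⟨q, h.1, by simp only [hφA'' 1 _ h.2, hφA' 1 _ h.2]⟩
      · refine ⟨(c 0 t, (l * ε) • deriv (c 0) t), ?_, ?_⟩
        · rw [hΛ]; exact Or.inr ⟨t, ht, l, hl, rfl⟩
        · simp only [map_smul, hφJ' 1 t ht, hφJ 1 t (interior_subset ht)]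

/-! ### The model crossing and its replacement by two arcs -/

/-- The Legendrian lift of the line `z = -x`. -/
def fLine (t : ℝ) : R3 := (t, -1, -t)

/-- The Legendrian lift of the line `z = x`. -/
def gLine (t : ℝ) : R3 := (t, 1, t)

/-- The closed cylinder in which the model crossing is modified. -/
def modelCyl : Set R3 := {p | |p.1| ≤ 1000 ∧ |p.2.2| ≤ 2000}

/-- The interior of `modelCyl`. -/
def modelCylInt : Set R3 := {p | |p.1| < 1000 ∧ |p.2.2| < 2000}

/-- An open cylinder containing `modelCyl`. -/
def modelNhd : Set R3 := {p | |p.1| < 1001 ∧ |p.2.2| < 2001}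

/-- The tangent vectors of the model crossing; the strand with slope `-1` is oriented to the right
if `ε > 0` and to the left if `ε < 0`, the other one is oriented oppositely. -/
def crossVec (ε : ℝ) : Set (R3 × R3) := vecOn ε fLine univ ∪ vecOn (-ε) gLine univ

/-- Near the closed model cylinder the vectors `V` are those of the model crossing. -/
def HasModelCrossing (ε : ℝ) (V : Set (R3 × R3)) : Prop :=
  ∀ q : R3 × R3, q.1 ∈ modelNhd → (q ∈ V ↔ q ∈ crossVec ε)

/-- A pair of disjoint properly embedded arcs which coincide with the model crossing away from the
model cylinder. -/
structure IsTanglePair (e ε ε' : ℝ) (a b : ℝ → R3) : Prop where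
  smooth_left : ContDiff ℝ ∞ a
  smooth_right : ContDiff ℝ ∞ b
  inj_left : Function.Injective a
  inj_right : Function.Injective b
  imm_left : ∀ t, deriv a t ≠ 0
  imm_right : ∀ t, deriv b t ≠ 0
  disj : ∀ s t, a s ≠ b t
  tail : ∀ q : R3 × R3, 1000 ≤ |q.1.1| → (q ∈ vecOn ε a univ ∪ vecOn ε' b univ ↔ q ∈ crossVec e)
  bound_left : ∀ t, |(a t).1| ≤ 1000 → |(a t).2.2| < 2000
  bound_right : ∀ t, |(b t).1| ≤ 1000 → |(b t).2.2| < 2000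
  proper : ∃ T : ℝ, ∀ t, (|(a t).1| ≤ 1001 → |t| ≤ T) ∧ (|(b t).1| ≤ 1001 → |t| ≤ T)

/-- The vectors obtained by replacing the part over the model cylinder by the arcs `a` and `b`. -/
def replaceVec (V : Set (R3 × R3)) (ε ε' : ℝ) (a b : ℝ → R3) : Set (R3 × R3) :=
  {q | (q.1 ∈ modelCyl ∧ q ∈ vecOn ε a univ ∪ vecOn ε' b univ) ∨ (q.1 ∉ modelCyl ∧ q ∈ V)}

theorem modelCyl_subset_modelNhd : modelCyl ⊆ modelNhd := fun _ hp =>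
  ⟨hp.1.trans_lt (by norm_num), hp.2.trans_lt (by norm_num)⟩

theorem isOpen_modelNhd : IsOpen modelNhd := by
  refine IsOpen.and ?_ ?_ <;> exact isOpen_lt (by fun_prop) (by fun_prop)

theorem isOpen_modelCylInt : IsOpen modelCylInt := by
  refine IsOpen.and ?_ ?_ <;> exact isOpen_lt (by fun_prop) (by fun_prop)

theorem isClosed_modelCyl : IsClosed modelCyl := by
  exact (isClosed_le (f := fun p : R3 => |p.1|) (by fun_prop) continuous_const).inter
    (isClosed_le (f := fun p : R3 => |p.2.2|) (by fun_prop) continuous_const)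

theorem crossVec_snd {ε : ℝ} {q : R3 × R3} (hq : q ∈ crossVec ε) : |q.1.2.2| = |q.1.1| := by
  rcases hq with ⟨t, -, l, -, rfl⟩ | ⟨t, -, l, -, rfl⟩ <;> simp [fLine, gLine]

theorem vecOn_fst {ε : ℝ} {a : ℝ → R3} {t : ℝ} : (a t, ((1 : ℝ) * ε) • deriv a t) ∈ vecOn ε a univ :=
  ⟨t, mem_univ _, 1, one_pos, rfl⟩

section

variable {e ε ε' : ℝ} {a b : ℝ → R3} {V : Set (R3 × R3)}

/-- In the collar between `modelCyl` and `modelNhd` either `1000 ≤ |x|`, where the tails agree, or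
`|x| < 1000` and `2000 < |z|`, where neither the arcs nor the lines have points. -/
theorem mem_replaceVec_of_mem_modelNhd (hV : HasModelCrossing e V) (h : IsTanglePair e ε ε' a b)
    {q : R3 × R3} (hq : q.1 ∈ modelNhd) :
    q ∈ replaceVec V ε ε' a b ↔ q ∈ vecOn ε a univ ∪ vecOn ε' b univ := by
  by_cases hc : q.1 ∈ modelCyl
  · simp [replaceVec, hc]
  · have h1 : q ∈ replaceVec V ε ε' a b ↔ q ∈ V := by simp [replaceVec, hc]
    rw [h1, hV q hq]
    by_cases hx : 1000 ≤ |q.1.1|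
    · exact (h.tail q hx).symm
    · push Not at hx
      have hz : 2000 < |q.1.2.2| := by
        by_contra hz
        exact hc ⟨hx.le, not_lt.1 hz⟩
      constructor
      · intro hq'
        have := crossVec_snd hq'
        linarith
      · rintro (⟨t, -, l, -, rfl⟩ | ⟨t, -, l, -, rfl⟩)
        · exact absurd (h.bound_left t hx.le) (not_lt.2 hz.le)
        · exact absurd (h.bound_right t hx.le) (not_lt.2 hz.le)

/-- Removing the open instead of the closed cylinder exhibits the first piece as closed, which
yields compactness. Points of `V` on the boundary of the cylinder have `|x| = 1000`, since `|z| =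
|x|` on the lines, so they lie on the common tails. -/
theorem fst_image_replaceVec (hV : HasModelCrossing e V) (h : IsTanglePair e ε ε' a b) :
    Prod.fst '' replaceVec V ε ε' a b =
      (Prod.fst '' V \ modelCylInt) ∪ ((range a ∪ range b) ∩ modelCyl) := by
  ext p
  constructor
  · rintro ⟨q, ⟨hc, hq⟩ | ⟨hc, hq⟩, rfl⟩
    · right
      refine ⟨?_, hc⟩
      rcases hq with ⟨t, -, l, -, rfl⟩ | ⟨t, -, l, -, rfl⟩
      · exact Or.inl ⟨t, rfl⟩
      · exact Or.inr ⟨t, rfl⟩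
    · exact Or.inl ⟨⟨q, hq, rfl⟩, fun h => hc ⟨h.1.le, h.2.le⟩⟩
  · rintro (⟨⟨q, hq, rfl⟩, hi⟩ | ⟨⟨t, rfl⟩ | ⟨t, rfl⟩, hc⟩)
    · by_cases hc : q.1 ∈ modelCyl
      · have hq' := (hV q (modelCyl_subset_modelNhd hc)).1 hq
        have h1 := crossVec_snd hq'
        have hx : 1000 ≤ |q.1.1| := by
          by_contra hx
          push Not at hx
          exact hi ⟨hx, by rw [h1]; linarith⟩
        exact ⟨q, Or.inl ⟨hc, (h.tail q hx).2 hq'⟩, rfl⟩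
      · exact ⟨q, Or.inr ⟨hc, hq⟩, rfl⟩
    · exact ⟨_, Or.inl ⟨hc, Or.inl vecOn_fst⟩, rfl⟩
    · exact ⟨_, Or.inl ⟨hc, Or.inr vecOn_fst⟩, rfl⟩

theorem isCompact_range_inter_modelCyl (ha : ContDiff ℝ ∞ a)
    {T : ℝ} (hT : ∀ t, |(a t).1| ≤ 1001 → |t| ≤ T) : IsCompact (range a ∩ modelCyl) := by
  have : range a ∩ modelCyl = a '' Icc (-T) T ∩ modelCyl := by
    ext p
    constructor
    · rintro ⟨⟨t, rfl⟩, hc⟩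
      exact ⟨⟨t, abs_le.1 (hT t (hc.1.trans (by norm_num))), rfl⟩, hc⟩
    · rintro ⟨⟨t, -, rfl⟩, hc⟩
      exact ⟨⟨t, rfl⟩, hc⟩
  rw [this]
  exact (isCompact_Icc.image ha.continuous).inter_right isClosed_modelCyl

/-- Replacing the model crossing of a Legendrian link by a pair of Legendrian arcs. -/
theorem exists_legendrianLink_replaceVec (N : LegendrianLink) (hN : HasModelCrossing e N.vec)
    (hε : ε = 1 ∨ ε = -1) (hε' : ε' = 1 ∨ ε' = -1) (h : IsTanglePair e ε ε' a b)
    (hla : ∀ t, contactForm (a t) (deriv a t) = 0) (hlb : ∀ t, contactForm (b t) (deriv b t) = 0) :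
    ∃ L : LegendrianLink, L.vec = replaceVec N.vec ε ε' a b := by
  obtain ⟨T, hT⟩ := h.proper
  have hnear : ∀ q : R3 × R3, q.1 ∈ modelNhd →
      (q ∈ replaceVec N.vec ε ε' a b ↔ q ∈ vecOn ε a univ ∪ vecOn ε' b univ) := fun q hq =>
    mem_replaceVec_of_mem_modelNhd hN h hq
  have hcl : ∀ {a : ℝ → R3}, ContDiff ℝ ∞ a → IsClosed (a '' Icc (-T) T) := fun ha =>
    (isCompact_Icc.image ha.continuous).isClosed
  have hfst : ∀ {η : ℝ} {d : ℝ → R3}, (∀ t, |(d t).1| ≤ 1001 → |t| ≤ T) →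
      ∀ q : R3 × R3, q.1 ∈ modelNhd → q ∈ vecOn η d univ → q.1 ∈ d '' Icc (-T) T := by
    rintro η d hd q hq ⟨t, -, l, -, rfl⟩
    exact ⟨t, abs_le.1 (hd t hq.1.le), rfl⟩
  refine ⟨⟨⟨replaceVec N.vec ε ε' a b, ?_, ?_⟩, ?_⟩, rfl⟩
  · rw [fst_image_replaceVec hN h, union_inter_distrib_right]
    refine (N.isCompact_points.diff isOpen_modelCylInt).union ((isCompact_range_inter_modelCyl
      h.smooth_left fun t => (hT t).1).union (isCompact_range_inter_modelCyl
      h.smooth_right fun t => (hT t).2))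
  · rintro _ ⟨q, hq, rfl⟩
    by_cases hc : q.1 ∈ modelCyl
    · have hn := modelCyl_subset_modelNhd hc
      rw [hnear q hn] at hq
      rcases hq with ⟨t, -, l, -, rfl⟩ | ⟨t, -, l, -, rfl⟩
      · refine exists_chart_of_arc hε h.smooth_left h.inj_left h.imm_left isOpen_modelNhd hn
          (hcl h.smooth_right) ?_ (isCompact_Icc (a := -T) (b := T))
          (fun t ht => abs_le.1 ((hT t).1 ht.1.le)) ?_
        · rintro ⟨s, -, hs⟩
          exact h.disj t s hs.symm
        · intro q hq hq'
          rw [hnear q hq]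
          exact or_iff_left fun hb => hq' (hfst (fun t => (hT t).2) q hq hb)
      · refine exists_chart_of_arc hε' h.smooth_right h.inj_right h.imm_right isOpen_modelNhd hn
          (hcl h.smooth_left) ?_ (isCompact_Icc (a := -T) (b := T))
          (fun t ht => abs_le.1 ((hT t).2 ht.1.le)) ?_
        · rintro ⟨s, -, hs⟩
          exact h.disj s t hs
        · intro q hq hq'
          rw [hnear q hq]
          exact or_iff_right fun hb => hq' (hfst (fun t => (hT t).1) q hq hb)
    -- Off the closed cylinder the chart of `N` is reused, with the cylinder removed from its
    -- domain.
    · have hqN : q ∈ N.vec := by simpa [replaceVec, hc] using hq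
      obtain ⟨U, I, γ, τ, hU, hqU, hI, hγ, hτ, hinv, hset⟩ := N.chart q.1 ⟨q, hqN, rfl⟩
      refine ⟨U \ modelCyl, {t ∈ I | γ t ∉ modelCyl}, γ, τ, hU.sdiff isClosed_modelCyl, ⟨hqU, hc⟩,
        ?_, hγ.mono fun t ht => ht.1, hτ.mono sdiff_subset, fun t ht => hinv t ht.1, ?_⟩
      · exact hγ.continuousOn.isOpen_inter_preimage hI isClosed_modelCyl.isOpen_compl
      · ext r
        have hr := Set.ext_iff.1 hset r
        constructor
        · rintro ⟨hr1, hr2, hr3⟩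
          have hrN : r ∈ N.vec := by simpa [replaceVec, hr3] using hr1
          obtain ⟨t, ht, l, hl, rfl⟩ := hr.1 ⟨hrN, hr2⟩
          exact ⟨t, ⟨ht, hr3⟩, l, hl, rfl⟩
        · rintro ⟨t, ⟨ht, htc⟩, l, hl, rfl⟩
          have := hr.2 ⟨t, ht, l, hl, rfl⟩
          exact ⟨Or.inr ⟨htc, this.1⟩, this.2, htc⟩
  · rintro q (⟨-, hq⟩ | ⟨-, hq⟩)
    · rcases hq with ⟨t, -, l, -, rfl⟩ | ⟨t, -, l, -, rfl⟩
      · have := hla t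
        simp only [contactForm, Prod.smul_fst, Prod.smul_snd, smul_eq_mul] at this ⊢
        linear_combination (l * ε) * this
      · have := hlb t
        simp only [contactForm, Prod.smul_fst, Prod.smul_snd, smul_eq_mul] at this ⊢
        linear_combination (l * ε') * this
    · exact N.legendrian q hq

end

/-! ### Smooth substitutes for sign, absolute value and positive part -/

theorem contDiff_integral {f : ℝ → ℝ} (hf : ContDiff ℝ ∞ f) :
    ContDiff ℝ ∞ (fun t => ∫ u in (0 : ℝ)..t, f u) := by
  have hd : ∀ t, HasDerivAt (fun t => ∫ u in (0 : ℝ)..t, f u) (f t) t := fun t =>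
    hf.continuous.integral_hasStrictDerivAt 0 t |>.hasDerivAt
  rw [contDiff_infty_iff_deriv]
  refine ⟨fun t => (hd t).differentiableAt, ?_⟩
  rwa [show deriv (fun t => ∫ u in (0 : ℝ)..t, f u) = f from funext fun t => (hd t).deriv]

/-- The function is the primitive `G` of an even bump function, divided by `G 2`. The bump equals
`1` on `[0, 1]`, so `G 2 ≥ 1` and the division keeps the derivative at most `1`; this bound later
controls the slopes at the cusps. -/
theorem exists_smooth_sign : ∃ σ : ℝ → ℝ, ContDiff ℝ ∞ σ ∧ (∀ t, σ (-t) = -σ t) ∧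
    (∀ t, 2 ≤ t → σ t = 1) ∧ (∀ t, 0 ≤ deriv σ t) ∧ (∀ t, deriv σ t ≤ 1) ∧ 0 < deriv σ 0 ∧
    ∀ t, 0 < t → 0 < σ t := by
  let β : ContDiffBump (0 : ℝ) := ⟨1, 2, one_pos, one_lt_two⟩
  have hβ : ContDiff ℝ ∞ β := β.contDiff
  have hβi : ∀ a b, IntervalIntegrable β MeasureTheory.volume a b := fun a b =>
    hβ.continuous.intervalIntegrable a b
  have h1 : ∀ t ∈ Icc (0 : ℝ) 1, β t = 1 := fun t ht => β.one_of_mem_closedBall (by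
    rw [Metric.mem_closedBall, dist_zero_right, Real.norm_eq_abs, abs_of_nonneg ht.1]; exact ht.2)
  have h0 : ∀ t, 2 ≤ t → β t = 0 := fun t ht => β.zero_of_le_dist (by
    rw [dist_zero_right, Real.norm_eq_abs]; exact ht.trans (le_abs_self t))
  set G : ℝ → ℝ := fun t => ∫ u in (0 : ℝ)..t, β u with hG
  have hGd : ∀ t, HasDerivAt G (β t) t := fun t =>
    (hβ.continuous.integral_hasStrictDerivAt 0 t).hasDerivAt
  have hG1 : G 1 = 1 := by
    simp only [hG]
    rw [intervalIntegral.integral_congr (g := fun _ => (1 : ℝ))]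
    · simp
    · intro t ht
      rw [uIcc_of_le zero_le_one] at ht
      exact h1 t ht
  have hmono : Monotone G := monotone_of_deriv_nonneg (fun t => (hGd t).differentiableAt)
    fun t => by rw [(hGd t).deriv]; exact β.nonneg
  have hI : 1 ≤ G 2 := hG1 ▸ hmono one_le_two
  have hI0 : 0 < G 2 := one_pos.trans_le hI
  have hσd : ∀ t, HasDerivAt (fun t => G t / G 2) (β t / G 2) t := fun t => (hGd t).div_const _
  have hodd : ∀ t, G (-t) = -G t := by
    intro t
    simp only [hG]
    have : ∀ u, β u = β (-u) := fun u => (β.neg u).symm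
    rw [← intervalIntegral.integral_symm]
    calc (∫ u in (0 : ℝ)..-t, β u) = ∫ u in (0 : ℝ)..-t, β (-u) := by simp_rw [← this]
      _ = ∫ u in t..0, β u := by rw [intervalIntegral.integral_comp_neg]; simp
  refine ⟨fun t => G t / G 2, (contDiff_integral hβ).div_const _, fun t => by
    simp only; rw [hodd, neg_div], fun t ht => ?_, fun t => ?_, fun t => ?_, ?_, fun t ht => ?_⟩
  · have : G t = G 2 := by
      have := intervalIntegral.integral_add_adjacent_intervals (hβi 0 2) (hβi 2 t)
      simp only [hG]
      rw [← this, intervalIntegral.integral_congr (a := 2) (b := t) (g := fun _ => (0 : ℝ))]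
      · simp
      · intro u hu
        rw [uIcc_of_le ht] at hu
        exact h0 u hu.1
    simp only [this]
    exact div_self hI0.ne'
  · rw [(hσd t).deriv]
    exact div_nonneg β.nonneg hI0.le
  · rw [(hσd t).deriv]
    exact (div_le_one hI0).2 (β.le_one.trans hI)
  · rw [(hσd 0).deriv, h1 0 (by simp)]
    exact div_pos one_pos hI0
  · refine div_pos ?_ hI0
    rcases le_total t 1 with h | h
    · have : G t = t := by
        simp only [hG]
        rw [intervalIntegral.integral_congr (g := fun _ => (1 : ℝ))]
        · simp
        · intro u hu
          rw [uIcc_of_le ht.le] at hu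
          exact h1 u ⟨hu.1, hu.2.trans h⟩
      rwa [this]
    · exact one_pos.trans_le (hG1 ▸ hmono h)

/-- A smooth odd nondecreasing function which is `1` on `[2, ∞)`. -/
noncomputable def smoothSign : ℝ → ℝ := exists_smooth_sign.choose

section

local notation "σ" => smoothSign

theorem smoothSign_contDiff : ContDiff ℝ ∞ σ := exists_smooth_sign.choose_spec.1
theorem smoothSign_neg (t : ℝ) : σ (-t) = -σ t := exists_smooth_sign.choose_spec.2.1 t
theorem smoothSign_of_two_le {t : ℝ} (h : 2 ≤ t) : σ t = 1 :=
  exists_smooth_sign.choose_spec.2.2.1 t h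
theorem deriv_smoothSign_nonneg (t : ℝ) : 0 ≤ deriv σ t :=
  exists_smooth_sign.choose_spec.2.2.2.1 t
theorem deriv_smoothSign_le (t : ℝ) : deriv σ t ≤ 1 := exists_smooth_sign.choose_spec.2.2.2.2.1 t
theorem deriv_smoothSign_zero : 0 < deriv σ 0 := exists_smooth_sign.choose_spec.2.2.2.2.2.1
theorem smoothSign_pos {t : ℝ} (h : 0 < t) : 0 < σ t :=
  exists_smooth_sign.choose_spec.2.2.2.2.2.2 t h

theorem smoothSign_of_le {t : ℝ} (h : t ≤ -2) : σ t = -1 := by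
  have := smoothSign_neg t
  rw [smoothSign_of_two_le (by linarith)] at this
  linarith

theorem smoothSign_neg_of_neg {t : ℝ} (h : t < 0) : σ t < 0 := by
  have := smoothSign_neg t
  have := smoothSign_pos (neg_pos.2 h)
  linarith

theorem smoothSign_zero : σ 0 = 0 := by
  have := smoothSign_neg 0
  rw [neg_zero] at this
  linarith

theorem smoothSign_mono : Monotone σ :=
  monotone_of_deriv_nonneg (smoothSign_contDiff.differentiable (by simp)) deriv_smoothSign_nonneg

theorem smoothSign_le_one (t : ℝ) : σ t ≤ 1 :=
  (smoothSign_mono (le_max_left t 2)).trans (smoothSign_of_two_le (le_max_right t 2)).le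

theorem neg_one_le_smoothSign (t : ℝ) : -1 ≤ σ t :=
  (smoothSign_of_le (min_le_right t (-2))).ge.trans (smoothSign_mono (min_le_left t (-2)))

theorem smoothSign_hasDerivAt (t : ℝ) : HasDerivAt σ (deriv σ t) t :=
  (smoothSign_contDiff.differentiable (by simp) t).hasDerivAt

theorem contDiff_deriv_smoothSign : ContDiff ℝ ∞ (deriv σ) :=
  (contDiff_infty_iff_deriv.1 smoothSign_contDiff).2

theorem deriv_smoothSign_of_two_le_abs {t : ℝ} (h : 2 ≤ |t|) : deriv σ t = 0 := by
  have h1 : ∀ t, 2 < t → deriv σ t = 0 := fun t ht => by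
    rw [Filter.EventuallyEq.deriv_eq (f := fun _ => (1 : ℝ)), deriv_const]
    filter_upwards [lt_mem_nhds ht] with u hu using smoothSign_of_two_le hu.le
  have h2 : ∀ t, t < -2 → deriv σ t = 0 := fun t ht => by
    rw [Filter.EventuallyEq.deriv_eq (f := fun _ => (-1 : ℝ)), deriv_const]
    filter_upwards [gt_mem_nhds ht] with u hu using smoothSign_of_le hu.le
  -- The derivative vanishes on the open rays; the end points `±2` follow by continuity.
  have hc : IsClosed {t | deriv σ t = 0} :=
    isClosed_eq contDiff_deriv_smoothSign.continuous continuous_const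
  rcases le_abs.1 h with h | h
  · have : Ici (2 : ℝ) ⊆ {t | deriv σ t = 0} := by
      rw [← closure_Ioi]; exact hc.closure_subset_iff.2 h1
    exact this h
  · have : Iic (-2 : ℝ) ⊆ {t | deriv σ t = 0} := by
      rw [← closure_Iio]; exact hc.closure_subset_iff.2 h2
    exact this (by simp only [mem_Iic]; linarith)

/-- The even primitive of `smoothSign`, a smooth substitute for the absolute value. -/
noncomputable def smoothAbs (t : ℝ) : ℝ := ∫ u in (0 : ℝ)..t, σ u

local notation "ω" => smoothAbs

/-- The difference between the absolute value and `smoothAbs` away from the origin. -/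
noncomputable def absDefect : ℝ := 2 - ω 2

local notation "w₀" => absDefect

theorem smoothAbs_contDiff : ContDiff ℝ ∞ ω := contDiff_integral smoothSign_contDiff

theorem smoothAbs_hasDerivAt (t : ℝ) : HasDerivAt ω (σ t) t :=
  (smoothSign_contDiff.continuous.integral_hasStrictDerivAt 0 t).hasDerivAt

theorem deriv_smoothAbs : deriv ω = σ := funext fun t => (smoothAbs_hasDerivAt t).deriv

theorem smoothAbs_zero : ω 0 = 0 := by simp [smoothAbs]

theorem smoothAbs_neg (t : ℝ) : ω (-t) = ω t := by
  have h : ∀ t, HasDerivAt (fun t => ω (-t) - ω t) 0 t := fun t => by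
    have h1 := (smoothAbs_hasDerivAt (-t)).comp t (hasDerivAt_neg t)
    have h2 := h1.sub (smoothAbs_hasDerivAt t)
    rw [smoothSign_neg] at h2
    exact h2.congr_deriv (by ring)
  have := is_const_of_deriv_eq_zero (fun t => (h t).differentiableAt) (fun t => (h t).deriv) t 0
  simp only [neg_zero, sub_self] at this
  linarith

theorem smoothAbs_abs (t : ℝ) : ω |t| = ω t := by
  rcases abs_choice t with h | h <;> rw [h]
  exact smoothAbs_neg t

theorem monotone_sub_smoothAbs : Monotone (fun t => t - ω t) := by
  have h : ∀ t, HasDerivAt (fun t => t - ω t) (1 - σ t) t := fun t =>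
    (hasDerivAt_id t).sub (smoothAbs_hasDerivAt t)
  refine monotone_of_deriv_nonneg (fun t => (h t).differentiableAt) fun t => ?_
  rw [(h t).deriv]
  linarith [smoothSign_le_one t]

theorem smoothAbs_strictMonoOn : StrictMonoOn ω (Ici 0) := by
  refine strictMonoOn_of_deriv_pos (convex_Ici 0) smoothAbs_contDiff.continuous.continuousOn ?_
  intro t ht
  rw [interior_Ici] at ht
  rw [deriv_smoothAbs]
  exact smoothSign_pos ht

theorem smoothAbs_nonneg (t : ℝ) : 0 ≤ ω t := by
  rw [← smoothAbs_abs, ← smoothAbs_zero]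
  exact smoothAbs_strictMonoOn.monotoneOn (by simp) (by simp) (abs_nonneg t)

theorem smoothAbs_le_abs (t : ℝ) : ω t ≤ |t| := by
  have := monotone_sub_smoothAbs (abs_nonneg t)
  simp only [smoothAbs_zero, smoothAbs_abs] at this
  linarith

theorem smoothAbs_of_two_le {t : ℝ} (ht : 2 ≤ t) : ω t = t - w₀ := by
  have h1 : ω 2 + ∫ u in (2 : ℝ)..t, σ u = ω t :=
    intervalIntegral.integral_add_adjacent_intervals
      (smoothSign_contDiff.continuous.intervalIntegrable _ _)
      (smoothSign_contDiff.continuous.intervalIntegrable _ _)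
  rw [intervalIntegral.integral_congr (g := fun _ => (1 : ℝ))] at h1
  · simp only [intervalIntegral.integral_const, smul_eq_mul, mul_one] at h1
    rw [absDefect]; linarith
  · intro u hu
    rw [uIcc_of_le ht] at hu
    exact smoothSign_of_two_le hu.1

theorem smoothAbs_of_le {t : ℝ} (ht : t ≤ -2) : ω t = -t - w₀ := by
  rw [← smoothAbs_neg, smoothAbs_of_two_le (by linarith)]

theorem absDefect_nonneg : 0 ≤ w₀ := by
  have := smoothAbs_le_abs 2
  rw [absDefect]
  rw [abs_of_pos two_pos] at this
  linarith

theorem absDefect_le : w₀ ≤ 2 := by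
  have := smoothAbs_nonneg 2
  rw [absDefect]
  linarith

/-- `t - smoothAbs t` is monotone and eventually equal to `absDefect`. -/
theorem abs_sub_le_smoothAbs (t : ℝ) : |t| - w₀ ≤ ω t := by
  have h := monotone_sub_smoothAbs (le_max_left |t| 2)
  simp only [smoothAbs_abs, smoothAbs_of_two_le (le_max_right |t| 2)] at h
  linarith

theorem smoothAbs_inj {s t : ℝ} (h : ω s = ω t) : |s| = |t| := by
  rw [← smoothAbs_abs s, ← smoothAbs_abs t] at h
  exact smoothAbs_strictMonoOn.injOn (abs_nonneg s) (abs_nonneg t) h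

/-- A smooth substitute for the positive part. -/
noncomputable def smoothPos (t : ℝ) : ℝ := (t + ω t + w₀) / 2

theorem smoothPos_contDiff : ContDiff ℝ ∞ smoothPos :=
  ((contDiff_id.add smoothAbs_contDiff).add contDiff_const).div_const 2

theorem smoothPos_hasDerivAt (t : ℝ) : HasDerivAt smoothPos ((1 + σ t) / 2) t := by
  exact (((hasDerivAt_id t).add (smoothAbs_hasDerivAt t)).add_const w₀).div_const 2

theorem smoothPos_of_le {t : ℝ} (ht : t ≤ -2) : smoothPos t = 0 := by
  rw [smoothPos, smoothAbs_of_le ht]; ring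

theorem smoothPos_of_two_le {t : ℝ} (ht : 2 ≤ t) : smoothPos t = t := by
  rw [smoothPos, smoothAbs_of_two_le ht]; ring

theorem smoothPos_nonneg (t : ℝ) : 0 ≤ smoothPos t := by
  have := abs_sub_le_smoothAbs t
  have := neg_abs_le t
  rw [smoothPos]
  linarith

theorem le_smoothPos (t : ℝ) : t ≤ smoothPos t := by
  have := abs_sub_le_smoothAbs t
  have := le_abs_self t
  rw [smoothPos]
  linarith

theorem smoothPos_le (t : ℝ) : smoothPos t ≤ max t 0 + 1 := by
  have := smoothAbs_le_abs t
  have := absDefect_le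
  rw [smoothPos]
  rcases le_total 0 t with h | h
  · rw [max_eq_left h]; rw [abs_of_nonneg h] at *; linarith
  · rw [max_eq_right h]; rw [abs_of_nonpos h] at *; linarith

end

/-! ### Lifts of graphs and changes of parameter -/

/-- The Legendrian lift of the graph of `H`. -/
noncomputable def graphLift (H : ℝ → ℝ) (x : ℝ) : R3 := (x, deriv H x, H x)

theorem graphLift_contDiff {H : ℝ → ℝ} (hH : ContDiff ℝ ∞ H) : ContDiff ℝ ∞ (graphLift H) :=
  contDiff_id.prodMk ((contDiff_infty_iff_deriv.1 hH).2.prodMk hH)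

theorem graphLift_congr {H H' : ℝ → ℝ} {x : ℝ} (h : H =ᶠ[𝓝 x] H') :
    graphLift H =ᶠ[𝓝 x] graphLift H' := by
  filter_upwards [h, h.deriv] with y h1 h2
  simp only [graphLift, h1, h2]

theorem graphLift_neg : graphLift (fun x => -x) = fLine := by
  funext x
  simp [graphLift, fLine]

theorem graphLift_id : graphLift (fun x => x) = gLine := by
  funext x
  simp [graphLift, gLine]

theorem hasDerivAt_coord_fst {a : ℝ → R3} {a' : R3} {t : ℝ} (h : HasDerivAt a a' t) :
    HasDerivAt (fun t => (a t).1) a'.1 t :=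
  (ContinuousLinearMap.fst ℝ ℝ (ℝ × ℝ)).hasFDerivAt.comp_hasDerivAt t h

theorem hasDerivAt_coord_snd_fst {a : ℝ → R3} {a' : R3} {t : ℝ} (h : HasDerivAt a a' t) :
    HasDerivAt (fun t => (a t).2.1) a'.2.1 t :=
  ((ContinuousLinearMap.fst ℝ ℝ ℝ).comp
    (ContinuousLinearMap.snd ℝ ℝ (ℝ × ℝ))).hasFDerivAt.comp_hasDerivAt t h

theorem hasDerivAt_coord_snd_snd {a : ℝ → R3} {a' : R3} {t : ℝ} (h : HasDerivAt a a' t) :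
    HasDerivAt (fun t => (a t).2.2) a'.2.2 t :=
  ((ContinuousLinearMap.snd ℝ ℝ ℝ).comp
    (ContinuousLinearMap.snd ℝ ℝ (ℝ × ℝ))).hasFDerivAt.comp_hasDerivAt t h

section vecOn

variable {ε m n : ℝ} {a b : ℝ → R3} {H : ℝ → ℝ} {x : ℝ → ℝ} {t u : ℝ} {q : R3 × R3} {I : Set ℝ}

theorem mem_vecOn_iff : q ∈ vecOn ε a I ↔ ∃ t ∈ I, q ∈ vecOn ε a {t} := by
  constructor
  · rintro ⟨t, ht, l, hl, rfl⟩
    exact ⟨t, ht, t, rfl, l, hl, rfl⟩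
  · rintro ⟨t, ht, _, rfl, l, hl, rfl⟩
    exact ⟨_, ht, l, hl, rfl⟩

theorem fst_of_mem_vecOn_singleton (h : q ∈ vecOn ε a {t}) : q.1 = a t := by
  obtain ⟨_, rfl, l, hl, rfl⟩ := h
  rfl

theorem vecOn_singleton_congr (h : a =ᶠ[𝓝 t] b) : vecOn ε a {t} = vecOn ε b {t} := by
  ext q
  simp only [vecOn, mem_singleton_iff, exists_eq_left, mem_ofPred_eq, h.eq_of_nhds, h.deriv_eq]

/-- An increasing change of parameter rescales the velocity by a positive factor, which `l` absorbs;
a decreasing one turns `ε` into `-ε`. These two rules identify the oriented branches of a cusped arc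
with pieces of graphs. -/
theorem vecOn_comp_of_pos {φ : ℝ → ℝ} {φ' : ℝ} (hφ : HasDerivAt φ φ' t)
    (hb : DifferentiableAt ℝ b (φ t)) (h : a =ᶠ[𝓝 t] fun s => b (φ s)) (hpos : 0 < φ') :
    vecOn ε a {t} = vecOn ε b {φ t} := by
  have hd : deriv a t = φ' • deriv b (φ t) :=
    h.deriv_eq.trans (hb.hasDerivAt.scomp t hφ).deriv
  ext q
  simp only [vecOn, mem_singleton_iff, exists_eq_left, mem_ofPred_eq, h.eq_of_nhds, hd, smul_smul]
  constructor
  · rintro ⟨l, hl, rfl⟩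
    exact ⟨l * φ', mul_pos hl hpos, by rw [mul_right_comm]⟩
  · rintro ⟨l, hl, rfl⟩
    refine ⟨l / φ', div_pos hl hpos, ?_⟩
    congr 2
    field_simp

theorem vecOn_comp_of_neg {φ : ℝ → ℝ} {φ' : ℝ} (hφ : HasDerivAt φ φ' t)
    (hb : DifferentiableAt ℝ b (φ t)) (h : a =ᶠ[𝓝 t] fun s => b (φ s)) (hneg : φ' < 0) :
    vecOn ε a {t} = vecOn (-ε) b {φ t} := by
  have hd : deriv a t = φ' • deriv b (φ t) :=
    h.deriv_eq.trans (hb.hasDerivAt.scomp t hφ).deriv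
  ext q
  simp only [vecOn, mem_singleton_iff, exists_eq_left, mem_ofPred_eq, h.eq_of_nhds, hd, smul_smul]
  constructor
  · rintro ⟨l, hl, rfl⟩
    exact ⟨l * -φ', mul_pos hl (neg_pos.2 hneg), by congr 2; ring⟩
  · rintro ⟨l, hl, rfl⟩
    refine ⟨l / -φ', div_pos hl (neg_pos.2 hneg), ?_⟩
    congr 2
    have := hneg.ne
    field_simp

end vecOn

/-! ### Legendrian arcs with cusps -/

/-- A plane curve `x`, `h(x) + E(x) (1 + S₁³) / 2 + F(x) (1 + S₂³) / 2` together with a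
`y`-coordinate. It is made of graphs over the `x`-axis, where `S₁` and `S₂` are locally constant
with values in `{-1, 1}`, and of cusps, where `x' = (3 / 2) Sᵢ / kᵢ`. -/
noncomputable def cuspArc (x h E F S₁ S₂ : ℝ → ℝ) (k₁ k₂ : ℝ) (t : ℝ) : R3 :=
  (x t, deriv h (x t) + deriv E (x t) * ((1 + S₁ t ^ 3) / 2) + deriv F (x t) * ((1 + S₂ t ^ 3) / 2)
    + k₁ * (E (x t) * (S₁ t * deriv S₁ t)) + k₂ * (F (x t) * (S₂ t * deriv S₂ t)),
    h (x t) + E (x t) * ((1 + S₁ t ^ 3) / 2) + F (x t) * ((1 + S₂ t ^ 3) / 2))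

section cuspArc

variable {x h E F S₁ S₂ : ℝ → ℝ} {k₁ k₂ : ℝ}

theorem cuspArc_contDiff (hx : ContDiff ℝ ∞ x) (hh : ContDiff ℝ ∞ h) (hE : ContDiff ℝ ∞ E)
    (hF : ContDiff ℝ ∞ F) (hS₁ : ContDiff ℝ ∞ S₁) (hS₂ : ContDiff ℝ ∞ S₂) :
    ContDiff ℝ ∞ (cuspArc x h E F S₁ S₂ k₁ k₂) := by
  have h1 := (contDiff_infty_iff_deriv.1 hh).2.comp hx
  have h2 := (contDiff_infty_iff_deriv.1 hE).2.comp hx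
  have h3 := (contDiff_infty_iff_deriv.1 hF).2.comp hx
  have h4 := (contDiff_infty_iff_deriv.1 hS₁).2
  have h5 := (contDiff_infty_iff_deriv.1 hS₂).2
  have h6 := hh.comp hx
  have h7 := hE.comp hx
  have h8 := hF.comp hx
  have h9 := (contDiff_const (c := (1 : ℝ)).add (hS₁.pow 3)).div_const 2
  have h10 := (contDiff_const (c := (1 : ℝ)).add (hS₂.pow 3)).div_const 2
  refine hx.prodMk (ContDiff.prodMk ?_ ?_)
  · exact (((h1.add (h2.mul h9)).add (h3.mul h10)).add
      (contDiff_const.mul (h7.mul (hS₁.mul h4)))).add (contDiff_const.mul (h8.mul (hS₂.mul h5)))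
  · exact (h6.add (h7.mul h9)).add (h8.mul h10)

theorem hasDerivAt_cuspArc_snd_snd {t x' : ℝ} (hx : HasDerivAt x x' t)
    (hh : DifferentiableAt ℝ h (x t)) (hE : DifferentiableAt ℝ E (x t))
    (hF : DifferentiableAt ℝ F (x t)) (hS₁ : DifferentiableAt ℝ S₁ t)
    (hS₂ : DifferentiableAt ℝ S₂ t) :
    HasDerivAt (fun t => (cuspArc x h E F S₁ S₂ k₁ k₂ t).2.2)
      ((deriv h (x t) + deriv E (x t) * ((1 + S₁ t ^ 3) / 2) + deriv F (x t) * ((1 + S₂ t ^ 3) / 2))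
        * x' + E (x t) * (3 / 2 * S₁ t ^ 2 * deriv S₁ t)
          + F (x t) * (3 / 2 * S₂ t ^ 2 * deriv S₂ t)) t := by
  have h9 := ((hS₁.hasDerivAt.pow 3).const_add 1).div_const 2
  have h10 := ((hS₂.hasDerivAt.pow 3).const_add 1).div_const 2
  have := ((hh.hasDerivAt.comp t hx).add ((hE.hasDerivAt.comp t hx).mul h9)).add
    ((hF.hasDerivAt.comp t hx).mul h10)
  refine this.congr_deriv ?_
  simp only [Function.comp_apply, Pi.pow_apply]
  push_cast
  ring

/-- The terms along the graphs cancel, and `z' - y x'` becomes `E S₁ S₁' (3/2 S₁ - k₁ x')` plus the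
same expression for `F`. So it vanishes where each `Sᵢ` is either stationary or tied to `x'` through
`kᵢ`. The cube in the height leaves a spare factor `Sᵢ`, so `y` stays smooth where `x'` vanishes. -/
theorem contactForm_cuspArc (hx : ContDiff ℝ ∞ x) (hh : ContDiff ℝ ∞ h) (hE : ContDiff ℝ ∞ E)
    (hF : ContDiff ℝ ∞ F) (hS₁ : ContDiff ℝ ∞ S₁) (hS₂ : ContDiff ℝ ∞ S₂) {t : ℝ}
    (h₁ : deriv S₁ t = 0 ∨ 3 / 2 * S₁ t = k₁ * deriv x t)
    (h₂ : deriv S₂ t = 0 ∨ 3 / 2 * S₂ t = k₂ * deriv x t) :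
    contactForm (cuspArc x h E F S₁ S₂ k₁ k₂ t) (deriv (cuspArc x h E F S₁ S₂ k₁ k₂) t) = 0 := by
  have hd : ∀ {f : ℝ → ℝ}, ContDiff ℝ ∞ f → ∀ t, DifferentiableAt ℝ f t := fun hf =>
    hf.differentiable (by simp)
  have ha := ((cuspArc_contDiff (k₁ := k₁) (k₂ := k₂) hx hh hE hF hS₁ hS₂).differentiable
    (by simp) t).hasDerivAt
  have hx' := (hd hx t).hasDerivAt
  have hz := hasDerivAt_cuspArc_snd_snd (k₁ := k₁) (k₂ := k₂) hx' (hd hh _) (hd hE _) (hd hF _)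
    (hd hS₁ t) (hd hS₂ t)
  have h1 : (deriv (cuspArc x h E F S₁ S₂ k₁ k₂) t).1 = deriv x t :=
    (hasDerivAt_coord_fst ha).unique hx'
  have h2 := (hasDerivAt_coord_snd_snd ha).unique hz
  simp only [contactForm, h1, h2, cuspArc]
  rcases h₁ with h₁ | h₁ <;> rcases h₂ with h₂ | h₂
  · simp only [h₁, h₂]; ring
  · simp only [h₁]; linear_combination F (x t) * S₂ t * deriv S₂ t * h₂
  · simp only [h₂]; linear_combination E (x t) * S₁ t * deriv S₁ t * h₁
  · linear_combination F (x t) * S₂ t * deriv S₂ t * h₂ + E (x t) * S₁ t * deriv S₁ t * h₁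

theorem deriv_cuspArc_fst (hx : ContDiff ℝ ∞ x) (hh : ContDiff ℝ ∞ h) (hE : ContDiff ℝ ∞ E)
    (hF : ContDiff ℝ ∞ F) (hS₁ : ContDiff ℝ ∞ S₁) (hS₂ : ContDiff ℝ ∞ S₂) (t : ℝ) :
    (deriv (cuspArc x h E F S₁ S₂ k₁ k₂) t).1 = deriv x t :=
  (hasDerivAt_coord_fst ((cuspArc_contDiff (k₁ := k₁) (k₂ := k₂) hx hh hE hF hS₁ hS₂).differentiable
    (by simp) t).hasDerivAt).unique (hx.differentiable (by simp) t).hasDerivAt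

/-- At a cusp the arc moves in the `y`-direction. -/
theorem deriv_cuspArc_snd_fst (hx : ContDiff ℝ ∞ x) (hh : ContDiff ℝ ∞ h) (hE : ContDiff ℝ ∞ E)
    (hF : ContDiff ℝ ∞ F) (hS₁ : ContDiff ℝ ∞ S₁) (hS₂ : ContDiff ℝ ∞ S₂) {t : ℝ}
    (hx0 : deriv x t = 0) (h₁ : S₁ t = 0 ∨ deriv S₁ t = 0 ∧ deriv (deriv S₁) t = 0)
    (h₂ : S₂ t = 0 ∨ deriv S₂ t = 0 ∧ deriv (deriv S₂) t = 0) :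
    (deriv (cuspArc x h E F S₁ S₂ k₁ k₂) t).2.1 =
      k₁ * (E (x t) * deriv S₁ t ^ 2) + k₂ * (F (x t) * deriv S₂ t ^ 2) := by
  have hd : ∀ {f : ℝ → ℝ}, ContDiff ℝ ∞ f → ∀ t, HasDerivAt f (deriv f t) t := fun hf t =>
    (hf.differentiable (by simp) t).hasDerivAt
  have hd' : ∀ {f : ℝ → ℝ}, ContDiff ℝ ∞ f → ContDiff ℝ ∞ (deriv f) := fun hf =>
    (contDiff_infty_iff_deriv.1 hf).2
  have hx' : HasDerivAt x 0 t := hx0 ▸ hd hx t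
  have ha := ((cuspArc_contDiff (k₁ := k₁) (k₂ := k₂) hx hh hE hF hS₁ hS₂).differentiable
    (by simp) t).hasDerivAt
  have h9 := (((hd hS₁ t).pow 3).const_add 1).div_const 2
  have h10 := (((hd hS₂ t).pow 3).const_add 1).div_const 2
  have hy := (((((hd (hd' hh) (x t)).comp t hx').add
    (((hd (hd' hE) (x t)).comp t hx').mul h9)).add
    (((hd (hd' hF) (x t)).comp t hx').mul h10)).add
    ((((hd hE (x t)).comp t hx').mul ((hd hS₁ t).mul (hd (hd' hS₁) t))).const_mul k₁)).add
    ((((hd hF (x t)).comp t hx').mul ((hd hS₂ t).mul (hd (hd' hS₂) t))).const_mul k₂)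
  rw [(hasDerivAt_coord_snd_fst ha).unique hy]
  simp only [Function.comp_apply, Pi.pow_apply, Pi.mul_apply]
  push_cast
  rcases h₁ with h₁ | ⟨h₁, h₁'⟩ <;> rcases h₂ with h₂ | ⟨h₂, h₂'⟩
  · simp only [h₁, h₂]; ring
  · simp only [h₁, h₂, h₂']; ring
  · simp only [h₁, h₁', h₂]; ring
  · simp only [h₁, h₁', h₂, h₂']; ring

/-- Away from the cusps the arc is the lift of a graph. -/
theorem cuspArc_eventuallyEq {c₁ c₂ t : ℝ} {H : ℝ → ℝ} (hh : ContDiff ℝ ∞ h)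
    (hE : ContDiff ℝ ∞ E) (hF : ContDiff ℝ ∞ F) (hx : ContinuousAt x t)
    (h₁ : ∀ᶠ u in 𝓝 t, S₁ u = c₁) (h₂ : ∀ᶠ u in 𝓝 t, S₂ u = c₂)
    (hH : ∀ᶠ X in 𝓝 (x t), H X = h X + E X * ((1 + c₁ ^ 3) / 2) + F X * ((1 + c₂ ^ 3) / 2)) :
    cuspArc x h E F S₁ S₂ k₁ k₂ =ᶠ[𝓝 t] fun u => graphLift H (x u) := by
  have h₁' : ∀ᶠ u in 𝓝 t, S₁ =ᶠ[𝓝 u] fun _ => c₁ := h₁.eventually_nhds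
  have h₂' : ∀ᶠ u in 𝓝 t, S₂ =ᶠ[𝓝 u] fun _ => c₂ := h₂.eventually_nhds
  filter_upwards [h₁', h₂', hx.eventually hH.eventually_nhds] with u hu₁ hu₂ hu
  have hH' := Filter.EventuallyEq.deriv_eq (f := fun X => h X + E X * ((1 + c₁ ^ 3) / 2) +
    F X * ((1 + c₂ ^ 3) / 2)) hu
  have hd : ∀ {f : ℝ → ℝ}, ContDiff ℝ ∞ f → ∀ t, HasDerivAt f (deriv f t) t := fun hf t =>
    (hf.differentiable (by simp) t).hasDerivAt
  replace hH' := hH'.trans (((hd hh (x u)).add ((hd hE (x u)).mul_const _)).add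
    ((hd hF (x u)).mul_const _)).deriv
  simp only [cuspArc, graphLift, hu₁.eq_of_nhds, hu₂.eq_of_nhds, hu₁.deriv_eq, hu₂.deriv_eq,
    deriv_const, hu.self_of_nhds, hH', mul_zero, add_zero]

end cuspArc

/-! ### Isotopies which move one arc of a tangle pair -/

section

variable {e ε ε' : ℝ} {a b : ℝ → R3} {V : Set (R3 × R3)}

theorem IsTanglePair.swap (h : IsTanglePair e ε ε' a b) : IsTanglePair e ε' ε b a where
  smooth_left := h.smooth_right
  smooth_right := h.smooth_left
  inj_left := h.inj_right
  inj_right := h.inj_left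
  imm_left := h.imm_right
  imm_right := h.imm_left
  disj s t := (h.disj t s).symm
  tail q hq := by rw [union_comm]; exact h.tail q hq
  bound_left := h.bound_right
  bound_right := h.bound_left
  proper := let ⟨T, hT⟩ := h.proper; ⟨T, fun t => (hT t).symm⟩

theorem replaceVec_swap : replaceVec V ε' ε b a = replaceVec V ε ε' a b := by
  simp only [replaceVec, union_comm]

/-- Changing one arc of a tangle pair inside the model cylinder. -/
theorem IsTanglePair.modify_left (h : IsTanglePair e ε ε' a b) {a' : ℝ → R3} {r : ℝ}
    (ha' : ContDiff ℝ ∞ a') (hinj : Function.Injective a') (himm : ∀ t, deriv a' t ≠ 0)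
    (hdisj : ∀ s t, a' s ≠ b t) (hfix : ∀ t, r < |t| → a' t = a t)
    (ha : ∀ t, |t| ≤ r → |(a t).1| < 1000) (hcyl : ∀ t, |t| ≤ r → a' t ∈ modelCylInt) :
    IsTanglePair e ε ε' a' b where
  smooth_left := ha'
  smooth_right := h.smooth_right
  inj_left := hinj
  inj_right := h.inj_right
  imm_left := himm
  imm_right := h.imm_right
  disj := hdisj
  tail q hq := by
    rw [← h.tail q hq, mem_union, mem_union]
    refine or_congr_left ?_
    rw [mem_vecOn_iff, mem_vecOn_iff]
    refine exists_congr fun t => and_congr_right fun _ => ?_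
    rcases lt_or_ge r |t| with ht | ht
    · rw [vecOn_singleton_congr]
      filter_upwards [(isOpen_lt continuous_const continuous_abs).mem_nhds ht] with u hu
      exact hfix u hu
    -- For `|t| ≤ r` both the old and the new arc stay in `|x| < 1000` and contribute nothing to the
    -- tails.
    · constructor <;> intro hq' <;> have h1 := fst_of_mem_vecOn_singleton hq' <;> rw [h1] at hq
      · exact absurd (hcyl t ht).1 (not_lt.2 hq)
      · exact absurd (ha t ht) (not_lt.2 hq)
  bound_left t ht := by
    rcases lt_or_ge r |t| with htr | htr
    · rw [hfix t htr] at ht ⊢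
      exact h.bound_left t ht
    · exact (hcyl t htr).2
  bound_right := h.bound_right
  proper := by
    obtain ⟨T, hT⟩ := h.proper
    refine ⟨max T r, fun t => ⟨fun ht => ?_, fun ht => ((hT t).2 ht).trans (le_max_left _ _)⟩⟩
    rcases lt_or_ge r |t| with htr | htr
    · rw [hfix t htr] at ht
      exact ((hT t).1 ht).trans (le_max_left _ _)
    · exact htr.trans (le_max_right _ _)

/-- The points which are not moved when the middle part of the arc `a` is changed. -/
def restSet (S : Set R3) (a b : ℝ → R3) (R : ℝ) : Set R3 :=
  (S \ modelCylInt) ∪ (range b ∩ modelCyl) ∪ (a '' {t | R ≤ |t|} ∩ modelCyl)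

theorem isClosed_restSet {S : Set R3} (hS : IsClosed S) (h : IsTanglePair e ε ε' a b) (R : ℝ) :
    IsClosed (restSet S a b R) := by
  obtain ⟨T, hT⟩ := h.proper
  refine ((hS.sdiff isOpen_modelCylInt).union (isCompact_range_inter_modelCyl h.smooth_right
    fun t => (hT t).2).isClosed).union ?_
  have : a '' {t | R ≤ |t|} ∩ modelCyl = a '' ({t | R ≤ |t|} ∩ Icc (-T) T) ∩ modelCyl := by
    ext p
    constructor
    · rintro ⟨⟨t, ht, rfl⟩, hc⟩
      exact ⟨⟨t, ⟨ht, abs_le.1 ((hT t).1 (hc.1.trans (by norm_num)))⟩, rfl⟩, hc⟩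
    · rintro ⟨⟨t, ht, rfl⟩, hc⟩
      exact ⟨⟨t, ht.1, rfl⟩, hc⟩
  rw [this]
  refine IsClosed.inter (IsCompact.isClosed ?_) isClosed_modelCyl
  refine IsCompact.image ?_ h.smooth_left.continuous
  exact isCompact_Icc.inter_left (isClosed_le continuous_const continuous_abs)

/-- Each piece of the fixed set is avoided for its own reason: the point is interior to the
cylinder, the two arcs are disjoint, and `a` is injective and equals `a₀` beyond `r < R`. -/
theorem notMem_restSet {S : Set R3} (h : IsTanglePair e ε ε' a b) {r R : ℝ} (hrR : r < R) {t : ℝ}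
    {a₀ : ℝ → R3} (ht : |t| ≤ r) (hfix : ∀ t, r < |t| → a t = a₀ t) (hat : a t ∈ modelCylInt) :
    a t ∉ restSet S a₀ b R := by
  rintro ((h1 | ⟨⟨u, h1⟩, -⟩) | ⟨⟨u, hu, h1⟩, -⟩)
  · exact h1.2 hat
  · exact h.disj t u h1.symm
  · have hu' : R ≤ |u| := hu
    rw [← hfix u (hrR.trans_le hu')] at h1
    have := h.inj_left h1
    subst this
    linarith

/-- The link splits into a closed set which never moves and a compact middle arc, whose parts with
`r < |t| ≤ R` are stationary. This is the form in which isotopy extension applies. -/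
theorem restSet_union {r R : ℝ} {a₀ : ℝ → R3} (hV : HasModelCrossing e V)
    (h : IsTanglePair e ε ε' a b) (hrR : r < R) (hfix : ∀ t, r < |t| → a t = a₀ t)
    (hcyl : ∀ t, |t| ≤ R → a t ∈ modelCyl) :
    restSet (Prod.fst '' V) a₀ b R ∪ a '' Icc (-R) R = Prod.fst '' replaceVec V ε ε' a b := by
  rw [fst_image_replaceVec hV h]
  ext p
  constructor
  · rintro (((h1 | ⟨h1, h2⟩) | ⟨⟨t, ht, rfl⟩, h2⟩) | ⟨t, ht, rfl⟩)
    · exact Or.inl h1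
    · exact Or.inr ⟨Or.inr h1, h2⟩
    · have ht' : R ≤ |t| := ht
      exact Or.inr ⟨Or.inl ⟨t, hfix t (hrR.trans_le ht')⟩, h2⟩
    · exact Or.inr ⟨Or.inl ⟨t, rfl⟩, hcyl t (abs_le.2 ht)⟩
  · rintro (h1 | ⟨⟨t, rfl⟩ | h1, h2⟩)
    · exact Or.inl (Or.inl (Or.inl h1))
    · rcases le_total |t| R with ht | ht
      · exact Or.inr ⟨t, abs_le.1 ht, rfl⟩
      · refine Or.inl (Or.inr ⟨⟨t, ht, (hfix t (hrR.trans_le ht)).symm⟩, h2⟩)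
    · exact Or.inl (Or.inl (Or.inr ⟨h1, h2⟩))

variable {c : ℝ → ℝ → R3} {r R : ℝ}

/-- Moving the left arc of a tangle pair gives ambient isotopic links. -/
theorem ambientIsotopic_replaceVec (hc : ContDiff ℝ ∞ (fun w : ℝ × ℝ => c w.1 w.2))
    (hV : HasModelCrossing e V) (hVc : IsClosed (Prod.fst '' V))
    (h : ∀ s ∈ Icc (0 : ℝ) 1, IsTanglePair e ε ε' (c s) b) (hrR : r < R)
    (hfix : ∀ s t, r < |t| → c s t = c 0 t)
    (hcyl : ∀ s ∈ Icc (0 : ℝ) 1, ∀ t, |t| ≤ r → c s t ∈ modelCylInt)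
    (hcyl' : ∀ t, |t| ≤ R → c 0 t ∈ modelCyl) :
    AmbientIsotopic (Prod.fst '' replaceVec V ε ε' (c 0) b)
      (Prod.fst '' replaceVec V ε ε' (c 1) b) := by
  have h0 : (0 : ℝ) ∈ Icc (0 : ℝ) 1 := left_mem_Icc.2 zero_le_one
  have h1 : (1 : ℝ) ∈ Icc (0 : ℝ) 1 := right_mem_Icc.2 zero_le_one
  have hcyl1 : ∀ t, |t| ≤ R → c 1 t ∈ modelCyl := fun t ht => by
    rcases lt_or_ge r |t| with htr | htr
    · rw [hfix 1 t htr]; exact hcyl' t ht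
    · exact ⟨(hcyl 1 h1 t htr).1.le, (hcyl 1 h1 t htr).2.le⟩
  rw [← restSet_union hV (h 0 h0) hrR (hfix 0) hcyl', ← restSet_union hV (h 1 h1) hrR (hfix 1)
    hcyl1]
  refine ambientIsotopic_of_arc_family hc isCompact_Icc (isCompact_Icc (a := -r) (b := r))
    (isClosed_restSet hVc (h 0 h0) R) (fun s hs => (h s hs).inj_left.injOn)
    (fun s hs t _ => (h s hs).imm_left t) (fun s _ t _ ht => ?_) (fun s hs t ht => ?_)
  · exact hfix s t (not_le.1 fun h => ht (abs_le.1 h))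
  · exact notMem_restSet (h s hs) hrR (abs_le.2 ht) (hfix s) (hcyl s hs t (abs_le.2 ht))

/-- Moving the left arc of a tangle pair through Legendrian arcs gives equivalent links. -/
theorem legendrianIsotopic_replaceVec (hc : ContDiff ℝ ∞ (fun w : ℝ × ℝ => c w.1 w.2))
    (hVc : IsClosed (Prod.fst '' V))
    (h : ∀ s ∈ Icc (0 : ℝ) 1, IsTanglePair e ε ε' (c s) b) (hε : ε ≠ 0) (hrR : r < R)
    (hleg : ∀ s ∈ Icc (0 : ℝ) 1, ∀ t, contactForm (c s t) (deriv (c s) t) = 0)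
    (hfix : ∀ s t, r < |t| → c s t = c 0 t)
    (hcyl : ∀ s ∈ Icc (0 : ℝ) 1, ∀ t, |t| ≤ r → c s t ∈ modelCylInt)
    (hcyl' : ∀ t, |t| ≤ R → c 0 t ∈ modelCyl) {L L' : LegendrianLink}
    (hL : L.vec = replaceVec V ε ε' (c 0) b) (hL' : L'.vec = replaceVec V ε ε' (c 1) b) :
    LegendrianIsotopic L L' := by
  have h0 : (0 : ℝ) ∈ Icc (0 : ℝ) 1 := left_mem_Icc.2 zero_le_one
  have h1 : (1 : ℝ) ∈ Icc (0 : ℝ) 1 := right_mem_Icc.2 zero_le_one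
  have hcs : ∀ s ∈ Icc (0 : ℝ) 1, ∀ t, |t| ≤ R → c s t ∈ modelCyl := fun s hs t ht => by
    rcases lt_or_ge r |t| with htr | htr
    · rw [hfix s t htr]; exact hcyl' t ht
    · exact ⟨(hcyl s hs t htr).1.le, (hcyl s hs t htr).2.le⟩
  have hfix' : ∀ s t, r < |t| → c s =ᶠ[𝓝 t] c 0 := fun s t ht => by
    filter_upwards [(isOpen_lt continuous_const continuous_abs).mem_nhds ht] with u hu
    exact hfix s u hu
  -- At every time the link consists of one fixed set of vectors and the vectors of the open middle
  -- arc.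
  have key : ∀ s ∈ Icc (0 : ℝ) 1, replaceVec V ε ε' (c s) b =
      {q ∈ L.vec | q.1 ∈ restSet (Prod.fst '' V) (c 0) b R} ∪
        vecOn ε (c s) (interior (Icc (-R) R)) := by
    intro s hs
    rw [interior_Icc, hL]
    ext q
    constructor
    · intro hq
      by_cases hsm : q ∈ vecOn ε (c s) (Ioo (-R) R)
      · exact Or.inr hsm
      left
      rcases hq with ⟨hqc, hq | hq⟩ | ⟨hqc, hq⟩
      · obtain ⟨t, -, ht⟩ := mem_vecOn_iff.1 hq
        have htR : R ≤ |t| := by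
          by_contra hlt
          exact hsm (mem_vecOn_iff.2 ⟨t, abs_lt.1 (not_le.1 hlt), ht⟩)
        rw [vecOn_singleton_congr (hfix' s t (hrR.trans_le htR))] at ht
        refine ⟨Or.inl ⟨hqc, Or.inl (mem_vecOn_iff.2 ⟨t, mem_univ _, ht⟩)⟩, Or.inr ⟨?_, hqc⟩⟩
        exact ⟨t, htR, (fst_of_mem_vecOn_singleton ht).symm⟩
      · refine ⟨Or.inl ⟨hqc, Or.inr hq⟩, Or.inl (Or.inr ⟨?_, hqc⟩)⟩
        obtain ⟨t, -, l, -, rfl⟩ := hq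
        exact ⟨t, rfl⟩
      · exact ⟨Or.inr ⟨hqc, hq⟩, Or.inl (Or.inl ⟨⟨q, hq, rfl⟩,
          fun hi => hqc ⟨hi.1.le, hi.2.le⟩⟩)⟩
    · rintro (⟨hq, hqr⟩ | hq)
      · rcases hq with ⟨hqc, hq | hq⟩ | ⟨hqc, hq⟩
        · obtain ⟨t, -, ht⟩ := mem_vecOn_iff.1 hq
          have htr : r < |t| := by
            by_contra hle
            rw [fst_of_mem_vecOn_singleton ht] at hqr
            exact notMem_restSet (h 0 h0) hrR (not_lt.1 hle) (hfix 0)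
              (hcyl 0 h0 t (not_lt.1 hle)) hqr
          rw [← vecOn_singleton_congr (hfix' s t htr)] at ht
          exact Or.inl ⟨hqc, Or.inl (mem_vecOn_iff.2 ⟨t, mem_univ _, ht⟩)⟩
        · exact Or.inl ⟨hqc, Or.inr hq⟩
        · exact Or.inr ⟨hqc, hq⟩
      · obtain ⟨t, ht, l, hl, rfl⟩ := hq
        exact Or.inl ⟨hcs s hs t (abs_lt.2 ht).le, Or.inl ⟨t, mem_univ _, l, hl, rfl⟩⟩
  refine legendrianIsotopic_of_arc_family hc (isCompact_Icc (a := -R) (b := R)) (isCompact_Icc (a := -r) (b := r))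
    (isClosed_restSet hVc (h 0 h0) R) (fun s hs => (h s hs).inj_left.injOn)
    (fun s hs t _ => (h s hs).imm_left t) (fun s hs t _ => hleg s hs t) (fun s t _ ht => ?_)
    (fun s hs t ht => ?_) hε ?_ ?_
  · exact hfix s t (not_le.1 fun h => ht (abs_le.1 h))
  · exact notMem_restSet (h s hs) hrR (abs_le.2 ht) (hfix s) (hcyl s hs t (abs_le.2 ht))
  · exact hL.trans (key 0 h0)
  · exact hL'.trans (key 1 h1)

end

/-! ### Recognising basic tangles over a rectangle -/

/-- The vectors `V` over the rectangle `B` are given by two arcs whose fronts have no crossings;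
the orientation of the arcs is correct for `η = 1` and wrong for `η = -1`. -/
structure IsTangleOver (η : ℝ) (V : Set (R3 × R3)) (B : Rect) (c d : ℝ → R3) : Prop where
  smooth_left : ContDiff ℝ ∞ c
  smooth_right : ContDiff ℝ ∞ d
  mem_left : ∀ t ∈ Icc (-1 : ℝ) 1, (c t, η • deriv c t) ∈ V
  mem_right : ∀ t ∈ Icc (-1 : ℝ) 1, (d t, η • deriv d t) ∈ V
  cover : ∀ q ∈ V, q.1 ∈ B.cylinder → q.1 ∈ c '' Icc (-1) 1 ∪ d '' Icc (-1) 1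
  range_left : ∀ t ∈ Icc (-1 : ℝ) 1, (c t).1 ∈ Icc B.a B.b ∧ (c t).2.2 ∈ Ioo B.c B.d
  range_right : ∀ t ∈ Icc (-1 : ℝ) 1, (d t).1 ∈ Icc B.a B.b ∧ (d t).2.2 ∈ Ioo B.c B.d
  inj_left : InjOn (front ∘ c) (Icc (-1) 1)
  inj_right : InjOn (front ∘ d) (Icc (-1) 1)
  disj : ∀ s ∈ Icc (-1 : ℝ) 1, ∀ t ∈ Icc (-1 : ℝ) 1, front (c s) ≠ front (d t)

theorem neg_mem_Icc_neg_one_one {t : ℝ} (ht : t ∈ Icc (-1 : ℝ) 1) : -t ∈ Icc (-1 : ℝ) 1 :=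
  ⟨neg_le_neg ht.2, neg_le.1 ht.1⟩

section

variable {η : ℝ} {V : Set (R3 × R3)} {B : Rect} {c d : ℝ → R3}

theorem IsTangleOver.swap (h : IsTangleOver η V B c d) : IsTangleOver η V B d c where
  smooth_left := h.smooth_right
  smooth_right := h.smooth_left
  mem_left := h.mem_right
  mem_right := h.mem_left
  cover q hq hB := by rw [union_comm]; exact h.cover q hq hB
  range_left := h.range_right
  range_right := h.range_left
  inj_left := h.inj_right
  inj_right := h.inj_left
  disj s hs t ht := (h.disj t ht s hs).symm

theorem deriv_comp_neg_arc (c : ℝ → R3) (t : ℝ) :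
    deriv (fun t => c (-t)) t = -deriv c (-t) := deriv_comp_neg c t

theorem IsTangleOver.reverse (h : IsTangleOver η V B c d) :
    IsTangleOver (-η) V B (fun t => c (-t)) (fun t => d (-t)) where
  smooth_left := h.smooth_left.comp contDiff_neg
  smooth_right := h.smooth_right.comp contDiff_neg
  mem_left t ht := by
    have := h.mem_left (-t) (neg_mem_Icc_neg_one_one ht)
    simpa [deriv_comp_neg_arc] using this
  mem_right t ht := by
    have := h.mem_right (-t) (neg_mem_Icc_neg_one_one ht)
    simpa [deriv_comp_neg_arc] using this
  cover q hq hB := by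
    rcases h.cover q hq hB with ⟨t, ht, h⟩ | ⟨t, ht, h⟩
    · exact Or.inl ⟨-t, neg_mem_Icc_neg_one_one ht, by simpa using h⟩
    · exact Or.inr ⟨-t, neg_mem_Icc_neg_one_one ht, by simpa using h⟩
  range_left t ht := h.range_left (-t) (neg_mem_Icc_neg_one_one ht)
  range_right t ht := h.range_right (-t) (neg_mem_Icc_neg_one_one ht)
  inj_left s hs t ht hst := neg_injective (h.inj_left (neg_mem_Icc_neg_one_one hs)
    (neg_mem_Icc_neg_one_one ht) hst)
  inj_right s hs t ht hst := neg_injective (h.inj_right (neg_mem_Icc_neg_one_one hs)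
    (neg_mem_Icc_neg_one_one ht) hst)
  disj s hs t ht := h.disj (-s) (neg_mem_Icc_neg_one_one hs) (-t) (neg_mem_Icc_neg_one_one ht)

theorem IsTangleOver.isCrossinglessTangle {L : OrientedLink} (h : IsTangleOver 1 L.vec B c d) :
    IsCrossinglessTangle L B c d := by
  refine ⟨h.smooth_left, h.smooth_right, fun t ht => ⟨?_, ?_⟩, ?_,
    fun t ht => ⟨(h.range_left t ht).2, (h.range_right t ht).2⟩, h.inj_left, h.inj_right, ?_⟩
  · simpa using h.mem_left t ht
  · simpa using h.mem_right t ht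
  · ext p
    constructor
    · rintro ⟨⟨q, hq, rfl⟩, hB⟩
      exact h.cover q hq hB
    · rintro (⟨t, ht, rfl⟩ | ⟨t, ht, rfl⟩)
      · exact ⟨⟨_, h.mem_left t ht, rfl⟩, (h.range_left t ht).1, (h.range_left t ht).2.1.le,
          (h.range_left t ht).2.2.le⟩
      · exact ⟨⟨_, h.mem_right t ht, rfl⟩, (h.range_right t ht).1, (h.range_right t ht).2.1.le,
          (h.range_right t ht).2.2.le⟩
  · rw [disjoint_left]
    rintro _ ⟨s, hs, rfl⟩ ⟨t, ht, hst⟩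
    exact h.disj s hs t ht hst.symm

theorem HasNoCusp.reverse (h : HasNoCusp c) : HasNoCusp (fun t => c (-t)) := fun t ht => by
  rw [deriv_comp_neg_arc]
  exact neg_ne_zero.2 (h (-t) (neg_mem_Icc_neg_one_one ht))

theorem HasOneCusp.reverse (h : HasOneCusp c) : HasOneCusp (fun t => c (-t)) := by
  obtain ⟨t₀, ht₀, h2, h⟩ := h
  refine ⟨-t₀, ⟨neg_lt_neg ht₀.2, neg_lt.1 ht₀.1⟩, ?_, fun t ht => ?_⟩
  · rw [iteratedDeriv_comp_neg 2 (fun t => (c t).1)]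
    simpa using h2
  · rw [deriv_comp_neg_arc]
    have := h (-t) (neg_mem_Icc_neg_one_one ht)
    simp only [Prod.fst_neg, neg_eq_zero]
    rw [this, neg_eq_iff_eq_neg]

/-- For `η = -1` both arcs are traversed backwards. This turns the strand running to the right into
the one running to the left and conversely, so the arcs also trade places; for the `∞`-tangle no
exchange is needed. -/
theorem IsTangleOver.isBasicZeroTangle {L : LegendrianLink} (h : IsTangleOver η L.vec B c d)
    (hη : η = 1 ∨ η = -1) (hc : HasNoCusp c) (hd : HasNoCusp d) (hc1 : (c (-1)).1 = B.a)
    (hc2 : (c 1).1 = B.b) (hd1 : (d (-1)).1 = B.b) (hd2 : (d 1).1 = B.a) :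
    IsBasicZeroTangle L B := by
  rcases hη with rfl | rfl
  · exact ⟨c, d, h.isCrossinglessTangle, hc, hd, hc1, hc2, hd1, hd2⟩
  · have h' := h.swap.reverse
    rw [neg_neg] at h'
    exact ⟨_, _, h'.isCrossinglessTangle, hd.reverse, hc.reverse, by simpa using hd2, hd1,
      by simpa using hc2, hc1⟩

theorem IsTangleOver.isBasicInftyTangle {L : LegendrianLink} (h : IsTangleOver η L.vec B c d)
    (hη : η = 1 ∨ η = -1) (hc : HasOneCusp c) (hd : HasOneCusp d) (hc1 : (c (-1)).1 = B.a)
    (hc2 : (c 1).1 = B.a) (hd1 : (d (-1)).1 = B.b) (hd2 : (d 1).1 = B.b) :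
    IsBasicInftyTangle L B := by
  rcases hη with rfl | rfl
  · exact ⟨c, d, h.isCrossinglessTangle, hc, hd, hc1, hc2, hd1, hd2⟩
  · have h' := h.reverse
    rw [neg_neg] at h'
    exact ⟨_, _, h'.isCrossinglessTangle, hc.reverse, hd.reverse, by simpa using hc2, hc1,
      by simpa using hd2, hd1⟩

variable {ε ε' δ δ' : ℝ} {a b a' b' : ℝ → R3}

theorem IsTangleOver.replaceVec (h : IsTangleOver η (vecOn ε a univ ∪ vecOn ε' b univ) B c d)
    (hB : B.cylinder ⊆ modelCyl) : IsTangleOver η (replaceVec V ε ε' a b) B c d where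
  smooth_left := h.smooth_left
  smooth_right := h.smooth_right
  mem_left t ht := Or.inl ⟨hB ⟨(h.range_left t ht).1, (h.range_left t ht).2.1.le,
    (h.range_left t ht).2.2.le⟩, h.mem_left t ht⟩
  mem_right t ht := Or.inl ⟨hB ⟨(h.range_right t ht).1, (h.range_right t ht).2.1.le,
    (h.range_right t ht).2.2.le⟩, h.mem_right t ht⟩
  cover q hq hqB := by
    rcases hq with ⟨-, hq⟩ | ⟨hq, -⟩
    · exact h.cover q hq hqB
    · exact absurd (hB hqB) hq
  range_left := h.range_left
  range_right := h.range_right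
  inj_left := h.inj_left
  inj_right := h.inj_right
  disj := h.disj

theorem agreeOutside_replaceVec {L L' : LegendrianLink} (hL : L.vec = _root_.replaceVec V ε ε' a b)
    (hL' : L'.vec = _root_.replaceVec V δ δ' a' b')
    (h : ∀ q : R3 × R3, q.1 ∉ B.cylinder → (q ∈ vecOn ε a univ ∪ vecOn ε' b univ ↔
      q ∈ vecOn δ a' univ ∪ vecOn δ' b' univ)) :
    AgreeOutside B L.toOrientedLink L'.toOrientedLink := by
  ext q
  simp only [mem_ofPred_eq, hL, hL', and_congr_left_iff, _root_.replaceVec]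
  intro hq
  rw [h q hq]

theorem LegendrianIsotopic.refl (L : LegendrianLink) : LegendrianIsotopic L L := by
  refine ⟨fun _ p => p, contDiff_snd, fun _ => rfl, fun t _ => ⟨injOn_id _, fun q hq => ?_⟩, ?_⟩
  · rw [fderiv_fun_id, ContinuousLinearMap.id_apply]
    exact ⟨L.vec_ne_zero hq, L.legendrian q hq⟩
  · simp

theorem IsLegendrianSurgery.of_tangles {L L' : LegendrianLink} (hL : IsBasicZeroTangle L B)
    (hL' : IsBasicInftyTangle L' B) (h : AgreeOutside B L.toOrientedLink L'.toOrientedLink) :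
    IsLegendrianSurgery L L' :=
  ⟨L, L', LegendrianIsotopic.refl L, LegendrianIsotopic.refl L', B, h, hL, hL'⟩

end

/-! ### Profile functions: the edges of the finger and the rising branch -/

section

local notation "σ" => smoothSign
local notation "ω" => smoothAbs
local notation "w₀" => absDefect

/-- A function with slope `-1` up to `-22` and with value `20` from `-18` on. -/
noncomputable def upperFn (x : ℝ) : ℝ := -x + smoothPos (x + 20)

/-- The height of the finger. -/
noncomputable def gapFn (x : ℝ) : ℝ := 12 + 2 * smoothPos (-x - 6)

/-- A function with slope `1` up to `-22` and with value `8` from `-4` on. -/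
noncomputable def lowerFn (x : ℝ) : ℝ := upperFn x - gapFn x

/-- A function with value `20` up to `38` and with slope `1` from `42` on. -/
noncomputable def riseFn (x : ℝ) : ℝ := 20 + smoothPos (x - 40)

theorem upperFn_contDiff : ContDiff ℝ ∞ upperFn :=
  contDiff_neg.add (smoothPos_contDiff.comp (contDiff_id.add contDiff_const))

theorem gapFn_contDiff : ContDiff ℝ ∞ gapFn :=
  contDiff_const.add (contDiff_const.mul (smoothPos_contDiff.comp
    (contDiff_neg.sub contDiff_const)))

theorem lowerFn_contDiff : ContDiff ℝ ∞ lowerFn := upperFn_contDiff.sub gapFn_contDiff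

theorem riseFn_contDiff : ContDiff ℝ ∞ riseFn :=
  contDiff_const.add (smoothPos_contDiff.comp (contDiff_id.sub contDiff_const))

theorem upperFn_of_le {x : ℝ} (h : x ≤ -22) : upperFn x = -x := by
  rw [upperFn, smoothPos_of_le (by linarith)]; ring

theorem upperFn_of_ge {x : ℝ} (h : -18 ≤ x) : upperFn x = 20 := by
  rw [upperFn, smoothPos_of_two_le (by linarith)]; ring

theorem twenty_le_upperFn (x : ℝ) : 20 ≤ upperFn x := by
  have := le_smoothPos (x + 20)
  rw [upperFn]; linarith

theorem upperFn_lt {x : ℝ} (h : |x| ≤ 1000) : upperFn x < 2000 := by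
  have := smoothPos_le (x + 20)
  have := abs_le.1 h
  rw [upperFn]
  rcases le_total (x + 20) 0 with h0 | h0
  · rw [max_eq_right h0] at *; linarith
  · rw [max_eq_left h0] at *; linarith

theorem gapFn_of_le {x : ℝ} (h : x ≤ -8) : gapFn x = -2 * x := by
  rw [gapFn, smoothPos_of_two_le (by linarith)]; ring

theorem gapFn_of_ge {x : ℝ} (h : -4 ≤ x) : gapFn x = 12 := by
  rw [gapFn, smoothPos_of_le (by linarith)]; ring

theorem twelve_le_gapFn (x : ℝ) : 12 ≤ gapFn x := by
  have := smoothPos_nonneg (-x - 6)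
  rw [gapFn]; linarith

theorem lowerFn_of_le {x : ℝ} (h : x ≤ -22) : lowerFn x = x := by
  rw [lowerFn, upperFn_of_le h, gapFn_of_le (by linarith)]; ring

theorem lowerFn_of_ge {x : ℝ} (h : -4 ≤ x) : lowerFn x = 8 := by
  rw [lowerFn, upperFn_of_ge (by linarith), gapFn_of_ge h]; norm_num

theorem lt_lowerFn {x : ℝ} (h : |x| ≤ 1000) : -2000 < lowerFn x := by
  have := smoothPos_le (-x - 6)
  have := abs_le.1 h
  have := twenty_le_upperFn x
  rw [lowerFn, gapFn]
  rcases le_total (-x - 6) 0 with h0 | h0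
  · rw [max_eq_right h0] at *; linarith
  · rw [max_eq_left h0] at *; linarith

theorem riseFn_of_le {x : ℝ} (h : x ≤ 38) : riseFn x = 20 := by
  rw [riseFn, smoothPos_of_le (by linarith)]; ring

theorem riseFn_of_ge {x : ℝ} (h : 42 ≤ x) : riseFn x = x - 20 := by
  rw [riseFn, smoothPos_of_two_le (by linarith)]; ring

theorem twenty_le_riseFn (x : ℝ) : 20 ≤ riseFn x := by
  have := smoothPos_nonneg (x - 40)
  rw [riseFn]; linarith

theorem eventually_smoothSign_of_lt {t : ℝ} (h : t < -2) : ∀ᶠ u in 𝓝 t, σ u = -1 := by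
  filter_upwards [gt_mem_nhds h] with u hu using smoothSign_of_le hu.le

theorem eventually_smoothSign_of_gt {t : ℝ} (h : 2 < t) : ∀ᶠ u in 𝓝 t, σ u = 1 := by
  filter_upwards [lt_mem_nhds h] with u hu using smoothSign_of_two_le hu.le

theorem graphLift_upperFn {x : ℝ} (h : x < -22) : graphLift upperFn =ᶠ[𝓝 x] fLine := by
  rw [← graphLift_neg]
  refine graphLift_congr ?_
  filter_upwards [gt_mem_nhds h] with y hy using upperFn_of_le hy.le

theorem graphLift_lowerFn {x : ℝ} (h : x < -22) : graphLift lowerFn =ᶠ[𝓝 x] gLine := by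
  rw [← graphLift_id]
  refine graphLift_congr ?_
  filter_upwards [gt_mem_nhds h] with y hy using lowerFn_of_le hy.le

/-! ### The finger -/

/-- The `x`-coordinate of the finger of length `s`. -/
noncomputable def fingerX (s t : ℝ) : ℝ := -4 - 36 * ω t + s * (154 * ((1 - σ (t ^ 2 - 8)) / 2))

/-- A Legendrian arc with one cusp whose front is a finger which gets longer with `s`. -/
noncomputable def fingerArc (s : ℝ) : ℝ → R3 :=
  cuspArc (fingerX s) upperFn (fun x => -gapFn x) (fun _ => 0) σ (fun _ => 0) (-1 / 24) 0

theorem fingerX_contDiff₂ : ContDiff ℝ ∞ (fun p : ℝ × ℝ => fingerX p.1 p.2) := by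
  have h1 := smoothAbs_contDiff
  have h2 := smoothSign_contDiff
  unfold fingerX
  fun_prop

theorem fingerX_contDiff (s : ℝ) : ContDiff ℝ ∞ (fingerX s) :=
  fingerX_contDiff₂.comp (contDiff_const.prodMk contDiff_id)

theorem fingerX_hasDerivAt (s t : ℝ) :
    HasDerivAt (fingerX s) (-36 * σ t - 154 * s * t * deriv σ (t ^ 2 - 8)) t := by
  have h1 := (smoothAbs_hasDerivAt t).const_mul 36
  have h2 := (smoothSign_hasDerivAt (t ^ 2 - 8)).comp t (((hasDerivAt_id t).pow 2).sub_const 8)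
  have h3 := (((h2.const_sub 1).div_const 2).const_mul 154).const_mul s
  refine ((h1.const_sub (-4)).add h3).congr_deriv ?_
  simp only [id_eq]
  push_cast
  ring

theorem fingerX_neg (s t : ℝ) : fingerX s (-t) = fingerX s t := by
  simp only [fingerX, smoothAbs_neg, neg_sq]

theorem fingerX_zero (t : ℝ) : fingerX 0 t = -4 - 36 * ω t := by simp [fingerX]

theorem fingerX_fix {s t : ℝ} (h : 4 < |t|) : fingerX s t = fingerX 0 t := by
  have : (16 : ℝ) ≤ t ^ 2 := by rw [← sq_abs]; nlinarith
  rw [fingerX, fingerX, smoothSign_of_two_le (by linarith)]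
  ring

theorem fingerX_of_le {s t : ℝ} (h : t ^ 2 ≤ 6) : fingerX s t = -4 + 154 * s - 36 * ω t := by
  rw [fingerX, smoothSign_of_le (by linarith)]
  ring

theorem deriv_fingerX_neg {s t : ℝ} (hs : 0 ≤ s) (ht : 0 < t) :
    -36 * σ t - 154 * s * t * deriv σ (t ^ 2 - 8) < 0 := by
  have h1 := smoothSign_pos ht
  have h2 := deriv_smoothSign_nonneg (t ^ 2 - 8)
  have : 0 ≤ 154 * s * t * deriv σ (t ^ 2 - 8) := by positivity
  linarith

theorem deriv_fingerX_pos {s t : ℝ} (hs : 0 ≤ s) (ht : t < 0) :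
    0 < -36 * σ t - 154 * s * t * deriv σ (t ^ 2 - 8) := by
  have h1 := deriv_fingerX_neg hs (neg_pos.2 ht)
  rw [smoothSign_neg, neg_sq] at h1
  linarith

theorem fingerX_strictAntiOn {s : ℝ} (hs : 0 ≤ s) : StrictAntiOn (fingerX s) (Ici 0) := by
  refine strictAntiOn_of_deriv_neg (convex_Ici 0) (fingerX_contDiff s).continuous.continuousOn ?_
  intro t ht
  rw [interior_Ici] at ht
  rw [(fingerX_hasDerivAt s t).deriv]
  exact deriv_fingerX_neg hs ht

theorem fingerX_abs (s t : ℝ) : fingerX s |t| = fingerX s t := by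
  rcases abs_choice t with h | h <;> rw [h]
  exact fingerX_neg s t

theorem fingerX_inj {s t u : ℝ} (hs : 0 ≤ s) (h : fingerX s t = fingerX s u) : |t| = |u| := by
  rw [← fingerX_abs s t, ← fingerX_abs s u] at h
  exact (fingerX_strictAntiOn hs).injOn (abs_nonneg t) (abs_nonneg u) h

theorem fingerX_le {s : ℝ} (hs : 0 ≤ s) (t : ℝ) : fingerX s t ≤ -4 + 154 * s := by
  rw [← fingerX_abs]
  have := (fingerX_strictAntiOn hs).antitoneOn (mem_Ici.2 le_rfl) (abs_nonneg t) (abs_nonneg t)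
  rw [fingerX_of_le (t := 0) (by norm_num), smoothAbs_zero] at this
  linarith

theorem le_fingerX {s t : ℝ} (hs : 0 ≤ s) : -4 - 36 * |t| ≤ fingerX s t := by
  have h1 := smoothAbs_le_abs t
  have h2 := smoothSign_le_one (t ^ 2 - 8)
  have : 0 ≤ s * (154 * ((1 - σ (t ^ 2 - 8)) / 2)) := by
    refine mul_nonneg hs ?_
    linarith
  rw [fingerX]
  linarith

theorem fingerArc_contDiff (s : ℝ) : ContDiff ℝ ∞ (fingerArc s) :=
  cuspArc_contDiff (fingerX_contDiff s) upperFn_contDiff gapFn_contDiff.neg contDiff_const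
    smoothSign_contDiff contDiff_const

theorem fingerArc_fst (s t : ℝ) : (fingerArc s t).1 = fingerX s t := rfl

theorem fingerArc_snd_snd (s t : ℝ) : (fingerArc s t).2.2 =
    upperFn (fingerX s t) - gapFn (fingerX s t) * ((1 + σ t ^ 3) / 2) := by
  simp only [fingerArc, cuspArc]; ring

theorem cube_mem_Icc {c : ℝ} (h : c ∈ Icc (-1 : ℝ) 1) : c ^ 3 ∈ Icc (-1 : ℝ) 1 :=
  ⟨by nlinarith [h.1, h.2, sq_nonneg c, sq_nonneg (c - 1)],
    by nlinarith [h.1, h.2, sq_nonneg c, sq_nonneg (c + 1)]⟩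

theorem smoothSign_cube_mem (t : ℝ) : σ t ^ 3 ∈ Icc (-1 : ℝ) 1 :=
  cube_mem_Icc ⟨neg_one_le_smoothSign t, smoothSign_le_one t⟩

theorem fingerArc_snd_snd_mem (s t : ℝ) :
    (fingerArc s t).2.2 ∈ Icc (lowerFn (fingerX s t)) (upperFn (fingerX s t)) := by
  rw [fingerArc_snd_snd, lowerFn]
  have h1 := twelve_le_gapFn (fingerX s t)
  have h2 := smoothSign_cube_mem t
  constructor <;> nlinarith [h2.1, h2.2]

theorem fingerArc_eventuallyEq_upper {s t : ℝ} (h : t < -2) :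
    fingerArc s =ᶠ[𝓝 t] fun u => graphLift upperFn (fingerX s u) := by
  refine cuspArc_eventuallyEq (c₁ := -1) (c₂ := 0) upperFn_contDiff gapFn_contDiff.neg
    contDiff_const (fingerX_contDiff s).continuous.continuousAt (eventually_smoothSign_of_lt h)
    (Filter.Eventually.of_forall fun _ => rfl) (Filter.Eventually.of_forall fun X => ?_)
  norm_num

theorem fingerArc_eventuallyEq_lower {s t : ℝ} (h : 2 < t) :
    fingerArc s =ᶠ[𝓝 t] fun u => graphLift lowerFn (fingerX s u) := by
  refine cuspArc_eventuallyEq (c₁ := 1) (c₂ := 0) upperFn_contDiff gapFn_contDiff.neg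
    contDiff_const (fingerX_contDiff s).continuous.continuousAt (eventually_smoothSign_of_gt h)
    (Filter.Eventually.of_forall fun _ => rfl) (Filter.Eventually.of_forall fun X => ?_)
  rw [lowerFn]; ring

/-- Near the tip `x' = -36 σ`, whence the constant `-1/24 = (3/2)/(-36)`. The cutoff which lengthens
the finger varies only where `t ^ 2 - 8` is between `-2` and `2`, hence not for `|t| < 2`, where the
cusp is formed. -/
theorem contactForm_fingerArc (s t : ℝ) :
    contactForm (fingerArc s t) (deriv (fingerArc s) t) = 0 := by
  refine contactForm_cuspArc (fingerX_contDiff s) upperFn_contDiff gapFn_contDiff.neg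
    contDiff_const smoothSign_contDiff contDiff_const ?_ (Or.inl (by simp))
  rcases le_or_gt 2 |t| with h | h
  · exact Or.inl (deriv_smoothSign_of_two_le_abs h)
  · right
    have h4 : t ^ 2 < 4 := by rw [← sq_abs]; nlinarith [abs_nonneg t]
    rw [(fingerX_hasDerivAt s t).deriv, deriv_smoothSign_of_two_le_abs (t := t ^ 2 - 8)]
    · ring
    · rw [abs_of_neg (by linarith)]; linarith

/-- `x'` vanishes only at the tip, and there the arc moves in the `y`-direction because the gap is
positive. -/
theorem deriv_fingerArc_ne_zero {s : ℝ} (hs : 0 ≤ s) (t : ℝ) : deriv (fingerArc s) t ≠ 0 := by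
  intro h0
  have hx : deriv (fingerX s) t = 0 := by
    rw [← deriv_cuspArc_fst (k₁ := -1 / 24) (k₂ := 0) (fingerX_contDiff s) upperFn_contDiff
      gapFn_contDiff.neg contDiff_const smoothSign_contDiff (contDiff_const (c := (0 : ℝ)))]
    exact congrArg Prod.fst h0
  have hx' := hx
  rw [(fingerX_hasDerivAt s t).deriv] at hx'
  rcases lt_trichotomy t 0 with ht | rfl | ht
  · exact (deriv_fingerX_pos hs ht).ne' hx'
  · have := deriv_cuspArc_snd_fst (k₁ := -1 / 24) (k₂ := 0) (fingerX_contDiff s) upperFn_contDiff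
      gapFn_contDiff.neg (contDiff_const (c := (0 : ℝ))) smoothSign_contDiff
      (contDiff_const (c := (0 : ℝ))) hx (Or.inl smoothSign_zero) (Or.inl rfl)
    have h1 : (deriv (fingerArc s) 0).2.1 = 0 := by rw [h0]; rfl
    rw [fingerArc, this] at h1
    have h2 := twelve_le_gapFn (fingerX s 0)
    have h3 := pow_pos deriv_smoothSign_zero 2
    nlinarith
  · exact (deriv_fingerX_neg hs ht).ne hx'

/-- `x` is even in `t` and strictly decreasing in `|t|`, so only `t` and `-t` lie over the same `x`.
Their heights differ by the gap times `σ ^ 3`, which is zero only at the tip. -/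
theorem fingerArc_front_inj {s t u : ℝ} (hs : 0 ≤ s) (h1 : fingerX s t = fingerX s u)
    (h2 : (fingerArc s t).2.2 = (fingerArc s u).2.2) : t = u := by
  rcases abs_eq_abs.1 (fingerX_inj hs h1) with h | rfl
  · exact h
  · rw [fingerArc_snd_snd, fingerArc_snd_snd, fingerX_neg, smoothSign_neg] at h2
    have h3 := twelve_le_gapFn (fingerX s u)
    have h4 : σ u ^ 3 = 0 := by
      have : gapFn (fingerX s u) * σ u ^ 3 = 0 := by linear_combination h2
      rcases mul_eq_zero.1 this with h | h
      · linarith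
      · exact h
    have h5 : σ u = 0 := pow_eq_zero_iff (by norm_num) |>.1 h4
    have h6 : u = 0 := by
      rcases lt_trichotomy u 0 with h | h | h
      · exact absurd h5 (smoothSign_neg_of_neg h).ne
      · exact h
      · exact absurd h5 (smoothSign_pos h).ne'
    rw [h6, neg_zero]

theorem fingerArc_injective {s : ℝ} (hs : 0 ≤ s) : Function.Injective (fingerArc s) :=
  fun _ _ h => fingerArc_front_inj hs (congrArg Prod.fst h) (congrArg (fun p : R3 => p.2.2) h)

theorem vecOn_fingerArc_upper {ε s t : ℝ} (hs : 0 ≤ s) (h : t < -2) :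
    vecOn ε (fingerArc s) {t} = vecOn ε (graphLift upperFn) {fingerX s t} :=
  vecOn_comp_of_pos (fingerX_hasDerivAt s t)
    ((graphLift_contDiff upperFn_contDiff).differentiable (by simp) _)
    (fingerArc_eventuallyEq_upper h) (deriv_fingerX_pos hs (by linarith))

theorem vecOn_fingerArc_lower {ε s t : ℝ} (hs : 0 ≤ s) (h : 2 < t) :
    vecOn ε (fingerArc s) {t} = vecOn (-ε) (graphLift lowerFn) {fingerX s t} :=
  vecOn_comp_of_neg (fingerX_hasDerivAt s t)
    ((graphLift_contDiff lowerFn_contDiff).differentiable (by simp) _)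
    (fingerArc_eventuallyEq_lower h) (deriv_fingerX_neg hs (by linarith))

theorem fingerX_two (s : ℝ) : fingerX s 2 = -76 + 36 * w₀ + 154 * s := by
  rw [fingerX_of_le (by norm_num), smoothAbs_of_two_le le_rfl]
  ring

/-- The branch `t > 2` is the lower edge; since `x` is even, the same values are taken on the upper
edge `t < -2`. -/
theorem fingerX_surj {s X : ℝ} (hX : X < -76 + 36 * w₀ + 154 * s) : ∃ t, 2 < t ∧
    fingerX s t = X := by
  have hc := (fingerX_contDiff s).continuous
  have h2 := fingerX_two s
  obtain ⟨v, hv2, hv⟩ : ∃ v, 2 ≤ v ∧ fingerX s v < X := by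
    refine ⟨5 + |X|, by linarith [abs_nonneg X], ?_⟩
    have h5 : 4 < |(5 + |X|)| := by rw [abs_of_pos (by positivity)]; linarith [abs_nonneg X]
    rw [fingerX_fix h5, fingerX_zero, smoothAbs_of_two_le (by linarith [abs_nonneg X])]
    have := neg_abs_le X
    have := absDefect_le
    linarith [abs_nonneg X]
  obtain ⟨t, ht, rfl⟩ := intermediate_value_Icc' hv2 hc.continuousOn ⟨hv.le, by linarith⟩
  refine ⟨t, lt_of_le_of_ne ht.1 ?_, rfl⟩
  rintro rfl
  linarith

/-! ### The bend -/

/-- A Legendrian arc with one cusp whose front is the union of two rays with a rounded corner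
removed. -/
noncomputable def bendArc : ℝ → R3 :=
  cuspArc (fun t => -3 + ω t) (fun x => x) (fun x => -2 * x) (fun _ => 0) σ (fun _ => 0) (3 / 2) 0

theorem bendX_contDiff : ContDiff ℝ ∞ (fun t => -3 + ω t) := contDiff_const.add smoothAbs_contDiff

theorem bendX_hasDerivAt (t : ℝ) : HasDerivAt (fun t => -3 + ω t) (σ t) t :=
  (smoothAbs_hasDerivAt t).const_add (-3)

theorem contDiff_neg_two_mul : ContDiff ℝ ∞ (fun x : ℝ => -2 * x) := contDiff_const.mul contDiff_id

theorem bendArc_contDiff : ContDiff ℝ ∞ bendArc :=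
  cuspArc_contDiff bendX_contDiff contDiff_id contDiff_neg_two_mul contDiff_const
    smoothSign_contDiff contDiff_const

theorem bendArc_fst (t : ℝ) : (bendArc t).1 = -3 + ω t := rfl

theorem bendArc_snd_snd (t : ℝ) : (bendArc t).2.2 = -((-3 + ω t) * σ t ^ 3) := by
  simp only [bendArc, cuspArc]; ring

theorem bendArc_eventuallyEq_left {t : ℝ} (h : t < -2) :
    bendArc =ᶠ[𝓝 t] fun u => gLine (-3 + ω u) := by
  rw [← graphLift_id]
  refine cuspArc_eventuallyEq (c₁ := -1) (c₂ := 0) contDiff_id contDiff_neg_two_mul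
    contDiff_const bendX_contDiff.continuous.continuousAt (eventually_smoothSign_of_lt h)
    (Filter.Eventually.of_forall fun _ => rfl) (Filter.Eventually.of_forall fun X => ?_)
  norm_num

theorem bendArc_eventuallyEq_right {t : ℝ} (h : 2 < t) :
    bendArc =ᶠ[𝓝 t] fun u => fLine (-3 + ω u) := by
  rw [← graphLift_neg]
  refine cuspArc_eventuallyEq (c₁ := 1) (c₂ := 0) contDiff_id contDiff_neg_two_mul
    contDiff_const bendX_contDiff.continuous.continuousAt (eventually_smoothSign_of_gt h)
    (Filter.Eventually.of_forall fun _ => rfl) (Filter.Eventually.of_forall fun X => ?_)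
  ring

theorem contactForm_bendArc (t : ℝ) : contactForm (bendArc t) (deriv bendArc t) = 0 := by
  refine contactForm_cuspArc bendX_contDiff contDiff_id contDiff_neg_two_mul
    contDiff_const smoothSign_contDiff contDiff_const (Or.inr ?_) (Or.inl (by simp))
  rw [(bendX_hasDerivAt t).deriv]

theorem smoothSign_eq_zero {t : ℝ} (h0 : σ t = 0) : t = 0 := by
  rcases lt_trichotomy t 0 with h | h | h
  · exact absurd h0 (smoothSign_neg_of_neg h).ne
  · exact h
  · exact absurd h0 (smoothSign_pos h).ne'

theorem deriv_bendArc_ne_zero (t : ℝ) : deriv bendArc t ≠ 0 := by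
  intro h0
  have hx : deriv (fun t => -3 + ω t) t = 0 := by
    rw [← deriv_cuspArc_fst (k₁ := 3 / 2) (k₂ := 0) bendX_contDiff contDiff_id
      contDiff_neg_two_mul contDiff_const smoothSign_contDiff (contDiff_const (c := (0 : ℝ)))]
    exact congrArg Prod.fst h0
  have hx' := hx
  rw [(bendX_hasDerivAt t).deriv] at hx'
  obtain rfl := smoothSign_eq_zero hx'
  have := deriv_cuspArc_snd_fst (k₁ := 3 / 2) (k₂ := 0) bendX_contDiff contDiff_fun_id
      contDiff_neg_two_mul (contDiff_const (c := (0 : ℝ))) smoothSign_contDiff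
      (contDiff_const (c := (0 : ℝ))) hx (Or.inl smoothSign_zero) (Or.inl rfl)
  have h1 : (deriv bendArc 0).2.1 = 0 := by rw [h0]; rfl
  rw [bendArc, this, smoothAbs_zero] at h1
  have h3 := pow_pos deriv_smoothSign_zero 2
  nlinarith

/-- Two different points of the bend with the same front projection lie over the crossing. -/
theorem bendArc_front {t u : ℝ} (h1 : ω t = ω u) (h2 : (bendArc t).2.2 = (bendArc u).2.2) :
    t = u ∨ u = -t ∧ ω t = 3 := by
  rcases abs_eq_abs.1 (smoothAbs_inj h1) with h | rfl
  · exact Or.inl h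
  · rw [bendArc_snd_snd, bendArc_snd_snd, smoothAbs_neg, smoothSign_neg] at h2
    have : (-3 + ω u) * σ u ^ 3 = 0 := by linear_combination h2 / 2
    rcases mul_eq_zero.1 this with h | h
    · right
      refine ⟨by ring, ?_⟩
      rw [smoothAbs_neg]; linarith
    · left
      obtain rfl := smoothSign_eq_zero (pow_eq_zero_iff (by norm_num) |>.1 h)
      simp

/-- The only double point of the front is at the origin, and there the branches have slopes `1` and
`-1`. -/
theorem bendArc_injective : Function.Injective bendArc := by
  intro t u h
  have h1 : ω t = ω u := by
    have := congrArg Prod.fst h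
    simpa [bendArc_fst] using this
  rcases bendArc_front h1 (congrArg (fun p : R3 => p.2.2) h) with h' | ⟨rfl, h3⟩
  · exact h'
  · exfalso
    have habs : 2 < |t| := by
      have := smoothAbs_le_abs t
      linarith
    have key : ∀ t, 2 < t → bendArc t ≠ bendArc (-t) := fun t ht he => by
      have hl := (bendArc_eventuallyEq_left (neg_lt_neg ht)).eq_of_nhds
      have hr := (bendArc_eventuallyEq_right ht).eq_of_nhds
      rw [hl, hr] at he
      have := congrArg (fun p : R3 => p.2.1) he
      norm_num [fLine, gLine] at this
    rcases lt_abs.1 habs with ht | ht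
    · exact key t ht h
    · refine key (-t) ht ?_
      rw [neg_neg]; exact h.symm

theorem vecOn_bendArc_left {ε t : ℝ} (h : t < -2) :
    vecOn ε bendArc {t} = vecOn (-ε) gLine {-3 + ω t} := by
  have hg : ContDiff ℝ ∞ gLine := graphLift_id ▸ graphLift_contDiff contDiff_id
  exact vecOn_comp_of_neg (bendX_hasDerivAt t) (hg.differentiable (by simp) _)
    (bendArc_eventuallyEq_left h) (smoothSign_neg_of_neg (by linarith))

theorem vecOn_bendArc_right {ε t : ℝ} (h : 2 < t) :
    vecOn ε bendArc {t} = vecOn ε fLine {-3 + ω t} := by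
  have hg : ContDiff ℝ ∞ fLine := graphLift_neg ▸ graphLift_contDiff contDiff_neg
  exact vecOn_comp_of_pos (bendX_hasDerivAt t) (hg.differentiable (by simp) _)
    (bendArc_eventuallyEq_right h) (smoothSign_pos (by linarith))

theorem bendX_surj {X : ℝ} (hX : -1 - w₀ < X) : ∃ t, 2 < t ∧ -3 + ω t = X := by
  refine ⟨X + 3 + w₀, by linarith, ?_⟩
  rw [smoothAbs_of_two_le (by linarith)]
  ring

/-! ### Finger and bend as a tangle pair -/

theorem deriv_eq_zero_of_eventually_const {f : ℝ → ℝ} {x c : ℝ} (h : ∀ᶠ y in 𝓝 x, f y = c) :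
    deriv f x = 0 := by
  rw [Filter.EventuallyEq.deriv_eq (f := fun _ => c) h, deriv_const]

theorem deriv_upperFn_of_gt {x : ℝ} (h : -18 < x) : deriv upperFn x = 0 :=
  deriv_eq_zero_of_eventually_const (c := 20) (by
    filter_upwards [lt_mem_nhds h] with y hy using upperFn_of_ge hy.le)

theorem deriv_gapFn_of_gt {x : ℝ} (h : -4 < x) : deriv gapFn x = 0 :=
  deriv_eq_zero_of_eventually_const (c := 12) (by
    filter_upwards [lt_mem_nhds h] with y hy using gapFn_of_ge hy.le)

/-- Beyond `x = -4` both edges are horizontal, and the cusp contributes at most `12/24` to the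
slope. This is why the tip is stretched by the factor `36`: the slope stays below that of the line
`z = x`. -/
theorem fingerArc_y_lt {s t : ℝ} (h : -4 < fingerX s t) : (fingerArc s t).2.1 < 1 := by
  have h1 := deriv_upperFn_of_gt (x := fingerX s t) (by linarith)
  have h2 : deriv (fun x => -gapFn x) (fingerX s t) = 0 := by
    rw [deriv.fun_neg, deriv_gapFn_of_gt h, neg_zero]
  simp only [fingerArc, cuspArc, h1, h2, gapFn_of_ge h.le, deriv_const]
  have h3 := deriv_smoothSign_nonneg t
  have h4 := deriv_smoothSign_le t
  have h5 := smoothSign_le_one t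
  have h6 : σ t * deriv σ t ≤ 1 :=
    (mul_le_of_le_one_left h3 h5).trans h4
  linarith

/-- The rounded part of the bend and its branch along `z = -x` reach at most height `3`. -/
theorem bendArc_snd_snd_le {t : ℝ} (h : 3 < (bendArc t).2.2) : t < -2 := by
  rw [bendArc_snd_snd] at h
  have h1 := smoothAbs_nonneg t
  have h2 := smoothSign_cube_mem t
  by_contra hlt
  push Not at hlt
  rcases le_or_gt t 2 with ht | ht
  · have h3 := smoothAbs_le_abs t
    have h4 : |t| ≤ 2 := abs_le.2 ⟨hlt, ht⟩
    nlinarith [h2.1, h2.2]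
  · rw [smoothSign_of_two_le ht.le] at h
    linarith

/-- Over the bend the finger has height at least `8`, so the fronts can meet only on the branch `z =
x` of the bend. There the bend has `y = 1` and the finger `y < 1`. Hence the finger passes the bend
without touching it, whatever its length. -/
theorem fingerArc_ne_bendArc {s : ℝ} (t u : ℝ) : fingerArc s t ≠ bendArc u := by
  intro h
  have hx : fingerX s t = -3 + ω u := congrArg Prod.fst h
  have hx3 : -3 ≤ fingerX s t := by have := smoothAbs_nonneg u; linarith
  have hz := (fingerArc_snd_snd_mem s t).1
  rw [lowerFn_of_ge (by linarith), h] at hz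
  have hu := bendArc_snd_snd_le (by linarith)
  have hy := fingerArc_y_lt (s := s) (t := t) (by linarith)
  rw [h, (bendArc_eventuallyEq_left hu).eq_of_nhds] at hy
  exact lt_irrefl _ hy

theorem vecOn_eq_of_upper {ε X : ℝ} (h : X < -22) :
    vecOn ε (graphLift upperFn) {X} = vecOn ε fLine {X} :=
  vecOn_singleton_congr (graphLift_upperFn h)

theorem vecOn_eq_of_lower {ε X : ℝ} (h : X < -22) :
    vecOn ε (graphLift lowerFn) {X} = vecOn ε gLine {X} :=
  vecOn_singleton_congr (graphLift_lowerFn h)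

theorem vecOn_mono {ε : ℝ} {a : ℝ → R3} {I J : Set ℝ} (h : I ⊆ J) : vecOn ε a I ⊆ vecOn ε a J := by
  rintro _ ⟨t, ht, l, hl, rfl⟩
  exact ⟨t, h ht, l, hl, rfl⟩

theorem mem_vecOn_univ {ε : ℝ} {a : ℝ → R3} {t : ℝ} {q : R3 × R3} (h : q ∈ vecOn ε a {t}) :
    q ∈ vecOn ε a univ := vecOn_mono (subset_univ _) h

/-- Over the left and the right of the first rectangle nothing changes. -/
theorem finger_bend_agree {ε : ℝ} {q : R3 × R3} (h : q.1.1 < fingerX 0 4 ∨ -1 - w₀ < q.1.1) :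
    q ∈ vecOn ε (fingerArc 0) univ ∪ vecOn ε bendArc univ ↔ q ∈ crossVec ε := by
  have hw := absDefect_nonneg
  have hw' := absDefect_le
  have h4 : fingerX 0 4 = -148 + 36 * w₀ := by
    rw [fingerX_zero, smoothAbs_of_two_le (by norm_num)]; ring
  -- The rounded parts `|t| ≤ 2` of both arcs project into the `x`-range of the first rectangle;
  -- elsewhere the arcs run along graphs.
  have hf2 : ∀ t, |t| ≤ 2 → fingerX 0 4 ≤ fingerX 0 t ∧ fingerX 0 t ≤ -1 - w₀ := fun t ht => by
    have h1 := smoothAbs_le_abs t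
    have h2 := smoothAbs_nonneg t
    rw [h4, fingerX_zero]
    constructor <;> linarith
  have hb2 : ∀ t, |t| ≤ 2 → fingerX 0 4 ≤ -3 + ω t ∧ -3 + ω t ≤ -1 - w₀ := fun t ht => by
    have h1 := smoothAbs_strictMonoOn.monotoneOn (abs_nonneg t) (mem_Ici.2 zero_le_two) ht
    rw [smoothAbs_abs, smoothAbs_of_two_le le_rfl] at h1
    have h2 := smoothAbs_nonneg t
    rw [h4]
    constructor <;> linarith
  have hf : ∀ t, fingerX 0 t ≤ -4 := fun t => by have := fingerX_le le_rfl (t := t); linarith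
  have hb : ∀ t, -3 ≤ -3 + ω t := fun t => by have := smoothAbs_nonneg t; linarith
  constructor
  · rintro (hq | hq) <;> obtain ⟨t, -, ht⟩ := mem_vecOn_iff.1 hq <;>
      have hq1 := congrArg Prod.fst (fst_of_mem_vecOn_singleton ht)
    · rw [fingerArc_fst] at hq1
      have hlt : q.1.1 < fingerX 0 4 := by
        rcases h with h | h
        · exact h
        · have := hf t; linarith
      have ht2 : 2 < |t| := by
        by_contra hle
        have := (hf2 t (not_lt.1 hle)).1
        linarith
      have hX : fingerX 0 t < -22 := by linarith
      rcases lt_abs.1 ht2 with h2 | h2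
      · rw [vecOn_fingerArc_lower le_rfl h2, vecOn_eq_of_lower hX] at ht
        exact Or.inr (mem_vecOn_univ ht)
      · rw [vecOn_fingerArc_upper le_rfl (by linarith), vecOn_eq_of_upper hX] at ht
        exact Or.inl (mem_vecOn_univ ht)
    · rw [bendArc_fst] at hq1
      have hlt : -1 - w₀ < q.1.1 := by
        rcases h with h | h
        · have := hb t; linarith
        · exact h
      have ht2 : 2 < |t| := by
        by_contra hle
        have := (hb2 t (not_lt.1 hle)).2
        linarith
      rcases lt_abs.1 ht2 with h2 | h2
      · rw [vecOn_bendArc_right h2] at ht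
        exact Or.inl (mem_vecOn_univ ht)
      · rw [vecOn_bendArc_left (by linarith)] at ht
        exact Or.inr (mem_vecOn_univ ht)
  · have hs : q.1.1 < fingerX 0 4 → ∃ t, 2 < t ∧ fingerX 0 t = q.1.1 := fun h =>
      fingerX_surj (by linarith)
    rintro (hq | hq) <;> obtain ⟨X, -, hX⟩ := mem_vecOn_iff.1 hq <;>
      have hq1 := congrArg Prod.fst (fst_of_mem_vecOn_singleton hX)
    · have hq1' : q.1.1 = X := hq1
      rw [← hq1'] at hX
      rcases h with h | h
      · obtain ⟨t, ht, htX⟩ := hs h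
        left
        refine mem_vecOn_univ (t := -t) ?_
        rw [vecOn_fingerArc_upper le_rfl (neg_lt_neg ht), fingerX_neg, htX,
          vecOn_eq_of_upper (by linarith)]
        exact hX
      · obtain ⟨t, ht, htX⟩ := bendX_surj h
        right
        refine mem_vecOn_univ (t := t) ?_
        rw [vecOn_bendArc_right ht, htX]
        exact hX
    · have hq1' : q.1.1 = X := hq1
      rw [← hq1'] at hX
      rcases h with h | h
      · obtain ⟨t, ht, htX⟩ := hs h
        left
        refine mem_vecOn_univ (t := t) ?_
        rw [vecOn_fingerArc_lower le_rfl ht, htX, vecOn_eq_of_lower (by linarith)]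
        exact hX
      · obtain ⟨t, ht, htX⟩ := bendX_surj h
        right
        refine mem_vecOn_univ (t := -t) ?_
        rw [vecOn_bendArc_left (neg_lt_neg ht), smoothAbs_neg, htX]
        exact hX

theorem fingerArc_bound {s t : ℝ} (h : |fingerX s t| ≤ 1000) : |(fingerArc s t).2.2| < 2000 := by
  have h1 := fingerArc_snd_snd_mem s t
  have h2 := upperFn_lt h
  have h3 := lt_lowerFn h
  exact abs_lt.2 ⟨by linarith [h1.1], by linarith [h1.2]⟩

theorem bendArc_bound (t : ℝ) : |(bendArc t).2.2| ≤ |-3 + ω t| := by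
  rw [bendArc_snd_snd, abs_neg, abs_mul]
  exact mul_le_of_le_one_right (abs_nonneg _) (abs_le.2 (smoothSign_cube_mem t))

theorem isTanglePair_finger_zero (ε : ℝ) : IsTanglePair ε ε ε (fingerArc 0) bendArc where
  smooth_left := fingerArc_contDiff 0
  smooth_right := bendArc_contDiff
  inj_left := fingerArc_injective le_rfl
  inj_right := bendArc_injective
  imm_left := deriv_fingerArc_ne_zero le_rfl
  imm_right := deriv_bendArc_ne_zero
  disj := fingerArc_ne_bendArc
  tail q hq := finger_bend_agree (by
    have := absDefect_nonneg
    have h4 : fingerX 0 4 = -148 + 36 * w₀ := by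
      rw [fingerX_zero, smoothAbs_of_two_le (by norm_num)]; ring
    rcases le_abs.1 hq with h | h
    · right; linarith
    · left; linarith)
  bound_left t ht := fingerArc_bound ht
  bound_right t ht := (bendArc_bound t).trans_lt (lt_of_le_of_lt ht (by norm_num))
  proper := by
    -- `1006 = 1001 + 3 + 2`: the bend starts at `x = -3`, and `smoothAbs` falls short of the
    -- absolute value by at most `2`. The finger needs less.
    refine ⟨1006, fun t => ⟨fun h => ?_, fun h => ?_⟩⟩ <;> have h1 := abs_sub_le_smoothAbs t <;>
      have h2 := absDefect_le
    · rw [fingerArc_fst, fingerX_zero] at h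
      have := (abs_le.1 h).1
      linarith
    · rw [bendArc_fst] at h
      have := (abs_le.1 h).2
      linarith

theorem fingerArc_fix {s t : ℝ} (h : 4 < |t|) : fingerArc s t = fingerArc 0 t := by
  simp only [fingerArc, cuspArc, fingerX_fix h]

theorem fingerArc_mem_modelCylInt {s t : ℝ} (hs : s ∈ Icc (0 : ℝ) 1) (h : |t| ≤ 20) :
    fingerArc s t ∈ modelCylInt := by
  have h1 := fingerX_le hs.1 t
  have h2 := le_fingerX (t := t) hs.1
  have h3 : |fingerX s t| < 1000 := abs_lt.2 ⟨by linarith, by linarith [hs.2]⟩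
  exact ⟨h3, fingerArc_bound h3.le⟩

theorem isTanglePair_finger (ε : ℝ) {s : ℝ} (hs : s ∈ Icc (0 : ℝ) 1) :
    IsTanglePair ε ε ε (fingerArc s) bendArc :=
  (isTanglePair_finger_zero ε).modify_left (r := 4) (fingerArc_contDiff s)
    (fingerArc_injective hs.1) (deriv_fingerArc_ne_zero hs.1) fingerArc_ne_bendArc
    (fun _ => fingerArc_fix)
    (fun t ht => (fingerArc_mem_modelCylInt (left_mem_Icc.2 zero_le_one) (ht.trans (by norm_num))).1)
    (fun t ht => fingerArc_mem_modelCylInt hs (ht.trans (by norm_num)))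

theorem fingerArc_contDiff₂ : ContDiff ℝ ∞ (fun p : ℝ × ℝ => fingerArc p.1 p.2) := by
  have h1 := fingerX_contDiff₂
  have h2 := (contDiff_infty_iff_deriv.1 upperFn_contDiff).2.comp h1
  have h3 := (contDiff_infty_iff_deriv.1 gapFn_contDiff.neg).2.comp h1
  have h4 := upperFn_contDiff.comp h1
  have h5 := gapFn_contDiff.comp h1
  have h6 := smoothSign_contDiff.comp (contDiff_snd (E := ℝ) (F := ℝ) (𝕜 := ℝ))
  have h7 := contDiff_deriv_smoothSign.comp (contDiff_snd (E := ℝ) (F := ℝ) (𝕜 := ℝ))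
  have : (fun p : ℝ × ℝ => fingerArc p.1 p.2) = fun p => (fingerX p.1 p.2,
      deriv upperFn (fingerX p.1 p.2) + deriv (-gapFn) (fingerX p.1 p.2) * ((1 + σ p.2 ^ 3) / 2)
        + -1 / 24 * (-gapFn (fingerX p.1 p.2) * (σ p.2 * deriv σ p.2)),
      upperFn (fingerX p.1 p.2) + -gapFn (fingerX p.1 p.2) * ((1 + σ p.2 ^ 3) / 2)) := by
    funext p
    simp only [fingerArc, cuspArc, deriv_const, zero_mul, add_zero, mul_zero]
    rfl
  rw [this]
  have h8 := (contDiff_const (c := (1 : ℝ)).add (h6.pow 3)).div_const 2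
  exact h1.prodMk (((h2.add (h3.mul h8)).add (contDiff_const.mul (h5.neg.mul (h6.mul h7)))).prodMk
    (h4.add (h5.neg.mul h8)))

/-- Two Legendrian links which contain the finger at its two extreme positions. -/
theorem legendrianIsotopic_finger {ε : ℝ} (hε : ε ≠ 0) {N L L' : LegendrianLink}
    (hL : L.vec = replaceVec N.vec ε ε (fingerArc 0) bendArc)
    (hL' : L'.vec = replaceVec N.vec ε ε (fingerArc 1) bendArc) : LegendrianIsotopic L L' :=
  legendrianIsotopic_replaceVec (e := ε) (c := fingerArc) (r := 4) (R := 20) fingerArc_contDiff₂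
    N.isCompact_points.isClosed (fun _ hs => isTanglePair_finger ε hs) hε (by norm_num)
    (fun s _ t => contactForm_fingerArc s t) (fun _ _ => fingerArc_fix)
    (fun s hs t ht => fingerArc_mem_modelCylInt hs (ht.trans (by norm_num)))
    (fun t ht => by
      have := fingerArc_mem_modelCylInt (left_mem_Icc.2 zero_le_one) ht
      exact ⟨this.1.le, this.2.le⟩) hL hL'

/-! ### The first surgery -/

/-- An arc whose `x`-coordinate is an affine image of `smoothAbs` has exactly one cusp. -/
theorem hasOneCusp_of_smoothAbs {c : ℝ → R3} (hc : ContDiff ℝ ∞ c) {p k m : ℝ} (hk : k ≠ 0)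
    (hm : m ≠ 0) (h : ∀ t ∈ Ioo (-(11 / 10) : ℝ) (11 / 10), (c t).1 = p + k * ω (m * t)) :
    HasOneCusp c := by
  have hd : ∀ t, HasDerivAt (fun t => p + k * ω (m * t)) (k * (σ (m * t) * m)) t := fun t => by
    have h1 := ((hasDerivAt_id t).const_mul m)
    rw [mul_one] at h1
    exact (((smoothAbs_hasDerivAt (m * t)).comp t h1).const_mul k).const_add p
  have hd2 : deriv (deriv fun t => p + k * ω (m * t)) 0 = k * (deriv σ 0 * m * m) := by
    rw [show deriv (fun t => p + k * ω (m * t)) = fun t => k * (σ (m * t) * m) from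
      funext fun t => (hd t).deriv]
    have h1 := ((hasDerivAt_id (0 : ℝ)).const_mul m)
    rw [mul_one] at h1
    have h2 := (smoothSign_hasDerivAt (m * 0)).comp (0 : ℝ) h1
    rw [mul_zero] at h2
    exact ((h2.mul_const m).const_mul k).deriv
  -- The margin beyond `1` makes the formula valid on a neighbourhood of the end points `±1` too, so
  -- that derivatives can be compared there.
  have hnear : ∀ t ∈ Ioo (-(11 / 10) : ℝ) (11 / 10),
      (fun t => (c t).1) =ᶠ[𝓝 t] fun t => p + k * ω (m * t) := fun t ht => by
    filter_upwards [isOpen_Ioo.mem_nhds ht] with u hu using h u hu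
  refine ⟨0, by norm_num, ?_, fun t ht => ?_⟩
  · rw [iteratedDeriv_succ, iteratedDeriv_one,
      (hnear 0 (by norm_num)).deriv.deriv_eq, hd2]
    exact mul_ne_zero hk (mul_ne_zero (mul_ne_zero deriv_smoothSign_zero.ne' hm) hm)
  · have h1 : (deriv c t).1 = k * (σ (m * t) * m) := by
      rw [← (hd t).deriv, ← (hnear t ⟨by linarith [ht.1], by linarith [ht.2]⟩).deriv_eq]
      exact (hasDerivAt_coord_fst (hc.differentiable (by simp) t).hasDerivAt).deriv.symm
    rw [h1]
    constructor
    · intro h0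
      have h2 : σ (m * t) = 0 := by simpa [hk, hm] using h0
      have := smoothSign_eq_zero h2
      simpa [hm] using this
    · rintro rfl
      simp [smoothSign_zero]

theorem deriv_comp_affine (c : ℝ → R3) (hc : ContDiff ℝ ∞ c) (p m t : ℝ) :
    deriv (fun t => c (p + m * t)) t = m • deriv c (p + m * t) := by
  have h1 : HasDerivAt (fun t : ℝ => p + m * t) m t := by
    simpa using ((hasDerivAt_id t).const_mul m).const_add p
  exact ((hc.differentiable (by simp) _).hasDerivAt.scomp t h1).deriv

theorem mem_vecOn_affine {c : ℝ → R3} (hc : ContDiff ℝ ∞ c) {p m : ℝ} (hm : 0 < m) (η t : ℝ) :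
    (c (p + m * t), η • deriv (fun t => c (p + m * t)) t) ∈ vecOn η c {p + m * t} := by
  refine ⟨_, rfl, m, hm, ?_⟩
  rw [deriv_comp_affine c hc, smul_smul, mul_comm η m]

theorem mem_vecOn_affine_neg {c : ℝ → R3} (hc : ContDiff ℝ ∞ c) {p m : ℝ} (hm : m < 0) (η t : ℝ) :
    (c (p + m * t), η • deriv (fun t => c (p + m * t)) t) ∈ vecOn (-η) c {p + m * t} := by
  refine ⟨_, rfl, -m, neg_pos.2 hm, ?_⟩
  rw [deriv_comp_affine c hc, smul_smul, neg_mul_neg, mul_comm η m]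

theorem fLine_contDiff : ContDiff ℝ ∞ fLine := graphLift_neg ▸ graphLift_contDiff contDiff_neg
theorem gLine_contDiff : ContDiff ℝ ∞ gLine := graphLift_id ▸ graphLift_contDiff contDiff_id

/-- The original link counts as a replacement by the trivial pair of lines, which allows
`agreeOutside_replaceVec` to compare it with the link after the surgery. -/
theorem replaceVec_lines {V : Set (R3 × R3)} {ε : ℝ} (hV : HasModelCrossing ε V) :
    replaceVec V ε (-ε) fLine gLine = V := by
  ext q
  by_cases hq : q.1 ∈ modelCyl
  · simp only [replaceVec, mem_ofPred_eq, hq, true_and, not_true, false_and, or_false]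
    exact (hV q (modelCyl_subset_modelNhd hq)).symm
  · simp [replaceVec, hq]

theorem mem_Icc_affine {p m t : ℝ} (hm : 0 < m) (ht : t ∈ Icc (-1 : ℝ) 1) :
    p + m * t ∈ Icc (p - m) (p + m) := by
  constructor <;> nlinarith [ht.1, ht.2]

theorem exists_affine {p m X : ℝ} (hm : 0 < m) (hX : X ∈ Icc (p - m) (p + m)) :
    ∃ t ∈ Icc (-1 : ℝ) 1, p + m * t = X := by
  refine ⟨(X - p) / m, ⟨?_, ?_⟩, by field_simp; ring⟩
  · rw [le_div_iff₀ hm]; linarith [hX.1]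
  · rw [div_le_iff₀ hm]; linarith [hX.2]

theorem affine_comp_contDiff {c : ℝ → R3} (hc : ContDiff ℝ ∞ c) (p m : ℝ) :
    ContDiff ℝ ∞ (fun t => c (p + m * t)) :=
  hc.comp (contDiff_const.add (contDiff_const.mul contDiff_id))

theorem deriv_fst_affine {c : ℝ → R3} (hc : ContDiff ℝ ∞ c) (p m : ℝ) {t x' : ℝ}
    (h : HasDerivAt (fun t => (c t).1) x' (p + m * t)) :
    (deriv (fun t => c (p + m * t)) t).1 = m * x' := by
  rw [deriv_comp_affine c hc]
  have := (hasDerivAt_coord_fst (hc.differentiable (by simp) (p + m * t)).hasDerivAt).unique h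
  simp [this]

/-- The rectangle of the first surgery. -/
noncomputable def firstRect : Rect := ⟨fingerX 0 4, -1 - w₀, -300, 300⟩

theorem fingerX_zero_four : fingerX 0 4 = -148 + 36 * w₀ := by
  rw [fingerX_zero, smoothAbs_of_two_le (by norm_num)]; ring

theorem firstRect_cylinder : firstRect.cylinder ⊆ modelCyl := by
  rintro p ⟨⟨h1, h2⟩, ⟨h3, h4⟩⟩
  simp only [firstRect, fingerX_zero_four] at h1 h2 h3 h4
  have := absDefect_nonneg
  exact ⟨abs_le.2 ⟨by linarith, by linarith⟩, abs_le.2 ⟨by linarith, by linarith⟩⟩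

theorem isTangleOver_lines_first (ε : ℝ) : ∃ p m : ℝ, 0 < m ∧ p - m = fingerX 0 4 ∧
    p + m = -1 - w₀ ∧
    IsTangleOver ε (vecOn ε fLine univ ∪ vecOn (-ε) gLine univ) firstRect
      (fun t => fLine (p + m * t)) (fun t => gLine (p + -m * t)) := by
  have hw := absDefect_nonneg
  have hw' := absDefect_le
  have h4 := fingerX_zero_four
  have hm : 0 < (-1 - w₀ - fingerX 0 4) / 2 := by linarith
  -- Midpoint and half-width of the `x`-range of the rectangle; the second strand runs the other way
  -- and uses `-m`.
  refine ⟨(fingerX 0 4 + (-1 - w₀)) / 2, (-1 - w₀ - fingerX 0 4) / 2, hm, by ring, by ring, ?_⟩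
  set p := (fingerX 0 4 + (-1 - w₀)) / 2
  set m := (-1 - w₀ - fingerX 0 4) / 2
  have h1 : p - m = fingerX 0 4 := by ring
  have h2 : p + m = -1 - w₀ := by ring
  have hI : ∀ t ∈ Icc (-1 : ℝ) 1, p + m * t ∈ Icc (fingerX 0 4) (-1 - w₀) := fun t ht => by
    rw [← h1, ← h2]; exact mem_Icc_affine hm ht
  have hI' : ∀ t ∈ Icc (-1 : ℝ) 1, p + -m * t ∈ Icc (fingerX 0 4) (-1 - w₀) := fun t ht => by
    have := hI (-t) (neg_mem_Icc_neg_one_one ht)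
    rwa [mul_neg, ← neg_mul] at this
  refine ⟨affine_comp_contDiff fLine_contDiff _ _, affine_comp_contDiff gLine_contDiff _ _,
    fun t ht => Or.inl (mem_vecOn_univ (mem_vecOn_affine fLine_contDiff hm _ _)),
    fun t ht => Or.inr (mem_vecOn_univ (mem_vecOn_affine_neg gLine_contDiff (neg_neg_of_pos hm) _ _)),
    ?_, fun t ht => ⟨hI t ht, ?_, ?_⟩, fun t ht => ⟨hI' t ht, ?_, ?_⟩, ?_, ?_, ?_⟩
  · rintro q (hq | hq) hB <;> obtain ⟨X, -, hX⟩ := mem_vecOn_iff.1 hq <;>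
      have hq1 := fst_of_mem_vecOn_singleton hX
    · obtain ⟨t, ht, htX⟩ := exists_affine (p := p) (X := X) hm (by
        rw [h1, h2]
        have := hB.1
        rwa [hq1] at this)
      refine Or.inl ⟨t, ht, ?_⟩
      simp only [htX, hq1]
    · obtain ⟨t, ht, htX⟩ := exists_affine (p := p) (X := X) hm (by
        rw [h1, h2]
        have := hB.1
        rwa [hq1] at this)
      refine Or.inr ⟨-t, neg_mem_Icc_neg_one_one ht, ?_⟩
      simp only [neg_mul_neg, htX, hq1]
  · have := hI t ht; simp only [fLine, firstRect]; linarith [this.1, this.2]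
  · have := hI t ht; simp only [fLine, firstRect]; linarith [this.1, this.2]
  · have := hI' t ht; simp only [gLine, firstRect]; linarith [this.1, this.2]
  · have := hI' t ht; simp only [gLine, firstRect]; linarith [this.1, this.2]
  · intro s hs t ht hst
    have := congrArg Prod.fst hst
    simp only [Function.comp_apply, front, fLine] at this
    exact mul_left_cancel₀ hm.ne' (by linarith)
  · intro s hs t ht hst
    have := congrArg Prod.fst hst
    simp only [Function.comp_apply, front, gLine] at this
    exact mul_left_cancel₀ hm.ne' (by linarith)
  -- The two lines meet only at `x = 0`, to the right of the rectangle.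
  · intro s hs t ht hst
    have h1 := congrArg Prod.fst hst
    have h2 := congrArg Prod.snd hst
    simp only [front, fLine, gLine] at h1 h2
    have := (hI s hs).2
    linarith

theorem fingerX_zero_le_iff {t u : ℝ} (hu : 0 ≤ u) : fingerX 0 u ≤ fingerX 0 t ↔ |t| ≤ u := by
  rw [← fingerX_abs 0 t]
  exact (fingerX_strictAntiOn le_rfl).le_iff_ge hu (abs_nonneg t)

theorem smoothAbs_le_iff {t u : ℝ} (hu : 0 ≤ u) : ω t ≤ ω u ↔ |t| ≤ u := by
  rw [← smoothAbs_abs t]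
  exact smoothAbs_strictMonoOn.le_iff_le (abs_nonneg t) hu

theorem bendX_le_iff {t : ℝ} : -3 + ω t ≤ -1 - w₀ ↔ |t| ≤ 2 := by
  rw [← smoothAbs_le_iff zero_le_two, smoothAbs_of_two_le le_rfl]
  constructor <;> intro h <;> linarith

theorem fingerArc_bound_first {t : ℝ} (h : fingerX 0 4 ≤ fingerX 0 t) :
    (fingerArc 0 t).2.2 ∈ Ioo (-300 : ℝ) 300 := by
  have h1 := fingerArc_snd_snd_mem 0 t
  have h2 : fingerX 0 t ≤ -4 := by have := fingerX_le le_rfl (t := t); linarith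
  have h3 := twenty_le_upperFn (fingerX 0 t)
  have hw := absDefect_nonneg
  rw [fingerX_zero_four] at h
  have h4 : smoothPos (fingerX 0 t + 20) ≤ 17 :=
    (smoothPos_le _).trans (by
      have := max_le (a := fingerX 0 t + 20) (b := 0) (c := 16) (by linarith) (by norm_num)
      linarith)
  have h5 : smoothPos (-fingerX 0 t - 6) ≤ 143 :=
    (smoothPos_le _).trans (by
      have := max_le (a := -fingerX 0 t - 6) (b := 0) (c := 142) (by linarith) (by norm_num)
      linarith)
  constructor
  · have := h1.1
    rw [lowerFn, gapFn] at this
    linarith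
  · have := h1.2
    rw [upperFn] at this
    linarith

theorem bendArc_bound_first {t : ℝ} (h : |t| ≤ 2) : (bendArc t).2.2 ∈ Ioo (-300 : ℝ) 300 := by
  have h1 := bendArc_bound t
  have h2 : |-3 + ω t| ≤ 5 := by
    have := smoothAbs_nonneg t
    have := smoothAbs_le_abs t
    exact abs_le.2 ⟨by linarith, by linarith⟩
  have := abs_le.1 (h1.trans h2)
  exact ⟨by linarith [this.1], by linarith [this.2]⟩

theorem isTangleOver_finger_bend (ε : ℝ) :
    IsTangleOver ε (vecOn ε (fingerArc 0) univ ∪ vecOn ε bendArc univ) firstRect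
      (fun t => fingerArc 0 (0 + 4 * t)) (fun t => bendArc (0 + 2 * t)) := by
  have hw := absDefect_nonneg
  have hw' := absDefect_le
  have h4 := fingerX_zero_four
  have hx1 : ∀ t, fingerX 0 t ≤ -4 := fun t => by have := fingerX_le le_rfl (t := t); linarith
  have hx2 : ∀ t, -3 ≤ -3 + ω t := fun t => by have := smoothAbs_nonneg t; linarith
  have ha1 : ∀ t ∈ Icc (-1 : ℝ) 1, fingerX 0 4 ≤ fingerX 0 (0 + 4 * t) := fun t ht => by
    rw [fingerX_zero_le_iff (by norm_num), zero_add, abs_mul, abs_of_pos (by norm_num : (0 : ℝ) < 4)]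
    have := abs_le.2 ht
    linarith
  have ha2 : ∀ t ∈ Icc (-1 : ℝ) 1, |0 + 2 * t| ≤ 2 := fun t ht => by
    rw [zero_add, abs_mul, abs_of_pos (by norm_num : (0 : ℝ) < 2)]
    have := abs_le.2 ht
    linarith
  refine ⟨affine_comp_contDiff (fingerArc_contDiff 0) _ _, affine_comp_contDiff bendArc_contDiff _ _,
    fun t ht => Or.inl (mem_vecOn_univ
      (mem_vecOn_affine (fingerArc_contDiff 0) (by norm_num) _ _)),
    fun t ht => Or.inr (mem_vecOn_univ (mem_vecOn_affine bendArc_contDiff two_pos _ _)),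
    ?_, fun t ht => ⟨⟨ha1 t ht, ?_⟩, fingerArc_bound_first (ha1 t ht)⟩,
    fun t ht => ⟨⟨?_, bendX_le_iff.2 (ha2 t ht)⟩, bendArc_bound_first (ha2 t ht)⟩, ?_, ?_, ?_⟩
  · rintro q (hq | hq) hB <;> obtain ⟨X, -, hX⟩ := mem_vecOn_iff.1 hq <;>
      have hq1 := fst_of_mem_vecOn_singleton hX
    · have h1 : fingerX 0 4 ≤ fingerX 0 X := by
        have := hB.1.1
        rwa [hq1] at this
      rw [fingerX_zero_le_iff (by norm_num)] at h1
      obtain ⟨t, ht, htX⟩ := exists_affine (p := 0) (m := 4) (X := X) (by norm_num) (by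
        simpa using abs_le.1 h1)
      refine Or.inl ⟨t, ht, ?_⟩
      simp only [htX, hq1]
    · have h1 : -3 + ω X ≤ -1 - w₀ := by
        have := hB.1.2
        rwa [hq1] at this
      rw [bendX_le_iff] at h1
      obtain ⟨t, ht, htX⟩ := exists_affine (p := 0) (m := 2) (X := X) (by norm_num) (by
        simpa using abs_le.1 h1)
      refine Or.inr ⟨t, ht, ?_⟩
      simp only [htX, hq1]
  · have := hx1 (0 + 4 * t); simp only [fingerArc_fst, firstRect]; linarith
  · have := hx2 (0 + 2 * t); simp only [bendArc_fst, firstRect]; linarith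
  · intro s hs t ht hst
    have := fingerArc_front_inj le_rfl (congrArg (fun p : ℝ × ℝ => p.1) hst)
      (Prod.ext_iff.1 hst).2
    linarith
  · intro s hs t ht hst
    have h1 := congrArg Prod.fst hst
    simp only [Function.comp_apply, front, bendArc_fst] at h1
    -- The double point of the bend lies over `x = 0`, outside the rectangle.
    rcases bendArc_front (add_left_cancel h1)
      (Prod.ext_iff.1 hst).2 with h | ⟨-, h⟩
    · linarith
    · have := bendX_le_iff.2 (ha2 s hs); linarith
  · intro s hs t ht hst
    have h1 : fingerX 0 (0 + 4 * s) = -3 + ω (0 + 2 * t) := congrArg Prod.fst hst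
    have := hx1 (0 + 4 * s)
    have := hx2 (0 + 2 * t)
    linarith

/-- A point outside the rectangle is either beyond its vertical sides, where `finger_bend_agree`
applies, or above or below it, where none of the four arcs has points. -/
theorem agree_lines_first {ε : ℝ} (q : R3 × R3) (hq : q.1 ∉ firstRect.cylinder) :
    q ∈ vecOn ε fLine univ ∪ vecOn (-ε) gLine univ ↔
      q ∈ vecOn ε (fingerArc 0) univ ∪ vecOn ε bendArc univ := by
  have hw := absDefect_nonneg
  have h4 := fingerX_zero_four
  by_cases h : q.1.1 < fingerX 0 4 ∨ -1 - w₀ < q.1.1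
  · exact (finger_bend_agree h).symm
  push Not at h
  have hz : q.1.2.2 ∉ Icc (-300 : ℝ) 300 := fun hz => hq ⟨h, hz⟩
  constructor
  · intro h'
    have := crossVec_snd h'
    have h300 : |q.1.2.2| ≤ 300 := by
      rw [this]
      exact abs_le.2 ⟨by linarith, by linarith⟩
    exact absurd (abs_le.1 h300) hz
  · rintro (hq | hq) <;> obtain ⟨t, -, ht⟩ := mem_vecOn_iff.1 hq <;>
      have hq1 := fst_of_mem_vecOn_singleton ht <;> rw [hq1] at h hz
    · exact absurd (Ioo_subset_Icc_self (fingerArc_bound_first h.1)) hz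
    · exact absurd (Ioo_subset_Icc_self (bendArc_bound_first (bendX_le_iff.1 h.2))) hz

/-- The first surgery at the model crossing. -/
theorem isLegendrianSurgery_first {ε : ℝ} (hε : ε = 1 ∨ ε = -1) {N L : LegendrianLink}
    (hN : HasModelCrossing ε N.vec) (hL : L.vec = replaceVec N.vec ε ε (fingerArc 0) bendArc) :
    IsLegendrianSurgery N L := by
  have hN' := (replaceVec_lines hN).symm
  obtain ⟨p, m, hm, h1, h2, hT⟩ := isTangleOver_lines_first ε
  have hT' := hT.replaceVec (V := N.vec) firstRect_cylinder
  rw [← hN'] at hT'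
  have hT2 := (isTangleOver_finger_bend ε).replaceVec (V := N.vec) firstRect_cylinder
  rw [← hL] at hT2
  have h0 := smoothAbs_zero
  refine IsLegendrianSurgery.of_tangles (B := firstRect) ?_ ?_
    (agreeOutside_replaceVec hN' hL agree_lines_first)
  · refine hT'.isBasicZeroTangle hε ?_ ?_ ?_ ?_ ?_ ?_
    · intro t _
      rw [deriv_fst_affine fLine_contDiff p m (x' := 1) (hasDerivAt_id _), mul_one]
      exact hm.ne'
    · intro t _
      rw [deriv_fst_affine gLine_contDiff p (-m) (x' := 1) (hasDerivAt_id _), mul_one]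
      exact (neg_neg_of_pos hm).ne
    all_goals simp only [fLine, gLine, firstRect]; linarith
  · refine hT2.isBasicInftyTangle hε ?_ ?_ ?_ ?_ ?_ ?_
    · refine hasOneCusp_of_smoothAbs hT2.smooth_left (p := -4) (k := -36) (m := 4) (by norm_num)
        (by norm_num) fun t _ => ?_
      simp only [fingerArc_fst, fingerX_zero, zero_add]; ring
    · refine hasOneCusp_of_smoothAbs hT2.smooth_right (p := -3) (k := 1) (m := 2) (by norm_num)
        (by norm_num) fun t _ => ?_
      simp only [bendArc_fst, zero_add]; ring
    · simp only [fingerArc_fst, firstRect]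
      rw [← fingerX_neg]; norm_num
    · simp only [fingerArc_fst, firstRect]; norm_num
    · simp only [bendArc_fst, firstRect]
      rw [← smoothAbs_neg, smoothAbs_of_two_le (by norm_num)]; norm_num; ring
    · simp only [bendArc_fst, firstRect]
      rw [smoothAbs_of_two_le (by norm_num)]; ring

/-! ### A bump of large height -/

theorem expNegInvGlue_lt {x y : ℝ} (hx : 0 ≤ x) (h : x < y) : expNegInvGlue x < expNegInvGlue y := by
  rcases hx.eq_or_lt with rfl | hx
  · rw [expNegInvGlue.zero]
    exact expNegInvGlue.pos_of_pos h
  · rw [expNegInvGlue, expNegInvGlue, if_neg (not_le.2 hx), if_neg (not_le.2 (hx.trans h))]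
    exact Real.exp_lt_exp.2 (neg_lt_neg (inv_strictAnti₀ hx h))

theorem hasDerivAt_expNegInvGlue {x : ℝ} (hx : 0 < x) :
    HasDerivAt expNegInvGlue (Real.exp (-x⁻¹) * (x ^ 2)⁻¹) x := by
  have h1 : HasDerivAt (fun x : ℝ => Real.exp (-x⁻¹)) (Real.exp (-x⁻¹) * (x ^ 2)⁻¹) x := by
    have := (hasDerivAt_inv hx.ne').neg.exp
    simpa using this
  refine h1.congr_of_eventuallyEq ?_
  filter_upwards [lt_mem_nhds hx] with y hy
  rw [expNegInvGlue, if_neg (not_le.2 hy)]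

/-- A function which is `-1` far away from `60` and very large near `60`. -/
noncomputable def peak (t : ℝ) : ℝ := -1 + 10 ^ 6 * expNegInvGlue (1 - ((t - 60) / 800) ^ 2)

theorem peak_contDiff : ContDiff ℝ ∞ peak := by
  refine contDiff_const.add (contDiff_const.mul (expNegInvGlue.contDiff.comp ?_))
  fun_prop

theorem peak_of_le {t : ℝ} (h : 800 ≤ |t - 60|) : peak t = -1 := by
  rw [peak, expNegInvGlue.zero_of_nonpos, mul_zero, add_zero]
  rw [← sq_abs, abs_div, abs_of_pos (by norm_num : (0 : ℝ) < 800), sub_nonpos]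
  have : 1 ≤ |t - 60| / 800 := by rw [le_div_iff₀ (by norm_num)]; linarith
  nlinarith

theorem peak_lt {t u : ℝ} (h : |t - 60| < |u - 60|) (ht : |t - 60| < 800) : peak u < peak t := by
  rcases le_or_gt 800 |u - 60| with hu | hu
  · rw [peak_of_le hu, peak]
    have : 0 < expNegInvGlue (1 - ((t - 60) / 800) ^ 2) := expNegInvGlue.pos_of_pos (by
      rw [← sq_abs, abs_div, abs_of_pos (by norm_num : (0 : ℝ) < 800)]
      have h1 : |t - 60| / 800 < 1 := by rw [div_lt_iff₀ (by norm_num)]; linarith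
      have h2 : 0 ≤ |t - 60| / 800 := by positivity
      nlinarith)
    linarith
  · have h1 : ((t - 60) / 800) ^ 2 < ((u - 60) / 800) ^ 2 := by
      rw [div_pow, div_pow, div_lt_div_iff_of_pos_right (by norm_num)]
      exact sq_lt_sq.2 h
    have h2 : ((u - 60) / 800) ^ 2 ≤ 1 := by
      rw [div_pow, div_le_one (by norm_num), ← sq_abs]
      nlinarith [abs_nonneg (u - 60)]
    have := expNegInvGlue_lt (x := 1 - ((u - 60) / 800) ^ 2) (by linarith)
      (sub_lt_sub_left h1 1)
    rw [peak, peak]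
    linarith

/-- At distance `700` the argument of `expNegInvGlue` is `1 - (7/8)² = 15/64`, and `exp(-64/15) ≥
exp(-5) ≥ 1/243`. The factor `10 ^ 6` turns this into far more than is needed. -/
theorem le_peak {t : ℝ} (h : |t - 60| ≤ 700) : 100 ≤ peak t := by
  have h1 : (15 / 64 : ℝ) ≤ 1 - ((t - 60) / 800) ^ 2 := by
    have : (t - 60) ^ 2 ≤ 700 ^ 2 := by rw [← sq_abs]; nlinarith [abs_nonneg (t - 60)]
    rw [div_pow]
    linarith
  have h2 := expNegInvGlue.monotone h1
  rw [expNegInvGlue, if_neg (by norm_num)] at h2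
  have h3 : Real.exp (-5) ≤ Real.exp (-(15 / 64)⁻¹) := Real.exp_le_exp.2 (by norm_num)
  have h4 : (1 / 243 : ℝ) ≤ Real.exp (-5) := by
    rw [Real.exp_neg, one_div]
    refine inv_anti₀ (Real.exp_pos _) ?_
    have h5 : Real.exp 5 = Real.exp 1 ^ 5 := by rw [← Real.exp_nat_mul]; norm_num
    rw [h5]
    calc Real.exp 1 ^ 5 ≤ 3 ^ 5 := pow_le_pow_left₀ (Real.exp_pos 1).le Real.exp_one_lt_three.le 5
      _ = 243 := by norm_num
  rw [peak]
  linarith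

theorem deriv_peak_ne_zero {t : ℝ} (h0 : t ≠ 60) (h : |t - 60| < 800) : deriv peak t ≠ 0 := by
  have hpos : 0 < 1 - ((t - 60) / 800) ^ 2 := by
    rw [← sq_abs, abs_div, abs_of_pos (by norm_num : (0 : ℝ) < 800)]
    have h1 : |t - 60| / 800 < 1 := by rw [div_lt_iff₀ (by norm_num)]; linarith
    have h2 : 0 ≤ |t - 60| / 800 := by positivity
    nlinarith
  have h1 := ((((hasDerivAt_id t).sub_const 60).div_const 800).pow 2).const_sub 1
  have h2 := (((hasDerivAt_expNegInvGlue hpos).comp t h1).const_mul (10 ^ 6)).const_add (-1)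
  have h3 : deriv peak t = _ := h2.deriv
  rw [h3]
  have h4 : t - 60 ≠ 0 := sub_ne_zero.2 h0
  have h5 := (Real.exp_pos (-(1 - ((t - 60) / 800) ^ 2)⁻¹)).ne'
  have h6 := (inv_pos.2 (pow_pos hpos 2)).ne'
  refine mul_ne_zero (by norm_num) (mul_ne_zero (mul_ne_zero h5 h6) ?_)
  simp [h4]

/-! ### The hook -/

/-- The `x`-coordinate of the hook. -/
noncomputable def hookX (t : ℝ) : ℝ :=
  t + ω (t - (63 + w₀)) - ω (t - 30) - 33 - w₀ + (33 + w₀) * (1 + σ (t - (68 + w₀)))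

/-- A Legendrian arc with two cusps whose front runs along `z = -x`, then to the right at height
`20`, then to the left along `z = x`, and finally to the right along `z = -x`. -/
noncomputable def hookArc : ℝ → R3 :=
  cuspArc hookX upperFn (fun x => x - upperFn x) (fun x => -2 * x) (fun t => σ (t - 30))
    (fun t => σ (t - (63 + w₀))) (-3 / 2) (3 / 2)

theorem hookX_contDiff : ContDiff ℝ ∞ hookX := by
  have h1 := smoothAbs_contDiff
  have h2 := smoothSign_contDiff
  unfold hookX
  fun_prop

theorem smoothSign_shift_contDiff (p : ℝ) : ContDiff ℝ ∞ (fun t => σ (t - p)) :=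
  smoothSign_contDiff.comp (contDiff_id.sub contDiff_const)

theorem smoothSign_shift_hasDerivAt (p t : ℝ) :
    HasDerivAt (fun t => σ (t - p)) (deriv σ (t - p)) t :=
  ((smoothSign_hasDerivAt (t - p)).comp t ((hasDerivAt_id t).sub_const p)).congr_deriv (mul_one _)

theorem smoothAbs_shift_hasDerivAt (p t : ℝ) :
    HasDerivAt (fun t => ω (t - p)) (σ (t - p)) t := by
  have h := (smoothAbs_hasDerivAt (t - p)).comp t ((hasDerivAt_id t).sub_const p)
  rw [mul_one] at h
  exact h

theorem hookX_hasDerivAt (t : ℝ) : HasDerivAt hookX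
    (1 + σ (t - (63 + w₀)) - σ (t - 30) + (33 + w₀) * deriv σ (t - (68 + w₀))) t := by
  have h := ((((((hasDerivAt_id t).add (smoothAbs_shift_hasDerivAt (63 + w₀) t)).sub
    (smoothAbs_shift_hasDerivAt 30 t)).sub_const 33).sub_const w₀).add
    (((smoothSign_shift_hasDerivAt (68 + w₀) t).const_add 1).const_mul (33 + w₀)))
  exact h

theorem hookX_left {t : ℝ} (h : t ≤ 61 + w₀) : hookX t = 30 - w₀ - ω (t - 30) := by
  rw [hookX, smoothAbs_of_le (t := t - (63 + w₀)) (by linarith),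
    smoothSign_of_le (by linarith)]
  ring

theorem hookX_right {t : ℝ} (h : 32 ≤ t) :
    hookX t = -3 + ω (t - (63 + w₀)) + (33 + w₀) * (1 + σ (t - (68 + w₀))) := by
  rw [hookX, smoothAbs_of_two_le (t := t - 30) (by linarith)]
  ring

theorem hookX_mid {t : ℝ} (h : 32 ≤ t) (h' : t ≤ 61 + w₀) : hookX t = 60 - t := by
  rw [hookX_left h', smoothAbs_of_two_le (by linarith)]
  ring

theorem hookX_start {t : ℝ} (h : t ≤ 28) : hookX t = t := by
  rw [hookX_left (by linarith [absDefect_nonneg]), smoothAbs_of_le (by linarith)]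
  ring

/-- The last term of `hookX` is a forward jump of total size `2 (33 + w₀)`, which makes up for the
time spent running backwards, so the arc ends in the parametrisation of the line itself. -/
theorem hookX_end {t : ℝ} (h : 70 + w₀ ≤ t) : hookX t = t := by
  have := absDefect_nonneg
  rw [hookX_right (by linarith), smoothAbs_of_two_le (by linarith),
    smoothSign_of_two_le (by linarith)]
  ring

theorem neg_three_le_hookX {t : ℝ} (h : 32 ≤ t) : -3 ≤ hookX t := by
  have h1 := smoothAbs_nonneg (t - (63 + w₀))
  have h2 := neg_one_le_smoothSign (t - (68 + w₀))
  have h3 := absDefect_nonneg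
  rw [hookX_right h]
  nlinarith

theorem hookX_pos {t : ℝ} (h : 28 ≤ t) (h' : t < 60) : 0 < hookX t := by
  have hw := absDefect_nonneg
  have hw' := absDefect_le
  rcases le_or_gt t 32 with h2 | h2
  · have h1 := smoothAbs_le_abs (t - 30)
    have h3 : |t - 30| ≤ 2 := abs_le.2 ⟨by linarith, by linarith⟩
    rw [hookX_left (by linarith)]
    linarith
  · rw [hookX_mid h2.le (by linarith)]
    linarith

theorem hookX_nonpos {t : ℝ} (h : 60 ≤ t) (h' : t ≤ 65 + w₀) : hookX t ≤ 0 := by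
  have hw := absDefect_nonneg
  have h3 : ω (t - (63 + w₀)) ≤ 3 := by
    have h1 : |t - (63 + w₀)| ≤ 3 + w₀ := abs_le.2 ⟨by linarith, by linarith⟩
    have h2 := smoothAbs_strictMonoOn.monotoneOn (mem_Ici.2 (abs_nonneg _))
      (mem_Ici.2 (by linarith : (0 : ℝ) ≤ 3 + w₀)) h1
    rw [smoothAbs_abs, smoothAbs_of_two_le (t := 3 + w₀) (by linarith)] at h2
    linarith
  rw [hookX_right (by linarith), smoothSign_of_le (t := t - (68 + w₀)) (by linarith)]
  linarith

theorem hookX_sixty : hookX 60 = 0 := by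
  rw [hookX_mid (by norm_num) (by linarith [absDefect_nonneg])]
  norm_num

theorem deriv_hookX_left {t : ℝ} (h : t ≤ 61 + w₀) : deriv hookX t = -σ (t - 30) := by
  have := absDefect_nonneg
  rw [(hookX_hasDerivAt t).deriv, smoothSign_of_le (t := t - (63 + w₀)) (by linarith),
    deriv_smoothSign_of_two_le_abs]
  · ring
  · rw [abs_of_neg (by linarith)]; linarith

theorem deriv_hookX_right {t : ℝ} (h : 32 ≤ t) :
    deriv hookX t = σ (t - (63 + w₀)) + (33 + w₀) * deriv σ (t - (68 + w₀)) := by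
  rw [(hookX_hasDerivAt t).deriv, smoothSign_of_two_le (t := t - 30) (by linarith)]
  ring

theorem deriv_hookX_pos {t : ℝ} (h : 63 + w₀ < t) : 0 < deriv hookX t := by
  have := absDefect_nonneg
  rw [deriv_hookX_right (by linarith)]
  have h1 := smoothSign_pos (t := t - (63 + w₀)) (by linarith)
  have h2 := deriv_smoothSign_nonneg (t - (68 + w₀))
  positivity

theorem deriv_hookX_neg {t : ℝ} (h : 30 < t) (h' : t < 63 + w₀) : deriv hookX t < 0 := by
  have := absDefect_nonneg
  rcases le_or_gt t (61 + w₀) with h1 | h1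
  · rw [deriv_hookX_left h1]
    have := smoothSign_pos (t := t - 30) (by linarith)
    linarith
  · rw [deriv_hookX_right (by linarith), deriv_smoothSign_of_two_le_abs (t := t - (68 + w₀))
      (by rw [abs_of_neg (by linarith)]; linarith)]
    have := smoothSign_neg_of_neg (t := t - (63 + w₀)) (by linarith)
    linarith

theorem deriv_hookX_pos_left {t : ℝ} (h : t < 30) : 0 < deriv hookX t := by
  have := absDefect_nonneg
  rw [deriv_hookX_left (by linarith)]
  have := smoothSign_neg_of_neg (t := t - 30) (by linarith)
  linarith

theorem deriv_hookX_eq_zero {t : ℝ} (h : deriv hookX t = 0) : t = 30 ∨ t = 63 + w₀ := by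
  by_contra! hne
  rcases lt_or_gt_of_ne hne.1 with h1 | h1
  · exact (deriv_hookX_pos_left h1).ne' h
  · rcases lt_or_gt_of_ne hne.2 with h2 | h2
    · exact (deriv_hookX_neg h1 h2).ne h
    · exact (deriv_hookX_pos h2).ne' h

theorem hookX_strictMonoOn : StrictMonoOn hookX (Ici (63 + w₀)) := by
  refine strictMonoOn_of_deriv_pos (convex_Ici _) hookX_contDiff.continuous.continuousOn ?_
  intro t ht
  rw [interior_Ici] at ht
  exact deriv_hookX_pos ht

theorem hookX_strictAntiOn : StrictAntiOn hookX (Icc 30 (63 + w₀)) := by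
  refine strictAntiOn_of_deriv_neg (convex_Icc _ _) hookX_contDiff.continuous.continuousOn ?_
  intro t ht
  rw [interior_Icc] at ht
  exact deriv_hookX_neg ht.1 ht.2

/-! ### The front of the hook and its double points -/

/-- The polynomial which interpolates between `v ^ 3` and `v`. -/
noncomputable def cubeMix (s v : ℝ) : ℝ := (1 - s) * v ^ 3 + s * v

/-- The double points of the front depend only on the sign, the bounds and the values at `±1` of the
interpolation, so they can be found for all `s` at once. For `s > 0` the linear term rounds the
cusps. -/
theorem cubeMix_pos {s v : ℝ} (hs : s ∈ Icc (0 : ℝ) 1) (hv : 0 < v) : 0 < cubeMix s v := by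
  have h3 : 0 < v ^ 3 := by positivity
  rw [cubeMix]
  rcases hs.1.eq_or_lt with rfl | h
  · linarith
  · have := mul_pos h hv
    nlinarith [hs.2]

theorem cubeMix_neg (s v : ℝ) : cubeMix s (-v) = -cubeMix s v := by
  rw [cubeMix, cubeMix]; ring

theorem cubeMix_neg_of_neg {s v : ℝ} (hs : s ∈ Icc (0 : ℝ) 1) (hv : v < 0) : cubeMix s v < 0 := by
  have := cubeMix_pos hs (neg_pos.2 hv)
  rw [cubeMix_neg] at this
  linarith

theorem cubeMix_mem {s v : ℝ} (hs : s ∈ Icc (0 : ℝ) 1) (hv : v ∈ Icc (-1 : ℝ) 1) :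
    cubeMix s v ∈ Icc (-1 : ℝ) 1 := by
  have h3 := cube_mem_Icc hv
  rw [cubeMix]
  constructor <;> nlinarith [hs.1, hs.2, hv.1, hv.2, h3.1, h3.2]

theorem cubeMix_smoothSign_mem {s : ℝ} (hs : s ∈ Icc (0 : ℝ) 1) (t : ℝ) :
    cubeMix s (σ t) ∈ Icc (-1 : ℝ) 1 :=
  cubeMix_mem hs ⟨neg_one_le_smoothSign t, smoothSign_le_one t⟩

theorem cubeMix_one (s : ℝ) : cubeMix s 1 = 1 := by rw [cubeMix]; ring

theorem cubeMix_neg_one (s : ℝ) : cubeMix s (-1) = -1 := by rw [cubeMix]; ring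

theorem cubeMix_contDiff₂ {S : ℝ → ℝ} (hS : ContDiff ℝ ∞ S) :
    ContDiff ℝ ∞ (fun p : ℝ × ℝ => cubeMix p.1 (S p.2)) := by
  unfold cubeMix
  fun_prop

/-- The height of the hook with cusps rounded according to `s`. -/
noncomputable def hookZ (s t : ℝ) : ℝ :=
  upperFn (hookX t) + (hookX t - upperFn (hookX t)) * ((1 + cubeMix s (σ (t - 30))) / 2)
    + -2 * hookX t * ((1 + cubeMix s (σ (t - (63 + w₀)))) / 2)

theorem hookArc_snd_snd (t : ℝ) : (hookArc t).2.2 = hookZ 0 t := by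
  simp only [hookArc, cuspArc, hookZ, cubeMix]; ring

theorem hookZ_left {s t : ℝ} (h : t ≤ 61 + w₀) : hookZ s t =
    upperFn (hookX t) + (hookX t - upperFn (hookX t)) * ((1 + cubeMix s (σ (t - 30))) / 2) := by
  rw [hookZ, smoothSign_of_le (t := t - (63 + w₀)) (by linarith), cubeMix_neg_one]; ring

theorem hookZ_right {s t : ℝ} (h : 32 ≤ t) :
    hookZ s t = -(hookX t * cubeMix s (σ (t - (63 + w₀)))) := by
  rw [hookZ, smoothSign_of_two_le (t := t - 30) (by linarith), cubeMix_one]; ring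

theorem hookZ_start {s t : ℝ} (h : t ≤ 28) : hookZ s t = upperFn t := by
  rw [hookZ_left (by linarith [absDefect_nonneg]), smoothSign_of_le (by linarith), cubeMix_neg_one,
    hookX_start h]
  ring

theorem hookZ_mid {s t : ℝ} (h : 32 ≤ t) (h' : t ≤ 61 + w₀) : hookZ s t = hookX t := by
  rw [hookZ_right h, smoothSign_of_le (by linarith), cubeMix_neg_one]; ring

theorem hookZ_end {s t : ℝ} (h : 65 + w₀ ≤ t) : hookZ s t = -hookX t := by
  rw [hookZ_right (by linarith [absDefect_nonneg]), smoothSign_of_two_le (by linarith), cubeMix_one]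
  ring

/-- Together with `hookZ_add_nonpos` this says that the line `z = -x` separates the part `28 ≤ t <
60` of the front from the part after `60`. The separation serves for the double points and again for
the unfolding. -/
theorem hookZ_add_pos {s t : ℝ} (hs : s ∈ Icc (0 : ℝ) 1) (h1 : 28 ≤ t) (h : t < 60) :
    0 < hookZ s t + hookX t := by
  have hw := absDefect_nonneg
  have hx := hookX_pos h1 h
  rw [hookZ_left (by linarith)]
  have h2 := cubeMix_smoothSign_mem hs (t - 30)
  have h3 := twenty_le_upperFn (hookX t)
  nlinarith [h2.1, h2.2]

theorem hookZ_add_nonpos {s t : ℝ} (hs : s ∈ Icc (0 : ℝ) 1) (h : 60 ≤ t) :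
    hookZ s t + hookX t ≤ 0 := by
  have hw := absDefect_nonneg
  rcases le_or_gt t (65 + w₀) with h1 | h1
  · rw [hookZ_right (by linarith)]
    have h2 := cubeMix_smoothSign_mem hs (t - (63 + w₀))
    have h3 := hookX_nonpos h h1
    nlinarith [h2.1, h2.2]
  · rw [hookZ_end h1.le]; linarith

/-- The double points of the front of the hook. -/
theorem hook_front {s t u : ℝ} (hs : s ∈ Icc (0 : ℝ) 1) (htu : t < u) (hx : hookX t = hookX u)
    (hz : hookZ s t = hookZ s u) : t = 20 ∧ u = 40 ∨ t = 60 ∧ 66 + w₀ ≤ u := by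
  have hw := absDefect_nonneg
  have hw' := absDefect_le
  -- Up to `t = 60` the `x`-coordinate is symmetric about the first cusp `t = 30`. Equal heights at
  -- symmetric parameters force `x = upperFn x`, that is, `x = 20`.
  rcases le_or_gt u 60 with hu | hu
  · left
    have hx' := hx
    rw [hookX_left (by linarith), hookX_left (by linarith)] at hx'
    have h1 := smoothAbs_inj (sub_right_inj.1 hx')
    have h2 : t - 30 = -(u - 30) := by
      rcases abs_eq_abs.1 h1 with h | h
      · linarith
      · exact h
    have h3 : 30 < u := by linarith
    rw [hookZ_left (by linarith), hookZ_left (by linarith), hx, h2, smoothSign_neg,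
      cubeMix_neg] at hz
    have h4 := cubeMix_pos hs (smoothSign_pos (t := u - 30) (by linarith))
    have h5 : (hookX u - upperFn (hookX u)) * cubeMix s (σ (u - 30)) = 0 := by linarith
    have h6 : hookX u = upperFn (hookX u) := by
      rcases mul_eq_zero.1 h5 with h | h
      · linarith
      · exact absurd h h4.ne'
    have h7 := twenty_le_upperFn (hookX u)
    rw [upperFn_of_ge (by linarith)] at h6
    have h8 : t ≤ 28 := by
      by_contra! h9
      rw [hookX_left (by linarith)] at h6
      have h10 := smoothAbs_le_abs (u - 30)
      rw [abs_of_pos (by linarith)] at h10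
      linarith
    rw [hookX_start h8] at hx
    constructor <;> linarith
  · right
    rcases lt_or_ge t 60 with ht | ht
    -- One parameter on each side of `60` is excluded by the sign of `z + x`, or, for `t < 28`, by
    -- `x ≥ -3` on the later part.
    · exfalso
      have h1 := hookZ_add_nonpos hs hu.le
      rcases le_or_gt 28 t with h2 | h2
      · have := hookZ_add_pos hs h2 ht
        rw [hx, hz] at this
        linarith
      · rw [← hx, ← hz, hookZ_start h2.le, hookX_start h2.le, upperFn] at h1
        have h3 := le_smoothPos (t + 20)
        have h4 := neg_three_le_hookX (t := u) (by linarith)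
        rw [← hx, hookX_start h2.le] at h4
        linarith
    · have htc : t < 63 + w₀ := by
        by_contra! h
        exact htu.ne (hookX_strictMonoOn.injOn h (h.trans htu.le) hx)
      have huc : 63 + w₀ < u := by
        by_contra! h
        exact htu.ne (hookX_strictAntiOn.injOn ⟨by linarith, htc.le⟩ ⟨by linarith, h⟩ hx)
      rw [hookZ_right (by linarith), hookZ_right (by linarith), hx] at hz
      have h1 := cubeMix_neg_of_neg hs (smoothSign_neg_of_neg (t := t - (63 + w₀)) (by linarith))
      have h2 := cubeMix_pos hs (smoothSign_pos (t := u - (63 + w₀)) (by linarith))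
      have h3 : hookX u = 0 := by nlinarith
      have h4 : t = 60 := hookX_strictAntiOn.injOn ⟨by linarith, htc.le⟩
        ⟨by linarith, by linarith⟩ (by rw [hx, h3, hookX_sixty])
      refine ⟨h4, ?_⟩
      -- At `66 + w₀` the `x`-coordinate is still `-w₀ ≤ 0`. So the second passage over `x = 0` does
      -- not come earlier, and `u` lies on the third branch, where `y = -1`.
      by_contra! h
      have h5 : hookX u < hookX (66 + w₀) := hookX_strictMonoOn huc.le (by simp; norm_num) h
      rw [h3, hookX_right (t := 66 + w₀) (by linarith), smoothAbs_of_two_le (by linarith),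
        smoothSign_of_le (by linarith)] at h5
      linarith

theorem hookArc_contDiff : ContDiff ℝ ∞ hookArc :=
  cuspArc_contDiff hookX_contDiff upperFn_contDiff (contDiff_id.sub upperFn_contDiff)
    contDiff_neg_two_mul (smoothSign_shift_contDiff _) (smoothSign_shift_contDiff _)

theorem eventually_smoothSign_shift_of_lt {p t : ℝ} (h : t < p - 2) :
    ∀ᶠ u in 𝓝 t, σ (u - p) = -1 := by
  filter_upwards [gt_mem_nhds h] with u hu using smoothSign_of_le (by linarith)

theorem eventually_smoothSign_shift_of_gt {p t : ℝ} (h : p + 2 < t) :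
    ∀ᶠ u in 𝓝 t, σ (u - p) = 1 := by
  filter_upwards [lt_mem_nhds h] with u hu using smoothSign_of_two_le (by linarith)

theorem hookArc_eventuallyEq {c₁ c₂ t : ℝ} {H : ℝ → ℝ} (h₁ : ∀ᶠ u in 𝓝 t, σ (u - 30) = c₁)
    (h₂ : ∀ᶠ u in 𝓝 t, σ (u - (63 + w₀)) = c₂)
    (hH : ∀ X, H X = upperFn X + (X - upperFn X) * ((1 + c₁ ^ 3) / 2)
      + -2 * X * ((1 + c₂ ^ 3) / 2)) :
    hookArc =ᶠ[𝓝 t] fun u => graphLift H (hookX u) :=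
  cuspArc_eventuallyEq upperFn_contDiff (contDiff_id.sub upperFn_contDiff)
    contDiff_neg_two_mul hookX_contDiff.continuous.continuousAt h₁ h₂ (Filter.Eventually.of_forall hH)

theorem hookArc_eventuallyEq_first {t : ℝ} (h : t < 28) :
    hookArc =ᶠ[𝓝 t] graphLift upperFn := by
  have hw := absDefect_nonneg
  have h1 := hookArc_eventuallyEq (H := upperFn)
    (eventually_smoothSign_shift_of_lt (p := 30) (t := t) (by linarith))
    (eventually_smoothSign_shift_of_lt (by linarith)) (fun X => by norm_num)
  filter_upwards [h1, gt_mem_nhds h] with u hu hu'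
  rw [hu, hookX_start hu'.le]

theorem hookArc_eventuallyEq_second {t : ℝ} (h : 32 < t) (h' : t < 61 + w₀) :
    hookArc =ᶠ[𝓝 t] fun u => gLine (hookX u) := by
  rw [← graphLift_id]
  exact hookArc_eventuallyEq (eventually_smoothSign_shift_of_gt (p := 30) (t := t) (by linarith))
    (eventually_smoothSign_shift_of_lt (by linarith)) (fun X => by norm_num)

theorem hookArc_eventuallyEq_third {t : ℝ} (h : 65 + w₀ < t) :
    hookArc =ᶠ[𝓝 t] fun u => fLine (hookX u) := by
  have hw := absDefect_nonneg
  rw [← graphLift_neg]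
  exact hookArc_eventuallyEq (eventually_smoothSign_shift_of_gt (p := 30) (t := t) (by linarith))
    (eventually_smoothSign_shift_of_gt (by linarith)) (fun X => by ring)

/-- `x' = -σ` at the first cusp and `x' = σ` at the second, whence the constants `-3/2` and `3/2`.
The parameter ranges of the two cusps and of the final jump do not overlap. -/
theorem contactForm_hookArc (t : ℝ) : contactForm (hookArc t) (deriv hookArc t) = 0 := by
  have hw := absDefect_nonneg
  refine contactForm_cuspArc hookX_contDiff upperFn_contDiff (contDiff_id.sub upperFn_contDiff)
    contDiff_neg_two_mul (smoothSign_shift_contDiff _) (smoothSign_shift_contDiff _) ?_ ?_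
  · rcases le_or_gt 2 |t - 30| with h | h
    · left
      rw [(smoothSign_shift_hasDerivAt _ _).deriv, deriv_smoothSign_of_two_le_abs h]
    · right
      rw [deriv_hookX_left (by linarith [(abs_lt.1 h).2])]
      ring
  · rcases le_or_gt 2 |t - (63 + w₀)| with h | h
    · left
      rw [(smoothSign_shift_hasDerivAt _ _).deriv, deriv_smoothSign_of_two_le_abs h]
    · right
      rw [deriv_hookX_right (by linarith [(abs_lt.1 h).1]),
        deriv_smoothSign_of_two_le_abs (t := t - (68 + w₀))]
      · ring
      · rw [abs_of_neg (by linarith [(abs_lt.1 h).2])]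
        linarith [(abs_lt.1 h).2]

/-! ### Unfolding the hook -/

/-- The hook with rounded cusps and lifted middle part. -/
noncomputable def hookRound (s t : ℝ) : R3 :=
  (hookX t, (1 - s) * (hookArc t).2.1 + s * peak t, hookZ s t)

/-- The homotopy which unfolds the front of the hook with lifted middle part. -/
noncomputable def hookFlat (s t : ℝ) : R3 :=
  ((1 - s) * hookX t + s * t, peak t,
    (1 - s) * (hookZ 1 t + hookX t) - ((1 - s) * hookX t + s * t))

/-- The line `z = -x` with lifted middle part. -/
noncomputable def topLine (t : ℝ) : R3 := (t, peak t, -t)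

theorem hookRound_zero : hookRound 0 = hookArc := by
  funext t
  rw [hookRound, ← hookArc_snd_snd]
  simp only [sub_zero, one_mul, zero_mul, add_zero]
  rfl

theorem hookFlat_zero : hookFlat 0 = hookRound 1 := by
  funext t
  simp [hookRound, hookFlat]

theorem hookFlat_one : hookFlat 1 = topLine := by
  funext t
  simp [hookFlat, topLine]

theorem hookZ_contDiff₂ : ContDiff ℝ ∞ (fun p : ℝ × ℝ => hookZ p.1 p.2) := by
  have h1 := hookX_contDiff.comp (contDiff_snd (E := ℝ) (F := ℝ) (𝕜 := ℝ))
  have h2 := upperFn_contDiff.comp h1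
  have h3 := cubeMix_contDiff₂ (smoothSign_shift_contDiff 30)
  have h4 := cubeMix_contDiff₂ (smoothSign_shift_contDiff (63 + w₀))
  exact (h2.add ((h1.sub h2).mul ((contDiff_const.add h3).div_const 2))).add
    ((contDiff_const.mul h1).mul ((contDiff_const.add h4).div_const 2))

theorem hookRound_contDiff₂ : ContDiff ℝ ∞ (fun p : ℝ × ℝ => hookRound p.1 p.2) := by
  have h1 := hookX_contDiff.comp (contDiff_snd (E := ℝ) (F := ℝ) (𝕜 := ℝ))
  have h2 := (hookArc_contDiff.comp (contDiff_snd (E := ℝ) (F := ℝ) (𝕜 := ℝ))).snd.fst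
  have h3 := peak_contDiff.comp (contDiff_snd (E := ℝ) (F := ℝ) (𝕜 := ℝ))
  exact h1.prodMk ((((contDiff_const.sub contDiff_fst).mul h2).add (contDiff_fst.mul h3)).prodMk
    hookZ_contDiff₂)

theorem hookFlat_contDiff₂ : ContDiff ℝ ∞ (fun p : ℝ × ℝ => hookFlat p.1 p.2) := by
  have h1 := hookX_contDiff.comp (contDiff_snd (E := ℝ) (F := ℝ) (𝕜 := ℝ))
  have h3 := peak_contDiff.comp (contDiff_snd (E := ℝ) (F := ℝ) (𝕜 := ℝ))
  have h4 := hookZ_contDiff₂.comp ((contDiff_const (c := (1 : ℝ))).prodMk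
    (contDiff_snd (E := ℝ) (F := ℝ) (𝕜 := ℝ)))
  have h5 := ((contDiff_const (c := (1 : ℝ))).sub
    (contDiff_fst (E := ℝ) (F := ℝ) (𝕜 := ℝ) (n := ∞)))
  have h6 := (h5.mul h1).add
    ((contDiff_fst (E := ℝ) (F := ℝ) (𝕜 := ℝ)).mul contDiff_snd)
  exact h6.prodMk (h3.prodMk ((h5.mul (h4.add h1)).sub h6))

theorem hookRound_contDiff (s : ℝ) : ContDiff ℝ ∞ (hookRound s) :=
  hookRound_contDiff₂.comp (contDiff_const.prodMk contDiff_id)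

theorem hookFlat_contDiff (s : ℝ) : ContDiff ℝ ∞ (hookFlat s) :=
  hookFlat_contDiff₂.comp (contDiff_const.prodMk contDiff_id)

theorem hookArc_y_first {t : ℝ} (h : t < 28) : (hookArc t).2.1 = deriv upperFn t := by
  rw [(hookArc_eventuallyEq_first h).eq_of_nhds]; rfl

theorem hookArc_y_second {t : ℝ} (h : 32 < t) (h' : t < 61 + w₀) : (hookArc t).2.1 = 1 := by
  rw [(hookArc_eventuallyEq_second h h').eq_of_nhds]; rfl

theorem hookArc_y_third {t : ℝ} (h : 65 + w₀ < t) : (hookArc t).2.1 = -1 := by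
  rw [(hookArc_eventuallyEq_third h).eq_of_nhds]; rfl

/-- At both double points the strand whose parameter is nearer to `60` has the larger `y`: in the
hook, `1` against `0` at parameters `40` and `20`, and `1` against `-1` at `60` and later. The
function `peak` has the same order, so every convex combination keeps the strands apart. -/
theorem hookRound_injective {s : ℝ} (hs : s ∈ Icc (0 : ℝ) 1) :
    Function.Injective (hookRound s) := by
  have hw := absDefect_nonneg
  have key : ∀ t u, t < u → hookRound s t ≠ hookRound s u := by
    intro t u htu h
    have hy : (1 - s) * (hookArc t).2.1 + s * peak t = (1 - s) * (hookArc u).2.1 + s * peak u :=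
      congrArg (fun p : R3 => p.2.1) h
    rcases hook_front hs htu (congrArg Prod.fst h) (congrArg (fun p : R3 => p.2.2) h) with
      ⟨rfl, rfl⟩ | ⟨rfl, hu⟩
    · rw [hookArc_y_first (by norm_num), deriv_upperFn_of_gt (by norm_num),
        hookArc_y_second (by norm_num) (by linarith)] at hy
      have h1 : peak 20 < peak 40 := peak_lt (by norm_num [abs_of_neg]) (by norm_num [abs_of_neg])
      rcases hs.1.eq_or_lt with rfl | h2
      · norm_num at hy
      · nlinarith [hs.2]
    · rw [hookArc_y_second (by norm_num) (by linarith), hookArc_y_third (by linarith)] at hy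
      have h1 : peak u < peak 60 := peak_lt (by
        rw [sub_self, abs_zero]; exact abs_pos.2 (by linarith)) (by norm_num)
      rcases hs.1.eq_or_lt with rfl | h2
      · norm_num at hy
      · nlinarith [hs.2]
  intro t u h
  rcases lt_trichotomy t u with h1 | h1 | h1
  · exact absurd h (key t u h1)
  · exact h1
  · exact absurd h.symm (key u t h1)

theorem deriv_deriv_eq_zero_of_eventually_const {f : ℝ → ℝ} {x c : ℝ} (h : ∀ᶠ y in 𝓝 x, f y = c) :
    deriv f x = 0 ∧ deriv (deriv f) x = 0 := by
  refine ⟨deriv_eq_zero_of_eventually_const h, deriv_eq_zero_of_eventually_const (c := 0) ?_⟩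
  filter_upwards [h.eventually_nhds] with y hy using deriv_eq_zero_of_eventually_const hy

theorem hasDerivAt_cubeMix {S : ℝ → ℝ} {t S' : ℝ} (s : ℝ) (hS : HasDerivAt S S' t) :
    HasDerivAt (fun t => cubeMix s (S t)) ((3 * (1 - s) * S t ^ 2 + s) * S') t := by
  have := ((hS.pow 3).const_mul (1 - s)).add (hS.const_mul s)
  refine this.congr_deriv ?_
  push_cast
  ring

theorem hookZ_hasDerivAt (s : ℝ) {t : ℝ} (h0 : deriv hookX t = 0) : HasDerivAt (hookZ s)
    ((hookX t - upperFn (hookX t)) * ((3 * (1 - s) * σ (t - 30) ^ 2 + s) * deriv σ (t - 30) / 2)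
      + -2 * hookX t * ((3 * (1 - s) * σ (t - (63 + w₀)) ^ 2 + s) * deriv σ (t - (63 + w₀)) / 2))
    t := by
  have hx : HasDerivAt hookX 0 t := h0 ▸ (hookX_contDiff.differentiable (by simp) t).hasDerivAt
  have hU := ((upperFn_contDiff.differentiable (by simp) (hookX t)).hasDerivAt).comp t hx
  have h1 := ((hasDerivAt_cubeMix s (smoothSign_shift_hasDerivAt 30 t)).const_add 1).div_const 2
  have h2 := ((hasDerivAt_cubeMix s (smoothSign_shift_hasDerivAt (63 + w₀) t)).const_add
    1).div_const 2
  have := (hU.add ((hx.sub hU).mul h1)).add ((hx.const_mul (-2)).mul h2)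
  refine this.congr_deriv ?_
  simp only [Function.comp_apply, Pi.sub_apply]
  ring

theorem deriv_fst_eq {a : ℝ → R3} (ha : ContDiff ℝ ∞ a) (t : ℝ) :
    (deriv a t).1 = deriv (fun t => (a t).1) t :=
  (hasDerivAt_coord_fst (ha.differentiable (by simp) t).hasDerivAt).deriv.symm

theorem deriv_snd_fst_eq {a : ℝ → R3} (ha : ContDiff ℝ ∞ a) (t : ℝ) :
    (deriv a t).2.1 = deriv (fun t => (a t).2.1) t :=
  (hasDerivAt_coord_snd_fst (ha.differentiable (by simp) t).hasDerivAt).deriv.symm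

theorem deriv_snd_snd_eq {a : ℝ → R3} (ha : ContDiff ℝ ∞ a) (t : ℝ) :
    (deriv a t).2.2 = deriv (fun t => (a t).2.2) t :=
  (hasDerivAt_coord_snd_snd (ha.differentiable (by simp) t).hasDerivAt).deriv.symm

theorem hookX_thirty : hookX 30 = 30 - w₀ := by
  rw [hookX_left (by linarith [absDefect_nonneg]), sub_self, smoothAbs_zero]; ring

theorem hookX_cusp : hookX (63 + w₀) = -3 := by
  have := absDefect_nonneg
  rw [hookX_right (by linarith), sub_self, smoothAbs_zero, smoothSign_of_le (by linarith)]; ring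

/-- `x'` vanishes only at the two cusps. There the arc moves in the `y`-direction for `s = 0`, and
for `s > 0` the linear term of `cubeMix` makes `z'` non-zero. -/
theorem deriv_hookRound_ne_zero {s : ℝ} (hs : s ∈ Icc (0 : ℝ) 1) (t : ℝ) :
    deriv (hookRound s) t ≠ 0 := by
  intro h0
  have hw := absDefect_nonneg
  have hw' := absDefect_le
  have hσ := deriv_smoothSign_zero
  have hx : deriv hookX t = 0 := by
    have := deriv_fst_eq (hookRound_contDiff s) t
    rw [h0] at this
    exact this.symm
  have hz := deriv_snd_snd_eq (hookRound_contDiff s) t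
  rw [h0] at hz
  have hz' : (0 : ℝ) = deriv (hookZ s) t := hz
  rw [(hookZ_hasDerivAt s hx).deriv] at hz'
  have hy := deriv_snd_fst_eq (hookRound_contDiff s) t
  rw [h0] at hy
  have hc₁ := smoothSign_shift_contDiff 30
  have hc₂ := smoothSign_shift_contDiff (63 + w₀)
  rcases deriv_hookX_eq_zero hx with rfl | rfl
  · have hS₂ := eventually_smoothSign_shift_of_lt (t := 30) (p := 63 + w₀) (by linarith)
    have hS₂' := deriv_deriv_eq_zero_of_eventually_const hS₂
    have h4 := hS₂'.1
    rw [(smoothSign_shift_hasDerivAt _ _).deriv] at h4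
    rw [h4, sub_self, smoothSign_zero, hookX_thirty, upperFn_of_ge (by linarith)] at hz'
    rcases hs.1.eq_or_lt with rfl | h2
    · rw [hookRound_zero] at h0
      have := deriv_cuspArc_snd_fst (k₁ := -3 / 2) (k₂ := 3 / 2) hookX_contDiff upperFn_contDiff
        (contDiff_fun_id.sub upperFn_contDiff) contDiff_neg_two_mul hc₁ hc₂ hx
        (Or.inl (by simp only [sub_self, smoothSign_zero])) (Or.inr hS₂')
      have h1 : (deriv hookArc 30).2.1 = 0 := by rw [h0]; rfl
      rw [hookArc, this, hS₂'.1, (smoothSign_shift_hasDerivAt _ _).deriv, hookX_thirty,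
        upperFn_of_ge (by linarith), sub_self] at h1
      have h3 := pow_pos hσ 2
      nlinarith
    · have := mul_pos h2 hσ
      nlinarith
  · have hS₁ := eventually_smoothSign_shift_of_gt (t := 63 + w₀) (p := 30) (by linarith)
    have hS₁' := deriv_deriv_eq_zero_of_eventually_const hS₁
    have h4 := hS₁'.1
    rw [(smoothSign_shift_hasDerivAt _ _).deriv] at h4
    rw [h4, sub_self, smoothSign_zero, hookX_cusp] at hz'
    rcases hs.1.eq_or_lt with rfl | h2
    · rw [hookRound_zero] at h0
      have := deriv_cuspArc_snd_fst (k₁ := -3 / 2) (k₂ := 3 / 2) hookX_contDiff upperFn_contDiff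
        (contDiff_fun_id.sub upperFn_contDiff) contDiff_neg_two_mul hc₁ hc₂ hx (Or.inr hS₁')
        (Or.inl (by simp only [sub_self, smoothSign_zero]))
      have h1 : (deriv hookArc (63 + w₀)).2.1 = 0 := by rw [h0]; rfl
      rw [hookArc, this, hS₁'.1, (smoothSign_shift_hasDerivAt _ _).deriv, hookX_cusp,
        sub_self] at h1
      have h3 := pow_pos hσ 2
      nlinarith
    · have := mul_pos h2 hσ
      nlinarith

theorem hookX_bound {t : ℝ} (h : |t| ≤ 950) : |hookX t| < 1000 := by
  have hw := absDefect_nonneg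
  have hw' := absDefect_le
  have h1 := abs_le.1 h
  rcases le_or_gt t 32 with h2 | h2
  · rw [hookX_left (by linarith)]
    have h3 := smoothAbs_nonneg (t - 30)
    have h4 := smoothAbs_le_abs (t - 30)
    have h5 : |t - 30| ≤ 980 := abs_le.2 ⟨by linarith, by linarith⟩
    exact abs_lt.2 ⟨by linarith, by linarith⟩
  · have h3 := neg_three_le_hookX h2.le
    have h4 := smoothAbs_le_abs (t - (63 + w₀))
    have h5 : |t - (63 + w₀)| ≤ 887 := abs_le.2 ⟨by linarith, by linarith⟩
    have h6 := smoothSign_le_one (t - (68 + w₀))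
    rw [hookX_right h2.le] at *
    refine abs_lt.2 ⟨by linarith, ?_⟩
    nlinarith

theorem hookZ_bound {s t : ℝ} (hs : s ∈ Icc (0 : ℝ) 1) (h : |hookX t| ≤ 1000) :
    |hookZ s t| < 2000 := by
  have h1 := abs_le.1 h
  rcases le_or_gt t (61 + absDefect) with h2 | h2
  · rw [hookZ_left h2]
    have h3 := cubeMix_smoothSign_mem hs (t - 30)
    have h4 := upperFn_lt h
    have h5 := twenty_le_upperFn (hookX t)
    have h6 : 0 ≤ (1 + cubeMix s (σ (t - 30))) / 2 := by linarith [h3.1]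
    have h7 : 0 ≤ 1 - (1 + cubeMix s (σ (t - 30))) / 2 := by linarith [h3.2]
    set p := (1 + cubeMix s (σ (t - 30))) / 2
    have h8 : upperFn (hookX t) + (hookX t - upperFn (hookX t)) * p
      = (1 - p) * upperFn (hookX t) + p * hookX t := by ring
    rw [h8]
    refine abs_lt.2 ⟨by nlinarith, by nlinarith⟩
  · rw [hookZ_right (by linarith [absDefect_nonneg]), abs_neg, abs_mul]
    have h3 := abs_le.2 (cubeMix_smoothSign_mem hs (t - (63 + w₀)))
    have := mul_le_of_le_one_right (abs_nonneg (hookX t)) h3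
    linarith

theorem hookRound_fix {s t : ℝ} (h : 900 < |t|) : hookRound s t = hookArc t := by
  have hw := absDefect_nonneg
  have hw' := absDefect_le
  have hp : peak t = -1 := peak_of_le (by
    rcases lt_abs.1 h with h | h
    · exact le_abs.2 (Or.inl (by linarith))
    · exact le_abs.2 (Or.inr (by linarith)))
  have key : (hookArc t).2.1 = -1 ∧ hookZ s t = hookZ 0 t := by
    rcases lt_abs.1 h with h | h
    · exact ⟨hookArc_y_third (by linarith), by rw [hookZ_end (by linarith), hookZ_end (by linarith)]⟩
    · refine ⟨?_, by rw [hookZ_start (by linarith), hookZ_start (by linarith)]⟩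
      rw [hookArc_y_first (by linarith), Filter.EventuallyEq.deriv_eq (f := fun x => -x), deriv_neg]
      filter_upwards [gt_mem_nhds (show t < -22 by linarith)] with y hy using upperFn_of_le hy.le
  refine Prod.ext rfl (Prod.ext ?_ ?_)
  · simp only [hookRound, hp, key.1]; ring
  · simp only [hookRound]
    rw [key.2, hookArc_snd_snd]

theorem hookFlat_fix {s t : ℝ} (h : 900 < |t|) : hookFlat s t = hookFlat 0 t := by
  have hw := absDefect_nonneg
  have hw' := absDefect_le
  have key : hookX t = t ∧ hookZ 1 t = -t := by
    rcases lt_abs.1 h with h | h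
    · have := hookX_end (t := t) (by linarith)
      exact ⟨this, by rw [hookZ_end (by linarith), this]⟩
    · have := hookX_start (t := t) (by linarith)
      exact ⟨this, by rw [hookZ_start (by linarith), upperFn_of_le (by linarith)]⟩
  simp only [hookFlat, key.1, key.2]
  refine Prod.ext ?_ (Prod.ext rfl ?_) <;> simp only <;> ring

theorem hookRound_mem_modelCylInt {s t : ℝ} (hs : s ∈ Icc (0 : ℝ) 1) (h : |t| ≤ 950) :
    hookRound s t ∈ modelCylInt :=
  ⟨hookX_bound h, hookZ_bound hs (hookX_bound h).le⟩

theorem hookFlat_fst_mem {s t : ℝ} (hs : s ∈ Icc (0 : ℝ) 1) (h : |t| ≤ 950) :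
    |(1 - s) * hookX t + s * t| < 1000 := by
  have h1 := abs_lt.1 (hookX_bound h)
  have h2 := abs_le.1 h
  exact abs_lt.2 ⟨by nlinarith [hs.1, hs.2], by nlinarith [hs.1, hs.2]⟩

theorem hookFlat_mem_modelCylInt {s t : ℝ} (hs : s ∈ Icc (0 : ℝ) 1) (h : |t| ≤ 950) :
    hookFlat s t ∈ modelCylInt := by
  refine ⟨hookFlat_fst_mem hs h, ?_⟩
  have h0 : (1 : ℝ) ∈ Icc (0 : ℝ) 1 := right_mem_Icc.2 zero_le_one
  have h1 := abs_lt.1 (hookX_bound h)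
  have h2 := abs_le.1 h
  have h3 := abs_lt.1 (hookZ_bound h0 (hookX_bound h).le)
  have h4 : (hookFlat s t).2.2 = (1 - s) * hookZ 1 t + s * -t := by simp only [hookFlat]; ring
  rw [h4]
  exact abs_lt.2 ⟨by nlinarith [hs.1, hs.2], by nlinarith [hs.1, hs.2]⟩

theorem peak_eq {t u : ℝ} (h : peak t = peak u) :
    |t - 60| = |u - 60| ∨ 800 ≤ |t - 60| ∧ 800 ≤ |u - 60| := by
  by_contra! hne
  rcases lt_or_gt_of_ne hne.1 with h1 | h1
  · rcases lt_or_ge |t - 60| 800 with h2 | h2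
    · exact (peak_lt h1 h2).ne' h
    · linarith [hne.2 h2]
  · rcases lt_or_ge |u - 60| 800 with h2 | h2
    · exact (peak_lt h1 h2).ne h
    · linarith [hne.2 (h2.trans h1.le)]

theorem hookFlat_tail {s t : ℝ} (h : 800 ≤ |t - 60|) : hookFlat s t = (t, -1, -t) := by
  have hw := absDefect_nonneg
  have hw' := absDefect_le
  have key : hookX t = t ∧ hookZ 1 t = -t := by
    rcases le_abs.1 h with h | h
    · have := hookX_end (t := t) (by linarith)
      exact ⟨this, by rw [hookZ_end (by linarith), this]⟩
    · have := hookX_start (t := t) (by linarith)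
      exact ⟨this, by rw [hookZ_start (by linarith), upperFn_of_le (by linarith)]⟩
  simp only [hookFlat, key.1, key.2, peak_of_le h]
  refine Prod.ext ?_ (Prod.ext rfl ?_) <;> simp only <;> ring

/-- The coordinate `y = peak t` never changes, and apart from the tails it takes equal values only
at parameters symmetric about `60`. Such a pair is separated by `z + x`, and by `x` where this
fails. -/
theorem hookFlat_injective {s : ℝ} (hs : s ∈ Icc (0 : ℝ) 1) :
    Function.Injective (hookFlat s) := by
  have hw := absDefect_nonneg
  have hw' := absDefect_le
  have h01 : (1 : ℝ) ∈ Icc (0 : ℝ) 1 := right_mem_Icc.2 zero_le_one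
  have key : ∀ t u, t + u = 120 → t < 60 → hookFlat s t ≠ hookFlat s u := by
    intro t u htu ht h
    have hx : (1 - s) * hookX t + s * t = (1 - s) * hookX u + s * u := congrArg Prod.fst h
    have hz : (1 - s) * (hookZ 1 t + hookX t) - ((1 - s) * hookX t + s * t) =
        (1 - s) * (hookZ 1 u + hookX u) - ((1 - s) * hookX u + s * u) :=
      congrArg (fun p : R3 => p.2.2) h
    rw [hx] at hz
    have hz' : (1 - s) * (hookZ 1 t + hookX t) = (1 - s) * (hookZ 1 u + hookX u) := by linarith
    rcases hs.2.eq_or_lt with rfl | hs1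
    · linarith
    · have hz2 : hookZ 1 t + hookX t = hookZ 1 u + hookX u :=
        mul_left_cancel₀ (sub_pos.2 hs1).ne' hz'
      have h1 := hookZ_add_nonpos h01 (t := u) (by linarith)
      rcases le_or_gt 28 t with h2 | h2
      · have := hookZ_add_pos h01 h2 ht
        linarith
      -- Equal `z + x` now forces `t ≤ -20`, while the point with parameter `u` has `x ≥ -3`; so the
      -- `x`-coordinates differ.
      · rw [← hz2, hookZ_start h2.le, hookX_start h2.le, upperFn] at h1
        have h3 := le_smoothPos (t + 20)
        have h4 := neg_three_le_hookX (t := u) (by linarith)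
        rw [hookX_start h2.le] at hx
        nlinarith [hs.1]
  intro t u h
  rcases peak_eq (congrArg (fun p : R3 => p.2.1) h) with h1 | ⟨h1, h2⟩
  · rcases abs_eq_abs.1 h1 with h2 | h2
    · linarith
    · rcases lt_trichotomy t 60 with h3 | h3 | h3
      · exact absurd h (key t u (by linarith) h3)
      · linarith
      · exact absurd h.symm (key u t (by linarith) (by linarith))
  · rw [hookFlat_tail h1, hookFlat_tail h2] at h
    exact congrArg Prod.fst h

/-- On the tails `x' = 1`, and between them `y' ≠ 0` except at `t = 60`. There both `x` and `z` of
the hook have derivative `-1`, so `x' = 0` forces `s = 1/2`, and then `(z + x)' = -1`. -/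
theorem deriv_hookFlat_ne_zero {s : ℝ} (t : ℝ) : deriv (hookFlat s) t ≠ 0 := by
  intro h0
  have hw := absDefect_nonneg
  have hw' := absDefect_le
  have hx := deriv_fst_eq (hookFlat_contDiff s) t
  have hy := deriv_snd_fst_eq (hookFlat_contDiff s) t
  have hz := deriv_snd_snd_eq (hookFlat_contDiff s) t
  rw [h0] at hx hy hz
  rcases le_or_gt 800 |t - 60| with h | h
  · have key2 : ∀ t, 800 ≤ |t - 60| → deriv (fun t => (hookFlat s t).1) t = 1 := fun t ht => by
      have hd : HasDerivAt (fun t => (1 - s) * hookX t + s * t)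
          ((1 - s) * deriv hookX t + s * 1) t :=
        ((hookX_contDiff.differentiable (by simp) t).hasDerivAt.const_mul (1 - s)).add
          ((hasDerivAt_id t).const_mul s)
      have h1 : deriv (fun t => (hookFlat s t).1) t = (1 - s) * deriv hookX t + s * 1 := hd.deriv
      rw [h1]
      have h2 : deriv hookX t = 1 := by
        rcases le_abs.1 ht with h | h
        · rw [deriv_hookX_right (by linarith), smoothSign_of_two_le (by linarith),
            deriv_smoothSign_of_two_le_abs]
          · ring
          · exact le_abs.2 (Or.inl (by linarith))
        · rw [deriv_hookX_left (by linarith), smoothSign_of_le (by linarith)]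
          ring
      rw [h2]; ring
    rw [key2 t h] at hx
    exact zero_ne_one hx
  · by_cases h60 : t = 60
    · subst h60
      have hdx : HasDerivAt hookX (-1) 60 := by
        have := (hookX_contDiff.differentiable (by simp) 60).hasDerivAt
        rwa [deriv_hookX_left (by linarith), smoothSign_of_two_le (by norm_num)] at this
      have hdz : HasDerivAt (hookZ 1) (-1) 60 := by
        refine hdx.congr_of_eventuallyEq ?_
        filter_upwards [lt_mem_nhds (show (32 : ℝ) < 60 by norm_num),
          gt_mem_nhds (show (60 : ℝ) < 61 + w₀ by linarith)] with u h1 h2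
        exact hookZ_mid h1.le h2.le
      have h1 := (hdx.const_mul (1 - s)).add ((hasDerivAt_id (60 : ℝ)).const_mul s)
      have h2 := ((hdz.add hdx).const_mul (1 - s)).sub h1
      have h3 : (0 : ℝ) = (1 - s) * -1 + s * 1 := hx.trans h1.deriv
      have h4 : (0 : ℝ) = (1 - s) * (-1 + -1) - ((1 - s) * -1 + s * 1) := hz.trans h2.deriv
      linarith
    · exact deriv_peak_ne_zero h60 h hy.symm

/-! ### The snake -/

/-- The `x`-coordinate of the snake. -/
noncomputable def snakeX (t : ℝ) : ℝ :=
  t + ω (t - (268 + 73 * w₀)) - 36 * ω ((t - (150 + 36 * w₀)) / 36) - 118 - 72 * w₀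
    + (118 + 37 * w₀) * (1 + σ (t - (288 + 73 * w₀)))

/-- A Legendrian arc with two cusps whose front runs along `z = x`, then around the finger, and
finally to the right along `z = x`. -/
noncomputable def snakeArc : ℝ → R3 :=
  cuspArc snakeX lowerFn gapFn riseFn (fun t => σ ((t - (150 + 36 * w₀)) / 36))
    (fun t => σ (t - (268 + 73 * w₀))) (-3 / 2) (3 / 2)

theorem snakeX_contDiff : ContDiff ℝ ∞ snakeX := by
  have h1 := smoothAbs_contDiff
  have h2 := smoothSign_contDiff
  unfold snakeX
  fun_prop

theorem smoothSign_scale_contDiff (p : ℝ) : ContDiff ℝ ∞ (fun t => σ ((t - p) / 36)) :=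
  smoothSign_contDiff.comp ((contDiff_id.sub contDiff_const).div_const 36)

theorem smoothSign_scale_hasDerivAt (p t : ℝ) :
    HasDerivAt (fun t => σ ((t - p) / 36)) (deriv σ ((t - p) / 36) * (1 / 36)) t :=
  (smoothSign_hasDerivAt ((t - p) / 36)).comp t (((hasDerivAt_id t).sub_const p).div_const 36)

theorem smoothAbs_scale_hasDerivAt (p t : ℝ) :
    HasDerivAt (fun t => ω ((t - p) / 36)) (σ ((t - p) / 36) * (1 / 36)) t := by
  have h := (smoothAbs_hasDerivAt ((t - p) / 36)).comp t
    (((hasDerivAt_id t).sub_const p).div_const 36)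
  exact h

theorem snakeX_hasDerivAt (t : ℝ) : HasDerivAt snakeX
    (1 + σ (t - (268 + 73 * w₀)) - σ ((t - (150 + 36 * w₀)) / 36)
      + (118 + 37 * w₀) * deriv σ (t - (288 + 73 * w₀))) t := by
  have h := ((((((hasDerivAt_id t).add (smoothAbs_shift_hasDerivAt (268 + 73 * w₀) t)).sub
    ((smoothAbs_scale_hasDerivAt (150 + 36 * w₀) t).const_mul 36)).sub_const 118).sub_const
    (72 * w₀)).add (((smoothSign_shift_hasDerivAt (288 + 73 * w₀) t).const_add 1).const_mul
    (118 + 37 * w₀)))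
  exact h.congr_deriv (by ring)

theorem snakeX_left {t : ℝ} (h : t ≤ 266 + 73 * w₀) :
    snakeX t = 150 - 36 * ω ((t - (150 + 36 * w₀)) / 36) := by
  rw [snakeX, smoothAbs_of_le (t := t - (268 + 73 * w₀)) (by linarith),
    smoothSign_of_le (by linarith)]
  ring

theorem snakeX_right {t : ℝ} (h : 222 + 36 * w₀ ≤ t) : snakeX t =
    32 + ω (t - (268 + 73 * w₀)) + (118 + 37 * w₀) * (1 + σ (t - (288 + 73 * w₀))) := by
  rw [snakeX, smoothAbs_of_two_le (t := (t - (150 + 36 * w₀)) / 36) (by linarith)]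
  ring

theorem snakeX_start {t : ℝ} (h : t ≤ 78 + 36 * w₀) : snakeX t = t := by
  have := absDefect_nonneg
  rw [snakeX_left (by linarith), smoothAbs_of_le (by linarith)]
  ring

theorem snakeX_end {t : ℝ} (h : 290 + 73 * w₀ ≤ t) : snakeX t = t := by
  have := absDefect_nonneg
  rw [snakeX_right (by linarith), smoothAbs_of_two_le (by linarith),
    smoothSign_of_two_le (by linarith)]
  ring

theorem snakeX_mid {t : ℝ} (h : 78 + 36 * w₀ ≤ t) (h' : t ≤ 222 + 36 * w₀) : 78 ≤ snakeX t := by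
  have := absDefect_nonneg
  rw [snakeX_left (by linarith)]
  have h1 := smoothAbs_le_abs ((t - (150 + 36 * w₀)) / 36)
  have h2 : |(t - (150 + 36 * w₀)) / 36| ≤ 2 := abs_le.2 ⟨by linarith, by linarith⟩
  linarith

theorem snakeX_right_ge {t : ℝ} (h : 222 + 36 * w₀ ≤ t) : 32 ≤ snakeX t := by
  have := absDefect_nonneg
  rw [snakeX_right h]
  have h1 := smoothAbs_nonneg (t - (268 + 73 * w₀))
  have h2 := neg_one_le_smoothSign (t - (288 + 73 * w₀))
  nlinarith

theorem snakeX_ge {t : ℝ} (h : 78 + 36 * w₀ ≤ t) : 32 ≤ snakeX t := by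
  rcases le_total t (222 + 36 * w₀) with h1 | h1
  · linarith [snakeX_mid h h1]
  · exact snakeX_right_ge h1

theorem snakeX_cusp_le {t : ℝ} (h : |t - (268 + 73 * w₀)| ≤ 2) : snakeX t ≤ 34 := by
  have hw := absDefect_nonneg
  have h1 := abs_le.1 h
  rw [snakeX_right (by linarith), smoothSign_of_le (by linarith)]
  have h2 := smoothAbs_le_abs (t - (268 + 73 * w₀))
  linarith

theorem snakeX_abs_le (t : ℝ) : |snakeX t| ≤ max |t| 600 + 2 := by
  have hw := absDefect_nonneg
  have hw' := absDefect_le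
  have hm1 := le_max_left |t| 600
  have hm2 := le_max_right |t| 600
  have ht := le_abs_self t
  rcases le_total t (78 + 36 * w₀) with h | h
  · rw [snakeX_start h]; linarith
  have h32 := snakeX_ge h
  rw [abs_of_nonneg (by linarith)]
  rcases le_total t (222 + 36 * w₀) with h1 | h1
  · rw [snakeX_left (by linarith)]
    have := smoothAbs_nonneg ((t - (150 + 36 * w₀)) / 36)
    linarith
  · have h3 := smoothAbs_le_abs (t - (268 + 73 * w₀))
    have h4 := smoothSign_le_one (t - (288 + 73 * w₀))
    have h5 : (118 + 37 * w₀) * (1 + σ (t - (288 + 73 * w₀))) ≤ 236 + 74 * w₀ := by nlinarith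
    rw [snakeX_right h1]
    rcases le_total 0 (t - (268 + 73 * w₀)) with h6 | h6
    · rw [abs_of_nonneg h6] at h3; linarith
    · rw [abs_of_nonpos h6] at h3; linarith

theorem deriv_snakeX_left {t : ℝ} (h : t ≤ 266 + 73 * w₀) :
    deriv snakeX t = -σ ((t - (150 + 36 * w₀)) / 36) := by
  rw [(snakeX_hasDerivAt t).deriv, smoothSign_of_le (t := t - (268 + 73 * w₀)) (by linarith),
    deriv_smoothSign_of_two_le_abs]
  · ring
  · rw [abs_of_neg (by linarith)]; linarith

theorem deriv_snakeX_right {t : ℝ} (h : 222 + 36 * w₀ ≤ t) : deriv snakeX t =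
    σ (t - (268 + 73 * w₀)) + (118 + 37 * w₀) * deriv σ (t - (288 + 73 * w₀)) := by
  rw [(snakeX_hasDerivAt t).deriv, smoothSign_of_two_le (t := (t - (150 + 36 * w₀)) / 36)
    (by linarith)]
  ring

theorem deriv_snakeX_right' {t : ℝ} (h : 222 + 36 * w₀ ≤ t) (h' : t ≤ 286 + 73 * w₀) :
    deriv snakeX t = σ (t - (268 + 73 * w₀)) := by
  rw [deriv_snakeX_right h, deriv_smoothSign_of_two_le_abs (t := t - (288 + 73 * w₀)), mul_zero,
    add_zero]
  exact le_abs.2 (Or.inr (by linarith))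

theorem deriv_snakeX_pos {t : ℝ} (h : 268 + 73 * w₀ < t) : 0 < deriv snakeX t := by
  have := absDefect_nonneg
  rw [deriv_snakeX_right (by linarith)]
  have h1 := smoothSign_pos (t := t - (268 + 73 * w₀)) (by linarith)
  have h2 := deriv_smoothSign_nonneg (t - (288 + 73 * w₀))
  positivity

theorem deriv_snakeX_neg {t : ℝ} (h : 150 + 36 * w₀ < t) (h' : t < 268 + 73 * w₀) :
    deriv snakeX t < 0 := by
  have := absDefect_nonneg
  rcases le_or_gt t (266 + 73 * w₀) with h1 | h1
  · rw [deriv_snakeX_left h1]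
    have := smoothSign_pos (t := (t - (150 + 36 * w₀)) / 36) (by linarith)
    linarith
  · rw [deriv_snakeX_right' (by linarith) (by linarith)]
    exact smoothSign_neg_of_neg (t := t - (268 + 73 * w₀)) (by linarith)

theorem deriv_snakeX_pos_left {t : ℝ} (h : t < 150 + 36 * w₀) : 0 < deriv snakeX t := by
  have := absDefect_nonneg
  rw [deriv_snakeX_left (by linarith)]
  have := smoothSign_neg_of_neg (t := (t - (150 + 36 * w₀)) / 36) (by linarith)
  linarith

theorem deriv_snakeX_eq_zero {t : ℝ} (h : deriv snakeX t = 0) :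
    t = 150 + 36 * w₀ ∨ t = 268 + 73 * w₀ := by
  by_contra! hne
  rcases lt_or_gt_of_ne hne.1 with h1 | h1
  · exact (deriv_snakeX_pos_left h1).ne' h
  · rcases lt_or_gt_of_ne hne.2 with h2 | h2
    · exact (deriv_snakeX_neg h1 h2).ne h
    · exact (deriv_snakeX_pos h2).ne' h

theorem snakeX_strictMonoOn : StrictMonoOn snakeX (Ici (268 + 73 * w₀)) := by
  refine strictMonoOn_of_deriv_pos (convex_Ici _) snakeX_contDiff.continuous.continuousOn ?_
  intro t ht
  rw [interior_Ici] at ht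
  exact deriv_snakeX_pos ht

theorem snakeX_strictAntiOn : StrictAntiOn snakeX (Icc (150 + 36 * w₀) (268 + 73 * w₀)) := by
  refine strictAntiOn_of_deriv_neg (convex_Icc _ _) snakeX_contDiff.continuous.continuousOn ?_
  intro t ht
  rw [interior_Icc] at ht
  exact deriv_snakeX_neg ht.1 ht.2

theorem snakeArc_snd_snd (t : ℝ) : (snakeArc t).2.2 = lowerFn (snakeX t)
    + gapFn (snakeX t) * ((1 + σ ((t - (150 + 36 * w₀)) / 36) ^ 3) / 2)
    + riseFn (snakeX t) * ((1 + σ (t - (268 + 73 * w₀)) ^ 3) / 2) := rfl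

theorem snakeArc_z_left {t : ℝ} (h : t ≤ 266 + 73 * w₀) : (snakeArc t).2.2 = lowerFn (snakeX t)
    + gapFn (snakeX t) * ((1 + σ ((t - (150 + 36 * w₀)) / 36) ^ 3) / 2) := by
  rw [snakeArc_snd_snd, smoothSign_of_le (t := t - (268 + 73 * w₀)) (by linarith)]; ring

theorem snakeArc_z_right {t : ℝ} (h : 222 + 36 * w₀ ≤ t) : (snakeArc t).2.2 =
    20 + riseFn (snakeX t) * ((1 + σ (t - (268 + 73 * w₀)) ^ 3) / 2) := by
  have := snakeX_right_ge h
  rw [snakeArc_snd_snd, smoothSign_of_two_le (t := (t - (150 + 36 * w₀)) / 36) (by linarith),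
    lowerFn_of_ge (by linarith), gapFn_of_ge (by linarith)]
  ring

theorem snakeArc_z_start {t : ℝ} (h : t ≤ 78 + 36 * w₀) : (snakeArc t).2.2 = lowerFn t := by
  have := absDefect_nonneg
  rw [snakeArc_z_left (by linarith), smoothSign_of_le (by linarith), snakeX_start h]
  ring

theorem lowerFn_le_snakeArc_z (t : ℝ) : lowerFn (snakeX t) ≤ (snakeArc t).2.2 := by
  rw [snakeArc_snd_snd]
  have h1 := smoothSign_cube_mem ((t - (150 + 36 * w₀)) / 36)
  have h2 := smoothSign_cube_mem (t - (268 + 73 * w₀))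
  have h3 := twelve_le_gapFn (snakeX t)
  have h4 := twenty_le_riseFn (snakeX t)
  have h5 := mul_nonneg (by linarith : 0 ≤ gapFn (snakeX t))
    (by linarith [h1.1] : 0 ≤ (1 + σ ((t - (150 + 36 * w₀)) / 36) ^ 3) / 2)
  have h6 := mul_nonneg (by linarith : 0 ≤ riseFn (snakeX t))
    (by linarith [h2.1] : 0 ≤ (1 + σ (t - (268 + 73 * w₀)) ^ 3) / 2)
  linarith

/-- Before the second cusp, parameters over the same `x` are symmetric about the first cusp and
separated by the gap. After the first cusp, `x` is monotone on either side of the second one, and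
the two sides are separated by `riseFn`. In the remaining case the heights are at most `20` and at
least `20`. Equality would put `t` near the first cusp, over `x ≥ 78`, and `u` near the second, over
`x ≤ 34`. -/
theorem snakeArc_front_inj {t u : ℝ} (htu : t < u) (hx : snakeX t = snakeX u) :
    (snakeArc t).2.2 ≠ (snakeArc u).2.2 := by
  intro hz
  have hw := absDefect_nonneg
  have hw' := absDefect_le
  rcases le_or_gt u (266 + 73 * w₀) with hu | hu
  · rw [snakeArc_z_left hu, snakeArc_z_left (by linarith), hx] at hz
    rw [snakeX_left hu, snakeX_left (by linarith)] at hx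
    have h1 : ω ((t - (150 + 36 * w₀)) / 36) = ω ((u - (150 + 36 * w₀)) / 36) := by linarith
    have h2 : (t - (150 + 36 * w₀)) / 36 = -((u - (150 + 36 * w₀)) / 36) := by
      rcases abs_eq_abs.1 (smoothAbs_inj h1) with h | h
      · linarith
      · exact h
    have h3 : 0 < (u - (150 + 36 * w₀)) / 36 := by linarith
    rw [h2, smoothSign_neg] at hz
    have h4 := pow_pos (smoothSign_pos h3) 3
    have h5 := mul_pos (lt_of_lt_of_le (by norm_num) (twelve_le_gapFn (snakeX u))) h4
    linarith
  rcases le_or_gt (222 + 36 * w₀) t with ht | ht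
  · rcases le_or_gt (268 + 73 * w₀) t with h1 | h1
    · exact htu.ne (snakeX_strictMonoOn.injOn h1 (h1.trans htu.le) hx)
    rcases le_or_gt u (268 + 73 * w₀) with h2 | h2
    · exact htu.ne (snakeX_strictAntiOn.injOn ⟨by linarith, h1.le⟩ ⟨by linarith, h2⟩ hx)
    rw [snakeArc_z_right ht, snakeArc_z_right (by linarith), hx] at hz
    have h3 := smoothSign_neg_of_neg (t := t - (268 + 73 * w₀)) (by linarith)
    have h4 := pow_pos (smoothSign_pos (t := u - (268 + 73 * w₀)) (by linarith)) 3
    have h5 : σ (t - (268 + 73 * w₀)) ^ 3 < 0 := Odd.pow_neg (by decide) h3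
    have h6 := twenty_le_riseFn (snakeX u)
    nlinarith
  · have hux := snakeX_right_ge (t := u) (by linarith)
    rw [snakeArc_z_left (by linarith), snakeArc_z_right (by linarith), hx,
      lowerFn_of_ge (by linarith), gapFn_of_ge (by linarith)] at hz
    have h1 := smoothSign_cube_mem ((t - (150 + 36 * w₀)) / 36)
    have h2 := smoothSign_cube_mem (u - (268 + 73 * w₀))
    have h3 := twenty_le_riseFn (snakeX u)
    have h4 := mul_nonneg (by linarith : 0 ≤ riseFn (snakeX u))
      (by linarith [h2.1] : 0 ≤ (1 + σ (u - (268 + 73 * w₀)) ^ 3) / 2)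
    have h5 : 0 < σ ((t - (150 + 36 * w₀)) / 36) ^ 3 := by linarith
    have h6 : riseFn (snakeX u) * ((1 + σ (u - (268 + 73 * w₀)) ^ 3) / 2) = 0 := by linarith [h1.2]
    have h7 : σ (u - (268 + 73 * w₀)) ^ 3 < 0 := by
      rcases mul_eq_zero.1 h6 with h | h <;> linarith
    have h8 : u < 268 + 73 * w₀ := by
      by_contra! h
      have : 0 ≤ σ (u - (268 + 73 * w₀)) := by
        rw [← smoothSign_zero]; exact smoothSign_mono (by linarith)
      exact absurd (pow_nonneg this 3) (not_le.2 h7)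
    have h9 : 150 + 36 * w₀ < t := by
      by_contra! h
      have : σ ((t - (150 + 36 * w₀)) / 36) ≤ 0 := by
        rw [← smoothSign_zero]; exact smoothSign_mono (by linarith)
      exact absurd (Odd.pow_nonpos (by decide : Odd 3) this) (not_le.2 h5)
    have h10 := snakeX_mid (by linarith) ht.le
    have h11 := snakeX_cusp_le (t := u) (abs_le.2 ⟨by linarith, by linarith⟩)
    linarith

theorem snakeArc_contDiff : ContDiff ℝ ∞ snakeArc :=
  cuspArc_contDiff snakeX_contDiff lowerFn_contDiff gapFn_contDiff riseFn_contDiff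
    (smoothSign_scale_contDiff _) (smoothSign_shift_contDiff _)

theorem snakeArc_injective : Function.Injective snakeArc := by
  intro t u h
  have hx : snakeX t = snakeX u := congrArg Prod.fst h
  have hz := congrArg (fun p : R3 => p.2.2) h
  rcases lt_trichotomy t u with h1 | h1 | h1
  · exact absurd hz (snakeArc_front_inj h1 hx)
  · exact h1
  · exact absurd hz.symm (snakeArc_front_inj h1 hx.symm)

theorem snake_scale_cases (t : ℝ) : deriv (fun t => σ ((t - (150 + 36 * w₀)) / 36)) t = 0 ∨
    78 + 36 * w₀ < t ∧ t < 222 + 36 * w₀ := by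
  rcases le_or_gt 2 |(t - (150 + 36 * w₀)) / 36| with h | h
  · left
    rw [(smoothSign_scale_hasDerivAt _ _).deriv, deriv_smoothSign_of_two_le_abs h, zero_mul]
  · right
    have := abs_lt.1 h
    constructor <;> linarith

theorem snake_shift_cases (t : ℝ) : deriv (fun t => σ (t - (268 + 73 * w₀))) t = 0 ∨
    266 + 73 * w₀ < t ∧ t < 270 + 73 * w₀ := by
  rcases le_or_gt 2 |t - (268 + 73 * w₀)| with h | h
  · left
    rw [(smoothSign_shift_hasDerivAt _ _).deriv, deriv_smoothSign_of_two_le_abs h]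
  · right
    have := abs_lt.1 h
    constructor <;> linarith

theorem contactForm_snakeArc (t : ℝ) : contactForm (snakeArc t) (deriv snakeArc t) = 0 := by
  have hw := absDefect_nonneg
  refine contactForm_cuspArc snakeX_contDiff lowerFn_contDiff gapFn_contDiff
    riseFn_contDiff (smoothSign_scale_contDiff _) (smoothSign_shift_contDiff _)
    ((snake_scale_cases t).imp_right fun h => ?_) ((snake_shift_cases t).imp_right fun h => ?_)
  · rw [deriv_snakeX_left (by linarith [h.2])]
    ring
  · rw [deriv_snakeX_right' (by linarith [h.1]) (by linarith [h.2])]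

theorem snakeX_cusp₁ : snakeX (150 + 36 * w₀) = 150 := by
  rw [snakeX_left (by linarith [absDefect_nonneg]), sub_self, zero_div, smoothAbs_zero]; ring

theorem snakeX_cusp₂ : snakeX (268 + 73 * w₀) = 32 := by
  have := absDefect_nonneg
  rw [snakeX_right (by linarith), sub_self, smoothAbs_zero, smoothSign_of_le (by linarith)]; ring

theorem deriv_snakeArc_ne_zero (t : ℝ) : deriv snakeArc t ≠ 0 := by
  intro h0
  have hw := absDefect_nonneg
  have hσ := pow_pos deriv_smoothSign_zero 2
  have hx : deriv snakeX t = 0 := by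
    have := deriv_fst_eq snakeArc_contDiff t
    rw [h0] at this
    exact this.symm
  have hy : (deriv snakeArc t).2.1 = 0 := by rw [h0]; rfl
  have key := deriv_cuspArc_snd_fst (k₁ := -3 / 2) (k₂ := 3 / 2) snakeX_contDiff lowerFn_contDiff
    gapFn_contDiff riseFn_contDiff (smoothSign_scale_contDiff (150 + 36 * w₀))
    (smoothSign_shift_contDiff (268 + 73 * w₀)) hx
  rcases deriv_snakeX_eq_zero hx with rfl | rfl
  · have hS := deriv_deriv_eq_zero_of_eventually_const (eventually_smoothSign_shift_of_lt
      (t := 150 + 36 * w₀) (p := 268 + 73 * w₀) (by linarith))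
    have := key (Or.inl (by simp only [sub_self, zero_div, smoothSign_zero])) (Or.inr hS)
    rw [snakeArc, this, hS.1, (smoothSign_scale_hasDerivAt _ _).deriv, snakeX_cusp₁, sub_self,
      zero_div, gapFn_of_ge (by norm_num)] at hy
    nlinarith
  · have hS := deriv_deriv_eq_zero_of_eventually_const (c := 1)
      (f := fun t => σ ((t - (150 + 36 * w₀)) / 36)) (x := 268 + 73 * w₀) (by
        filter_upwards [lt_mem_nhds (show 222 + 36 * w₀ < 268 + 73 * w₀ by linarith)] with u hu
        exact smoothSign_of_two_le (by linarith))
    have := key (Or.inr hS) (Or.inl (by simp only [sub_self, smoothSign_zero]))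
    rw [snakeArc, this, hS.1, (smoothSign_shift_hasDerivAt _ _).deriv, snakeX_cusp₂, sub_self,
      riseFn_of_le (by norm_num)] at hy
    nlinarith

theorem deriv_upperFn (x : ℝ) : deriv upperFn x = -1 + (1 + σ (x + 20)) / 2 := by
  have h := (hasDerivAt_neg x).add ((smoothPos_hasDerivAt (x + 20)).comp x
    ((hasDerivAt_id x).add_const 20))
  rw [mul_one] at h
  exact h.deriv

theorem deriv_gapFn (x : ℝ) : deriv gapFn x = -(1 + σ (-x - 6)) := by
  have h := (((smoothPos_hasDerivAt (-x - 6)).comp x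
    ((hasDerivAt_neg x).sub_const 6)).const_mul 2).const_add 12
  exact (h.congr_deriv (by ring)).deriv

theorem deriv_lowerFn (x : ℝ) : deriv lowerFn x = (1 + σ (x + 20)) / 2 + σ (-x - 6) := by
  have h := ((upperFn_contDiff.differentiable (by simp) x).hasDerivAt).sub
    ((gapFn_contDiff.differentiable (by simp) x).hasDerivAt)
  rw [show deriv lowerFn x = _ from h.deriv, deriv_upperFn, deriv_gapFn]
  ring

theorem deriv_riseFn (x : ℝ) : deriv riseFn x = (1 + σ (x - 40)) / 2 := by
  have h := ((smoothPos_hasDerivAt (x - 40)).comp x ((hasDerivAt_id x).sub_const 40)).const_add 20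
  rw [mul_one] at h
  exact h.deriv

theorem deriv_lowerFn_nonneg (x : ℝ) : 0 ≤ deriv lowerFn x := by
  rw [deriv_lowerFn]
  have h1 := neg_one_le_smoothSign (x + 20)
  have h2 := neg_one_le_smoothSign (-x - 6)
  rcases le_total x (-8) with h | h
  · rw [smoothSign_of_two_le (t := -x - 6) (by linarith)]; linarith
  · rw [smoothSign_of_two_le (t := x + 20) (by linarith)]; linarith

theorem deriv_lowerFn_of_ge {x : ℝ} (h : -4 ≤ x) : deriv lowerFn x = 0 := by
  rw [deriv_lowerFn, smoothSign_of_two_le (t := x + 20) (by linarith),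
    smoothSign_of_le (t := -x - 6) (by linarith)]
  norm_num

theorem deriv_riseFn_nonneg (x : ℝ) : 0 ≤ deriv riseFn x := by
  rw [deriv_riseFn]; linarith [neg_one_le_smoothSign (x - 40)]

/-- The slopes of the edges contribute at most `2 + 1`, the first cusp at most `1` because of its
width `36`, and the second at most `30`. The bound `100` matches the one in `le_peak`. -/
theorem snakeArc_y_lt (t : ℝ) : (snakeArc t).2.1 < 100 := by
  have hw := absDefect_nonneg
  have e1 := smoothSign_cube_mem ((t - (150 + 36 * w₀)) / 36)
  have e2 := smoothSign_cube_mem (t - (268 + 73 * w₀))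
  have h1 : deriv lowerFn (snakeX t) + deriv gapFn (snakeX t) *
      ((1 + σ ((t - (150 + 36 * w₀)) / 36) ^ 3) / 2) ≤ 2 := by
    have h2 : deriv gapFn (snakeX t) ≤ 0 := by
      rw [deriv_gapFn]; linarith [neg_one_le_smoothSign (-snakeX t - 6)]
    have h3 : deriv lowerFn (snakeX t) ≤ 2 := by
      rw [deriv_lowerFn]
      linarith [smoothSign_le_one (-snakeX t - 6), smoothSign_le_one (snakeX t + 20)]
    nlinarith [e1.1]
  have h2 : deriv riseFn (snakeX t) * ((1 + σ (t - (268 + 73 * w₀)) ^ 3) / 2) ≤ 1 := by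
    have h3 := deriv_riseFn_nonneg (snakeX t)
    have h4 : deriv riseFn (snakeX t) ≤ 1 := by
      rw [deriv_riseFn]; linarith [smoothSign_le_one (snakeX t - 40)]
    nlinarith [e2.1, e2.2]
  have key : ∀ v, |σ v * deriv σ v| ≤ 1 := fun v => by
    rw [abs_mul, abs_of_nonneg (deriv_smoothSign_nonneg v)]
    exact mul_le_one₀ (abs_le.2 ⟨neg_one_le_smoothSign v, smoothSign_le_one v⟩)
      (deriv_smoothSign_nonneg v) (deriv_smoothSign_le v)
  have h3 : -3 / 2 * (gapFn (snakeX t) * (σ ((t - (150 + 36 * w₀)) / 36) *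
      deriv (fun t => σ ((t - (150 + 36 * w₀)) / 36)) t)) ≤ 1 := by
    rcases snake_scale_cases t with h | h
    · rw [h]; norm_num
    · rw [gapFn_of_ge (by linarith [snakeX_mid h.1.le h.2.le]),
        (smoothSign_scale_hasDerivAt _ _).deriv]
      have := (abs_le.1 (key ((t - (150 + 36 * w₀)) / 36))).1
      linarith
  have h4 : 3 / 2 * (riseFn (snakeX t) * (σ (t - (268 + 73 * w₀)) *
      deriv (fun t => σ (t - (268 + 73 * w₀))) t)) ≤ 30 := by
    rcases snake_shift_cases t with h | h
    · rw [h]; norm_num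
    · have := snakeX_cusp_le (t := t) (abs_le.2 ⟨by linarith [h.1], by linarith [h.2]⟩)
      rw [riseFn_of_le (by linarith), (smoothSign_shift_hasDerivAt _ _).deriv]
      have := (abs_le.1 (key (t - (268 + 73 * w₀)))).2
      linarith
  simp only [snakeArc, cuspArc]
  linarith

/-- The snake never descends: it runs backwards only where the edges are horizontal, forwards only
along edges of non-negative slope, and the transitions at the cusps add height. This makes the
straightening by convex combinations possible. -/
theorem deriv_snakeArc_z_nonneg (t : ℝ) : 0 ≤ deriv (fun t => (snakeArc t).2.2) t := by
  have hw := absDefect_nonneg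
  have hd : ∀ {f : ℝ → ℝ}, ContDiff ℝ ∞ f → ∀ t, DifferentiableAt ℝ f t := fun hf =>
    hf.differentiable (by simp)
  have h := hasDerivAt_cuspArc_snd_snd (k₁ := -3 / 2) (k₂ := 3 / 2)
    (hd snakeX_contDiff t).hasDerivAt (hd lowerFn_contDiff _)
    (hd gapFn_contDiff _) (hd riseFn_contDiff _) (hd (smoothSign_scale_contDiff (150 + 36 * w₀)) t)
    (hd (smoothSign_shift_contDiff (268 + 73 * w₀)) t)
  rw [show deriv (fun t => (snakeArc t).2.2) t = _ from h.deriv]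
  have e1 := twelve_le_gapFn (snakeX t)
  have e2 := twenty_le_riseFn (snakeX t)
  have e3 : 0 ≤ deriv (fun t => σ ((t - (150 + 36 * w₀)) / 36)) t := by
    rw [(smoothSign_scale_hasDerivAt _ _).deriv]
    have := deriv_smoothSign_nonneg ((t - (150 + 36 * w₀)) / 36)
    positivity
  have e4 : 0 ≤ deriv (fun t => σ (t - (268 + 73 * w₀))) t := by
    rw [(smoothSign_shift_hasDerivAt _ _).deriv]
    exact deriv_smoothSign_nonneg _
  have e5 : 0 ≤ gapFn (snakeX t) * (3 / 2 * σ ((t - (150 + 36 * w₀)) / 36) ^ 2 *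
      deriv (fun t => σ ((t - (150 + 36 * w₀)) / 36)) t) := by
    have : 0 ≤ gapFn (snakeX t) := by linarith
    positivity
  have e6 : 0 ≤ riseFn (snakeX t) * (3 / 2 * σ (t - (268 + 73 * w₀)) ^ 2 *
      deriv (fun t => σ (t - (268 + 73 * w₀))) t) := by
    have : 0 ≤ riseFn (snakeX t) := by linarith
    positivity
  refine add_nonneg (add_nonneg ?_ e5) e6
  have f2 := smoothSign_cube_mem (t - (268 + 73 * w₀))
  rcases le_or_gt t (78 + 36 * w₀) with h1 | h1
  · have hx' : 0 ≤ deriv snakeX t := (deriv_snakeX_pos_left (by linarith)).le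
    rw [smoothSign_of_le (t := (t - (150 + 36 * w₀)) / 36) (by linarith),
      smoothSign_of_le (t := t - (268 + 73 * w₀)) (by linarith)]
    refine mul_nonneg ?_ hx'
    have := deriv_lowerFn_nonneg (snakeX t)
    linarith
  · have hx := snakeX_ge h1.le
    rw [deriv_lowerFn_of_ge (by linarith), deriv_gapFn_of_gt (by linarith)]
    rcases le_or_gt t (266 + 73 * w₀) with h2 | h2
    · rw [smoothSign_of_le (t := t - (268 + 73 * w₀)) (by linarith)]
      norm_num
    · rcases le_or_gt t (268 + 73 * w₀) with h3 | h3
      · have := snakeX_cusp_le (t := t) (abs_le.2 ⟨by linarith, by linarith⟩)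
        rw [deriv_riseFn, smoothSign_of_le (t := snakeX t - 40) (by linarith)]
        norm_num
      · have := deriv_riseFn_nonneg (snakeX t)
        refine mul_nonneg ?_ (deriv_snakeX_pos h3).le
        have : 0 ≤ deriv riseFn (snakeX t) * ((1 + σ (t - (268 + 73 * w₀)) ^ 3) / 2) :=
          mul_nonneg this (by linarith [f2.1])
        linarith

theorem snakeArc_eventuallyEq {c₁ c₂ t : ℝ} {H : ℝ → ℝ}
    (h₁ : ∀ᶠ u in 𝓝 t, σ ((u - (150 + 36 * w₀)) / 36) = c₁)
    (h₂ : ∀ᶠ u in 𝓝 t, σ (u - (268 + 73 * w₀)) = c₂)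
    (hH : ∀ᶠ X in 𝓝 (snakeX t), H X = lowerFn X + gapFn X * ((1 + c₁ ^ 3) / 2)
      + riseFn X * ((1 + c₂ ^ 3) / 2)) :
    snakeArc =ᶠ[𝓝 t] fun u => graphLift H (snakeX u) :=
  cuspArc_eventuallyEq lowerFn_contDiff gapFn_contDiff riseFn_contDiff
    snakeX_contDiff.continuous.continuousAt h₁ h₂ hH

theorem snakeArc_eventuallyEq_first {t : ℝ} (h : t < 78 + 36 * w₀) :
    snakeArc =ᶠ[𝓝 t] graphLift lowerFn := by
  have hw := absDefect_nonneg
  have h1 := snakeArc_eventuallyEq (t := t) (c₁ := -1) (H := lowerFn) (by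
    filter_upwards [gt_mem_nhds h] with u hu using smoothSign_of_le (by linarith))
    (eventually_smoothSign_shift_of_lt (by linarith))
    (Filter.Eventually.of_forall fun X => by norm_num)
  filter_upwards [h1, gt_mem_nhds h] with u hu hu'
  rw [hu, snakeX_start hu'.le]

theorem snakeArc_eventuallyEq_second {t : ℝ} (h : 222 + 36 * w₀ < t) (h' : t < 266 + 73 * w₀) :
    snakeArc =ᶠ[𝓝 t] fun u => graphLift upperFn (snakeX u) := by
  have hw := absDefect_nonneg
  refine snakeArc_eventuallyEq (t := t) (c₁ := 1) (by
    filter_upwards [lt_mem_nhds h] with u hu using smoothSign_of_two_le (by linarith))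
    (eventually_smoothSign_shift_of_lt (by linarith))
    (Filter.Eventually.of_forall fun X => by rw [lowerFn]; ring)

theorem snakeArc_eventuallyEq_third {t : ℝ} (h : 270 + 73 * w₀ < t) (hx : 42 < snakeX t) :
    snakeArc =ᶠ[𝓝 t] fun u => gLine (snakeX u) := by
  have hw := absDefect_nonneg
  rw [← graphLift_id]
  refine snakeArc_eventuallyEq (t := t) (c₁ := 1) (by
    filter_upwards [lt_mem_nhds h] with u hu using smoothSign_of_two_le (by linarith))
    (eventually_smoothSign_shift_of_gt (by linarith)) ?_
  filter_upwards [lt_mem_nhds hx] with X hX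
  rw [lowerFn_of_ge (by linarith), gapFn_of_ge (by linarith), riseFn_of_ge (by linarith)]
  ring

theorem hookArc_eventuallyEq_fLine {t : ℝ} (h : t < -22 ∨ 70 + w₀ < t) :
    hookArc =ᶠ[𝓝 t] fLine := by
  rcases h with h | h
  · exact (hookArc_eventuallyEq_first (by linarith)).trans (graphLift_upperFn h)
  · filter_upwards [hookArc_eventuallyEq_third (t := t) (by linarith), lt_mem_nhds h] with u hu hu'
    rw [hu, hookX_end hu'.le]

theorem snakeArc_eventuallyEq_gLine {t : ℝ} (h : t < -22 ∨ 290 + 73 * w₀ < t) :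
    snakeArc =ᶠ[𝓝 t] gLine := by
  have hw := absDefect_nonneg
  rcases h with h | h
  · exact (snakeArc_eventuallyEq_first (by linarith)).trans (graphLift_lowerFn h)
  · have hx := snakeX_end h.le
    filter_upwards [snakeArc_eventuallyEq_third (t := t) (by linarith) (by linarith),
      lt_mem_nhds h] with u hu hu'
    rw [hu, snakeX_end hu'.le]

/-! ### The hook lies above the snake -/

theorem hookX_ge_of_mid {t : ℝ} (h : |t - 30| ≤ 3) : 27 ≤ hookX t := by
  have hw := absDefect_nonneg
  have hw' := absDefect_le
  have h1 := (smoothAbs_le_iff (t := t - 30) (u := 3) (by norm_num)).2 h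
  rw [smoothAbs_of_two_le (t := 3) (by norm_num)] at h1
  rw [hookX_left (by linarith [(abs_le.1 h).2])]
  linarith

/-- The front of the hook meets the front of the snake only at the height `8`. -/
theorem hookRound_ne_snakeArc {s : ℝ} (hs : s ∈ Icc (0 : ℝ) 1) (t u : ℝ) :
    hookRound s t ≠ snakeArc u := by
  intro h
  have hw := absDefect_nonneg
  have hw' := absDefect_le
  have hx : hookX t = snakeX u := congrArg Prod.fst h
  have hz : hookZ s t = (snakeArc u).2.2 := congrArg (fun p : R3 => p.2.2) h
  have hy : (1 - s) * (hookArc t).2.1 + s * peak t = (snakeArc u).2.1 :=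
    congrArg (fun p : R3 => p.2.1) h
  -- From `61 + w₀` on the hook is either left of `x = 4` and below height `4`, or below height `0`;
  -- this part is too low to meet the snake.
  have h61 : 61 + w₀ ≤ t → hookX t < 4 ∧ hookZ s t < 4 ∨ hookZ s t < 0 := fun ht => by
    rcases le_or_gt t (65 + w₀) with h1 | h1
    · left
      have h2 := hookX_nonpos (by linarith) h1
      have h3 := neg_three_le_hookX (t := t) (by linarith)
      have h4 := cubeMix_smoothSign_mem hs (t - (63 + w₀))
      rw [hookZ_right (by linarith)]
      exact ⟨by linarith, by nlinarith [h4.1, h4.2]⟩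
    · rcases le_or_gt (hookX t) 0 with h2 | h2
      · left
        have h3 := neg_three_le_hookX (t := t) (by linarith)
        rw [hookZ_end h1.le]
        exact ⟨by linarith, by linarith⟩
      · right
        rw [hookZ_end h1.le]
        linarith
  -- For `u ≥ 78 + 36 w₀` the snake stays in `x ≥ 32`, out of reach of the hook up to `t = 61 + w₀`.
  rcases le_or_gt (78 + 36 * w₀) u with hu | hu
  · have h1 := snakeX_ge hu
    have h2 := lowerFn_le_snakeArc_z u
    rw [lowerFn_of_ge (by linarith)] at h2
    rcases le_or_gt t (61 + w₀) with ht | ht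
    · rw [hookX_left ht] at hx
      have := smoothAbs_nonneg (t - 30)
      linarith
    · rcases h61 ht.le with h3 | h3
      · linarith [h3.1]
      · linarith
  · rw [snakeArc_z_start hu.le] at hz
    have hxu := snakeX_start hu.le
    rcases le_or_gt t 28 with h1 | h1
    · rw [hookZ_start h1, ← hxu, ← hx, hookX_start h1, lowerFn] at hz
      have := twelve_le_gapFn t
      linarith
    have hx4 : -4 ≤ u := by
      rcases le_or_gt t 33 with h2 | h2
      · have := hookX_ge_of_mid (t := t) (abs_le.2 ⟨by linarith, by linarith⟩)
        linarith
      · have := neg_three_le_hookX (t := t) (by linarith)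
        linarith
    rw [lowerFn_of_ge hx4] at hz
    rcases le_or_gt t 32 with h2 | h2
    · have h3 := hookX_ge_of_mid (t := t) (abs_le.2 ⟨by linarith, by linarith⟩)
      rw [hookZ_left (by linarith), upperFn_of_ge (by linarith)] at hz
      have h4 := cubeMix_smoothSign_mem hs (t - 30)
      have := mul_nonneg (by linarith : 0 ≤ hookX t - 20)
        (by linarith [h4.1] : 0 ≤ (1 + cubeMix s (σ (t - 30))) / 2)
      linarith
    rcases lt_or_ge t (61 + w₀) with h3 | h3
    · rw [hookZ_mid h2.le h3.le, hookX_mid h2.le h3.le] at hz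
      -- The only common front point is `(8, 8)`. The snake has `y = 0` there, and the hook a convex
      -- combination of `1` and `peak 52 ≥ 100`.
      have h4 : t = 52 := by linarith
      subst h4
      rw [hookArc_y_second (by norm_num) (by linarith),
        (snakeArc_eventuallyEq_first hu).eq_of_nhds] at hy
      have h5 : deriv lowerFn u = 0 := deriv_lowerFn_of_ge hx4
      have h6 : (1 - s) * 1 + s * peak 52 = deriv lowerFn u := hy
      have h7 : 100 ≤ peak 52 := le_peak (by norm_num [abs_of_neg])
      nlinarith [hs.1, hs.2]
    · rcases h61 h3 with h4 | h4
      · linarith [h4.2]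
      · linarith

theorem hookFlat_far {s t : ℝ} (h : 700 ≤ |t - 60|) : hookFlat s t = (t, peak t, -t) := by
  have hw := absDefect_nonneg
  have hw' := absDefect_le
  have key : hookX t = t ∧ hookZ 1 t = -t := by
    rcases le_abs.1 h with h | h
    · have := hookX_end (t := t) (by linarith)
      exact ⟨this, by rw [hookZ_end (by linarith), this]⟩
    · have := hookX_start (t := t) (by linarith)
      exact ⟨this, by rw [hookZ_start (by linarith), upperFn_of_le (by linarith)]⟩
  simp only [hookFlat, key.1, key.2]
  refine Prod.ext ?_ (Prod.ext rfl ?_) <;> simp only <;> ring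

theorem abs_of_peak_lt {t : ℝ} (h : peak t < 100) : 700 ≤ |t - 60| ∧ 640 ≤ |t| := by
  have h1 : 700 ≤ |t - 60| := by
    by_contra! hlt
    linarith [le_peak hlt.le]
  refine ⟨h1, ?_⟩
  rcases le_abs.1 h1 with h | h
  · exact le_abs.2 (Or.inl (by linarith))
  · exact le_abs.2 (Or.inr (by linarith))

theorem snakeArc_eventuallyEq_of_far {u : ℝ} (h : 600 < |u|) : snakeArc =ᶠ[𝓝 u] gLine := by
  have hw' := absDefect_le
  refine snakeArc_eventuallyEq_gLine ?_
  rcases lt_abs.1 h with h | h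
  · exact Or.inr (by linarith)
  · exact Or.inl (by linarith)

/-- Since the snake has `y < 100`, only the tails of the hook can be low enough to meet it. There
both arcs are straight, and the fronts of the two lines meet only at `x = 0`. -/
theorem hookFlat_ne_snakeArc (s t u : ℝ) : hookFlat s t ≠ snakeArc u := by
  intro h
  have hy : peak t = (snakeArc u).2.1 := congrArg (fun p : R3 => p.2.1) h
  obtain ⟨h1, h2⟩ := abs_of_peak_lt (by rw [hy]; exact snakeArc_y_lt u)
  rw [hookFlat_far h1] at h
  have hx : t = snakeX u := congrArg Prod.fst h
  have h3 : 600 < |u| := by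
    by_contra! h3
    have := snakeX_abs_le u
    rw [max_eq_right h3, ← hx] at this
    linarith
  rw [(snakeArc_eventuallyEq_of_far h3).eq_of_nhds] at h
  have e1 : t = u := congrArg Prod.fst h
  have e2 : -t = u := congrArg (fun p : R3 => p.2.2) h
  have : t = 0 := by linarith
  rw [this, abs_zero] at h2
  linarith

/-! ### Straightening the snake -/

/-- The straightening of the snake. -/
noncomputable def snakeFlat (s t : ℝ) : R3 := (1 - s) • snakeArc t + s • gLine t

theorem snakeFlat_zero : snakeFlat 0 = snakeArc := by
  funext t; simp [snakeFlat]

theorem snakeFlat_one : snakeFlat 1 = gLine := by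
  funext t; simp [snakeFlat]

theorem snakeFlat_contDiff₂ : ContDiff ℝ ∞ (fun p : ℝ × ℝ => snakeFlat p.1 p.2) :=
  ((contDiff_const.sub contDiff_fst).smul (snakeArc_contDiff.comp contDiff_snd)).add
    (contDiff_fst.smul (gLine_contDiff.comp contDiff_snd))

theorem snakeFlat_contDiff (s : ℝ) : ContDiff ℝ ∞ (snakeFlat s) :=
  snakeFlat_contDiff₂.comp (contDiff_const.prodMk contDiff_id)

theorem snakeArc_z_mono : Monotone (fun t => (snakeArc t).2.2) :=
  monotone_of_deriv_nonneg (snakeArc_contDiff.snd.snd.differentiable (by simp))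
    deriv_snakeArc_z_nonneg

/-- For `s > 0` the height is strictly increasing, as the snake never descends and the line rises.
-/
theorem snakeFlat_injective {s : ℝ} (hs : s ∈ Icc (0 : ℝ) 1) : Function.Injective (snakeFlat s) := by
  rcases hs.1.eq_or_lt with rfl | hs0
  · rw [snakeFlat_zero]; exact snakeArc_injective
  · have : StrictMono (fun t => (snakeFlat s t).2.2) := by
      intro t u htu
      have h1 := snakeArc_z_mono htu.le
      simp only [snakeFlat, gLine, Prod.snd_add, Prod.smul_snd, smul_eq_mul] at h1 ⊢
      nlinarith [hs.2]
    exact fun t u h => this.injective (congrArg (fun p : R3 => p.2.2) h)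

theorem deriv_snakeFlat_ne_zero {s : ℝ} (hs : s ∈ Icc (0 : ℝ) 1) (t : ℝ) :
    deriv (snakeFlat s) t ≠ 0 := by
  rcases hs.1.eq_or_lt with rfl | hs0
  · rw [snakeFlat_zero]; exact deriv_snakeArc_ne_zero t
  · intro h0
    have hz := deriv_snd_snd_eq (snakeFlat_contDiff s) t
    have h1 := deriv_snakeArc_z_nonneg t
    have h2 : HasDerivAt (fun t => (snakeFlat s t).2.2)
        ((1 - s) * deriv (fun t => (snakeArc t).2.2) t + s * 1) t :=
      ((snakeArc_contDiff.snd.snd.differentiable (by simp) t).hasDerivAt.const_mul (1 - s)).add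
        ((hasDerivAt_id t).const_mul s)
    rw [h0, h2.deriv] at hz
    have h3 : (0 : ℝ) = (1 - s) * deriv (fun t => (snakeArc t).2.2) t + s * 1 := hz
    nlinarith [hs.2]

theorem snakeFlat_fix {s t : ℝ} (h : 600 < |t|) : snakeFlat s t = gLine t := by
  rw [snakeFlat, (snakeArc_eventuallyEq_of_far h).eq_of_nhds, ← add_smul, sub_add_cancel, one_smul]

/-- Convex combinations of a number below `100` with `1` stay below `100`, so the comparison with
the lifted line again reduces to the tails. -/
theorem snakeFlat_ne_topLine {s : ℝ} (hs : s ∈ Icc (0 : ℝ) 1) (u t : ℝ) :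
    snakeFlat s u ≠ topLine t := by
  intro h
  have hy : (1 - s) * (snakeArc u).2.1 + s * 1 = peak t := congrArg (fun p : R3 => p.2.1) h
  have hx : (1 - s) * snakeX u + s * u = t := congrArg Prod.fst h
  have h0 := snakeArc_y_lt u
  obtain ⟨h1, h2⟩ := abs_of_peak_lt (t := t) (by
    rw [← hy]
    rcases hs.2.eq_or_lt with rfl | h1
    · norm_num
    · have := mul_lt_mul_of_pos_left h0 (sub_pos.2 h1)
      have := hs.1
      linarith)
  have h3 : 600 < |u| := by
    by_contra! h3
    have h4 := snakeX_abs_le u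
    rw [max_eq_right h3] at h4
    have h5 := abs_le.1 h4
    have h6 := abs_le.1 h3
    have h7 : |t| ≤ 602 := by
      rw [← hx]
      exact abs_le.2 ⟨by nlinarith [hs.1, hs.2], by nlinarith [hs.1, hs.2]⟩
    linarith
  rw [snakeFlat_fix h3] at h
  have e1 : u = t := congrArg Prod.fst h
  have e2 : u = -t := congrArg (fun p : R3 => p.2.2) h
  have : t = 0 := by linarith
  rw [this, abs_zero] at h2
  linarith

theorem snakeArc_bound {t : ℝ} (h : |snakeX t| ≤ 1000) : |(snakeArc t).2.2| < 2000 := by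
  have h0 := abs_le.1 h
  have h1 := lowerFn_le_snakeArc_z t
  have h2 := lt_lowerFn h
  refine abs_lt.2 ⟨by linarith, ?_⟩
  rcases le_or_gt t (266 + 73 * w₀) with h3 | h3
  · rw [snakeArc_z_left h3]
    have h4 := smoothSign_cube_mem ((t - (150 + 36 * w₀)) / 36)
    have h5 := twelve_le_gapFn (snakeX t)
    have h6 := upperFn_lt h
    rw [lowerFn]
    nlinarith [h4.2]
  · rw [snakeArc_z_right (by linarith [absDefect_nonneg])]
    have h4 := smoothSign_cube_mem (t - (268 + 73 * w₀))
    have h5 := twenty_le_riseFn (snakeX t)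
    have h6 : riseFn (snakeX t) ≤ 981 := by
      rw [riseFn]
      have := (smoothPos_le (snakeX t - 40)).trans (add_le_add_left
        (max_le (c := 960) (by linarith) (by norm_num)) 1)
      linarith
    nlinarith [h4.2]

/-! ### From hook and snake to the changed crossing -/

/-- The signs `ε` and `-ε` are those of the two lines: the hook joins the ends of `fLine` and the
snake joins the ends of `gLine`, each in the original direction. -/
theorem isTanglePair_hook_snake (ε : ℝ) : IsTanglePair ε ε (-ε) hookArc snakeArc where
  smooth_left := hookArc_contDiff
  smooth_right := snakeArc_contDiff
  inj_left := hookRound_zero ▸ hookRound_injective (left_mem_Icc.2 zero_le_one)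
  inj_right := snakeArc_injective
  imm_left := hookRound_zero ▸ deriv_hookRound_ne_zero (left_mem_Icc.2 zero_le_one)
  imm_right := deriv_snakeArc_ne_zero
  disj := hookRound_zero ▸ hookRound_ne_snakeArc (left_mem_Icc.2 zero_le_one)
  tail q hq := by
    have hw' := absDefect_le
    have h1 : ∀ t, 900 < |t| → hookArc =ᶠ[𝓝 t] fLine := fun t ht => by
      refine hookArc_eventuallyEq_fLine ?_
      rcases lt_abs.1 ht with h | h
      · exact Or.inr (by linarith)
      · exact Or.inl (by linarith)
    refine or_congr ?_ ?_ <;> rw [mem_vecOn_iff, mem_vecOn_iff] <;>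
      refine exists_congr fun t => and_congr_right fun _ => ?_
    · rcases lt_or_ge 900 |t| with ht | ht
      · rw [vecOn_singleton_congr (h1 t ht)]
      · refine iff_of_false (fun h => ?_) (fun h => ?_) <;>
          rw [fst_of_mem_vecOn_singleton h] at hq
        · exact absurd (hookX_bound (ht.trans (by norm_num))) (not_lt.2 hq)
        · have : 1000 ≤ |t| := hq
          linarith
    · rcases lt_or_ge 900 |t| with ht | ht
      · rw [vecOn_singleton_congr (snakeArc_eventuallyEq_of_far (by linarith))]
      · refine iff_of_false (fun h => ?_) (fun h => ?_) <;>
          rw [fst_of_mem_vecOn_singleton h] at hq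
        · have h2 : 1000 ≤ |snakeX t| := hq
          have h3 := snakeX_abs_le t
          have h4 := max_le ht (by norm_num : (600 : ℝ) ≤ 900)
          linarith
        · have : 1000 ≤ |t| := hq
          linarith
  bound_left t ht := by
    rw [hookArc_snd_snd]
    exact hookZ_bound (left_mem_Icc.2 zero_le_one) ht
  bound_right t ht := snakeArc_bound ht
  proper := by
    have hw' := absDefect_le
    have hw := absDefect_nonneg
    refine ⟨1001, fun t => ⟨fun h => ?_, fun h => ?_⟩⟩ <;> by_contra! ht
    · have h2 : hookX t = t := by
        rcases lt_abs.1 ht with h | h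
        · exact hookX_end (by linarith)
        · exact hookX_start (by linarith)
      have h3 : |hookX t| ≤ 1001 := h
      rw [h2] at h3
      linarith
    · have h2 : snakeX t = t := by
        rcases lt_abs.1 ht with h | h
        · exact snakeX_end (by linarith)
        · exact snakeX_start (by linarith)
      have h3 : |snakeX t| ≤ 1001 := h
      rw [h2] at h3
      linarith

theorem isTanglePair_hookRound (ε : ℝ) {s : ℝ} (hs : s ∈ Icc (0 : ℝ) 1) :
    IsTanglePair ε ε (-ε) (hookRound s) snakeArc :=
  (isTanglePair_hook_snake ε).modify_left (r := 900) (hookRound_contDiff s)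
    (hookRound_injective hs) (deriv_hookRound_ne_zero hs) (hookRound_ne_snakeArc hs)
    (fun _ => hookRound_fix) (fun t ht => hookX_bound (ht.trans (by norm_num)))
    (fun t ht => hookRound_mem_modelCylInt hs (ht.trans (by norm_num)))

theorem isTanglePair_hookFlat (ε : ℝ) {s : ℝ} (hs : s ∈ Icc (0 : ℝ) 1) :
    IsTanglePair ε ε (-ε) (hookFlat s) snakeArc :=
  (isTanglePair_hookRound ε (right_mem_Icc.2 zero_le_one)).modify_left (r := 900)
    (hookFlat_contDiff s) (hookFlat_injective hs) deriv_hookFlat_ne_zero (hookFlat_ne_snakeArc s)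
    (fun _ h => (hookFlat_fix h).trans (congrFun hookFlat_zero _))
    (fun t ht => hookX_bound (ht.trans (by norm_num)))
    (fun t ht => hookFlat_mem_modelCylInt hs (ht.trans (by norm_num)))

theorem snakeFlat_mem_modelCylInt {s t : ℝ} (hs : s ∈ Icc (0 : ℝ) 1) (h : |t| ≤ 950) :
    snakeFlat s t ∈ modelCylInt := by
  have h1 := snakeX_abs_le t
  have h2 := max_le h (by norm_num : (600 : ℝ) ≤ 950)
  have h3 := abs_le.1 (h1.trans (add_le_add_left h2 2))
  have h4 := abs_lt.1 (snakeArc_bound (t := t) (by linarith))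
  have h5 := abs_le.1 h
  have e1 : (snakeFlat s t).1 = (1 - s) * snakeX t + s * t := rfl
  have e2 : (snakeFlat s t).2.2 = (1 - s) * (snakeArc t).2.2 + s * t := rfl
  refine ⟨?_, ?_⟩
  · rw [e1]
    exact abs_lt.2 ⟨by nlinarith [hs.1, hs.2], by nlinarith [hs.1, hs.2]⟩
  · rw [e2]
    exact abs_lt.2 ⟨by nlinarith [hs.1, hs.2], by nlinarith [hs.1, hs.2]⟩

theorem isTanglePair_snakeFlat (ε : ℝ) {s : ℝ} (hs : s ∈ Icc (0 : ℝ) 1) :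
    IsTanglePair ε (-ε) ε (snakeFlat s) topLine := by
  have h := isTanglePair_hookFlat ε (right_mem_Icc.2 zero_le_one)
  rw [hookFlat_one] at h
  refine h.swap.modify_left (r := 900) (snakeFlat_contDiff s) (snakeFlat_injective hs)
    (deriv_snakeFlat_ne_zero hs) (snakeFlat_ne_topLine hs) (fun t ht => ?_) (fun t ht => ?_)
    (fun t ht => snakeFlat_mem_modelCylInt hs (ht.trans (by norm_num)))
  · rw [snakeFlat_fix (by linarith), (snakeArc_eventuallyEq_of_far (by linarith)).eq_of_nhds]
  · have := snakeFlat_mem_modelCylInt (left_mem_Icc.2 zero_le_one)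
      (ht.trans (by norm_num : (900 : ℝ) ≤ 950))
    rw [snakeFlat_zero] at this
    exact this.1

/-- The result of the two surgeries at the model crossing is obtained from the model crossing by
lifting one strand above the other one. -/
theorem ambientIsotopic_model {ε : ℝ} {V : Set (R3 × R3)} (hV : HasModelCrossing ε V)
    (hVc : IsClosed (Prod.fst '' V)) :
    AmbientIsotopic (Prod.fst '' replaceVec V ε (-ε) hookArc snakeArc)
      (Prod.fst '' replaceVec V ε (-ε) topLine gLine) := by
  have h950 : (900 : ℝ) < 950 := by norm_num
  have hround := ambientIsotopic_replaceVec (r := 900) hookRound_contDiff₂ hV hVc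
    (fun s hs => isTanglePair_hookRound ε hs) h950
    (fun s t ht => (hookRound_fix ht).trans (hookRound_fix ht).symm)
    (fun s hs t ht => hookRound_mem_modelCylInt hs (ht.trans h950.le))
    (fun t ht => by
      have := hookRound_mem_modelCylInt (left_mem_Icc.2 zero_le_one) ht
      exact ⟨this.1.le, this.2.le⟩)
  have hflat := ambientIsotopic_replaceVec (r := 900) hookFlat_contDiff₂ hV hVc
    (fun s hs => isTanglePair_hookFlat ε hs) h950 (fun s t ht => hookFlat_fix ht)
    (fun s hs t ht => hookFlat_mem_modelCylInt hs (ht.trans h950.le))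
    (fun t ht => by
      have := hookFlat_mem_modelCylInt (left_mem_Icc.2 zero_le_one) ht
      exact ⟨this.1.le, this.2.le⟩)
  have hsnake := ambientIsotopic_replaceVec (r := 900) snakeFlat_contDiff₂ hV hVc
    (fun s hs => isTanglePair_snakeFlat ε hs) h950
    (fun s t ht => (snakeFlat_fix (by linarith)).trans (snakeFlat_fix (by linarith)).symm)
    (fun s hs t ht => snakeFlat_mem_modelCylInt hs (ht.trans h950.le))
    (fun t ht => by
      have := snakeFlat_mem_modelCylInt (left_mem_Icc.2 zero_le_one) ht
      exact ⟨this.1.le, this.2.le⟩)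
  rw [hookRound_zero] at hround
  rw [hookFlat_zero, hookFlat_one] at hflat
  -- In the last move the snake is the left arc of the pair, so the arcs have to be exchanged.
  rw [snakeFlat_zero, snakeFlat_one, replaceVec_swap (a := topLine) (b := snakeArc) (ε := ε) (ε' := -ε),
    replaceVec_swap (a := topLine) (b := gLine) (ε := ε) (ε' := -ε)] at hsnake
  exact (hround.trans hflat).trans hsnake

/-! ### The second surgery -/

variable {ε X t : ℝ} {q : R3 × R3}

theorem smoothAbs_le_of_abs_le {u : ℝ} (h : |t| ≤ u) (hu : 2 ≤ u) : ω t ≤ u - w₀ := by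
  rw [← smoothAbs_of_two_le hu]
  exact (smoothAbs_le_iff (by linarith)).2 h

/-- The bound `78 + 36 w₀` is `fingerX 1 2`, where the rounded tip of the full finger begins. -/
theorem vecOn_finger_upper (h : X < 78 + 36 * w₀) :
    vecOn ε (graphLift upperFn) {X} ⊆ vecOn ε (fingerArc 1) univ := by
  obtain ⟨t, ht, htX⟩ := fingerX_surj (s := 1) (X := X) (by linarith)
  rw [← htX, ← fingerX_neg, ← vecOn_fingerArc_upper zero_le_one (neg_lt_neg ht)]
  exact vecOn_mono (subset_univ _)

theorem vecOn_finger_lower (h : X < 78 + 36 * w₀) :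
    vecOn (-ε) (graphLift lowerFn) {X} ⊆ vecOn ε (fingerArc 1) univ := by
  obtain ⟨t, ht, htX⟩ := fingerX_surj (s := 1) (X := X) (by linarith)
  rw [← htX, ← vecOn_fingerArc_lower zero_le_one ht]
  exact vecOn_mono (subset_univ _)

theorem vecOn_bend_gLine (h : -1 - w₀ < X) : vecOn (-ε) gLine {X} ⊆ vecOn ε bendArc univ := by
  obtain ⟨t, ht, htX⟩ := bendX_surj h
  rw [← htX, ← smoothAbs_neg, ← vecOn_bendArc_left (neg_lt_neg ht)]
  exact vecOn_mono (subset_univ _)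

theorem vecOn_bend_fLine (h : -1 - w₀ < X) : vecOn ε fLine {X} ⊆ vecOn ε bendArc univ := by
  obtain ⟨t, ht, htX⟩ := bendX_surj h
  rw [← htX, ← vecOn_bendArc_right ht]
  exact vecOn_mono (subset_univ _)

theorem vecOn_hook_first (h : t < 28) :
    vecOn ε hookArc {t} = vecOn ε (graphLift upperFn) {t} :=
  vecOn_singleton_congr (hookArc_eventuallyEq_first h)

theorem vecOn_hook_second (h : 32 < t) (h' : t < 61 + w₀) :
    vecOn ε hookArc {t} = vecOn (-ε) gLine {hookX t} :=
  vecOn_comp_of_neg (hookX_contDiff.differentiable (by simp) t).hasDerivAt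
    (gLine_contDiff.differentiable (by simp) _) (hookArc_eventuallyEq_second h h')
    (deriv_hookX_neg (by linarith) (by linarith))

theorem vecOn_hook_third (h : 65 + w₀ < t) :
    vecOn ε hookArc {t} = vecOn ε fLine {hookX t} :=
  vecOn_comp_of_pos (hookX_contDiff.differentiable (by simp) t).hasDerivAt
    (fLine_contDiff.differentiable (by simp) _) (hookArc_eventuallyEq_third h)
    (deriv_hookX_pos (by linarith))

theorem vecOn_snake_first (h : t < 78 + 36 * w₀) :
    vecOn ε snakeArc {t} = vecOn ε (graphLift lowerFn) {t} :=
  vecOn_singleton_congr (snakeArc_eventuallyEq_first h)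

theorem vecOn_snake_second (h : 222 + 36 * w₀ < t) (h' : t < 266 + 73 * w₀) :
    vecOn (-ε) snakeArc {t} = vecOn ε (graphLift upperFn) {snakeX t} := by
  have := vecOn_comp_of_neg (ε := -ε) (snakeX_contDiff.differentiable (by simp) t).hasDerivAt
    ((graphLift_contDiff upperFn_contDiff).differentiable (by simp) _)
    (snakeArc_eventuallyEq_second h h') (deriv_snakeX_neg (by linarith) (by linarith))
  rwa [neg_neg] at this

theorem vecOn_snake_third (h : 270 + 73 * w₀ < t) (hx : 42 < snakeX t) :
    vecOn ε snakeArc {t} = vecOn ε gLine {snakeX t} :=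
  vecOn_comp_of_pos (snakeX_contDiff.differentiable (by simp) t).hasDerivAt
    (gLine_contDiff.differentiable (by simp) _) (snakeArc_eventuallyEq_third h hx)
    (deriv_snakeX_pos (by linarith))

theorem snakeX_second (h : 222 + 36 * w₀ ≤ t) (h' : t ≤ 266 + 73 * w₀) :
    snakeX t = 300 + 72 * w₀ - t := by
  rw [snakeX_left h', smoothAbs_of_two_le (by linarith)]
  ring

theorem hookX_bend : hookX (65 + w₀) = -1 - w₀ := by
  have := absDefect_nonneg
  rw [hookX_right (by linarith), smoothAbs_of_two_le (by linarith), smoothSign_of_le (by linarith)]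
  ring

theorem snakeX_exit : snakeX (281 + 73 * w₀) = 45 - w₀ := by
  have := absDefect_nonneg
  rw [snakeX_right (by linarith), smoothAbs_of_two_le (by linarith), smoothSign_of_le (by linarith)]
  ring

theorem hookX_surj (h : -1 - w₀ < X) : ∃ t, 65 + w₀ < t ∧ hookX t = X := by
  have hw := absDefect_nonneg
  have h1 : 65 + w₀ ≤ 70 + w₀ + |X| := by linarith [abs_nonneg X]
  obtain ⟨t, ht, rfl⟩ := intermediate_value_Icc h1 hookX_contDiff.continuous.continuousOn
    (show X ∈ _ by
      rw [hookX_bend, hookX_end (by linarith [abs_nonneg X])]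
      exact ⟨h.le, by linarith [le_abs_self X]⟩)
  refine ⟨t, lt_of_le_of_ne ht.1 ?_, rfl⟩
  rintro rfl
  rw [hookX_bend] at h
  exact lt_irrefl _ h

theorem snakeX_surj (h : 45 - w₀ < X) : ∃ t, 281 + 73 * w₀ < t ∧ snakeX t = X := by
  have hw := absDefect_nonneg
  have h1 : 281 + 73 * w₀ ≤ 290 + 73 * w₀ + |X| := by linarith [abs_nonneg X]
  obtain ⟨t, ht, rfl⟩ := intermediate_value_Icc h1 snakeX_contDiff.continuous.continuousOn
    (show X ∈ _ by
      rw [snakeX_exit, snakeX_end (by linarith [abs_nonneg X])]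
      exact ⟨h.le, by linarith [le_abs_self X]⟩)
  refine ⟨t, lt_of_le_of_ne ht.1 ?_, rfl⟩
  rintro rfl
  rw [snakeX_exit] at h
  exact lt_irrefl _ h

theorem cuspArc_congr {x h E F S₁ S₂ : ℝ → ℝ} {k₁ k₂ : ℝ} {x' h' E' F' S₁' S₂' : ℝ → ℝ}
    {k₁' k₂' t u : ℝ} (hx : x t = x' u)
    (h1 : deriv h (x' u) + deriv E (x' u) * ((1 + S₁ t ^ 3) / 2)
        + deriv F (x' u) * ((1 + S₂ t ^ 3) / 2)
        + k₁ * (E (x' u) * (S₁ t * deriv S₁ t)) + k₂ * (F (x' u) * (S₂ t * deriv S₂ t))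
      = deriv h' (x' u) + deriv E' (x' u) * ((1 + S₁' u ^ 3) / 2)
        + deriv F' (x' u) * ((1 + S₂' u ^ 3) / 2)
        + k₁' * (E' (x' u) * (S₁' u * deriv S₁' u)) + k₂' * (F' (x' u) * (S₂' u * deriv S₂' u)))
    (h2 : h (x' u) + E (x' u) * ((1 + S₁ t ^ 3) / 2) + F (x' u) * ((1 + S₂ t ^ 3) / 2)
      = h' (x' u) + E' (x' u) * ((1 + S₁' u ^ 3) / 2) + F' (x' u) * ((1 + S₂' u ^ 3) / 2)) :
    cuspArc x h E F S₁ S₂ k₁ k₂ t = cuspArc x' h' E' F' S₁' S₂' k₁' k₂' u := by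
  simp only [cuspArc, hx, h1, h2]

/-- The tip of the full finger is the first cusp of the snake traversed backwards; the parameters
differ by an affine map of slope `-36`, the speed of the tip. -/
theorem vecOn_finger_tip (h : |t| ≤ 2) :
    vecOn ε (fingerArc 1) {t} = vecOn (-ε) snakeArc {150 + 36 * w₀ - 36 * t} := by
  have hw := absDefect_nonneg
  have hd : HasDerivAt (fun t : ℝ => 150 + 36 * w₀ - 36 * t) (-36) t := by
    simpa using ((hasDerivAt_id t).const_mul 36).const_sub (150 + 36 * w₀)
  refine vecOn_comp_of_neg hd (snakeArc_contDiff.differentiable (by simp) _) ?_ (by norm_num)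
  -- A strict bound slightly above `2` persists near `t`, and `(12/5)² ≤ 6` keeps `fingerX_of_le`
  -- applicable.
  have hlt : |t| < 12 / 5 := by linarith
  filter_upwards [(isOpen_lt continuous_abs continuous_const).mem_nhds hlt] with u hu
  have hu' := abs_lt.1 hu
  have e1 : (150 + 36 * w₀ - 36 * u - (150 + 36 * w₀)) / 36 = -u := by ring
  have hx : fingerX 1 u = snakeX (150 + 36 * w₀ - 36 * u) := by
    rw [fingerX_of_le (by nlinarith), snakeX_left (by linarith), e1, smoothAbs_neg]
    ring
  have hs2 := eventually_smoothSign_shift_of_lt (p := 268 + 73 * w₀)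
    (t := 150 + 36 * w₀ - 36 * u) (by linarith)
  have d1 := ((smoothSign_scale_hasDerivAt (150 + 36 * w₀) (150 + 36 * w₀ - 36 * u))).deriv
  have d2 : deriv (fun t => σ (t - (268 + 73 * w₀))) (150 + 36 * w₀ - 36 * u) = 0 :=
    deriv_eq_zero_of_eventually_const hs2
  have d3 : deriv σ (-u) = deriv σ u := by
    have h1 := ((smoothSign_hasDerivAt (-u)).comp u (hasDerivAt_neg u)).neg
    have h3 : HasDerivAt σ (-(deriv σ (-u) * -1)) u :=
      h1.congr_of_eventuallyEq (Filter.Eventually.of_forall fun t => by simp [smoothSign_neg])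
    rw [h3.deriv]; ring
  have g1 : ∀ x, HasDerivAt upperFn (deriv upperFn x) x := fun x =>
    (upperFn_contDiff.differentiable (by simp) x).hasDerivAt
  have g2 : ∀ x, HasDerivAt gapFn (deriv gapFn x) x := fun x =>
    (gapFn_contDiff.differentiable (by simp) x).hasDerivAt
  have d4 : ∀ x, deriv lowerFn x = deriv upperFn x - deriv gapFn x := fun x =>
    ((g1 x).sub (g2 x)).deriv
  have d5 : ∀ x, deriv (fun x => -gapFn x) x = -deriv gapFn x := fun x => (g2 x).neg.deriv
  refine cuspArc_congr hx ?_ ?_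
  · rw [d1, d2, d4, d5, e1, d3, smoothSign_neg, hs2.self_of_nhds, deriv_const]
    ring
  · rw [e1, smoothSign_neg, hs2.self_of_nhds, lowerFn]
    ring

/-- The shift `63 + w₀` is the parameter of the second cusp of the hook, which is the cusp of the
bend. -/
theorem vecOn_bend_tip (h : |t| ≤ 2) :
    vecOn ε bendArc {t} = vecOn ε hookArc {63 + w₀ + t} := by
  have hw := absDefect_nonneg
  have hd : HasDerivAt (fun t : ℝ => 63 + w₀ + t) 1 t := by
    simpa using (hasDerivAt_id t).const_add (63 + w₀)
  refine vecOn_comp_of_pos hd (hookArc_contDiff.differentiable (by simp) _) ?_ (by norm_num)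
  have hlt : |t| < 12 / 5 := by linarith
  filter_upwards [(isOpen_lt continuous_abs continuous_const).mem_nhds hlt] with u hu
  have hu' := abs_lt.1 hu
  have e1 : 63 + w₀ + u - (63 + w₀) = u := by ring
  have hx : -3 + ω u = hookX (63 + w₀ + u) := by
    rw [hookX_right (by linarith), smoothSign_of_le (by linarith), e1]
    ring
  have hs1 := eventually_smoothSign_shift_of_gt (p := 30) (t := 63 + w₀ + u) (by linarith)
  have d1 := ((smoothSign_shift_hasDerivAt (63 + w₀) (63 + w₀ + u))).deriv
  have d2 : deriv (fun t => σ (t - 30)) (63 + w₀ + u) = 0 :=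
    deriv_eq_zero_of_eventually_const hs1
  have d4 : ∀ x, deriv (fun x => x - upperFn x) x = 1 - deriv upperFn x := fun x =>
    ((hasDerivAt_id x).sub (upperFn_contDiff.differentiable (by simp) x).hasDerivAt).deriv
  refine cuspArc_congr hx ?_ ?_
  · rw [d1, d2, d4, e1, hs1.self_of_nhds, deriv_const, deriv_id'']
    ring
  · rw [e1, hs1.self_of_nhds]
    ring

/-- The rectangle of the second surgery. -/
noncomputable def secondRect : Rect := ⟨27, 45 - w₀, 14, 100⟩

theorem secondRect_cylinder : secondRect.cylinder ⊆ modelCyl := by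
  have := absDefect_nonneg
  rintro p ⟨⟨h1, h2⟩, ⟨h3, h4⟩⟩
  simp only [secondRect] at h1 h2 h3 h4
  exact ⟨abs_le.2 ⟨by linarith, by linarith⟩, abs_le.2 ⟨by linarith, by linarith⟩⟩

theorem hookArc_range_second (h : |t - 30| ≤ 3) :
    hookX t ∈ Icc 27 (30 - w₀) ∧ (hookArc t).2.2 ∈ Icc (20 : ℝ) 30 := by
  have hw := absDefect_nonneg
  have h1 := hookX_ge_of_mid h
  have ht := abs_le.1 h
  have h2 : hookX t ≤ 30 - w₀ := by
    rw [hookX_left (by linarith)]; linarith [smoothAbs_nonneg (t - 30)]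
  refine ⟨⟨h1, h2⟩, ?_⟩
  rw [hookArc_snd_snd, hookZ_left (by linarith), upperFn_of_ge (by linarith)]
  have h3 := cubeMix_smoothSign_mem (left_mem_Icc.2 zero_le_one) (t - 30)
  constructor <;> nlinarith [h3.1, h3.2]

theorem snakeArc_range_second (h : |t - (268 + 73 * w₀)| ≤ 13) :
    snakeX t ∈ Icc 32 (45 - w₀) ∧ (snakeArc t).2.2 ∈ Icc (20 : ℝ) 46 := by
  have hw := absDefect_nonneg
  have ht := abs_le.1 h
  have h0 := smoothAbs_le_of_abs_le h (by norm_num)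
  have h1 : 222 + 36 * w₀ ≤ t := by linarith
  have hX : snakeX t = 32 + ω (t - (268 + 73 * w₀)) := by
    rw [snakeX_right h1, smoothSign_of_le (by linarith)]; ring
  have h2 := snakeX_right_ge h1
  refine ⟨⟨h2, by linarith⟩, ?_⟩
  rw [snakeArc_z_right h1]
  have h4 := smoothSign_cube_mem (t - (268 + 73 * w₀))
  have h5 := twenty_le_riseFn (snakeX t)
  have h6 : riseFn (snakeX t) ≤ 26 := by
    rw [riseFn]
    have := (smoothPos_le (snakeX t - 40)).trans (add_le_add_left
      (max_le (c := 5) (by linarith) (by norm_num)) 1)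
    linarith
  constructor <;> nlinarith [h4.1, h4.2]

theorem mem_second_of_hook (h : |t - 30| ≤ 3) : hookArc t ∈ secondRect.cylinder := by
  obtain ⟨h1, h2⟩ := hookArc_range_second h
  have := absDefect_nonneg
  exact ⟨⟨h1.1, h1.2.trans (by simp only [secondRect]; linarith)⟩,
    le_trans (by norm_num [secondRect]) h2.1, h2.2.trans (by norm_num [secondRect])⟩

theorem mem_second_of_snake (h : |t - (268 + 73 * w₀)| ≤ 13) :
    snakeArc t ∈ secondRect.cylinder := by
  obtain ⟨h1, h2⟩ := snakeArc_range_second h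
  exact ⟨⟨le_trans (by norm_num [secondRect]) h1.1, h1.2⟩,
    le_trans (by norm_num [secondRect]) h2.1, h2.2.trans (by norm_num [secondRect])⟩

theorem snakeX_gt_of_gt (h : 281 + 73 * w₀ < t) : 45 - w₀ < snakeX t := by
  rw [← snakeX_exit]
  exact snakeX_strictMonoOn (mem_Ici.2 (by linarith)) (mem_Ici.2 (by linarith)) h

/-- Every branch of finger and bend recurs on the hook or the snake, except the upper edge `z = 20`
and the branch `z = x` over `[27, 45 - w₀]`. These two pieces lie in the rectangle. -/
theorem agree_second_subset (hq : q.1 ∉ secondRect.cylinder)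
    (h : q ∈ vecOn ε (fingerArc 1) univ ∪ vecOn ε bendArc univ) :
    q ∈ vecOn ε hookArc univ ∪ vecOn (-ε) snakeArc univ := by
  have hw := absDefect_nonneg
  have hw' := absDefect_le
  rcases h with h | h <;> obtain ⟨t, -, ht⟩ := mem_vecOn_iff.1 h
  · rcases le_or_gt |t| 2 with h2 | h2
    · rw [vecOn_finger_tip h2] at ht
      exact Or.inr (mem_vecOn_univ ht)
    · have hX : fingerX 1 t < 78 + 36 * w₀ := by
        rw [← fingerX_abs]
        have := fingerX_strictAntiOn zero_le_one (mem_Ici.2 zero_le_two) (mem_Ici.2 (abs_nonneg t)) h2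
        rw [fingerX_two] at this
        linarith
      rcases lt_abs.1 h2 with h2 | h2
      · rw [vecOn_fingerArc_lower zero_le_one h2, ← vecOn_snake_first hX] at ht
        exact Or.inr (mem_vecOn_univ ht)
      · rw [vecOn_fingerArc_upper zero_le_one (by linarith)] at ht
        have hq1 := fst_of_mem_vecOn_singleton ht
        set X := fingerX 1 t
        rcases lt_or_ge X 27 with h3 | h3
        · rw [← vecOn_hook_first (by linarith)] at ht
          exact Or.inl (mem_vecOn_univ ht)
        rcases le_or_gt X (45 - w₀) with h4 | h4
        · refine absurd ⟨⟨h3, h4⟩, ?_⟩ (hq1 ▸ hq)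
          simp only [graphLift, upperFn_of_ge (by linarith : -18 ≤ X)]
          norm_num [secondRect]
        · have e := vecOn_snake_second (ε := ε) (t := 300 + 72 * w₀ - X) (by linarith) (by linarith)
          rw [snakeX_second (by linarith) (by linarith), sub_sub_cancel] at e
          rw [← e] at ht
          exact Or.inr (mem_vecOn_univ ht)
  · rcases le_or_gt |t| 2 with h2 | h2
    · rw [vecOn_bend_tip h2] at ht
      exact Or.inl (mem_vecOn_univ ht)
    · have hX : -1 - w₀ < -3 + ω t := by
        have := not_le.1 (mt bendX_le_iff.1 (not_le.2 h2))
        exact this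
      rcases lt_abs.1 h2 with h2 | h2
      · rw [vecOn_bendArc_right h2] at ht
        obtain ⟨T, hT, hTX⟩ := hookX_surj hX
        rw [← hTX, ← vecOn_hook_third hT] at ht
        exact Or.inl (mem_vecOn_univ ht)
      · rw [vecOn_bendArc_left (by linarith)] at ht
        have hq1 := fst_of_mem_vecOn_singleton ht
        set X := -3 + ω t
        rcases lt_or_ge X 27 with h3 | h3
        · have e := vecOn_hook_second (ε := ε) (t := 60 - X) (by linarith) (by linarith)
          rw [hookX_mid (by linarith) (by linarith), sub_sub_cancel] at e
          rw [← e] at ht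
          exact Or.inl (mem_vecOn_univ ht)
        rcases le_or_gt X (45 - w₀) with h4 | h4
        · refine absurd ⟨⟨h3, h4⟩, ?_⟩ (hq1 ▸ hq)
          simp only [gLine, secondRect]
          constructor <;> linarith
        · obtain ⟨T, hT, hTX⟩ := snakeX_surj h4
          rw [← hTX, ← vecOn_snake_third (by linarith) (by linarith)] at ht
          exact Or.inr (mem_vecOn_univ ht)

/-- Only the two new cusps, on the hook around `t = 30` and on the snake around `t = 268 + 73 w₀`,
are absent from finger and bend, and both lie in the rectangle. -/
theorem agree_second_superset (hq : q.1 ∉ secondRect.cylinder)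
    (h : q ∈ vecOn ε hookArc univ ∪ vecOn (-ε) snakeArc univ) :
    q ∈ vecOn ε (fingerArc 1) univ ∪ vecOn ε bendArc univ := by
  have hw := absDefect_nonneg
  have hw' := absDefect_le
  rcases h with h | h <;> obtain ⟨t, -, ht⟩ := mem_vecOn_iff.1 h <;>
    have hq1 := fst_of_mem_vecOn_singleton ht
  · rcases lt_or_ge t 28 with h1 | h1
    · rw [vecOn_hook_first h1] at ht
      exact Or.inl (vecOn_finger_upper (by linarith) ht)
    rcases le_or_gt t 32 with h2 | h2
    · exact absurd (mem_second_of_hook (abs_le.2 ⟨by linarith, by linarith⟩)) (hq1 ▸ hq)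
    rcases lt_or_ge t (61 + w₀) with h3 | h3
    · rw [vecOn_hook_second h2 h3] at ht
      refine Or.inr (vecOn_bend_gLine ?_ ht)
      rw [hookX_mid h2.le h3.le]; linarith
    rcases le_or_gt t (65 + w₀) with h4 | h4
    · have e := vecOn_bend_tip (ε := ε) (t := t - 63 - w₀) (abs_le.2 ⟨by linarith, by linarith⟩)
      rw [show 63 + w₀ + (t - 63 - w₀) = t by ring] at e
      rw [← e] at ht
      exact Or.inr (mem_vecOn_univ ht)
    · rw [vecOn_hook_third h4] at ht
      refine Or.inr (vecOn_bend_fLine ?_ ht)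
      rw [← hookX_bend]
      exact hookX_strictMonoOn (mem_Ici.2 (by linarith)) (mem_Ici.2 (by linarith)) h4
  · rcases lt_or_ge t (78 + 36 * w₀) with h1 | h1
    · rw [vecOn_snake_first h1] at ht
      exact Or.inl (vecOn_finger_lower h1 ht)
    rcases le_or_gt t (222 + 36 * w₀) with h2 | h2
    · have e := vecOn_finger_tip (ε := ε) (t := (150 + 36 * w₀ - t) / 36)
        (abs_le.2 ⟨by linarith, by linarith⟩)
      rw [show 150 + 36 * w₀ - 36 * ((150 + 36 * w₀ - t) / 36) = t by ring] at e
      rw [← e] at ht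
      exact Or.inl (mem_vecOn_univ ht)
    rcases lt_or_ge t (266 + 73 * w₀) with h3 | h3
    · rw [vecOn_snake_second h2 h3] at ht
      refine Or.inl (vecOn_finger_upper ?_ ht)
      rw [snakeX_second h2.le h3.le]; linarith
    rcases le_or_gt t (281 + 73 * w₀) with h4 | h4
    · exact absurd (mem_second_of_snake (abs_le.2 ⟨by linarith, by linarith⟩)) (hq1 ▸ hq)
    · have := snakeX_gt_of_gt h4
      rw [vecOn_snake_third (by linarith) (by linarith)] at ht
      exact Or.inr (vecOn_bend_gLine (by linarith) ht)

theorem isTangleOver_finger_second (ε : ℝ) : ∃ p m : ℝ, 0 < m ∧ p - m = 27 ∧ p + m = 45 - w₀ ∧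
    IsTangleOver ε (vecOn ε (fingerArc 1) univ ∪ vecOn ε bendArc univ) secondRect
      (fun t => graphLift upperFn (p + m * t)) (fun t => gLine (p + -m * t)) := by
  have hw := absDefect_nonneg
  have hw' := absDefect_le
  have hm : 0 < (45 - w₀ - 27) / 2 := by linarith
  refine ⟨(27 + (45 - w₀)) / 2, (45 - w₀ - 27) / 2, hm, by ring, by ring, ?_⟩
  set p := (27 + (45 - w₀)) / 2
  set m := (45 - w₀ - 27) / 2
  have h1 : p - m = 27 := by ring
  have h2 : p + m = 45 - w₀ := by ring
  have hI : ∀ t ∈ Icc (-1 : ℝ) 1, p + m * t ∈ Icc 27 (45 - w₀) := fun t ht => by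
    rw [← h1, ← h2]; exact mem_Icc_affine hm ht
  have hI' : ∀ t ∈ Icc (-1 : ℝ) 1, p + -m * t ∈ Icc 27 (45 - w₀) := fun t ht => by
    have := hI (-t) (neg_mem_Icc_neg_one_one ht)
    rwa [mul_neg, ← neg_mul] at this
  have hsm := graphLift_contDiff upperFn_contDiff
  have hcov : ∀ X ∈ Icc 27 (45 - w₀), ∃ t ∈ Icc (-1 : ℝ) 1, p + m * t = X := fun X hX =>
    exists_affine hm (by rwa [h1, h2])
  refine ⟨affine_comp_contDiff hsm _ _, affine_comp_contDiff gLine_contDiff _ _,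
    fun t ht => Or.inl (vecOn_finger_upper (by linarith [(hI t ht).2])
      (mem_vecOn_affine hsm hm _ _)),
    fun t ht => Or.inr (vecOn_bend_gLine (by linarith [(hI' t ht).1])
      (mem_vecOn_affine_neg gLine_contDiff (neg_neg_of_pos hm) _ _)),
    ?_, fun t ht => ⟨hI t ht, ?_⟩, fun t ht => ⟨hI' t ht, ?_⟩, ?_, ?_, ?_⟩
  · rintro q (hq | hq) ⟨hB, hB'⟩ <;> obtain ⟨t, -, ht⟩ := mem_vecOn_iff.1 hq
    · rcases le_or_gt |t| 2 with ht2 | ht2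
      · have hq1 := congrArg Prod.fst (fst_of_mem_vecOn_singleton ht)
        have h3 : fingerX 1 2 ≤ fingerX 1 t := by
          rw [← fingerX_abs 1 t]
          exact (fingerX_strictAntiOn zero_le_one).antitoneOn (mem_Ici.2 (abs_nonneg t))
            (mem_Ici.2 zero_le_two) ht2
        rw [fingerX_two] at h3
        rw [hq1, fingerArc_fst] at hB
        have := hB.2
        simp only [secondRect] at this
        linarith
      rcases lt_abs.1 ht2 with ht2 | ht2
      · rw [vecOn_fingerArc_lower zero_le_one ht2] at ht
        have hq1 := fst_of_mem_vecOn_singleton ht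
        rw [hq1] at hB hB'
        -- The bottom of the rectangle, at height `14`, separates the two edges of the finger, at
        -- heights `8` and `20`.
        have h3 : (14 : ℝ) ≤ lowerFn (fingerX 1 t) := hB'.1
        rw [lowerFn_of_ge (by linarith [show (27 : ℝ) ≤ fingerX 1 t from hB.1])] at h3
        norm_num at h3
      · rw [vecOn_fingerArc_upper zero_le_one (by linarith)] at ht
        have hq1 := fst_of_mem_vecOn_singleton ht
        rw [hq1] at hB
        obtain ⟨u, hu, huX⟩ := hcov _ hB
        exact Or.inl ⟨u, hu, by simp only [huX, hq1]; rfl⟩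
    · rcases le_or_gt |t| 2 with ht2 | ht2
      · have hq1 := congrArg Prod.fst (fst_of_mem_vecOn_singleton ht)
        have h3 := bendX_le_iff.2 ht2
        rw [hq1, bendArc_fst] at hB
        have := hB.1
        simp only [secondRect] at this
        linarith
      rcases lt_abs.1 ht2 with ht2 | ht2
      · rw [vecOn_bendArc_right ht2] at ht
        have hq1 := fst_of_mem_vecOn_singleton ht
        rw [hq1] at hB hB'
        have h3 : (14 : ℝ) ≤ -(-3 + ω t) := hB'.1
        have h4 : (27 : ℝ) ≤ -3 + ω t := hB.1
        linarith
      · rw [vecOn_bendArc_left (by linarith)] at ht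
        have hq1 := fst_of_mem_vecOn_singleton ht
        rw [hq1] at hB
        obtain ⟨u, hu, huX⟩ := hcov _ hB
        refine Or.inr ⟨-u, neg_mem_Icc_neg_one_one hu, ?_⟩
        simp only [neg_mul_neg, huX, hq1]
        rfl
  · simp only [graphLift, upperFn_of_ge (by linarith [(hI t ht).1] : -18 ≤ p + m * t)]
    norm_num [secondRect]
  · have := hI' t ht; simp only [gLine, secondRect]; constructor <;> linarith [this.1, this.2]
  · intro s hs t ht hst
    have := congrArg Prod.fst hst
    simp only [Function.comp_apply, front, graphLift] at this
    exact mul_left_cancel₀ hm.ne' (by linarith)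
  · intro s hs t ht hst
    have := congrArg Prod.fst hst
    simp only [Function.comp_apply, front, gLine] at this
    exact mul_left_cancel₀ hm.ne' (by linarith)
  · intro s hs t ht hst
    have h3 := congrArg Prod.fst hst
    have h4 := (Prod.ext_iff.1 hst).2
    simp only [front, gLine, graphLift,
      upperFn_of_ge (by linarith [(hI s hs).1] : -18 ≤ p + m * s)] at h3 h4
    have := (hI s hs).1
    linarith

theorem isTangleOver_hook_snake (ε : ℝ) :
    IsTangleOver ε (vecOn ε hookArc univ ∪ vecOn (-ε) snakeArc univ) secondRect
      (fun t => hookArc (30 + 3 * t)) (fun t => snakeArc (268 + 73 * w₀ + -13 * t)) := by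
  have hw := absDefect_nonneg
  have hw' := absDefect_le
  have ha : ∀ t ∈ Icc (-1 : ℝ) 1, |30 + 3 * t - 30| ≤ 3 := fun t ht =>
    abs_le.2 ⟨by linarith [ht.1], by linarith [ht.2]⟩
  have hb : ∀ t ∈ Icc (-1 : ℝ) 1, |268 + 73 * w₀ + -13 * t - (268 + 73 * w₀)| ≤ 13 := fun t ht =>
    abs_le.2 ⟨by linarith [ht.2], by linarith [ht.1]⟩
  refine ⟨affine_comp_contDiff hookArc_contDiff _ _, affine_comp_contDiff snakeArc_contDiff _ _,
    fun t ht => Or.inl (mem_vecOn_univ (mem_vecOn_affine hookArc_contDiff (by norm_num) _ _)),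
    fun t ht => Or.inr (mem_vecOn_univ
      (mem_vecOn_affine_neg snakeArc_contDiff (by norm_num) _ _)),
    ?_, fun t ht => ⟨(mem_second_of_hook (ha t ht)).1, ?_⟩,
    fun t ht => ⟨(mem_second_of_snake (hb t ht)).1, ?_⟩, ?_, ?_, ?_⟩
  · rintro q (hq | hq) ⟨hB, hB'⟩ <;> obtain ⟨t, -, ht⟩ := mem_vecOn_iff.1 hq <;>
      have hq1 := fst_of_mem_vecOn_singleton ht <;> rw [hq1] at hB hB'
    · have h1 : 27 ≤ hookX t := hB.1
      have h2 : 14 ≤ (hookArc t).2.2 := hB'.1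
      rw [hookArc_snd_snd] at h2
      have h3 : |t - 30| ≤ 3 := by
        by_contra! h3
        rcases lt_abs.1 h3 with h4 | h4
        · rcases lt_or_ge t (61 + w₀) with h5 | h5
          · rw [hookX_mid (by linarith) h5.le] at h1; linarith
          rcases le_or_gt t (65 + w₀) with h6 | h6
          · linarith [hookX_nonpos (t := t) (by linarith) h6]
          · rw [hookZ_end h6.le] at h2; linarith
        · rw [hookX_start (by linarith)] at h1; linarith
      obtain ⟨u, hu, rfl⟩ := exists_affine (p := 30) (m := 3) (X := t) (by norm_num)
        ⟨by linarith [(abs_le.1 h3).1], by linarith [(abs_le.1 h3).2]⟩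
      exact Or.inl ⟨u, hu, hq1.symm⟩
    · have h1 : 27 ≤ snakeX t := hB.1
      have h1' : snakeX t ≤ 45 - w₀ := hB.2
      have h2 : 14 ≤ (snakeArc t).2.2 := hB'.1
      have h3 : |t - (268 + 73 * w₀)| ≤ 13 := by
        by_contra! h3
        rcases lt_abs.1 h3 with h4 | h4
        · linarith [snakeX_gt_of_gt (t := t) (by linarith)]
        · rcases le_or_gt t (78 + 36 * w₀) with h5 | h5
          · rw [snakeX_start h5] at h1
            rw [snakeArc_z_start h5, lowerFn_of_ge (by linarith)] at h2
            linarith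
          rcases le_or_gt t (222 + 36 * w₀) with h6 | h6
          · linarith [snakeX_mid h5.le h6]
          · rw [snakeX_second h6.le (by linarith)] at h1'
            linarith
      obtain ⟨u, hu, hut⟩ := exists_affine (p := 268 + 73 * w₀) (m := 13) (X := t) (by norm_num)
        ⟨by linarith [(abs_le.1 h3).1], by linarith [(abs_le.1 h3).2]⟩
      refine Or.inr ⟨-u, neg_mem_Icc_neg_one_one hu, ?_⟩
      simp only [neg_mul_neg, hut, hq1]
  · have := (hookArc_range_second (ha t ht)).2
    exact ⟨lt_of_lt_of_le (by norm_num [secondRect]) this.1,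
      lt_of_le_of_lt this.2 (by norm_num [secondRect])⟩
  · have := (snakeArc_range_second (hb t ht)).2
    exact ⟨lt_of_lt_of_le (by norm_num [secondRect]) this.1,
      lt_of_le_of_lt this.2 (by norm_num [secondRect])⟩
  · have key : ∀ s ∈ Icc (-1 : ℝ) 1, ∀ t ∈ Icc (-1 : ℝ) 1, s < t →
        front (hookArc (30 + 3 * s)) ≠ front (hookArc (30 + 3 * t)) := by
      intro s hs t ht hlt hst
      have h1 := congrArg Prod.fst hst
      have h2 := (Prod.ext_iff.1 hst).2
      simp only [front, hookArc_snd_snd] at h2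
      -- No double point of the hook has both its parameters in `[27, 33]`.
      rcases hook_front (left_mem_Icc.2 zero_le_one) (by linarith : 30 + 3 * s < 30 + 3 * t) h1 h2
        with h | h
      · linarith [hs.1]
      · linarith [hs.2]
    intro s hs t ht hst
    rcases lt_trichotomy s t with h | h | h
    · exact absurd hst (key s hs t ht h)
    · exact h
    · exact absurd hst.symm (key t ht s hs h)
  · intro s hs t ht hst
    have h1 : snakeX _ = snakeX _ := congrArg Prod.fst hst
    have h2 := (Prod.ext_iff.1 hst).2
    simp only [Function.comp_apply, front] at h2
    rcases lt_trichotomy s t with h | h | h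
    · exact absurd h2.symm (snakeArc_front_inj (by linarith) h1.symm)
    · exact h
    · exact absurd h2 (snakeArc_front_inj (by linarith) h1)
  -- The new cusped piece of the hook stays in `x ≤ 30 - w₀`, that of the snake in `x ≥ 32`.
  · intro s hs t ht hst
    have h1 : hookX (30 + 3 * s) = snakeX (268 + 73 * w₀ + -13 * t) := congrArg Prod.fst hst
    have h2 := (hookArc_range_second (ha s hs)).1.2
    have h3 := (snakeArc_range_second (hb t ht)).1.1
    linarith

/-- The second surgery at the model crossing. -/
theorem isLegendrianSurgery_second {ε : ℝ} (hε : ε = 1 ∨ ε = -1) {V : Set (R3 × R3)}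
    {L₁ L L' : LegendrianLink} (hL₁ : LegendrianIsotopic L₁ L)
    (hL : L.vec = replaceVec V ε ε (fingerArc 1) bendArc)
    (hL' : L'.vec = replaceVec V ε (-ε) hookArc snakeArc) : IsLegendrianSurgery L₁ L' := by
  have hw := absDefect_nonneg
  obtain ⟨p, m, hm, h1, h2, hT⟩ := isTangleOver_finger_second ε
  have hT' := hT.replaceVec (V := V) secondRect_cylinder
  rw [← hL] at hT'
  have hT2 := (isTangleOver_hook_snake ε).replaceVec (V := V) secondRect_cylinder
  rw [← hL'] at hT2
  refine ⟨L, L', hL₁, LegendrianIsotopic.refl L', secondRect, agreeOutside_replaceVec hL hL'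
    fun q hq => ⟨agree_second_subset hq, agree_second_superset hq⟩, ?_, ?_⟩
  · refine hT'.isBasicZeroTangle hε ?_ ?_ ?_ ?_ ?_ ?_
    · intro t _
      rw [deriv_fst_affine (graphLift_contDiff upperFn_contDiff) p m (x' := 1) (hasDerivAt_id _),
        mul_one]
      exact hm.ne'
    · intro t _
      rw [deriv_fst_affine gLine_contDiff p (-m) (x' := 1) (hasDerivAt_id _), mul_one]
      exact (neg_neg_of_pos hm).ne
    all_goals simp only [graphLift, gLine, secondRect]; linarith
  · refine hT2.isBasicInftyTangle hε ?_ ?_ ?_ ?_ ?_ ?_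
    · refine hasOneCusp_of_smoothAbs hT2.smooth_left (p := 30 - w₀) (k := -1) (m := 3)
        (by norm_num) (by norm_num) fun t ht => ?_
      change hookX (30 + 3 * t) = _
      rw [hookX_left (by linarith [ht.2])]
      ring_nf
    · refine hasOneCusp_of_smoothAbs hT2.smooth_right (p := 32) (k := 1) (m := -13) (by norm_num)
        (by norm_num) fun t ht => ?_
      change snakeX (268 + 73 * w₀ + -13 * t) = _
      rw [snakeX_right (by linarith [ht.2]), smoothSign_of_le (by linarith [ht.1]),
        show 268 + 73 * w₀ + -13 * t - (268 + 73 * w₀) = -13 * t by ring]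
      ring
    · change hookX _ = 27
      rw [hookX_start (by norm_num)]; norm_num
    · change hookX _ = 27
      rw [hookX_mid (by norm_num) (by linarith)]; norm_num
    · change snakeX _ = 45 - w₀
      rw [← snakeX_exit]; congr 1; ring
    · change snakeX _ = 45 - w₀
      rw [snakeX_second (by linarith) (by linarith)]; ring

end

/-! ### Both surgeries at the model crossing -/

/-- The two surgeries at a model crossing. -/
theorem exists_surgeries_model {ε : ℝ} (hε : ε = 1 ∨ ε = -1) {N : LegendrianLink}
    (hN : HasModelCrossing ε N.vec) : ∃ N₁ N₀ : LegendrianLink,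
      IsLegendrianSurgery N N₁ ∧ IsLegendrianSurgery N₁ N₀ ∧
      (∀ q : R3 × R3, q.1 ∉ modelCyl → (q ∈ N.vec ↔ q ∈ N₁.vec)) ∧
      (∀ q : R3 × R3, q.1 ∉ modelCyl → (q ∈ N.vec ↔ q ∈ N₀.vec)) ∧
      AmbientIsotopic N₀.carrier (Prod.fst '' replaceVec N.vec ε (-ε) topLine gLine) := by
  have hε' : -ε = 1 ∨ -ε = -1 := by rcases hε with rfl | rfl <;> norm_num
  have hε0 : ε ≠ 0 := by rcases hε with rfl | rfl <;> norm_num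
  have hout : ∀ {L : LegendrianLink} {ε' : ℝ} {a b : ℝ → R3}, L.vec = replaceVec N.vec ε ε' a b →
      ∀ q : R3 × R3, q.1 ∉ modelCyl → (q ∈ N.vec ↔ q ∈ L.vec) := fun h q hq => by
    simp [h, replaceVec, hq]
  obtain ⟨N₁, h₁⟩ := exists_legendrianLink_replaceVec N hN hε hε
    (isTanglePair_finger ε (left_mem_Icc.2 zero_le_one)) (contactForm_fingerArc 0)
    contactForm_bendArc
  obtain ⟨N₁', h₁'⟩ := exists_legendrianLink_replaceVec N hN hε hε
    (isTanglePair_finger ε (right_mem_Icc.2 zero_le_one)) (contactForm_fingerArc 1)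
    contactForm_bendArc
  obtain ⟨N₀, h₀⟩ := exists_legendrianLink_replaceVec N hN hε hε' (isTanglePair_hook_snake ε)
    contactForm_hookArc contactForm_snakeArc
  refine ⟨N₁, N₀, isLegendrianSurgery_first hε hN h₁,
    isLegendrianSurgery_second hε (legendrianIsotopic_finger hε0 h₁ h₁') h₁' h₀,
    hout h₁, hout h₀, ?_⟩
  rw [OrientedLink.carrier, h₀]
  exact ambientIsotopic_model hN N.isCompact_points.isClosed

/-! ### Composition of Legendrian isotopies -/

/-- The isotopies are run one after the other with a pause: `S (3 t)` is constant for `t ≥ 1/3` and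
`S (3 t - 2)` for `t ≤ 2/3`. So the family is smooth, and at each time at most one of the two maps
moves. -/
theorem LegendrianIsotopic.trans {L₁ L₂ L₃ : LegendrianLink} (h : LegendrianIsotopic L₁ L₂)
    (h' : LegendrianIsotopic L₂ L₃) : LegendrianIsotopic L₁ L₃ := by
  obtain ⟨φ, hφ, φ0, hφL, hφ1⟩ := h
  obtain ⟨ψ, hψ, ψ0, hψL, hψ1⟩ := h'
  let S := Real.smoothTransition
  have hS : ContDiff ℝ ∞ S := Real.smoothTransition.contDiff
  have hSm : ∀ t, S t ∈ Icc (0 : ℝ) 1 := fun t =>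
    ⟨Real.smoothTransition.nonneg t, Real.smoothTransition.le_one t⟩
  have hφs : ∀ t, ContDiff ℝ ∞ (φ t) := fun t => hφ.comp (contDiff_const.prodMk contDiff_id)
  have hψs : ∀ t, ContDiff ℝ ∞ (ψ t) := fun t => hψ.comp (contDiff_const.prodMk contDiff_id)
  have hcomp : ∀ s t p, fderiv ℝ (fun p => ψ s (φ t p)) p = (fderiv ℝ (ψ s) (φ t p)).comp
      (fderiv ℝ (φ t) p) := fun s t p =>
    fderiv_comp p ((hψs s).differentiable (by simp) _) ((hφs t).differentiable (by simp) _)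
  have hcar : ∀ q ∈ L₁.vec, (φ 1 q.1, fderiv ℝ (φ 1) q.1 q.2) ∈ L₂.vec := fun q hq =>
    hφ1 ▸ mem_image_of_mem _ hq
  have hS1 : ∀ {t : ℝ}, 1 ≤ t → S t = 1 := Real.smoothTransition.one_of_one_le
  have hS0 : ∀ {t : ℝ}, t ≤ 0 → S t = 0 := Real.smoothTransition.zero_of_nonpos
  refine ⟨fun t p => ψ (S (3 * t - 2)) (φ (S (3 * t)) p), ?_, fun p => ?_, fun t _ => ?_, ?_⟩
  · exact hψ.comp ((hS.comp ((contDiff_const.mul contDiff_fst).sub contDiff_const)).prodMk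
      (hφ.comp ((hS.comp (contDiff_const.mul contDiff_fst)).prodMk contDiff_snd)))
  · change ψ (S (3 * 0 - 2)) (φ (S (3 * 0)) p) = p
    rw [hS0 (by norm_num), hS0 (by norm_num), ψ0, φ0]
  · dsimp only
    rcases le_total t (1 / 2) with ht | ht
    · rw [show S (3 * t - 2) = 0 from hS0 (by linarith)]
      simp only [ψ0]
      exact hφL _ (hSm _)
    · rw [show S (3 * t) = 1 from hS1 (by linarith)]
      obtain ⟨hinj, hvec⟩ := hψL _ (hSm (3 * t - 2))
      refine ⟨fun p hp q hq hpq => ?_, fun q hq => ?_⟩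
      · refine (hφL 1 (right_mem_Icc.2 zero_le_one)).1 hp hq (hinj ?_ ?_ hpq)
        · obtain ⟨q, hq, rfl⟩ := hp; exact ⟨_, hcar q hq, rfl⟩
        · obtain ⟨q, hq, rfl⟩ := hq; exact ⟨_, hcar q hq, rfl⟩
      · rw [hcomp]
        exact hvec _ (hcar q hq)
  · rw [← hψ1, ← hφ1, image_image]
    dsimp only
    rw [show S (3 * 1 - 2) = 1 from hS1 (by norm_num), show S (3 * 1) = 1 from hS1 (by norm_num)]
    refine image_congr fun q _ => ?_
    rw [hcomp]
    rfl

/-! ### Diffeomorphisms acting on links -/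

/-- The action of a smooth map on tangent vectors. -/
noncomputable def pushVec (F : R3 → R3) (q : R3 × R3) : R3 × R3 := (F q.1, fderiv ℝ F q.1 q.2)

theorem pushVec_pushVec {F G : R3 → R3} (hF : ContDiff ℝ ∞ F) (hG : ContDiff ℝ ∞ G)
    (hGF : ∀ p, G (F p) = p) (q : R3 × R3) : pushVec G (pushVec F q) = q := by
  have h : fderiv ℝ (fun p => G (F p)) q.1 = (fderiv ℝ G (F q.1)).comp (fderiv ℝ F q.1) :=
    fderiv_comp q.1 (hG.differentiable (by simp) _) (hF.differentiable (by simp) _)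
  rw [funext hGF, fderiv_fun_id] at h
  refine Prod.ext (hGF q.1) ?_
  exact (DFunLike.congr_fun h q.2).symm

theorem mem_pushVec_image {F G : R3 → R3} (hF : ContDiff ℝ ∞ F) (hG : ContDiff ℝ ∞ G)
    (hGF : ∀ p, G (F p) = p) (hFG : ∀ p, F (G p) = p) {V : Set (R3 × R3)} {q : R3 × R3} :
    q ∈ pushVec F '' V ↔ pushVec G q ∈ V := by
  constructor
  · rintro ⟨r, hr, rfl⟩
    rwa [pushVec_pushVec hF hG hGF]
  · intro h
    exact ⟨_, h, pushVec_pushVec hG hF hFG q⟩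

theorem fst_image_pushVec (F : R3 → R3) (V : Set (R3 × R3)) :
    Prod.fst '' (pushVec F '' V) = F '' (Prod.fst '' V) := by
  rw [image_image, image_image]; rfl

/-- The image of a link under a diffeomorphism. -/
noncomputable def OrientedLink.map (L : OrientedLink) (F G : R3 → R3) (hF : ContDiff ℝ ∞ F)
    (hG : ContDiff ℝ ∞ G) (hGF : ∀ p, G (F p) = p) : OrientedLink where
  vec := pushVec F '' L.vec
  isCompact_points := by
    rw [fst_image_pushVec]
    exact L.isCompact_points.image hF.continuous
  chart := by
    rw [fst_image_pushVec]
    rintro _ ⟨p, hp, rfl⟩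
    obtain ⟨U, I, γ, τ, hU, hpU, hI, hγ, hτ, hinv, hset⟩ := L.chart p hp
    have hγU : ∀ t ∈ I, γ t ∈ U := fun t ht => by
      have : (γ t, (1 : ℝ) • deriv γ t) ∈ {q ∈ L.vec | q.1 ∈ U} := by
        rw [hset]; exact ⟨t, ht, 1, one_pos, rfl⟩
      exact this.2
    have hd : ∀ t ∈ I, deriv (fun t => F (γ t)) t = fderiv ℝ F (γ t) (deriv γ t) := fun t ht =>
      ((hF.differentiable (by simp) (γ t)).hasFDerivAt.comp_hasDerivAt t
        ((hγ.contDiffAt (hI.mem_nhds ht)).differentiableAt (by simp)).hasDerivAt).deriv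
    refine ⟨G ⁻¹' U, I, fun t => F (γ t), fun q => τ (G q), hU.preimage hG.continuous,
      by rwa [mem_preimage, hGF], hI, hF.comp_contDiffOn hγ,
      hτ.comp hG.contDiffOn (fun q hq => hq), fun t ht => by simp only [hGF, hinv t ht], ?_⟩
    ext q
    constructor
    · rintro ⟨⟨r, hr, rfl⟩, hq⟩
      have : r ∈ {q ∈ L.vec | q.1 ∈ U} := ⟨hr, by simpa [pushVec, hGF] using hq⟩
      rw [hset] at this
      obtain ⟨t, ht, c, hc, rfl⟩ := this
      exact ⟨t, ht, c, hc, by rw [hd t ht, pushVec, map_smul]⟩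
    · rintro ⟨t, ht, c, hc, rfl⟩
      have : (γ t, c • deriv γ t) ∈ {q ∈ L.vec | q.1 ∈ U} := by
        rw [hset]; exact ⟨t, ht, c, hc, rfl⟩
      refine ⟨⟨_, this.1, ?_⟩, ?_⟩
      · rw [hd t ht, pushVec, map_smul]
      · rw [mem_preimage, hGF]; exact this.2

/-- An isotopy of three-space through contact diffeomorphisms which ends with a diffeomorphism
with inverse `G`. -/
structure IsContactIsotopy (F : ℝ → R3 → R3) (G : R3 → R3) : Prop where
  smooth : ContDiff ℝ ∞ (fun w : ℝ × R3 => F w.1 w.2)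
  smooth_inv : ContDiff ℝ ∞ G
  zero : ∀ p, F 0 p = p
  left_inv : ∀ p, G (F 1 p) = p
  right_inv : ∀ p, F 1 (G p) = p
  inj : ∀ t, Function.Injective (F t)
  imm : ∀ t p v, fderiv ℝ (F t) p v = 0 → v = 0
  contact : ∀ t p v, contactForm (F t p) (fderiv ℝ (F t) p v) = 0 ↔ contactForm p v = 0

namespace IsContactIsotopy

variable {F : ℝ → R3 → R3} {G : R3 → R3}

theorem smooth_at (h : IsContactIsotopy F G) (t : ℝ) : ContDiff ℝ ∞ (F t) :=
  h.smooth.comp (contDiff_const.prodMk contDiff_id)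

theorem exists_map (h : IsContactIsotopy F G) (L : LegendrianLink) :
    ∃ L' : LegendrianLink, L'.vec = pushVec (F 1) '' L.vec :=
  ⟨{ L.toOrientedLink.map (F 1) G (h.smooth_at 1) h.smooth_inv h.left_inv with
      legendrian := by
        rintro _ ⟨q, hq, rfl⟩
        exact (h.contact 1 q.1 q.2).2 (L.legendrian q hq) }, rfl⟩

theorem exists_comap (h : IsContactIsotopy F G) (L : LegendrianLink) :
    ∃ L' : LegendrianLink, L'.vec = pushVec G '' L.vec :=
  ⟨{ L.toOrientedLink.map G (F 1) h.smooth_inv (h.smooth_at 1) h.right_inv with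
      legendrian := by
        rintro _ ⟨q, hq, rfl⟩
        have := pushVec_pushVec h.smooth_inv (h.smooth_at 1) h.right_inv q
        refine (h.contact 1 _ _).1 ?_
        change contactForm (pushVec (F 1) (pushVec G q)).1
          (pushVec (F 1) (pushVec G q)).2 = 0
        rw [this]
        exact L.legendrian q hq }, rfl⟩

theorem legendrianIsotopic (h : IsContactIsotopy F G) {L L' : LegendrianLink}
    (hL : L'.vec = pushVec (F 1) '' L.vec) : LegendrianIsotopic L L' :=
  ⟨F, h.smooth, h.zero, fun t _ => ⟨(h.inj t).injOn, fun q hq =>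
    ⟨fun h0 => L.vec_ne_zero hq (h.imm t q.1 q.2 h0), (h.contact t _ _).2 (L.legendrian q hq)⟩⟩,
    hL.symm⟩

/-- The isotopy is run backwards from the image as `F (1 - t) ∘ G`, which is defined on all of space
because `F 1` is invertible. -/
theorem legendrianIsotopic_symm (h : IsContactIsotopy F G) {L L' : LegendrianLink}
    (hL : L'.vec = pushVec (F 1) '' L.vec) : LegendrianIsotopic L' L := by
  have hcomp : ∀ t (q : R3 × R3), fderiv ℝ (fun p => F t (G p)) (F 1 q.1)
      (fderiv ℝ (F 1) q.1 q.2) = fderiv ℝ (F t) q.1 q.2 := fun t q => by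
    have h1 : fderiv ℝ (fun p => (fun p => F t (G p)) (F 1 p)) q.1 =
        (fderiv ℝ (fun p => F t (G p)) (F 1 q.1)).comp (fderiv ℝ (F 1) q.1) :=
      fderiv_comp q.1 (((h.smooth_at t).comp h.smooth_inv).differentiable (by simp) _)
        ((h.smooth_at 1).differentiable (by simp) _)
    simp only [h.left_inv] at h1
    exact (DFunLike.congr_fun h1 q.2).symm
  refine ⟨fun t p => F (1 - t) (G p), h.smooth.comp ((contDiff_const (c := (1 : ℝ)).sub contDiff_fst).prodMk
      (h.smooth_inv.comp contDiff_snd)), fun p => ?_, fun t _ => ⟨?_, ?_⟩, ?_⟩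
  · simpa using h.right_inv p
  · intro p _ q _ hpq
    exact (Function.LeftInverse.injective h.right_inv) (h.inj _ hpq)
  · rw [hL]
    rintro _ ⟨q, hq, rfl⟩
    simp only [pushVec, hcomp, h.left_inv]
    exact ⟨fun h0 => L.vec_ne_zero hq (h.imm _ q.1 q.2 h0),
      (h.contact _ _ _).2 (L.legendrian q hq)⟩
  · rw [hL, image_image]
    have : ∀ q : R3 × R3, (F (1 - 1) (G (pushVec (F 1) q).1),
        fderiv ℝ (fun p => F (1 - 1) (G p)) (pushVec (F 1) q).1 (pushVec (F 1) q).2) = q := by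
      intro q
      simp only [pushVec, hcomp, h.left_inv, sub_self]
      rw [show F 0 = fun p => p from funext h.zero, fderiv_fun_id]
      rfl
    simp only [this, image_id']

/-- Surgery is defined up to Legendrian isotopy, and a contact isotopy joins each link with its
image. So a surgery between the images is already one between the links, and no tangle has to be
transported. -/
theorem isLegendrianSurgery (h : IsContactIsotopy F G) {L₁ L₂ L₁' L₂' : LegendrianLink}
    (h₁ : L₁'.vec = pushVec (F 1) '' L₁.vec) (h₂ : L₂'.vec = pushVec (F 1) '' L₂.vec)
    (hs : IsLegendrianSurgery L₁' L₂') : IsLegendrianSurgery L₁ L₂ := by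
  obtain ⟨M, M', hM, hM', h'⟩ := hs
  exact ⟨M, M', (h.legendrianIsotopic h₁).trans hM, hM'.trans (h.legendrianIsotopic_symm h₂), h'⟩

end IsContactIsotopy

theorem AmbientIsotopic.image {S T : Set R3} (h : AmbientIsotopic S T) {F G : R3 → R3}
    (hF : ContDiff ℝ ∞ F) (hG : ContDiff ℝ ∞ G) (hGF : ∀ p, G (F p) = p)
    (hFG : ∀ p, F (G p) = p) : AmbientIsotopic (F '' S) (F '' T) := by
  obtain ⟨Φ, Ψ, hΦ, hΨ, hi, h0, h1⟩ := h
  refine ⟨fun t p => F (Φ t (G p)), fun t p => F (Ψ t (G p)),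
    hF.comp (hΦ.comp (contDiff_fst.prodMk (hG.comp contDiff_snd))),
    hF.comp (hΨ.comp (contDiff_fst.prodMk (hG.comp contDiff_snd))), fun t p => ?_, fun p => ?_, ?_⟩
  · simp [hGF, hFG, (hi _ _).1, (hi _ _).2]
  · simp [h0, hFG]
  · simp only [image_image, hGF, ← h1]

/-! ### Contact diffeomorphisms which preserve the vertical direction -/

/-- The contact diffeomorphism with front `(x, z) ↦ (ψ x, m (z - G x))`, interpolated with the
identity. -/
noncomputable def frontMap (ψ G : ℝ → ℝ) (m s : ℝ) (p : R3) : R3 :=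
  ((1 - s) * p.1 + s * ψ p.1,
    (1 - s + s * m) * (p.2.1 - s * deriv G p.1) / (1 - s + s * deriv ψ p.1),
    (1 - s + s * m) * (p.2.2 - s * G p.1))

/-- The inverse of `frontMap ψ G m 1`, where `χ` is the inverse of `ψ`. -/
noncomputable def frontInv (ψ χ G : ℝ → ℝ) (m : ℝ) (p : R3) : R3 :=
  (χ p.1, p.2.1 * deriv ψ (χ p.1) / m + deriv G (χ p.1), p.2.2 / m + G (χ p.1))

theorem frontMap_one (ψ G : ℝ → ℝ) (m : ℝ) (p : R3) : frontMap ψ G m 1 p =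
    (ψ p.1, m * (p.2.1 - deriv G p.1) / deriv ψ p.1, m * (p.2.2 - G p.1)) := by
  simp [frontMap]

theorem convex_comb_pos {s m : ℝ} (hs : s ∈ Icc (0 : ℝ) 1) (hm : 0 < m) : 0 < 1 - s + s * m := by
  rcases hs.1.eq_or_lt with rfl | h
  · norm_num
  · have := mul_pos h hm
    linarith [hs.2]

section

variable {ψ χ G : ℝ → ℝ} {m : ℝ}

theorem frontMap_contDiffAt (hψ : ContDiff ℝ ∞ ψ) (hG : ContDiff ℝ ∞ G) {w : ℝ × R3}
    (hw : 1 - w.1 + w.1 * deriv ψ w.2.1 ≠ 0) :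
    ContDiffAt ℝ ∞ (fun w : ℝ × R3 => frontMap ψ G m w.1 w.2) w := by
  have hψ' := (contDiff_infty_iff_deriv.1 hψ).2
  have hG' := (contDiff_infty_iff_deriv.1 hG).2
  unfold frontMap
  refine ContDiffAt.prodMk (by fun_prop) (ContDiffAt.prodMk ?_ (by fun_prop))
  exact ContDiffAt.div (by fun_prop) (by fun_prop) hw

theorem hasDerivAt_frontMap_fst (hψ : ContDiff ℝ ∞ ψ) (s : ℝ) (p v : R3) :
    HasDerivAt (fun t : ℝ => (frontMap ψ G m s (p + t • v)).1)
      ((1 - s + s * deriv ψ p.1) * v.1) 0 := by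
  have hx : HasDerivAt (fun t : ℝ => p.1 + t * v.1) v.1 0 := by
    simpa using ((hasDerivAt_id (0 : ℝ)).mul_const v.1).const_add p.1
  have hd : HasDerivAt ψ (deriv ψ p.1) (p.1 + 0 * v.1) := by
    simpa using (hψ.differentiable (by simp) p.1).hasDerivAt
  have h := (hx.const_mul (1 - s)).add ((hd.comp (0 : ℝ) hx).const_mul s)
  refine (h.congr_deriv (by ring)).congr_of_eventuallyEq (Filter.Eventually.of_forall fun t => ?_)
  simp [frontMap]

theorem hasDerivAt_frontMap_snd_snd (hG : ContDiff ℝ ∞ G) (s : ℝ) (p v : R3) :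
    HasDerivAt (fun t : ℝ => (frontMap ψ G m s (p + t • v)).2.2)
      ((1 - s + s * m) * (v.2.2 - s * deriv G p.1 * v.1)) 0 := by
  have hx : HasDerivAt (fun t : ℝ => p.1 + t * v.1) v.1 0 := by
    simpa using ((hasDerivAt_id (0 : ℝ)).mul_const v.1).const_add p.1
  have hz : HasDerivAt (fun t : ℝ => p.2.2 + t * v.2.2) v.2.2 0 := by
    simpa using ((hasDerivAt_id (0 : ℝ)).mul_const v.2.2).const_add p.2.2
  have hd : HasDerivAt G (deriv G p.1) (p.1 + 0 * v.1) := by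
    simpa using (hG.differentiable (by simp) p.1).hasDerivAt
  have h := (hz.sub ((hd.comp (0 : ℝ) hx).const_mul s)).const_mul (1 - s + s * m)
  refine (h.congr_deriv (by ring)).congr_of_eventuallyEq (Filter.Eventually.of_forall fun t => ?_)
  simp [frontMap]

/-- The `y`-coordinate of `frontMap` is the slope of the transformed front, and the contact form is
multiplied by the constant `1 - s + s m`. Positivity of `m` and of `deriv ψ` keeps all factors
positive for `s ∈ [0, 1]`, which gives injectivity of the maps and of their differentials along the
whole path. -/
theorem isContactIsotopy_frontMap (hψ : ContDiff ℝ ∞ ψ) (hψ' : ∀ x, 0 < deriv ψ x)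
    (hχ : ContDiff ℝ ∞ χ) (hχψ : ∀ x, χ (ψ x) = x) (hψχ : ∀ x, ψ (χ x) = x)
    (hG : ContDiff ℝ ∞ G) (hm : 0 < m) :
    IsContactIsotopy (fun t => frontMap ψ G m (Real.smoothTransition t)) (frontInv ψ χ G m) := by
  have hS : ∀ t, Real.smoothTransition t ∈ Icc (0 : ℝ) 1 := fun t =>
    ⟨Real.smoothTransition.nonneg t, Real.smoothTransition.le_one t⟩
  have hD : ∀ t x, 0 < 1 - Real.smoothTransition t + Real.smoothTransition t * deriv ψ x :=
    fun t x => convex_comb_pos (hS t) (hψ' x)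
  have hM : ∀ t, 0 < 1 - Real.smoothTransition t + Real.smoothTransition t * m :=
    fun t => convex_comb_pos (hS t) hm
  have hsm : ContDiff ℝ ∞ (fun w : ℝ × R3 => frontMap ψ G m (Real.smoothTransition w.1) w.2) := by
    rw [contDiff_iff_contDiffAt]
    intro w
    have h1 := frontMap_contDiffAt (m := m) hψ hG (w := (Real.smoothTransition w.1, w.2))
      (hD w.1 w.2.1).ne'
    exact h1.comp w ((Real.smoothTransition.contDiff.comp contDiff_fst).prodMk
      contDiff_snd).contDiffAt
  -- The differential is read off coordinatewise along straight lines `p + τ v`.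
  have hline : ∀ t p v, HasDerivAt (fun τ : ℝ => frontMap ψ G m (Real.smoothTransition t) (p + τ • v))
      (fderiv ℝ (frontMap ψ G m (Real.smoothTransition t)) p v) 0 := fun t p v => by
    have h1 : HasDerivAt (fun τ : ℝ => p + τ • v) v 0 := by
      simpa using ((hasDerivAt_id (0 : ℝ)).smul_const v).const_add p
    have h2 : ContDiff ℝ ∞ (frontMap ψ G m (Real.smoothTransition t)) :=
      hsm.comp (contDiff_const.prodMk contDiff_id)
    have h3 : HasFDerivAt (frontMap ψ G m (Real.smoothTransition t))
        (fderiv ℝ (frontMap ψ G m (Real.smoothTransition t)) p) (p + (0 : ℝ) • v) := by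
      rw [zero_smul, add_zero]; exact (h2.differentiable (by simp) p).hasFDerivAt
    exact h3.comp_hasDerivAt (0 : ℝ) h1
  have h1 : ∀ t p v, (fderiv ℝ (frontMap ψ G m (Real.smoothTransition t)) p v).1 =
      (1 - Real.smoothTransition t + Real.smoothTransition t * deriv ψ p.1) * v.1 := fun t p v =>
    (hasDerivAt_coord_fst (hline t p v)).unique (hasDerivAt_frontMap_fst hψ _ p v)
  have h2 : ∀ t p v, (fderiv ℝ (frontMap ψ G m (Real.smoothTransition t)) p v).2.2 =
      (1 - Real.smoothTransition t + Real.smoothTransition t * m)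
        * (v.2.2 - Real.smoothTransition t * deriv G p.1 * v.1) := fun t p v =>
    (hasDerivAt_coord_snd_snd (hline t p v)).unique (hasDerivAt_frontMap_snd_snd hG _ p v)
  refine ⟨hsm, ?_, fun p => ?_, fun p => ?_, fun p => ?_, fun t p q hpq => ?_, fun t p v h0 => ?_,
    fun t p v => ?_⟩
  · have hψd := (contDiff_infty_iff_deriv.1 hψ).2
    have hGd := (contDiff_infty_iff_deriv.1 hG).2
    unfold frontInv
    fun_prop
  · simp [frontMap, Real.smoothTransition.zero]
  · rw [Real.smoothTransition.one, frontMap_one]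
    have := (hψ' p.1).ne'
    refine Prod.ext (hχψ _) (Prod.ext ?_ ?_)
    · simp only [frontInv, hχψ]; field_simp; ring
    · simp only [frontInv, hχψ]; field_simp; ring
  · rw [Real.smoothTransition.one, frontMap_one]
    have := (hψ' (χ p.1)).ne'
    refine Prod.ext (hψχ _) (Prod.ext ?_ ?_)
    · simp only [frontInv]; field_simp; ring
    · simp only [frontInv]; field_simp; ring
  · have hmono : StrictMono (fun x => (1 - Real.smoothTransition t) * x
        + Real.smoothTransition t * ψ x) := by
      refine strictMono_of_deriv_pos fun x => ?_
      have h := ((hasDerivAt_id x).const_mul (1 - Real.smoothTransition t)).add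
        ((hψ.differentiable (by simp) x).hasDerivAt.const_mul (Real.smoothTransition t))
      have h' : deriv (fun x => (1 - Real.smoothTransition t) * x + Real.smoothTransition t * ψ x) x
        = _ := h.deriv
      rw [h', mul_one]
      exact hD t x
    have e1 : p.1 = q.1 := hmono.injective (congrArg Prod.fst hpq)
    have e2 := (Prod.ext_iff.1 (Prod.ext_iff.1 hpq).2).1
    have e3 := (Prod.ext_iff.1 (Prod.ext_iff.1 hpq).2).2
    simp only [frontMap, e1] at e2 e3
    rw [div_left_inj' (hD t q.1).ne'] at e2
    have e2' := mul_left_cancel₀ (hM t).ne' e2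
    have e3' := mul_left_cancel₀ (hM t).ne' e3
    exact Prod.ext e1 (Prod.ext (by linarith) (by linarith))
  · have hv1 : v.1 = 0 := by
      have := h1 t p v
      rw [h0] at this
      exact (mul_eq_zero.1 this.symm).resolve_left (hD t p.1).ne'
    have hv3 : v.2.2 = 0 := by
      have := h2 t p v
      rw [h0, hv1, mul_zero, sub_zero] at this
      exact (mul_eq_zero.1 this.symm).resolve_left (hM t).ne'
    have h3 := hasDerivAt_coord_snd_fst (hline t p v)
    have hy : HasDerivAt (fun τ : ℝ => p.2.1 + τ * v.2.1) v.2.1 0 := by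
      simpa using ((hasDerivAt_id (0 : ℝ)).mul_const v.2.1).const_add p.2.1
    have h4 : HasDerivAt
        (fun τ : ℝ => (frontMap ψ G m (Real.smoothTransition t) (p + τ • v)).2.1)
        ((1 - Real.smoothTransition t + Real.smoothTransition t * m) * v.2.1
          / (1 - Real.smoothTransition t + Real.smoothTransition t * deriv ψ p.1)) 0 := by
      refine (((hy.sub_const (Real.smoothTransition t * deriv G p.1)).const_mul _).div_const
        _).congr_of_eventuallyEq (Filter.Eventually.of_forall fun τ => ?_)
      simp [frontMap, hv1]
    have h5 := h3.unique h4
    rw [h0] at h5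
    have hv2 : v.2.1 = 0 := by
      rcases div_eq_zero_iff.1 h5.symm with h | h
      · exact (mul_eq_zero.1 h).resolve_left (hM t).ne'
      · exact absurd h (hD t p.1).ne'
    exact Prod.ext hv1 (Prod.ext hv2 hv3)
  · have hD' := (hD t p.1).ne'
    have : contactForm (frontMap ψ G m (Real.smoothTransition t) p)
        (fderiv ℝ (frontMap ψ G m (Real.smoothTransition t)) p v) =
        (1 - Real.smoothTransition t + Real.smoothTransition t * m) * contactForm p v := by
      rw [contactForm, h1, h2, contactForm]
      simp only [frontMap]
      field_simp
      ring
    rw [this, mul_eq_zero, or_iff_right (hM t).ne']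

/-- A function with positive derivative can be extended to a diffeomorphism of the real line. -/
theorem exists_diffeo_of_deriv_pos {h : ℝ → ℝ} (hh : ContDiff ℝ ∞ h) {x₀ : ℝ} (h0 : h x₀ = 0)
    (h1 : 0 < deriv h x₀) : ∃ (ψ χ : ℝ → ℝ) (r : ℝ), 0 < r ∧ ContDiff ℝ ∞ ψ ∧ ContDiff ℝ ∞ χ ∧
      (∀ x, 0 < deriv ψ x) ∧ (∀ x, χ (ψ x) = x) ∧ (∀ x, ψ (χ x) = x) ∧
      ∀ x, |x - x₀| < r → ψ x = h x := by
  have hh' := (contDiff_infty_iff_deriv.1 hh).2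
  obtain ⟨R, hR, hpos⟩ := Metric.mem_nhds_iff.1
    ((isOpen_lt continuous_const hh'.continuous).mem_nhds h1)
  let b : ContDiffBump x₀ := ⟨R / 2, R, by linarith, by linarith⟩
  -- The new derivative equals `deriv h` near `x₀` and `1` far away. It is positive, since `deriv h`
  -- has weight zero outside the ball where it is known to be positive, and the value `1` far out
  -- makes the primitive surjective.
  let k : ℝ → ℝ := fun x => b x * deriv h x + (1 - b x)
  have hk : ContDiff ℝ ∞ k := (b.contDiff.mul hh').add (contDiff_const.sub b.contDiff)
  have hkpos : ∀ x, 0 < k x := fun x => by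
    by_cases hx : x ∈ Metric.ball x₀ R
    · have h2 : 0 < deriv h x := hpos hx
      have h3 := b.nonneg (x := x)
      have h4 := b.le_one (x := x)
      have := convex_comb_pos (s := b x) ⟨h3, h4⟩ h2
      change 0 < b x * deriv h x + (1 - b x)
      linarith
    · have : b x = 0 := by
        have hs := b.support_eq
        by_contra h
        exact hx (hs ▸ h)
      simp [k, this]
  let ψ : ℝ → ℝ := fun x => ∫ u in x₀..x, k u
  have hψd : ∀ x, HasDerivAt ψ (k x) x := fun x =>
    intervalIntegral.integral_hasDerivAt_right (hk.continuous.intervalIntegrable _ _)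
      (hk.continuous.stronglyMeasurableAtFilter _ _) hk.continuous.continuousAt
  have hψ : ContDiff ℝ ∞ ψ := by
    rw [contDiff_infty_iff_deriv]
    refine ⟨fun x => (hψd x).differentiableAt, ?_⟩
    rw [show deriv ψ = k from funext fun x => (hψd x).deriv]
    exact hk
  have hψ' : ∀ x, 0 < deriv ψ x := fun x => by rw [(hψd x).deriv]; exact hkpos x
  have hmono : StrictMono ψ := strictMono_of_deriv_pos hψ'
  have hfar : ∀ x, R ≤ |x - x₀| → k x = 1 := fun x hx => by
    have : b x = 0 := b.zero_of_le_dist (by rwa [Real.dist_eq])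
    simp [k, this]
  have hright : ∀ x, x₀ + R ≤ x → ψ x = ψ (x₀ + R) + (x - (x₀ + R)) := fun x hx => by
    have e : ψ x - ψ (x₀ + R) = ∫ u in (x₀ + R)..x, k u :=
      intervalIntegral.integral_interval_sub_left (hk.continuous.intervalIntegrable _ _)
        (hk.continuous.intervalIntegrable _ _)
    have e2 : ∫ u in (x₀ + R)..x, k u = ∫ u in (x₀ + R)..x, (1 : ℝ) :=
      intervalIntegral.integral_congr fun u hu => by
        rw [uIcc_of_le hx] at hu
        exact hfar u (by rw [abs_of_nonneg] <;> linarith [hu.1])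
    rw [e2, intervalIntegral.integral_const, smul_eq_mul, mul_one] at e
    linarith
  have hleft : ∀ x, x ≤ x₀ - R → ψ x = ψ (x₀ - R) + (x - (x₀ - R)) := fun x hx => by
    have e : ψ x - ψ (x₀ - R) = ∫ u in (x₀ - R)..x, k u :=
      intervalIntegral.integral_interval_sub_left (hk.continuous.intervalIntegrable _ _)
        (hk.continuous.intervalIntegrable _ _)
    have e2 : ∫ u in (x₀ - R)..x, k u = ∫ u in (x₀ - R)..x, (1 : ℝ) :=
      intervalIntegral.integral_congr fun u hu => by
        rw [uIcc_of_ge hx] at hu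
        exact hfar u (by rw [abs_of_nonpos] <;> linarith [hu.2])
    rw [e2, intervalIntegral.integral_const, smul_eq_mul, mul_one] at e
    linarith
  have hsurj : Function.Surjective ψ := by
    intro y
    have hlo : ψ (x₀ - R - |y - ψ (x₀ - R)|) ≤ y := by
      rw [hleft _ (by linarith [abs_nonneg (y - ψ (x₀ - R))])]
      linarith [neg_abs_le (y - ψ (x₀ - R))]
    have hhi : y ≤ ψ (x₀ + R + |y - ψ (x₀ + R)|) := by
      rw [hright _ (by linarith [abs_nonneg (y - ψ (x₀ + R))])]
      linarith [le_abs_self (y - ψ (x₀ + R))]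
    exact mem_range_of_exists_le_of_exists_ge hψ.continuous ⟨_, hlo⟩ ⟨_, hhi⟩
  obtain ⟨χ, hχ⟩ := hsurj.hasRightInverse
  have hχψ : ∀ x, χ (ψ x) = x := fun x => hmono.injective (hχ (ψ x))
  have hχs : ContDiff ℝ ∞ χ := by
    refine contDiff_inverse_of_injective_fderiv hψ (fun x => ?_) hχψ hχ
    rw [injective_iff_map_eq_zero]
    intro v hv
    have h2 : fderiv ℝ ψ x v = v * deriv ψ x := by
      rw [(hψd x).hasFDerivAt.fderiv, (hψd x).deriv]; simp
    rw [h2] at hv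
    exact (mul_eq_zero.1 hv).resolve_right (hψ' x).ne'
  refine ⟨ψ, χ, R / 2, by linarith, hψ, hχs, hψ', hχψ, hχ, fun x hx => ?_⟩
  have hb : ∀ u ∈ uIcc x₀ x, k u = deriv h u := fun u hu => by
    have h2 : |u - x₀| ≤ |x - x₀| := abs_sub_left_of_mem_uIcc hu
    have : b u = 1 := b.one_of_mem_closedBall (by
      rw [Metric.mem_closedBall, Real.dist_eq]; exact h2.trans hx.le)
    simp [k, this]
  change ∫ u in x₀..x, k u = h x
  rw [intervalIntegral.integral_congr hb, intervalIntegral.integral_deriv_eq_sub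
    (fun u _ => hh.differentiable (by simp) u) (hh'.continuous.intervalIntegrable _ _), h0, sub_zero]

end

/-! ### Curves contained in a link -/

theorem OrientedLink.exists_chart_carrier (L : OrientedLink) {p : R3} (hp : p ∈ L.carrier) :
    ∃ (U : Set R3) (I : Set ℝ) (γ : ℝ → R3) (τ : R3 → ℝ), IsOpen U ∧ p ∈ U ∧ IsOpen I ∧
      ContDiffOn ℝ ∞ γ I ∧ ContDiffOn ℝ ∞ τ U ∧ (∀ t ∈ I, τ (γ t) = t ∧ γ t ∈ L.carrier) ∧
      (∀ q ∈ L.carrier, q ∈ U → τ q ∈ I ∧ γ (τ q) = q) ∧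
      ∀ q v, q ∈ L.carrier → q ∈ U → ((q, v) ∈ L.vec ↔ ∃ c : ℝ, 0 < c ∧ v = c • deriv γ (τ q)) := by
  obtain ⟨U, I, γ, τ, hU, hpU, hI, hγ, hτ, hinv, hset⟩ := L.chart p hp
  have hmem : ∀ q ∈ L.carrier, q ∈ U → τ q ∈ I ∧ γ (τ q) = q := by
    rintro _ ⟨q, hq, rfl⟩ hqU
    have : q ∈ {q ∈ L.vec | q.1 ∈ U} := ⟨hq, hqU⟩
    rw [hset] at this
    obtain ⟨t, ht, c, -, rfl⟩ := this
    have e := hinv t ht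
    exact ⟨by simpa only [e] using ht, by simp only [e]⟩
  refine ⟨U, I, γ, τ, hU, hpU, hI, hγ, hτ, fun t ht => ⟨hinv t ht, ?_⟩, hmem, fun q v hq hqU => ?_⟩
  · have : (γ t, (1 : ℝ) • deriv γ t) ∈ {q ∈ L.vec | q.1 ∈ U} := by
      rw [hset]; exact ⟨t, ht, 1, one_pos, rfl⟩
    exact ⟨_, this.1, rfl⟩
  · have : (q, v) ∈ L.vec ↔ (q, v) ∈ {q ∈ L.vec | q.1 ∈ U} := ⟨fun h => ⟨h, hqU⟩, fun h => h.1⟩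
    rw [this, hset]
    constructor
    · rintro ⟨t, ht, c, hc, h⟩
      obtain ⟨rfl, rfl⟩ := Prod.mk.inj h
      rw [hinv t ht]
      exact ⟨c, hc, rfl⟩
    · rintro ⟨c, hc, rfl⟩
      obtain ⟨h1, h2⟩ := hmem q hq hqU
      exact ⟨τ q, h1, c, hc, by rw [h2]⟩

/-- A link which contains a curve on one side of `a` that is a graph over the `x`-axis is a graph
over the `x`-axis near the end point of the curve. -/
theorem OrientedLink.exists_local_graph (L : OrientedLink) {F : ℝ → R3} (hF : ContDiff ℝ ∞ F)
    (hF1 : ∀ x, (F x).1 = x) {a : ℝ} {A : Set ℝ} (haA : a ∈ A) (hA : UniqueDiffWithinAt ℝ A a)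
    (hFA : ∀ᶠ x in 𝓝[A] a, F x ∈ L.carrier) :
    ∃ Γ : ℝ → R3, ContDiffAt ℝ ∞ Γ a ∧ (∀ᶠ x in 𝓝 a, Γ x ∈ L.carrier ∧ (Γ x).1 = x) ∧
      Γ a = F a ∧ ∀ᶠ p in 𝓝 (F a), p ∈ L.carrier → p = Γ p.1 := by
  have ha : F a ∈ L.carrier := hFA.self_of_nhdsWithin haA
  obtain ⟨U, I, γ, τ, hU, hpU, hI, hγ, hτ, hinv, hmem, -⟩ := L.exists_chart_carrier ha
  obtain ⟨ht₀, hγt₀⟩ := hmem _ ha hpU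
  have hγd : HasDerivAt (fun t => (γ t).1) (deriv (fun t => (γ t).1) (τ (F a))) (τ (F a)) :=
    (((hγ.contDiffAt (hI.mem_nhds ht₀)).fst).differentiableAt (by simp)).hasDerivAt
  have hτF : ContDiffAt ℝ ∞ (fun x => τ (F x)) a :=
    (hτ.contDiffAt (hU.mem_nhds hpU)).comp a hF.contDiffAt
  have hsd := (hτF.differentiableAt (by simp)).hasDerivAt
  have h1 := ((hγd.comp a hsd).hasDerivWithinAt (s := A))
  have h2 : HasDerivWithinAt (fun x : ℝ => x) 1 A a := (hasDerivAt_id a).hasDerivWithinAt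
  have h3 : (fun x : ℝ => x) =ᶠ[𝓝[A] a] (fun t => (γ t).1) ∘ fun x => τ (F x) := by
    filter_upwards [hFA, mem_nhdsWithin_of_mem_nhds
      (hF.continuous.continuousAt.preimage_mem_nhds (hU.mem_nhds hpU))] with x hx hxU
    simp only [Function.comp_apply, (hmem _ hx hxU).2, hF1]
  -- Uniqueness of the derivative within `A`, applied to `x = (γ (τ (F x))).1`, shows that the chart
  -- has non-zero `x`-speed. It can therefore be reparametrised by `x` on both sides of `a`.
  have h4 := hA.eq_deriv _ h2 (h1.congr_of_eventuallyEq h3 (h3.self_of_nhdsWithin haA))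
  have hne : deriv (fun t => (γ t).1) (τ (F a)) ≠ 0 := fun h => by
    rw [h, zero_mul] at h4; exact one_ne_zero h4
  obtain ⟨σ, W, I', hW, hI', hmW, hmI, hII, hσ, hl, hr⟩ :=
    exists_open_smooth_inverse hI ht₀ hγ.fst hne
  have e : (γ (τ (F a))).1 = a := by rw [hγt₀, hF1]
  have hσa : σ a = τ (F a) := by have := (hl _ hmI).2; rwa [e] at this
  rw [e] at hmW
  refine ⟨fun x => γ (σ x), ?_, ?_, ?_, ?_⟩
  · refine ContDiffAt.comp a ?_ (hσ.contDiffAt (hW.mem_nhds hmW))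
    rw [hσa]
    exact hγ.contDiffAt (hI.mem_nhds ht₀)
  · filter_upwards [hW.mem_nhds hmW] with x hx
    obtain ⟨h5, h6⟩ := hr x hx
    exact ⟨(hinv _ (hII h5)).2, h6⟩
  · change γ (σ a) = F a
    rw [hσa, hγt₀]
  · have hc : ContinuousAt τ (F a) := (hτ.contDiffAt (hU.mem_nhds hpU)).continuousAt
    filter_upwards [hU.mem_nhds hpU, hc.preimage_mem_nhds (hI'.mem_nhds hmI)] with p hp hp' hpL
    obtain ⟨-, h5⟩ := hmem p hpL hp
    have := (hl _ hp').2
    simp only [h5] at this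
    simp only [this, h5]

/-- Near `x₀` the curve factors through a chart as `F = γ ∘ τ ∘ F`, and `τ ∘ F` has non-zero
derivative because `F` is immersed. The sign of that derivative is `ε`. -/
theorem OrientedLink.eventually_orientation (L : OrientedLink) {F : ℝ → R3}
    (hF : ContDiff ℝ ∞ F) {x₀ : ℝ} (himm : deriv F x₀ ≠ 0) (hFL : ∀ᶠ x in 𝓝 x₀, F x ∈ L.carrier) :
    ∃ ε : ℝ, (ε = 1 ∨ ε = -1) ∧ ∀ᶠ x in 𝓝 x₀, ∀ v, (F x, v) ∈ L.vec ↔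
      ∃ l : ℝ, 0 < l ∧ v = (l * ε) • deriv F x := by
  obtain ⟨U, I, γ, τ, hU, hpU, hI, hγ, hτ, hinv, hmem, hvec⟩ :=
    L.exists_chart_carrier hFL.self_of_nhds
  have hτF : ContDiffAt ℝ ∞ (fun x => τ (F x)) x₀ :=
    (hτ.contDiffAt (hU.mem_nhds hpU)).comp x₀ hF.contDiffAt
  have hFU := hF.continuous.continuousAt.preimage_mem_nhds (hU.mem_nhds hpU)
  have hsm : ∀ᶠ x in 𝓝 x₀, F x ∈ L.carrier ∧ F x ∈ U ∧
      deriv F x = deriv (fun x => τ (F x)) x • deriv γ (τ (F x)) := by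
    filter_upwards [hFL.eventually_nhds, hF.continuous.continuousAt.eventually_mem
      (hU.mem_nhds hpU)] with x hx hxU
    refine ⟨hx.self_of_nhds, hxU, ?_⟩
    have heq : F =ᶠ[𝓝 x] fun x => γ (τ (F x)) := by
      filter_upwards [hx, hF.continuous.continuousAt.preimage_mem_nhds (hU.mem_nhds hxU)]
        with y hy hyU using (hmem _ hy hyU).2.symm
    have h1 : DifferentiableAt ℝ (fun x => τ (F x)) x :=
      ((hτ.contDiffAt (hU.mem_nhds hxU)).comp x hF.contDiffAt).differentiableAt (by simp)
    have h2 : DifferentiableAt ℝ γ (τ (F x)) :=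
      (hγ.contDiffAt (hI.mem_nhds (hmem _ hx.self_of_nhds hxU).1)).differentiableAt (by simp)
    rw [heq.deriv_eq]
    exact (h2.hasDerivAt.scomp x h1.hasDerivAt).deriv
  have hs0 : deriv (fun x => τ (F x)) x₀ ≠ 0 := fun h => by
    have := hsm.self_of_nhds.2.2
    rw [h, zero_smul] at this
    exact himm this
  have hcont : ContinuousAt (deriv fun x => τ (F x)) x₀ :=
    (hτF.continuousAt_fderiv (by simp)).clm_apply continuousAt_const
  rcases lt_or_gt_of_ne hs0 with h | h
  · refine ⟨-1, Or.inr rfl, ?_⟩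
    filter_upwards [hsm, hcont.eventually (gt_mem_nhds h)] with x hx hneg v
    rw [hvec _ v hx.1 hx.2.1, hx.2.2]
    constructor
    · rintro ⟨c, hc, rfl⟩
      refine ⟨c / -deriv (fun x => τ (F x)) x, div_pos hc (neg_pos.2 hneg), ?_⟩
      rw [smul_smul]
      congr 1
      have := hneg.ne
      field_simp
    · rintro ⟨l, hl, rfl⟩
      refine ⟨l * -deriv (fun x => τ (F x)) x, mul_pos hl (neg_pos.2 hneg), ?_⟩
      rw [smul_smul]
      congr 1
      ring
  · refine ⟨1, Or.inl rfl, ?_⟩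
    filter_upwards [hsm, hcont.eventually (lt_mem_nhds h)] with x hx hpos v
    rw [hvec _ v hx.1 hx.2.1, hx.2.2]
    constructor
    · rintro ⟨c, hc, rfl⟩
      refine ⟨c / deriv (fun x => τ (F x)) x, div_pos hc hpos, ?_⟩
      rw [smul_smul]
      congr 1
      field_simp
    · rintro ⟨l, hl, rfl⟩
      refine ⟨l * deriv (fun x => τ (F x)) x, mul_pos hl hpos, ?_⟩
      rw [smul_smul]
      congr 1
      ring

/-- The orientation of a link along a curve contained in it. -/
theorem OrientedLink.exists_orientation (L : OrientedLink) {F : ℝ → R3} (hF : ContDiff ℝ ∞ F)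
    {J : Set ℝ} (hJ : IsOpen J) (hJc : IsPreconnected J) (himm : ∀ x ∈ J, deriv F x ≠ 0)
    (hFL : ∀ x ∈ J, F x ∈ L.carrier) : ∃ ε : ℝ, (ε = 1 ∨ ε = -1) ∧ ∀ x ∈ J, ∀ v,
      (F x, v) ∈ L.vec ↔ ∃ l : ℝ, 0 < l ∧ v = (l * ε) • deriv F x := by
  -- The parameters near which the orientation is `ε` form an open set; the sets for `1` and `-1`
  -- are disjoint and cover the connected set `J`.
  let P : ℝ → Set ℝ := fun ε => {x | ∀ᶠ y in 𝓝 x, y ∈ J ∧ ∀ v, (F y, v) ∈ L.vec ↔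
      ∃ l : ℝ, 0 < l ∧ v = (l * ε) • deriv F y}
  have hP : ∀ ε, IsOpen (P ε) := fun ε => isOpen_setOfPred_eventually_nhds
  have hcov : J ⊆ P 1 ∪ P (-1) := fun x hx => by
    obtain ⟨ε, rfl | rfl, h⟩ := L.eventually_orientation hF (himm x hx)
      (by filter_upwards [hJ.mem_nhds hx] with y hy using hFL y hy)
    · left; filter_upwards [h, hJ.mem_nhds hx] with y hy hyJ using ⟨hyJ, hy⟩
    · right; filter_upwards [h, hJ.mem_nhds hx] with y hy hyJ using ⟨hyJ, hy⟩
  have hdisj : Disjoint (P 1) (P (-1)) := by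
    rw [disjoint_left]
    intro x h1 h2
    obtain ⟨hxJ, h1⟩ := h1.self_of_nhds
    have h2 := h2.self_of_nhds.2
    have h3 := (h1 _).2 ⟨1, one_pos, rfl⟩
    obtain ⟨l, hl, h4⟩ := (h2 _).1 h3
    have h5 : 1 * 1 = l * -1 := smul_left_injective ℝ (himm x hxJ) h4
    linarith
  rcases J.eq_empty_or_nonempty with rfl | ⟨x, hx⟩
  · exact ⟨1, Or.inl rfl, fun x hx => absurd hx (notMem_empty x)⟩
  · rcases hcov hx with h | h
    · exact ⟨1, Or.inl rfl, fun y hy => (hJc.subset_left_of_subset_union (hP _) (hP _) hdisj hcov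
        ⟨x, hx, h⟩ hy).self_of_nhds.2⟩
    · rw [union_comm] at hcov
      exact ⟨-1, Or.inr rfl, fun y hy => (hJc.subset_left_of_subset_union (hP _) (hP _) hdisj.symm
        hcov ⟨x, hx, h⟩ hy).self_of_nhds.2⟩

/-! ### Equal fronts and equal order at the crossing give ambient isotopic links -/

/-- Two links which coincide outside a cylinder fit together smoothly at an end point of a strand
in the cylinder. -/
theorem contDiffAt_indicator_sub {L L' : OrientedLink} {B : Rect} {f u u' : ℝ → ℝ}
    (hf : ContDiff ℝ ∞ f) (hu : ContDiff ℝ ∞ u) (hu' : ContDiff ℝ ∞ u') (hab : B.a < B.b)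
    (hout : ∀ p ∉ B.cylinder, p ∈ L.carrier ↔ p ∈ L'.carrier)
    (hL : ∀ x ∈ Icc B.a B.b, ((x, u x, f x) : R3) ∈ L.carrier)
    (hL' : ∀ x ∈ Icc B.a B.b, ((x, u' x, f x) : R3) ∈ L'.carrier) {e : ℝ}
    (he : e = B.a ∨ e = B.b) (hfe : f e ∈ Icc B.c B.d)
    (huniq : ∀ p ∈ L'.carrier, p ∈ B.cylinder → p.1 = e → p.2.2 = f e → p = (e, u' e, f e)) :
    ContDiffAt ℝ ∞ (indicator (Icc B.a B.b) fun x => u x - u' x) e := by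
  have heI : e ∈ Icc B.a B.b := by
    rcases he with rfl | rfl
    · exact left_mem_Icc.2 hab.le
    · exact right_mem_Icc.2 hab.le
  -- The end point is a limit of parameters outside the interval, where the two links agree.
  have hcl : ∃ᶠ x in 𝓝 e, x ∉ Icc B.a B.b := by
    have : e ∈ closure (Icc B.a B.b)ᶜ := by
      rcases he with rfl | rfl
      · refine closure_mono (s := Iio B.a) (fun x hx (h : x ∈ Icc B.a B.b) => not_lt.2 h.1 hx) ?_
        rw [closure_Iio]; exact mem_Iic.2 le_rfl
      · refine closure_mono (s := Ioi B.b) (fun x hx (h : x ∈ Icc B.a B.b) => not_lt.2 h.2 hx) ?_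
        rw [closure_Ioi]; exact mem_Ici.2 le_rfl
    exact mem_closure_iff_frequently.1 this
  have hF : ContDiff ℝ ∞ (fun x => ((x, u x, f x) : R3)) := contDiff_fun_id.prodMk (hu.prodMk hf)
  have hF' : ContDiff ℝ ∞ (fun x => ((x, u' x, f x) : R3)) :=
    contDiff_fun_id.prodMk (hu'.prodMk hf)
  have hU := uniqueDiffOn_Icc hab e heI
  obtain ⟨Γ, hΓ, hΓL, hΓe, hΓu⟩ := L.exists_local_graph hF (fun _ => rfl) heI hU
    (by filter_upwards [self_mem_nhdsWithin] with x hx using hL x hx)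
  obtain ⟨Γ', hΓ', -, hΓe', hΓu'⟩ := L'.exists_local_graph hF' (fun _ => rfl) heI hU
    (by filter_upwards [self_mem_nhdsWithin] with x hx using hL' x hx)
  have hΓout : ∀ᶠ x in 𝓝 e, x ∉ Icc B.a B.b → Γ x ∈ L'.carrier := by
    filter_upwards [hΓL] with x hx hxI
    refine (hout _ fun h => hxI ?_).1 hx.1
    rw [← hx.2]; exact h.1
  -- `L'` is closed and so contains the end point of the strand of `L`. By `huniq` the strands of
  -- the two links share this end point.
  have hmem : (e, u e, f e) ∈ L'.carrier := by
    rw [OrientedLink.carrier, ← L'.isCompact_points.isClosed.closure_eq, ← hΓe]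
    refine mem_closure_of_frequently_of_tendsto ?_ hΓ.continuousAt
    exact (hcl.and_eventually hΓout).mono fun x hx => hx.2 hx.1
  have heq := huniq _ hmem ⟨heI, hfe⟩ rfl rfl
  have hΓt : Filter.Tendsto Γ (𝓝 e) (𝓝 (e, u' e, f e)) := by
    rw [← heq, ← hΓe]; exact hΓ.continuousAt
  refine (hΓ.snd.fst.sub hΓ'.snd.fst).congr_of_eventuallyEq ?_
  filter_upwards [hΓL, hΓout, hΓt.eventually hΓu',
    (hF.continuous.tendsto e).eventually hΓu, (hF'.continuous.tendsto e).eventually hΓu']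
    with x h1 h2 h3 h4 h5
  -- Inside the interval `Γ` and `Γ'` follow the two strands; outside, `Γ` runs on the common link,
  -- which `Γ'` describes as well, so their difference is zero. Thus the indicator is a difference
  -- of smooth functions.
  by_cases hx : x ∈ Icc B.a B.b
  · rw [indicator_of_mem hx, ← h4 (hL x hx), ← h5 (hL' x hx)]
  · rw [indicator_of_notMem hx]
    have := h3 (h2 hx)
    rw [h1.2] at this
    rw [this, sub_self]

theorem contDiff_indicator_sub {a b : ℝ} {u u' : ℝ → ℝ} (hu : ContDiff ℝ ∞ u)
    (hu' : ContDiff ℝ ∞ u')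
    (h : ∀ e, e = a ∨ e = b → ContDiffAt ℝ ∞ (indicator (Icc a b) fun x => u x - u' x) e) :
    ContDiff ℝ ∞ (indicator (Icc a b) fun x => u x - u' x) := by
  rw [contDiff_iff_contDiffAt]
  intro x
  by_cases hx : x ∈ Icc a b
  · by_cases hx' : x ∈ Ioo a b
    · refine (hu.sub hu').contDiffAt.congr_of_eventuallyEq ?_
      filter_upwards [isOpen_Ioo.mem_nhds hx'] with y hy
      exact indicator_of_mem (Ioo_subset_Icc_self hy) _
    · refine h x ?_
      by_contra! hne
      exact hx' ⟨lt_of_le_of_ne hx.1 hne.1.symm, lt_of_le_of_ne hx.2 hne.2⟩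
  · refine contDiffAt_const (c := (0 : ℝ)) |>.congr_of_eventuallyEq ?_
    filter_upwards [isClosed_Icc.isOpen_compl.mem_nhds hx] with y hy
    exact indicator_of_notMem hy _

/-- The diffeomorphism of three-space which is affine in the `y`-direction. -/
noncomputable def yMap (b α : ℝ × ℝ → ℝ) (t : ℝ) (p : R3) : R3 :=
  (p.1, Real.exp (t * b (p.1, p.2.2)) * p.2.1 + t * α (p.1, p.2.2), p.2.2)

/-- The factor `exp (t b)` makes the map invertible for every `t`, with an explicit smooth inverse,
so only its effect at `t = 1` has to be examined. -/
theorem ambientIsotopic_yMap {b α : ℝ × ℝ → ℝ} (hb : ContDiff ℝ ∞ b) (hα : ContDiff ℝ ∞ α)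
    {S T : Set R3} (h : ∀ p, p ∈ S ↔ yMap b α 1 p ∈ T) : AmbientIsotopic S T := by
  refine ⟨yMap b α, fun t p => (p.1, Real.exp (-(t * b (p.1, p.2.2))) *
    (p.2.1 - t * α (p.1, p.2.2)), p.2.2), ?_, ?_, fun t p => ⟨?_, ?_⟩, fun p => ?_, ?_⟩
  · unfold yMap
    fun_prop
  · fun_prop
  · simp only [yMap, add_sub_cancel_right, ← mul_assoc, ← Real.exp_add, neg_add_cancel,
      Real.exp_zero, one_mul]
  · simp only [yMap, ← mul_assoc, ← Real.exp_add, add_neg_cancel, Real.exp_zero, one_mul,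
      sub_add_cancel]
  · simp [yMap]
  · ext q
    constructor
    · rintro ⟨p, hp, rfl⟩
      exact (h p).1 hp
    · intro hq
      have e : yMap b α 1 (q.1, Real.exp (-(1 * b (q.1, q.2.2))) *
          (q.2.1 - 1 * α (q.1, q.2.2)), q.2.2) = q := by
        simp only [yMap, ← mul_assoc, ← Real.exp_add, add_neg_cancel, Real.exp_zero, one_mul,
          sub_add_cancel]
      exact ⟨_, (h _).2 (e.symm ▸ hq), e⟩

theorem yMap_injective (b α : ℝ × ℝ → ℝ) (t : ℝ) : Function.Injective (yMap b α t) := by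
  intro p q h
  have h1 : p.1 = q.1 := (Prod.ext_iff.1 h).1
  have h2 := (Prod.ext_iff.1 (Prod.ext_iff.1 h).2).1
  have h3 : p.2.2 = q.2.2 := (Prod.ext_iff.1 (Prod.ext_iff.1 h).2).2
  simp only [yMap, h1, h3, add_left_inj] at h2
  exact Prod.ext h1 (Prod.ext (mul_left_cancel₀ (Real.exp_pos _).ne' h2) h3)

/-- Two sets which coincide outside a cylinder, and which are given by two curves with the same
fronts in the cylinder, are ambient isotopic if the order of the curves at the crossing is the
same. -/
theorem ambientIsotopic_of_graphs {B : Rect} {S T : Set R3} {f g u v u' v' : ℝ → ℝ} {x₀ : ℝ}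
    (hf : ContDiff ℝ ∞ f) (hg : ContDiff ℝ ∞ g) (hu : ContDiff ℝ ∞ u) (hv : ContDiff ℝ ∞ v)
    (hu' : ContDiff ℝ ∞ u') (hv' : ContDiff ℝ ∞ v') (hx₀ : x₀ ∈ Ioo B.a B.b)
    (hfg : ∀ x ∈ Icc B.a B.b, f x ∈ Ioo B.c B.d ∧ g x ∈ Ioo B.c B.d)
    (hcross : ∀ x ∈ Icc B.a B.b, f x = g x ↔ x = x₀)
    (hDf : ContDiff ℝ ∞ (indicator (Icc B.a B.b) fun x => u' x - u x))
    (hDg : ContDiff ℝ ∞ (indicator (Icc B.a B.b) fun x => v' x - v x))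
    (hsign : 0 < (u x₀ - v x₀) * (u' x₀ - v' x₀))
    (hout : ∀ p ∉ B.cylinder, p ∈ S ↔ p ∈ T)
    (hS : S ∩ B.cylinder = (fun x => ((x, u x, f x) : R3)) '' Icc B.a B.b ∪
      (fun x => ((x, v x, g x) : R3)) '' Icc B.a B.b)
    (hT : T ∩ B.cylinder = (fun x => ((x, u' x, f x) : R3)) '' Icc B.a B.b ∪
      (fun x => ((x, v' x, g x) : R3)) '' Icc B.a B.b) : AmbientIsotopic S T := by
  set I := Icc B.a B.b
  set Df := indicator I fun x => u' x - u x with hDf_def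
  set Dg := indicator I fun x => v' x - v x with hDg_def
  -- On `O`, a neighbourhood of the crossing, `u - v` and `u' - v'` have the same sign, so their
  -- quotient can serve as a positive dilation factor.
  set O : Set ℝ := {x | 0 < (u x - v x) * (u' x - v' x)} ∩ Ioo B.a B.b with hO
  have hOo : IsOpen O := (isOpen_lt continuous_const
    ((hu.continuous.sub hv.continuous).mul (hu'.continuous.sub hv'.continuous))).inter isOpen_Ioo
  have hx₀O : x₀ ∈ O := ⟨hsign, hx₀⟩
  have hx₀I : x₀ ∈ I := Ioo_subset_Icc_self hx₀
  have hOI : O ⊆ I := fun x hx => Ioo_subset_Icc_self hx.2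
  obtain ⟨χ, hχ, hχ0, hχ1, -⟩ := exists_smooth_cutoff (s := Oᶜ) (t := {x₀}) hOo.isClosed_compl
    isClosed_singleton (disjoint_singleton_right.2 fun h => h hx₀O)
  set R : ℝ → ℝ := fun x => (u' x - v' x) / (u x - v x) with hR
  have hO1 : ∀ x ∈ O, u x - v x ≠ 0 := fun x hx h => by
    have : 0 < (u x - v x) * (u' x - v' x) := hx.1
    rw [h, zero_mul] at this; exact lt_irrefl _ this
  have hRpos : ∀ x ∈ O, 0 < R x := fun x hx => by
    have : R x = (u x - v x) * (u' x - v' x) / (u x - v x) ^ 2 := by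
      have := hO1 x hx
      simp only [hR]; field_simp
    rw [this]
    exact div_pos hx.1 (sq_pos_of_ne_zero (hO1 x hx))
  -- In logarithmic form the dilation can be cut off smoothly away from the crossing.
  set lam : ℝ → ℝ := fun x => χ x * Real.log (R x) with hlam
  have hlam0 : ∀ x ∉ O, ∀ᶠ y in 𝓝 x, lam y = 0 := fun x hx => by
    filter_upwards [hχ0 x hx] with y hy
    simp [hlam, hy]
  have hlams : ContDiff ℝ ∞ lam := by
    rw [contDiff_iff_contDiffAt]
    intro x
    by_cases hx : x ∈ O
    · exact hχ.contDiffAt.mul (((hu'.sub hv').contDiffAt.div (hu.sub hv).contDiffAt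
        (hO1 x hx)).log (hRpos x hx).ne')
    · exact contDiffAt_const.congr_of_eventuallyEq (hlam0 x hx)
  -- `Af` and `Ag` are the translations which must follow the dilation to bring `u` to `u'` and `v`
  -- to `v'`. At the crossing both strands lie over the same front point, so one translation has to
  -- serve both; the dilation factor `R` makes the two agree near `x₀`.
  set Af : ℝ → ℝ := fun x => Df x + (1 - Real.exp (lam x)) * u x with hAf
  set Ag : ℝ → ℝ := fun x => Dg x + (1 - Real.exp (lam x)) * v x with hAg
  have hAfs : ContDiff ℝ ∞ Af := hDf.add ((contDiff_const.sub hlams.exp).mul hu)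
  have hAgs : ContDiff ℝ ∞ Ag := hDg.add ((contDiff_const.sub hlams.exp).mul hv)
  have hA0 : ∀ x ∉ I, ∀ᶠ y in 𝓝 x, Af y = 0 ∧ Ag y = 0 := fun x hx => by
    filter_upwards [hlam0 x fun h => hx (hOI h), isClosed_Icc.isOpen_compl.mem_nhds hx]
      with y hy hyI
    have hyI' : y ∉ I := hyI
    simp [hAf, hAg, hDf_def, hDg_def, hy, indicator_of_notMem hyI']
  have hAx₀ : ∀ᶠ y in 𝓝 x₀, Af y - Ag y = 0 := by
    filter_upwards [hχ1 x₀ rfl, hOo.mem_nhds hx₀O] with y hy hyO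
    have h1 := hO1 y hyO
    have h2 : Real.exp (lam y) = R y := by
      simp only [hlam, hy, one_mul]; exact Real.exp_log (hRpos y hyO)
    simp only [hAf, hAg, hDf_def, hDg_def, indicator_of_mem (hOI hyO), h2, hR]
    field_simp
    ring
  -- The translation interpolates affinely in `z` between the two strands, with slope `Q`. Its
  -- numerator vanishes near `x₀`, which removes the singularity at the only zero of `f - g` in the
  -- interval.
  set Q : ℝ → ℝ := fun x => (Af x - Ag x) / (f x - g x) with hQ
  have hQs : ContDiff ℝ ∞ Q := by
    rw [contDiff_iff_contDiffAt]
    intro x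
    by_cases hx : x ∈ I
    · by_cases hxx : x = x₀
      · subst hxx
        refine contDiffAt_const (c := (0 : ℝ)) |>.congr_of_eventuallyEq ?_
        filter_upwards [hAx₀] with y hy
        simp [hQ, hy]
      · exact (hAfs.sub hAgs).contDiffAt.div (hf.sub hg).contDiffAt
          (sub_ne_zero.2 fun h => hxx ((hcross x hx).1 h))
    · refine contDiffAt_const (c := (0 : ℝ)) |>.congr_of_eventuallyEq ?_
      filter_upwards [hA0 x hx] with y hy
      simp [hQ, hy.1, hy.2]
  have hQf : ∀ x ∈ I, Ag x + Q x * (f x - g x) = Af x := fun x hx => by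
    by_cases hxx : x = x₀
    · rw [(hcross x hx).2 hxx, sub_self, mul_zero, add_zero]
      have := hAx₀.self_of_nhds
      rw [← hxx] at this
      linarith
    · have : f x - g x ≠ 0 := sub_ne_zero.2 fun h => hxx ((hcross x hx).1 h)
      simp only [hQ]
      field_simp
      ring
  have hcompact : IsCompact (f '' I ∪ g '' I) :=
    (isCompact_Icc.image hf.continuous).union (isCompact_Icc.image hg.continuous)
  -- A cutoff in `z` makes the map the identity above and below the rectangle without changing it on
  -- the strands.
  obtain ⟨κ, hκ, hκ0, hκ1, -⟩ := exists_smooth_cutoff (s := (Ioo B.c B.d)ᶜ) (t := f '' I ∪ g '' I)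
    isOpen_Ioo.isClosed_compl hcompact.isClosed (by
      rw [disjoint_left]
      rintro z hz (⟨x, hx, rfl⟩ | ⟨x, hx, rfl⟩)
      · exact hz (hfg x hx).1
      · exact hz (hfg x hx).2)
  have hκf : ∀ x ∈ I, κ (f x) = 1 := fun x hx =>
    (hκ1 _ (Or.inl (mem_image_of_mem _ hx))).self_of_nhds
  have hκg : ∀ x ∈ I, κ (g x) = 1 := fun x hx =>
    (hκ1 _ (Or.inr (mem_image_of_mem _ hx))).self_of_nhds
  set b : ℝ × ℝ → ℝ := fun w => κ w.2 * lam w.1 with hb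
  set α : ℝ × ℝ → ℝ := fun w => κ w.2 * (Ag w.1 + Q w.1 * (w.2 - g w.1)) with hα
  have hfix : ∀ p ∉ B.cylinder, yMap b α 1 p = p := fun p hp => by
    have : b (p.1, p.2.2) = 0 ∧ α (p.1, p.2.2) = 0 := by
      by_cases hx : p.1 ∈ I
      · have hz : p.2.2 ∉ Icc B.c B.d := fun hz => hp ⟨hx, hz⟩
        have : κ p.2.2 = 0 := (hκ0 _ fun h => hz (Ioo_subset_Icc_self h)).self_of_nhds
        simp [hb, hα, this]
      · have h1 := (hlam0 p.1 fun h => hx (hOI h)).self_of_nhds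
        obtain ⟨h2, h3⟩ := (hA0 p.1 hx).self_of_nhds
        simp [hb, hα, h1, h2, h3, hQ]
    simp [yMap, this.1, this.2]
  have hmapf : ∀ x ∈ I, yMap b α 1 (x, u x, f x) = (x, u' x, f x) := fun x hx => by
    have : b (x, f x) = lam x ∧ α (x, f x) = Af x := by
      simp only [hb, hα, hκf x hx, one_mul, hQf x hx, and_self]
    simp only [yMap, this.1, this.2, one_mul]
    simp only [hAf, hDf_def, indicator_of_mem hx]
    ring_nf
  have hmapg : ∀ x ∈ I, yMap b α 1 (x, v x, g x) = (x, v' x, g x) := fun x hx => by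
    have : b (x, g x) = lam x ∧ α (x, g x) = Ag x := by
      simp only [hb, hα, hκg x hx, one_mul, sub_self, mul_zero, add_zero, and_self]
    simp only [yMap, this.1, this.2, one_mul]
    simp only [hAg, hDg_def, indicator_of_mem hx]
    ring_nf
  have hbs : ContDiff ℝ ∞ b := by fun_prop
  have hαs : ContDiff ℝ ∞ α := by fun_prop
  refine ambientIsotopic_yMap hbs hαs fun p => ?_
  by_cases hp : p ∈ B.cylinder
  · have hp' : yMap b α 1 p ∈ B.cylinder := hp
    have e1 : p ∈ S ↔ p ∈ S ∩ B.cylinder := ⟨fun h => ⟨h, hp⟩, fun h => h.1⟩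
    have e2 : yMap b α 1 p ∈ T ↔ yMap b α 1 p ∈ T ∩ B.cylinder := ⟨fun h => ⟨h, hp'⟩, fun h => h.1⟩
    rw [e1, e2, hS, hT]
    refine or_congr ⟨?_, ?_⟩ ⟨?_, ?_⟩
    · rintro ⟨x, hx, rfl⟩
      exact ⟨x, hx, (hmapf x hx).symm⟩
    · rintro ⟨x, hx, h⟩
      exact ⟨x, hx, yMap_injective b α 1 ((hmapf x hx).trans h)⟩
    · rintro ⟨x, hx, rfl⟩
      exact ⟨x, hx, (hmapg x hx).symm⟩
    · rintro ⟨x, hx, h⟩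
      exact ⟨x, hx, yMap_injective b α 1 ((hmapg x hx).trans h)⟩
  · rw [hfix p hp]
    exact hout p hp

/-! ### Straightening a crossing -/

theorem pushVec_image_vecOn {F : R3 → R3} (hF : ContDiff ℝ ∞ F) {c : ℝ → R3}
    (hc : ContDiff ℝ ∞ c) (ε t : ℝ) :
    pushVec F '' vecOn ε c {t} = vecOn ε (fun s => F (c s)) {t} := by
  have hd : deriv (fun s => F (c s)) t = fderiv ℝ F (c t) (deriv c t) :=
    ((hF.differentiable (by simp) (c t)).hasFDerivAt.comp_hasDerivAt t
      (hc.differentiable (by simp) t).hasDerivAt).deriv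
  ext q
  constructor
  · rintro ⟨_, ⟨_, rfl, l, hl, rfl⟩, rfl⟩
    exact ⟨_, rfl, l, hl, by rw [hd, pushVec, map_smul]⟩
  · rintro ⟨_, rfl, l, hl, rfl⟩
    exact ⟨_, ⟨_, rfl, l, hl, rfl⟩, by rw [hd, pushVec, map_smul]⟩

theorem IsContactIsotopy.mem_pushVec_iff {Φ : ℝ → R3 → R3} {Φi : R3 → R3}
    (h : IsContactIsotopy Φ Φi) {L : OrientedLink} {c line : ℝ → R3} {ψ : ℝ → ℝ} {ε t : ℝ}
    (hc : ContDiff ℝ ∞ c) (hline : ContDiff ℝ ∞ line) (hψ : ContDiff ℝ ∞ ψ) (hψ' : 0 < deriv ψ t)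
    (hL : ∀ v, (c t, v) ∈ L.vec ↔ ∃ l : ℝ, 0 < l ∧ v = (l * ε) • deriv c t)
    (heq : (fun s => Φ 1 (c s)) =ᶠ[𝓝 t] fun s => line (ψ s)) {q : R3 × R3}
    (hq : q.1 = line (ψ t)) :
    q ∈ pushVec (Φ 1) '' L.vec ↔ q ∈ vecOn ε line {ψ t} := by
  rw [← vecOn_comp_of_pos (hψ.differentiable (by simp) t).hasDerivAt
    (hline.differentiable (by simp) _) heq hψ', ← pushVec_image_vecOn (h.smooth_at 1) hc,
    mem_pushVec_image (h.smooth_at 1) h.smooth_inv h.left_inv h.right_inv,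
    mem_pushVec_image (h.smooth_at 1) h.smooth_inv h.left_inv h.right_inv]
  have h1 : (pushVec Φi q).1 = c t := by
    change Φi q.1 = c t
    rw [hq, ← heq.eq_of_nhds, h.left_inv]
  have h2 : pushVec Φi q = (c t, (pushVec Φi q).2) := Prod.ext h1 rfl
  rw [h2, hL]
  constructor
  · rintro ⟨l, hl, e⟩
    exact ⟨t, rfl, l, hl, by rw [← e]⟩
  · rintro ⟨_, rfl, l, hl, e⟩
    exact ⟨l, hl, (Prod.ext_iff.1 e).2⟩

theorem fst_image_replaceVec_eq {V : Set (R3 × R3)} {ε ε' : ℝ} {a b : ℝ → R3} (p : R3) :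
    p ∈ Prod.fst '' replaceVec V ε ε' a b ↔
      (p ∈ modelCyl ∧ p ∈ range a ∪ range b) ∨ (p ∉ modelCyl ∧ p ∈ Prod.fst '' V) := by
  constructor
  · rintro ⟨q, ⟨hq, h | h⟩ | ⟨hq, h⟩, rfl⟩
    · obtain ⟨t, -, l, -, rfl⟩ := h
      exact Or.inl ⟨hq, Or.inl ⟨t, rfl⟩⟩
    · obtain ⟨t, -, l, -, rfl⟩ := h
      exact Or.inl ⟨hq, Or.inr ⟨t, rfl⟩⟩
    · exact Or.inr ⟨hq, q, h, rfl⟩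
  · rintro (⟨hq, ⟨t, rfl⟩ | ⟨t, rfl⟩⟩ | ⟨hq, q, h, rfl⟩)
    · exact ⟨_, Or.inl ⟨hq, Or.inl vecOn_fst⟩, rfl⟩
    · exact ⟨_, Or.inl ⟨hq, Or.inr vecOn_fst⟩, rfl⟩
    · exact ⟨_, Or.inr ⟨hq, h⟩, rfl⟩

/-- The data used to straighten a crossing of the graphs of `f` and `g`. -/
structure Straightening (B : Rect) (f g : ℝ → ℝ) (x₀ : ℝ) (ψ χ : ℝ → ℝ) (m r : ℝ) : Prop where
  smooth : ContDiff ℝ ∞ ψ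
  smooth_inv : ContDiff ℝ ∞ χ
  deriv_pos : ∀ x, 0 < deriv ψ x
  left_inv : ∀ x, χ (ψ x) = x
  right_inv : ∀ x, ψ (χ x) = x
  scale_pos : 0 < m
  radius_pos : 0 < r
  eq_near : ∀ x, |x - x₀| < r → ψ x = m * ((g x - f x) / 2)
  mem_Ioo : ∀ x, |x - x₀| < r → x ∈ Ioo B.a B.b
  height : ∀ x z, |x - x₀| < r → |m * (z - (f x + g x) / 2)| < 2001 → z ∈ Ioo B.c B.d
  near : ∀ x, |ψ x| < 1001 → |x - x₀| < r

/-- Subtracting the mean of `f` and `g` turns them into `∓(g - f)/2`. Near `x₀` a multiple of `(g -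
f)/2` is a coordinate, extended to a diffeomorphism `ψ`, so the graphs become `z = ∓x`. A large
scale `m` shrinks the preimage of `modelNhd` into the given rectangle. -/
theorem exists_straightening {B : Rect} {f g : ℝ → ℝ} {x₀ : ℝ} (hf : ContDiff ℝ ∞ f)
    (hg : ContDiff ℝ ∞ g) (hx₀ : x₀ ∈ Ioo B.a B.b)
    (hfg : f x₀ ∈ Ioo B.c B.d ∧ g x₀ ∈ Ioo B.c B.d) (h0 : f x₀ = g x₀)
    (h1 : deriv f x₀ < deriv g x₀) : ∃ ψ χ m r, Straightening B f g x₀ ψ χ m r := by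
  have hhs : ContDiff ℝ ∞ (fun x => (g x - f x) / 2) := (hg.sub hf).div_const 2
  have hd : deriv (fun x => (g x - f x) / 2) x₀ = (deriv g x₀ - deriv f x₀) / 2 :=
    (((hg.differentiable (by simp) x₀).hasDerivAt.sub
      (hf.differentiable (by simp) x₀).hasDerivAt).div_const 2).deriv
  obtain ⟨ψ, χ, r₀, hr₀, hψ, hχ, hψ', hχψ, hψχ, heq⟩ := exists_diffeo_of_deriv_pos hhs (x₀ := x₀)
    (by rw [h0]; simp) (by rw [hd]; linarith)
  have hmono : StrictMono ψ := strictMono_of_deriv_pos hψ'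
  have hψ0 : ψ x₀ = 0 := by rw [heq x₀ (by simpa using hr₀), h0]; simp
  have hGc : Continuous fun x => (f x + g x) / 2 := (hf.continuous.add hg.continuous).div_const 2
  obtain ⟨η, hη, hc, hd'⟩ : ∃ η > 0, B.c + 2 * η < (f x₀ + g x₀) / 2 ∧
      (f x₀ + g x₀) / 2 < B.d - 2 * η := by
    have h2 : B.c < (f x₀ + g x₀) / 2 := by linarith [hfg.1.1, hfg.2.1]
    have h3 : (f x₀ + g x₀) / 2 < B.d := by linarith [hfg.1.2, hfg.2.2]
    refine ⟨min ((f x₀ + g x₀) / 2 - B.c) (B.d - (f x₀ + g x₀) / 2) / 4, ?_, ?_, ?_⟩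
    · have := lt_min (sub_pos.2 h2) (sub_pos.2 h3)
      linarith
    · have := min_le_left ((f x₀ + g x₀) / 2 - B.c) (B.d - (f x₀ + g x₀) / 2)
      linarith
    · have := min_le_right ((f x₀ + g x₀) / 2 - B.c) (B.d - (f x₀ + g x₀) / 2)
      linarith
  obtain ⟨r₁, hr₁, hsub⟩ := Metric.isOpen_iff.1 ((isOpen_Ioo (a := B.a) (b := B.b)).inter
    ((isOpen_lt continuous_const hGc).inter (isOpen_lt hGc continuous_const))) x₀
    ⟨hx₀, hc, hd'⟩
  have hr : 0 < min r₀ r₁ := lt_min hr₀ hr₁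
  have hlo : 0 < -ψ (x₀ - min r₀ r₁) := by
    have := hmono (sub_lt_self x₀ hr)
    linarith
  have hhi : 0 < ψ (x₀ + min r₀ r₁) := by
    have := hmono (lt_add_of_pos_right x₀ hr)
    linarith
  -- `δ` is how far the unscaled coordinates may go without leaving the rectangle; the factor `2001
  -- / δ` stretches it to the size of `modelNhd`.
  set δ := min (2 * η) (min (-ψ (x₀ - min r₀ r₁)) (ψ (x₀ + min r₀ r₁)))
  have hδ : 0 < δ := lt_min (by linarith) (lt_min hlo hhi)
  have hm : 0 < 2001 / δ := div_pos (by norm_num) hδ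
  have hmδ : ∀ y, δ ≤ y → 2001 ≤ 2001 / δ * y := fun y hy => by
    calc (2001 : ℝ) = 2001 / δ * δ := by field_simp
      _ ≤ _ := mul_le_mul_of_nonneg_left hy hm.le
  have hder : ∀ x, deriv (fun x => 2001 / δ * ψ x) x = 2001 / δ * deriv ψ x := fun x =>
    ((hψ.differentiable (by simp) x).hasDerivAt.const_mul _).deriv
  have hball : ∀ x, |x - x₀| < min r₀ r₁ → x ∈ Ioo B.a B.b ∧
      B.c + 2 * η < (f x + g x) / 2 ∧ (f x + g x) / 2 < B.d - 2 * η := fun x hx =>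
    hsub (Metric.mem_ball.2 (by rw [Real.dist_eq]; exact hx.trans_le (min_le_right _ _)))
  refine ⟨fun x => 2001 / δ * ψ x, fun x => χ (x / (2001 / δ)), 2001 / δ, min r₀ r₁,
    contDiff_const.mul hψ, hχ.comp (contDiff_id.div_const _), fun x => ?_, fun x => ?_,
    fun x => ?_, hm, hr, fun x hx => ?_, fun x hx => (hball x hx).1, fun x z hx hz => ?_,
    fun x hx => ?_⟩
  · rw [hder]; exact mul_pos hm (hψ' x)
  · simp only [mul_div_cancel_left₀ _ hm.ne', hχψ]
  · simp only [hψχ]; field_simp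
  · simp only [heq x (hx.trans_le (min_le_left _ _))]
  · obtain ⟨-, h2, h3⟩ := hball x hx
    have h4 : |z - (f x + g x) / 2| < 2 * η := by
      by_contra! h4
      have := hmδ _ ((min_le_left _ _).trans h4)
      rw [abs_mul, abs_of_pos hm] at hz
      linarith
    have := abs_lt.1 h4
    exact ⟨by linarith, by linarith⟩
  · by_contra! h2
    rcases le_abs.1 h2 with h3 | h3
    · have h4 : ψ (x₀ + min r₀ r₁) ≤ ψ x := hmono.monotone (by linarith)
      have := hmδ _ (((min_le_right _ _).trans (min_le_right _ _)).trans h4)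
      have := (abs_lt.1 hx).2
      linarith
    · have h4 : ψ x ≤ ψ (x₀ - min r₀ r₁) := hmono.monotone (by linarith)
      have := hmδ (-ψ x) (((min_le_right _ _).trans (min_le_left _ _)).trans (neg_le_neg h4))
      have := (abs_lt.1 hx).1
      linarith

section

variable {B : Rect} {f g ψ χ : ℝ → ℝ} {x₀ m r : ℝ}

namespace Straightening

/-- The contact diffeomorphism which straightens the crossing. -/
theorem isContactIsotopy (h : Straightening B f g x₀ ψ χ m r) (hf : ContDiff ℝ ∞ f)
    (hg : ContDiff ℝ ∞ g) :
    IsContactIsotopy (fun t => frontMap ψ (fun x => (f x + g x) / 2) m (Real.smoothTransition t))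
      (frontInv ψ χ (fun x => (f x + g x) / 2) m) :=
  isContactIsotopy_frontMap h.smooth h.deriv_pos h.smooth_inv h.left_inv h.right_inv
    ((hf.add hg).div_const 2) h.scale_pos

theorem deriv_eq (h : Straightening B f g x₀ ψ χ m r) (hf : ContDiff ℝ ∞ f)
    (hg : ContDiff ℝ ∞ g) {x : ℝ} (hx : |x - x₀| < r) :
    deriv ψ x = m * ((deriv g x - deriv f x) / 2) := by
  have he : ψ =ᶠ[𝓝 x] fun x => m * ((g x - f x) / 2) := by
    filter_upwards [(isOpen_lt ((continuous_id.sub continuous_const).abs)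
      continuous_const).mem_nhds hx] with y hy using h.eq_near y hy
  rw [he.deriv_eq]
  exact ((((hg.differentiable (by simp) x).hasDerivAt.sub
    (hf.differentiable (by simp) x).hasDerivAt).div_const 2).const_mul m).deriv

theorem deriv_avg (hf : ContDiff ℝ ∞ f) (hg : ContDiff ℝ ∞ g) (x : ℝ) :
    deriv (fun x => (f x + g x) / 2) x = (deriv f x + deriv g x) / 2 :=
  (((hf.differentiable (by simp) x).hasDerivAt.add
    (hg.differentiable (by simp) x).hasDerivAt).div_const 2).deriv

theorem frontMap_left (h : Straightening B f g x₀ ψ χ m r) (hf : ContDiff ℝ ∞ f)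
    (hg : ContDiff ℝ ∞ g) {x : ℝ} (hx : |x - x₀| < r) (y : ℝ) :
    frontMap ψ (fun x => (f x + g x) / 2) m 1 (x, y, f x) =
      (ψ x, m * (y - deriv f x) / deriv ψ x - 1, -ψ x) := by
  rw [frontMap_one]
  have hne := (h.deriv_pos x).ne'
  have hd := h.deriv_eq hf hg hx
  refine Prod.ext rfl (Prod.ext ?_ ?_)
  · simp only [deriv_avg hf hg]
    rw [div_eq_iff hne, sub_mul, div_mul_cancel₀ _ hne, hd]
    ring
  · simp only [h.eq_near x hx]; ring

theorem frontMap_right (h : Straightening B f g x₀ ψ χ m r) (hf : ContDiff ℝ ∞ f)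
    (hg : ContDiff ℝ ∞ g) {x : ℝ} (hx : |x - x₀| < r) (y : ℝ) :
    frontMap ψ (fun x => (f x + g x) / 2) m 1 (x, y, g x) =
      (ψ x, m * (y - deriv g x) / deriv ψ x + 1, ψ x) := by
  rw [frontMap_one]
  have hne := (h.deriv_pos x).ne'
  have hd := h.deriv_eq hf hg hx
  refine Prod.ext rfl (Prod.ext ?_ ?_)
  · simp only [deriv_avg hf hg]
    rw [div_eq_iff hne, add_mul, div_mul_cancel₀ _ hne, hd]
    ring
  · simp only [h.eq_near x hx]; ring

theorem frontMap_left_lift (h : Straightening B f g x₀ ψ χ m r) (hf : ContDiff ℝ ∞ f)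
    (hg : ContDiff ℝ ∞ g) {x : ℝ} (hx : |x - x₀| < r) :
    frontMap ψ (fun x => (f x + g x) / 2) m 1 (x, deriv f x, f x) = fLine (ψ x) := by
  rw [h.frontMap_left hf hg hx, sub_self, mul_zero, zero_div, zero_sub]
  rfl

theorem frontMap_right_lift (h : Straightening B f g x₀ ψ χ m r) (hf : ContDiff ℝ ∞ f)
    (hg : ContDiff ℝ ∞ g) {x : ℝ} (hx : |x - x₀| < r) :
    frontMap ψ (fun x => (f x + g x) / 2) m 1 (x, deriv g x, g x) = gLine (ψ x) := by
  rw [h.frontMap_right hf hg hx, sub_self, mul_zero, zero_div, zero_add]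
  rfl

theorem mem_of_mem_modelNhd (h : Straightening B f g x₀ ψ χ m r) {p : R3}
    (hp : frontMap ψ (fun x => (f x + g x) / 2) m 1 p ∈ modelNhd) :
    |p.1 - x₀| < r ∧ p ∈ B.cylinder := by
  rw [frontMap_one] at hp
  have h1 := h.near p.1 hp.1
  exact ⟨h1, Ioo_subset_Icc_self (h.mem_Ioo _ h1),
    Ioo_subset_Icc_self (h.height p.1 p.2.2 h1 hp.2)⟩

/-- Orientation is constant along each strand over the open interval, and negativity of the crossing
makes the two signs opposite. -/
theorem hasModelCrossing (h : Straightening B f g x₀ ψ χ m r) {M : LegendrianLink}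
    (hM : IsNegativeCrossing M B f g x₀) : ∃ ε : ℝ, (ε = 1 ∨ ε = -1) ∧
      HasModelCrossing ε (pushVec (frontMap ψ (fun x => (f x + g x) / 2) m 1) '' M.vec) := by
  obtain ⟨hf, hg, hx₀, -, -, -, hcyl, v, w, hv, hw, hvw⟩ := hM
  have hΦ := h.isContactIsotopy hf hg
  have hone : frontMap ψ (fun x => (f x + g x) / 2) m (Real.smoothTransition 1) =
      frontMap ψ (fun x => (f x + g x) / 2) m 1 := by rw [Real.smoothTransition.one]
  have hlf := graphLift_contDiff hf
  have hlg := graphLift_contDiff hg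
  have himm : ∀ {H : ℝ → ℝ}, ContDiff ℝ ∞ H → ∀ x, (deriv (graphLift H) x).1 = 1 := fun hH x => by
    rw [deriv_fst_eq (graphLift_contDiff hH)]
    exact (hasDerivAt_id x).deriv
  have himm' : ∀ {H : ℝ → ℝ}, ContDiff ℝ ∞ H → ∀ x, deriv (graphLift H) x ≠ 0 := fun hH x h0 => by
    have := himm hH x
    rw [h0] at this
    exact zero_ne_one this
  have hmemf : ∀ x ∈ Ioo B.a B.b, graphLift f x ∈ M.carrier := fun x hx => by
    have : graphLift f x ∈ M.carrier ∩ B.cylinder := by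
      rw [hcyl]; exact Or.inl ⟨x, Ioo_subset_Icc_self hx, rfl⟩
    exact this.1
  have hmemg : ∀ x ∈ Ioo B.a B.b, graphLift g x ∈ M.carrier := fun x hx => by
    have : graphLift g x ∈ M.carrier ∩ B.cylinder := by
      rw [hcyl]; exact Or.inr ⟨x, Ioo_subset_Icc_self hx, rfl⟩
    exact this.1
  obtain ⟨ε, hε, hεf⟩ := M.exists_orientation hlf isOpen_Ioo isPreconnected_Ioo
    (fun x _ => himm' hf x) hmemf
  obtain ⟨ε', hε', hεg⟩ := M.exists_orientation hlg isOpen_Ioo isPreconnected_Ioo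
    (fun x _ => himm' hg x) hmemg
  have hneg : ε' = -ε := by
    obtain ⟨l, hl, rfl⟩ := (hεf x₀ hx₀ v).1 hv
    obtain ⟨l', hl', rfl⟩ := (hεg x₀ hx₀ w).1 hw
    rw [Prod.smul_fst, Prod.smul_fst, himm hf, himm hg, smul_eq_mul, smul_eq_mul] at hvw
    have h2 : 0 < l * l' := mul_pos hl hl'
    rcases hε with rfl | rfl <;> rcases hε' with rfl | rfl <;>
      first | (exfalso; linarith) | norm_num
  refine ⟨ε, hε, fun q hq => ?_⟩
  have hnear : ∀ {x : ℝ}, |x - x₀| < r → ∀ᶠ y in 𝓝 x, |y - x₀| < r := fun hx =>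
    (isOpen_lt ((continuous_id.sub continuous_const).abs) continuous_const).mem_nhds hx
  have keyf : ∀ {x : ℝ}, |x - x₀| < r → q.1 = fLine (ψ x) →
      (q ∈ pushVec (frontMap ψ (fun x => (f x + g x) / 2) m 1) '' M.vec ↔
        q ∈ vecOn ε fLine {ψ x}) := fun {x} hx hq1 => by
    have := hΦ.mem_pushVec_iff (L := M.toOrientedLink) hlf fLine_contDiff h.smooth (h.deriv_pos x)
      (hεf x (h.mem_Ioo x hx)) (by
        filter_upwards [hnear hx] with y hy
        rw [hone]
        exact h.frontMap_left_lift hf hg hy) hq1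
    rwa [hone] at this
  have keyg : ∀ {x : ℝ}, |x - x₀| < r → q.1 = gLine (ψ x) →
      (q ∈ pushVec (frontMap ψ (fun x => (f x + g x) / 2) m 1) '' M.vec ↔
        q ∈ vecOn (-ε) gLine {ψ x}) := fun {x} hx hq1 => by
    have := hΦ.mem_pushVec_iff (L := M.toOrientedLink) hlg gLine_contDiff h.smooth (h.deriv_pos x)
      (hεg x (h.mem_Ioo x hx)) (by
        filter_upwards [hnear hx] with y hy
        rw [hone]
        exact h.frontMap_right_lift hf hg hy) hq1
    rwa [hone, hneg] at this
  constructor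
  · intro hqM
    obtain ⟨⟨p, v⟩, hp, rfl⟩ := hqM
    obtain ⟨hpx, hpB⟩ := h.mem_of_mem_modelNhd hq
    have hpc : p ∈ M.carrier ∩ B.cylinder := ⟨⟨_, hp, rfl⟩, hpB⟩
    rw [hcyl] at hpc
    rcases hpc with ⟨x, -, rfl⟩ | ⟨x, -, rfl⟩
    · exact Or.inl (mem_vecOn_univ ((keyf hpx (h.frontMap_left_lift hf hg hpx)).1
        (mem_image_of_mem _ hp)))
    · exact Or.inr (mem_vecOn_univ ((keyg hpx (h.frontMap_right_lift hf hg hpx)).1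
        (mem_image_of_mem _ hp)))
  · rintro (hqV | hqV) <;> obtain ⟨X, -, hX⟩ := mem_vecOn_iff.1 hqV <;>
      have hq1 := fst_of_mem_vecOn_singleton hX <;>
      rw [← h.right_inv X] at hX hq1 <;>
      have hx : |χ X - x₀| < r := h.near _ (by
        have := hq.1
        rw [hq1] at this
        exact this)
    · exact (keyf hx hq1).2 hX
    · exact (keyg hx hq1).2 hX

end Straightening

end

/-! ### The crossing change in the original coordinates -/

section

variable {B : Rect} {f g ψ χ : ℝ → ℝ} {x₀ m r : ℝ}

namespace Straightening

/-- The `y`-coordinate of the strand which is lifted above the other one. -/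
noncomputable def lifted (f ψ : ℝ → ℝ) (m x : ℝ) : ℝ :=
  deriv f x + deriv ψ x * (peak (ψ x) + 1) / m

theorem lifted_contDiff (h : Straightening B f g x₀ ψ χ m r) (hf : ContDiff ℝ ∞ f) :
    ContDiff ℝ ∞ (lifted f ψ m) := by
  have h1 := (contDiff_infty_iff_deriv.1 hf).2
  have h2 := (contDiff_infty_iff_deriv.1 h.smooth).2
  have h3 := peak_contDiff.comp h.smooth
  exact h1.add ((h2.mul (h3.add contDiff_const)).div_const m)

theorem peak_of_far {X : ℝ} (hX : 1000 < |X|) : peak X = -1 :=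
  peak_of_le (by
    have := abs_sub_abs_le_abs_sub X 60
    rw [abs_of_pos (by norm_num : (0 : ℝ) < 60)] at this
    linarith)

theorem lifted_of_far {x : ℝ} (hx : 1000 < |ψ x|) : lifted f ψ m x = deriv f x := by
  rw [lifted, peak_of_far hx]; simp

theorem frontMap_lifted (h : Straightening B f g x₀ ψ χ m r) (hf : ContDiff ℝ ∞ f)
    (hg : ContDiff ℝ ∞ g) {x : ℝ} (hx : |x - x₀| < r) :
    frontMap ψ (fun x => (f x + g x) / 2) m 1 (x, lifted f ψ m x, f x) = topLine (ψ x) := by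
  rw [h.frontMap_left hf hg hx, topLine]
  have h1 := (h.deriv_pos x).ne'
  have h2 := h.scale_pos.ne'
  refine Prod.ext rfl (Prod.ext ?_ rfl)
  simp only [lifted]
  field_simp
  ring

/-- The crossing change at a straightened crossing, in the original coordinates. -/
theorem preimage_inter_cylinder (h : Straightening B f g x₀ ψ χ m r) {M : LegendrianLink}
    (hM : IsNegativeCrossing M B f g x₀) {S : Set R3}
    (hS : ∀ p, p ∈ S ↔
      (frontMap ψ (fun x => (f x + g x) / 2) m 1 p ∈ modelCyl ∧
        frontMap ψ (fun x => (f x + g x) / 2) m 1 p ∈ range topLine ∪ range gLine) ∨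
      (frontMap ψ (fun x => (f x + g x) / 2) m 1 p ∉ modelCyl ∧ p ∈ M.carrier)) :
    S ∩ B.cylinder = (fun x => ((x, lifted f ψ m x, f x) : R3)) '' Icc B.a B.b ∪
      (fun x => ((x, deriv g x, g x) : R3)) '' Icc B.a B.b := by
  obtain ⟨hf, hg, -, hfg, -, -, hcyl, -⟩ := hM
  have hinj : Function.Injective (frontMap ψ (fun x => (f x + g x) / 2) m 1) := by
    have := (h.isContactIsotopy hf hg).inj 1
    rwa [Real.smoothTransition.one] at this
  have hfst : ∀ p, (frontMap ψ (fun x => (f x + g x) / 2) m 1 p).1 = ψ p.1 := fun p => by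
    rw [frontMap_one]
  have hfar : ∀ {p : R3}, frontMap ψ (fun x => (f x + g x) / 2) m 1 p ∉ modelCyl →
      (|p.1 - x₀| < r → |(frontMap ψ (fun x => (f x + g x) / 2) m 1 p).2.2| = |ψ p.1|) →
      1000 < |ψ p.1| := fun {p} hp hz => by
    by_contra! hle
    have := hz (h.near p.1 (by linarith))
    exact hp ⟨by rw [hfst]; exact hle, by rw [this]; linarith⟩
  have hM' : ∀ p, p ∈ M.carrier ∧ p ∈ B.cylinder ↔ p ∈
      (fun x => ((x, deriv f x, f x) : R3)) '' Icc B.a B.b ∪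
        (fun x => ((x, deriv g x, g x) : R3)) '' Icc B.a B.b := fun p => by rw [← hcyl]; rfl
  ext p
  constructor
  · rintro ⟨hp, hpB⟩
    rcases (hS p).1 hp with ⟨h1, ⟨t, ht⟩ | ⟨t, ht⟩⟩ | ⟨h1, h2⟩
    · have hx := (h.mem_of_mem_modelNhd (modelCyl_subset_modelNhd h1)).1
      have ht' : ψ p.1 = t := by rw [← hfst, ← ht]; rfl
      refine Or.inl ⟨p.1, hpB.1, hinj ?_⟩
      rw [h.frontMap_lifted hf hg hx, ← ht, ht']
    · have hx := (h.mem_of_mem_modelNhd (modelCyl_subset_modelNhd h1)).1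
      have ht' : ψ p.1 = t := by rw [← hfst, ← ht]; rfl
      refine Or.inr ⟨p.1, hpB.1, hinj ?_⟩
      rw [h.frontMap_right_lift hf hg hx, ← ht, ht']
    · rcases (hM' p).1 ⟨h2, hpB⟩ with ⟨x, hx, rfl⟩ | ⟨x, hx, rfl⟩
      · refine Or.inl ⟨x, hx, ?_⟩
        simp only [lifted_of_far (hfar h1 fun hr => by
          rw [h.frontMap_left_lift hf hg hr]; exact abs_neg _)]
      · exact Or.inr ⟨x, hx, rfl⟩
  · rintro (⟨x, hx, rfl⟩ | ⟨x, hx, rfl⟩)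
    · refine ⟨(hS _).2 ?_, hx, Ioo_subset_Icc_self (hfg x hx).1⟩
      rcases le_or_gt |ψ x| 1000 with h1 | h1
      · have hr := h.near x (by linarith)
        left
        rw [h.frontMap_lifted hf hg hr]
        exact ⟨⟨h1, by change |-ψ x| ≤ 2000; rw [abs_neg]; linarith⟩, Or.inl ⟨_, rfl⟩⟩
      · refine Or.inr ⟨fun hc => ?_, ?_⟩
        · have := hc.1
          rw [hfst] at this
          exact not_lt.2 this h1
        · simp only [lifted_of_far h1]
          exact ((hM' _).2 (Or.inl ⟨x, hx, rfl⟩)).1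
    · refine ⟨(hS _).2 ?_, hx, Ioo_subset_Icc_self (hfg x hx).2⟩
      rcases le_or_gt |ψ x| 1000 with h1 | h1
      · have hr := h.near x (by linarith)
        left
        simp only [h.frontMap_right_lift hf hg hr]
        exact ⟨⟨h1, by change |ψ x| ≤ 2000; linarith⟩, Or.inr ⟨_, rfl⟩⟩
      · refine Or.inr ⟨fun hc => ?_, ((hM' _).2 (Or.inr ⟨x, hx, rfl⟩)).1⟩
        have := hc.1
        rw [hfst] at this
        exact not_lt.2 this h1

/-- `S` and `K` differ from `M` only in the `y`-coordinates over `B`, and both have the order at the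
crossing reversed, so `ambientIsotopic_of_graphs` applies. Smoothness at the sides of `B` comes from
`contDiffAt_indicator_sub`. -/
theorem ambientIsotopic_crossingChange (h : Straightening B f g x₀ ψ χ m r) {M : LegendrianLink}
    (hM : IsNegativeCrossing M B f g x₀) (hlt : deriv f x₀ < deriv g x₀) {K : OrientedLink}
    (hout : AgreeOutside B M.toOrientedLink K) {u v : ℝ → ℝ} (hu : ContDiff ℝ ∞ u)
    (hv : ContDiff ℝ ∞ v)
    (hK : K.carrier ∩ B.cylinder = (fun x => ((x, u x, f x) : R3)) '' Icc B.a B.b ∪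
      (fun x => ((x, v x, g x) : R3)) '' Icc B.a B.b)
    (hsign : (deriv f x₀ - deriv g x₀) * (u x₀ - v x₀) < 0) {S : Set R3}
    (hS : ∀ p, p ∈ S ↔
      (frontMap ψ (fun x => (f x + g x) / 2) m 1 p ∈ modelCyl ∧
        frontMap ψ (fun x => (f x + g x) / 2) m 1 p ∈ range topLine ∪ range gLine) ∨
      (frontMap ψ (fun x => (f x + g x) / 2) m 1 p ∉ modelCyl ∧ p ∈ M.carrier)) :
    AmbientIsotopic S K.carrier := by
  have hSB := h.preimage_inter_cylinder hM hS
  obtain ⟨hf, hg, hx₀, hfg, hcross, -, hcyl, -⟩ := hM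
  have hab : B.a < B.b := hx₀.1.trans hx₀.2
  have hf' := (contDiff_infty_iff_deriv.1 hf).2
  have hg' := (contDiff_infty_iff_deriv.1 hg).2
  have houtc : ∀ p ∉ B.cylinder, p ∈ K.carrier ↔ p ∈ M.carrier := fun p hp => by
    constructor
    · rintro ⟨q, hq, rfl⟩
      have : q ∈ {q ∈ M.vec | q.1 ∉ B.cylinder} := by
        rw [show {q ∈ M.vec | q.1 ∉ B.cylinder} = _ from hout]; exact ⟨hq, hp⟩
      exact ⟨q, this.1, rfl⟩
    · rintro ⟨q, hq, rfl⟩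
      have : q ∈ {q ∈ K.vec | q.1 ∉ B.cylinder} := by
        rw [← show {q ∈ M.vec | q.1 ∉ B.cylinder} = _ from hout]; exact ⟨hq, hp⟩
      exact ⟨q, this.1, rfl⟩
  have hKf : ∀ x ∈ Icc B.a B.b, ((x, u x, f x) : R3) ∈ K.carrier := fun x hx =>
    (show _ ∈ K.carrier ∩ B.cylinder by rw [hK]; exact Or.inl ⟨x, hx, rfl⟩).1
  have hKg : ∀ x ∈ Icc B.a B.b, ((x, v x, g x) : R3) ∈ K.carrier := fun x hx =>
    (show _ ∈ K.carrier ∩ B.cylinder by rw [hK]; exact Or.inr ⟨x, hx, rfl⟩).1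
  have hMf : ∀ x ∈ Icc B.a B.b, ((x, deriv f x, f x) : R3) ∈ M.carrier := fun x hx =>
    (show _ ∈ M.carrier ∩ B.cylinder by rw [hcyl]; exact Or.inl ⟨x, hx, rfl⟩).1
  have hMg : ∀ x ∈ Icc B.a B.b, ((x, deriv g x, g x) : R3) ∈ M.carrier := fun x hx =>
    (show _ ∈ M.carrier ∩ B.cylinder by rw [hcyl]; exact Or.inr ⟨x, hx, rfl⟩).1
  have hend : ∀ e, e = B.a ∨ e = B.b → e ∈ Icc B.a B.b ∧ f e ≠ g e := fun e he => by
    have heI : e ∈ Icc B.a B.b := by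
      rcases he with rfl | rfl
      · exact left_mem_Icc.2 hab.le
      · exact right_mem_Icc.2 hab.le
    refine ⟨heI, fun h0 => ?_⟩
    have := (hcross e heI).1 h0
    rcases he with rfl | rfl
    · exact hx₀.1.ne this
    · exact hx₀.2.ne' this
  have hDf : ContDiff ℝ ∞ (indicator (Icc B.a B.b) fun x => u x - deriv f x) := by
    refine contDiff_indicator_sub hu hf' fun e he => ?_
    obtain ⟨heI, hne⟩ := hend e he
    refine contDiffAt_indicator_sub (L := K) (L' := M.toOrientedLink) hf hu hf' hab houtc hKf hMf he
      (Ioo_subset_Icc_self (hfg e heI).1) fun p hp hpB hp1 hp2 => ?_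
    have : p ∈ M.carrier ∩ B.cylinder := ⟨hp, hpB⟩
    rw [hcyl] at this
    rcases this with ⟨x, -, rfl⟩ | ⟨x, -, rfl⟩
    · obtain rfl : x = e := hp1
      rfl
    · obtain rfl : x = e := hp1
      exact absurd hp2.symm hne
  have hDg : ContDiff ℝ ∞ (indicator (Icc B.a B.b) fun x => v x - deriv g x) := by
    refine contDiff_indicator_sub hv hg' fun e he => ?_
    obtain ⟨heI, hne⟩ := hend e he
    refine contDiffAt_indicator_sub (L := K) (L' := M.toOrientedLink) hg hv hg' hab houtc hKg hMg he
      (Ioo_subset_Icc_self (hfg e heI).2) fun p hp hpB hp1 hp2 => ?_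
    have : p ∈ M.carrier ∩ B.cylinder := ⟨hp, hpB⟩
    rw [hcyl] at this
    rcases this with ⟨x, -, rfl⟩ | ⟨x, -, rfl⟩
    · obtain rfl : x = e := hp1
      exact absurd hp2 hne
    · obtain rfl : x = e := hp1
      rfl
  have hl := h.lifted_contDiff hf
  have hDl : ContDiff ℝ ∞ (indicator (Icc B.a B.b) fun x => u x - lifted f ψ m x) := by
    -- The lift is zero where `1000 < |ψ x|`, in particular off the interval, so it does not affect
    -- the smoothness at the end points.
    have e : (indicator (Icc B.a B.b) fun x => u x - lifted f ψ m x) = fun x =>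
        indicator (Icc B.a B.b) (fun x => u x - deriv f x) x - (lifted f ψ m x - deriv f x) := by
      funext x
      by_cases hx : x ∈ Icc B.a B.b
      · simp only [indicator_of_mem hx]; ring
      · rw [indicator_of_notMem hx, indicator_of_notMem hx, lifted_of_far, sub_self, sub_zero]
        by_contra! hle
        exact hx (Ioo_subset_Icc_self (h.mem_Ioo x (h.near x (by linarith))))
    rw [e]
    exact hDf.sub (hl.sub hf')
  have hr0 : |x₀ - x₀| < r := by simpa using h.radius_pos
  -- At the crossing the lift is `(peak 0 + 1) / 2` times the difference of the slopes, which is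
  -- more than enough to pass the other strand.
  have hpos : 0 < lifted f ψ m x₀ - deriv g x₀ := by
    have h2 := h.eq_near x₀ hr0
    rw [(hcross x₀ (Ioo_subset_Icc_self hx₀)).2 rfl, sub_self, zero_div, mul_zero] at h2
    have h3 := h.scale_pos.ne'
    have h4 := le_peak (t := 0) (by norm_num)
    rw [lifted, h.deriv_eq hf hg hr0, h2]
    have : m * ((deriv g x₀ - deriv f x₀) / 2) * (peak 0 + 1) / m =
        (deriv g x₀ - deriv f x₀) / 2 * (peak 0 + 1) := by field_simp
    rw [this]
    nlinarith
  have hpos' : 0 < u x₀ - v x₀ := by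
    by_contra! hle
    exact absurd hsign (not_lt.2 (mul_nonneg_of_nonpos_of_nonpos (by linarith) hle))
  refine ambientIsotopic_of_graphs hf hg hl hg' hu hv hx₀ hfg hcross hDl hDg (mul_pos hpos hpos')
    (fun p hp => ?_) hSB hK
  have hp' : frontMap ψ (fun x => (f x + g x) / 2) m 1 p ∉ modelCyl := fun hc =>
    hp (h.mem_of_mem_modelNhd (modelCyl_subset_modelNhd hc)).2
  rw [hS, houtc p hp]
  simp [hp']

end Straightening

/-- The crossing is straightened by a contact isotopy, modified in the model and carried back. The
links agree outside `B` because the preimage of `modelCyl` lies over `B`. -/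
theorem exists_surgeries_of_lt {M : LegendrianLink} {B : Rect} {f g : ℝ → ℝ} {x₀ : ℝ}
    (hM : IsNegativeCrossing M B f g x₀) (hlt : deriv f x₀ < deriv g x₀) {K : OrientedLink}
    (hout : AgreeOutside B M.toOrientedLink K) {u v : ℝ → ℝ} (hu : ContDiff ℝ ∞ u)
    (hv : ContDiff ℝ ∞ v)
    (hK : K.carrier ∩ B.cylinder = (fun x => ((x, u x, f x) : R3)) '' Icc B.a B.b ∪
      (fun x => ((x, v x, g x) : R3)) '' Icc B.a B.b)
    (hsign : (deriv f x₀ - deriv g x₀) * (u x₀ - v x₀) < 0) :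
    ∃ M₁ M₀ : LegendrianLink, IsLegendrianSurgery M M₁ ∧ IsLegendrianSurgery M₁ M₀ ∧
      AgreeOutside B M.toOrientedLink M₁.toOrientedLink ∧
      AgreeOutside B M.toOrientedLink M₀.toOrientedLink ∧
      AmbientIsotopic M₀.carrier K.carrier := by
  have hM' := hM
  obtain ⟨hf, hg, hx₀, hfg, hcross, -⟩ := hM'
  have hx₀I := Ioo_subset_Icc_self hx₀
  obtain ⟨ψ, χ, m, r, h⟩ := exists_straightening hf hg hx₀ (hfg x₀ hx₀I)
    ((hcross x₀ hx₀I).2 rfl) hlt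
  obtain ⟨ε, hε, hmodel⟩ := h.hasModelCrossing hM
  have hΦ := h.isContactIsotopy hf hg
  set G := fun x => (f x + g x) / 2
  have hone : frontMap ψ G m (Real.smoothTransition 1) = frontMap ψ G m 1 := by
    rw [Real.smoothTransition.one]
  obtain ⟨N, hN⟩ := hΦ.exists_map M
  have hN' := hN
  simp only [hone] at hN'
  rw [← hN'] at hmodel
  obtain ⟨N₁, N₀, hs₁, hs₀, ho₁, ho₀, hiso⟩ := exists_surgeries_model hε hmodel
  have hback : ∀ L : LegendrianLink, ∃ L' : LegendrianLink,
      L'.vec = pushVec (frontInv ψ χ G m) '' L.vec ∧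
      L.vec = pushVec (frontMap ψ G m (Real.smoothTransition 1)) '' L'.vec := fun L => by
    obtain ⟨L', hL'⟩ := hΦ.exists_comap L
    refine ⟨L', hL', ?_⟩
    rw [hL', image_image]
    simp only [pushVec_pushVec hΦ.smooth_inv (hΦ.smooth_at 1) hΦ.right_inv, image_id']
  obtain ⟨M₁, h₁, h₁'⟩ := hback N₁
  obtain ⟨M₀, h₀, h₀'⟩ := hback N₀
  have hmem : ∀ {L L' : LegendrianLink},
      L.vec = pushVec (frontMap ψ G m (Real.smoothTransition 1)) '' L'.vec →
      ∀ q, q ∈ L'.vec ↔ pushVec (frontMap ψ G m 1) q ∈ L.vec := fun hL q => by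
    rw [hL, mem_pushVec_image (hΦ.smooth_at 1) hΦ.smooth_inv hΦ.left_inv hΦ.right_inv, ← hone,
      pushVec_pushVec (hΦ.smooth_at 1) hΦ.smooth_inv hΦ.left_inv]
  have hagree : ∀ {L L' : LegendrianLink},
      L.vec = pushVec (frontMap ψ G m (Real.smoothTransition 1)) '' L'.vec →
      (∀ q : R3 × R3, q.1 ∉ modelCyl → (q ∈ N.vec ↔ q ∈ L.vec)) →
      AgreeOutside B M.toOrientedLink L'.toOrientedLink := fun hL ho => by
    ext q
    refine and_congr_left fun hq => ?_
    rw [hmem hN, hmem hL]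
    exact ho _ fun hc => hq (h.mem_of_mem_modelNhd (modelCyl_subset_modelNhd hc)).2
  refine ⟨M₁, M₀, hΦ.isLegendrianSurgery hN h₁' hs₁, hΦ.isLegendrianSurgery h₁' h₀' hs₀,
    hagree h₁' ho₁, hagree h₀' ho₀, ?_⟩
  have hiso' := hiso.image hΦ.smooth_inv (hΦ.smooth_at 1) hΦ.right_inv hΦ.left_inv
  have hc : M₀.carrier = frontInv ψ χ G m '' N₀.carrier := by
    rw [OrientedLink.carrier, h₀, fst_image_pushVec]; rfl
  rw [← hc] at hiso'
  refine hiso'.trans (h.ambientIsotopic_crossingChange hM hlt hout hu hv hK hsign fun p => ?_)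
  have hp : p ∈ frontInv ψ χ G m '' (Prod.fst '' replaceVec N.vec ε (-ε) topLine gLine) ↔
      frontMap ψ G m 1 p ∈ Prod.fst '' replaceVec N.vec ε (-ε) topLine gLine := by
    rw [← hone]
    constructor
    · rintro ⟨q, hq, rfl⟩
      rwa [hΦ.right_inv]
    · intro hq
      exact ⟨_, hq, hΦ.left_inv p⟩
  rw [hp, fst_image_replaceVec_eq]
  refine or_congr_right (and_congr_right fun _ => ?_)
  rw [hN', fst_image_pushVec, ← hone]
  constructor
  · rintro ⟨q, hq, e⟩
    rwa [← hΦ.inj 1 e]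
  · intro hq
    exact mem_image_of_mem _ hq

end

/-! ### Conclusion for an arbitrary negative crossing -/

theorem IsNegativeCrossing.symm {M : LegendrianLink} {B : Rect} {f g : ℝ → ℝ} {x₀ : ℝ}
    (h : IsNegativeCrossing M B f g x₀) : IsNegativeCrossing M B g f x₀ := by
  obtain ⟨hf, hg, hx₀, hfg, hcross, hne, hcyl, v, w, hv, hw, hvw⟩ := h
  exact ⟨hg, hf, hx₀, fun x hx => (hfg x hx).symm, fun x hx => eq_comm.trans (hcross x hx),
    hne.symm, by rw [hcyl, union_comm], w, v, hw, hv, by rwa [mul_comm]⟩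

/-- A negative crossing can be changed by two surgeries. -/
theorem exists_surgeries {M : LegendrianLink} {B : Rect} {K : OrientedLink}
    (hK : IsNegativeCrossingChange M B K) :
    ∃ M₁ M₀ : LegendrianLink, IsLegendrianSurgery M M₁ ∧ IsLegendrianSurgery M₁ M₀ ∧
      AgreeOutside B M.toOrientedLink M₁.toOrientedLink ∧
      AgreeOutside B M.toOrientedLink M₀.toOrientedLink ∧
      AmbientIsotopic M₀.carrier K.carrier := by
  obtain ⟨f, g, x₀, hM, hout, u, v, hu, hv, hKB, hsign⟩ := hK
  -- The strands play symmetric roles, so `f` may be taken to be the one with the smaller slope.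
  rcases lt_or_gt_of_ne hM.2.2.2.2.2.1 with h | h
  · exact exists_surgeries_of_lt hM h hout hu hv hKB hsign
  · refine exists_surgeries_of_lt hM.symm h hout hv hu (by rw [hKB, union_comm]) ?_
    linarith

theorem lemma5p2 (Λ M : LegendrianLink) (hΛ : Λ.IsKnot) (hM : LegendrianIsotopic Λ M)
    (B : Rect) (K : OrientedLink) (hK : IsNegativeCrossingChange M B K) :
    (∃ M₁ M₀ : LegendrianLink, IsLegendrianSurgery M M₁ ∧ IsLegendrianSurgery M₁ M₀ ∧
      AgreeOutside B M.toOrientedLink M₁.toOrientedLink ∧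
      AgreeOutside B M.toOrientedLink M₀.toOrientedLink ∧
      AmbientIsotopic M₀.carrier K.carrier) ∧
    (K.IsUnknot → surgeryUnknottingNumber Λ ≤ 2) := by
  obtain ⟨M₁, M₀, h₁, h₀, ha₁, ha₀, hiso⟩ := exists_surgeries hK
  refine ⟨⟨M₁, M₀, h₁, h₀, ha₁, ha₀, hiso⟩, fun hunknot => ?_⟩
  -- The isotopy from `Λ` to `M` is absorbed into the first surgery.
  have hΛ₁ : IsLegendrianSurgery Λ M₁ := by
    obtain ⟨N, N', hN, h⟩ := h₁
    exact ⟨N, N', hM.trans hN, h⟩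
  refine iInf₂_le (2 : ℕ) ⟨fun n => if n = 2 then Λ else if n = 1 then M₁ else M₀, rfl,
    fun j hj => ?_, hiso.trans hunknot⟩
  interval_cases j
  · exact h₀
  · exact hΛ₁
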